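/- **Setting.** Let $L_1,L_2>0$, $\alpha>2$, $\gamma=\min\{2,\alpha-2\}$, $M=(0,L_1)\times(0,L_2)$, $\Omega=M\times(-1,1)$, $\nabla_H=(\partial_x,\partial_y)$, $\Delta_H=\partial_x^2+\partial_y^2$; $\|\cdot\|_2$ is the norm of $L^2(\Omega)$. All fields $u=(\tilde u,u_3)$, $\tilde u=(u_1,u_2)$, are periodic in $x,y,z$ with periods $L_1,L_2,2$, with $\tilde u$ even and $u_3$ odd in $z$; Sobolev spaces are spaces of periodic functions. *Data.* $\tilde A_0,\tilde B_0\in H^1(\Omega)$ satisfy $\nabla_H\cdot\int_{-1}^1\tilde A_0\,dz=\nabla_H\cdot\int_{-1}^1\tilde B_0\,dz=0$ on $M$, and $A_{3,0}=-\int_0^z\nabla_H\cdot\tilde A_0\,d\xi$, $B_{3,0}=-\int_0^z\nabla_H\cdot\tilde B_0\,d\xi$ (so $A_0,B_0$ are divergence-free). *Scaled system.* For $\varepsilon>0$ consider, with $\nabla\cdot A_\varepsilon=\nabla\cdot B_\varepsilon=0$, $$\partial_t\tilde A_\varepsilon+(B_\varepsilon\cdot\nabla)\tilde A_\varepsilon+\nabla_Hp_\varepsilon-\Delta_H\tilde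 A_\varepsilon-\varepsilon^{\alpha-2}\partial_{zz}\tilde A_\varepsilon=0,$$ $$\varepsilon^2\big(\partial_tA_{3,\varepsilon}+B_\varepsilon\cdot\nabla A_{3,\varepsilon}-\Delta_HA_{3,\varepsilon}-\varepsilon^{\alpha-2}\partial_{zz}A_{3,\varepsilon}\big)+\partial_zp_\varepsilon=0,$$ and the same two equations with the roles of $A_\varepsilon$ and $B_\varepsilon$ exchanged, and initial data $(A_0,B_0)$. A Leray–Hopf weak solution is a pair $(A_\varepsilon,B_\varepsilon)\in C_w([0,\infty);L^2_\sigma(\Omega))\cap L^2_{loc}([0,\infty);H^1(\Omega))$ of fields as above, where $L^2_\sigma(\Omega)$ is the space of divergence-free $L^2$ fields, attaining the initial data and satisfying the equations weakly against all smooth, compactly supported in $[0,\infty)$, periodic, symmetric, divergence-free test fields. It satisfies the energy inequality if for a.e. $t\ge0$ $$E_\varepsilon(A_\varepsilon(t))+E_\varepsilon(B_\varepsilon(t))+2\int_0^t\big(D_\varepsilon(A_\varepsilon)+D_\varepsilon(B_\varepsilon)\big)ds\le E_\varepsilon(A_0)+E_\varepsilon(B_0),$$ where $E_\varepsilon(u)=\|\tilde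 u\|_2^2+\varepsilon^2\|u_3\|_2^2$ and $D_\varepsilon(u)=\|\nabla_H\tilde u\|_2^2+\varepsilon^{\alpha-2}\|\partial_z\tilde u\|_2^2+\varepsilon^2\|\nabla_Hu_3\|_2^2+\varepsilon^\alpha\|\partial_zu_3\|_2^2$. *Limit system (PEHM).* A strong solution on $[0,t_1^*)$, $0<t_1^*<\infty$, is a pair of divergence-free fields $A,B$ as above with initial data $\tilde A(0)=\tilde A_0$, $\tilde B(0)=\tilde B_0$, with $\tilde A,\tilde B\in L^\infty(0,t_1^*;H^1)\cap C([0,t_1^*);L^2)$, $\nabla_H\tilde A,\nabla_H\tilde B\in L^2(0,t_1^*;H^1)$, $\partial_t\tilde A,\partial_t\tilde B\in L^2(0,t_1^*;L^2)$, and with a pressure $p\in L^2(0,t_1^*;H^1)$ such that a.e. $$\partial_t\tilde A+(B\cdot\nabla)\tilde A-\Delta_H\tilde A+\nabla_Hp=0,\quad \partial_t\tilde B+(A\cdot\nabla)\tilde B-\Delta_H\tilde B+\nabla_Hp=0,\quad \partial_zp=0 .$$ Let $N(A,B)$ be the squared norm $\operatorname{ess\,sup}_{t<t_1^*}\|(\tilde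 A,\tilde B)\|_{H^1}^2+\int_0^{t_1^*}\big(\|\nabla_H\tilde A\|_{H^1}^2+\|\nabla_H\tilde B\|_{H^1}^2+\|(\partial_t\tilde A,\partial_t\tilde B)\|_2^2\big)dt$, which is finite. **Theorem 2.3.** (i) For all $\varepsilon_0>0$ and $K\ge0$ there is $C>0$, depending only on $L_1,L_2,\alpha,\varepsilon_0,K$ (in particular independent of $\varepsilon$), such that the following holds. Let $(A,B)$ be a strong solution of the PEHM on $[0,t_1^*)$ with such data $(A_0,B_0)$ and with $N(A,B)\le K$, let $0<\varepsilon\le\varepsilon_0$, and let $(A_\varepsilon,B_\varepsilon)$ be any Leray–Hopf weak solution of the scaled system with the same data that satisfies the energy inequality. Then, with $U=A_\varepsilon-A$ and $V=B_\varepsilon-B$, $$\sup_{0\le t<t_1^*}\big(E_\varepsilon(U(t))+E_\varepsilon(V(t))\big)+\int_0^{t_1^*}\big(D_\varepsilon(U)+D_\varepsilon(V)\big)dt\le C\varepsilon^\gamma(t_1^*+1)e^{C(t_1^*+1)}\Big[1+\big(\|\tilde A_0\|_2^2+\|A_{3,0}\|_2^2+\|\tilde B_0\|_2^2+\|B_{3,0}\|_2^2\big)^2\Big].$$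 (ii) Let $(A,B)$ be a strong solution of the PEHM on $[0,t_1^*)$ with data $(A_0,B_0)$, and for every small $\varepsilon>0$ let $(A_\varepsilon,B_\varepsilon)$ be a Leray–Hopf weak solution with the same data that satisfies the energy inequality. Then, as $\varepsilon\to0^+$, $(\tilde A_\varepsilon,\varepsilon A_{3,\varepsilon})\to(\tilde A,0)$ in $L^\infty([0,t_1^*);L^2(\Omega))$ and $$\big(\nabla_H\tilde A_\varepsilon,\varepsilon^{(\alpha-2)/2}\partial_z\tilde A_\varepsilon,\varepsilon\nabla_HA_{3,\varepsilon},\varepsilon^{\alpha/2}\partial_zA_{3,\varepsilon},A_{3,\varepsilon}\big)\to(\nabla_H\tilde A,0,0,0,A_3)\quad\text{in }L^2([0,t_1^*);L^2(\Omega)),$$ and likewise for $B_\varepsilon,B$; each of these convergences is of order $O(\varepsilon^{\gamma/2})$ in the stated norm. -/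

import Mathlib

open MeasureTheory Filter Topology Set
open scoped ENNReal NNReal ContDiff

namespace HydroMHD

/-! Points of space are `x = (x 0, x 1, x 2)`, i.e. `(x, y, z)`; vector fields have components
`0, 1` (horizontal) and `2` (vertical). `Fin.castSucc : Fin 2 → Fin 3` embeds the horizontal
indices. -/

/-- The space of points and of vectors (coordinates `x, y, z`). -/
abbrev E3 := Fin 3 → ℝ

/-- The domain `Ω = (0, L₁) × (0, L₂) × (-1, 1)`. -/
def box (L₁ L₂ : ℝ) : Set E3 :=
  {x | x 0 ∈ Ioo 0 L₁ ∧ x 1 ∈ Ioo 0 L₂ ∧ x 2 ∈ Ioo (-1) 1}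

/-- Lebesgue measure on `Ω`. -/
noncomputable def boxMeas (L₁ L₂ : ℝ) : Measure E3 := volume.restrict (box L₁ L₂)

/-- Lebesgue measure on `(0, T) × Ω`. -/
noncomputable def cylMeas (L₁ L₂ T : ℝ) : Measure (ℝ × E3) :=
  (volume.restrict (Ioo 0 T)).prod (boxMeas L₁ L₂)

/-- Periodicity with periods `L₁, L₂, 2` in `x, y, z`. -/
def IsPeriodic {β : Type*} (L₁ L₂ : ℝ) (f : E3 → β) : Prop :=
  ∀ (i : Fin 3) (x : E3), f (x + Pi.single i ((![L₁, L₂, 2] : Fin 3 → ℝ) i)) = f x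

/-- Symmetry condition: horizontal components are even in `z`, the vertical one is odd in `z`. -/
def IsSymmetric (u : E3 → E3) : Prop :=
  ∀ x : E3, (∀ i : Fin 2, u (Function.update x 2 (-x 2)) i.castSucc = u x i.castSucc) ∧
    u (Function.update x 2 (-x 2)) 2 = -u x 2

/-- Classical partial derivative `∂ⱼ φ`. -/
noncomputable def pd (j : Fin 3) (φ : E3 → ℝ) (x : E3) : ℝ := fderiv ℝ φ x (Pi.single j 1)

/-- `‖f‖₂²`, the squared norm of `L²(Ω)`. -/
noncomputable def nsq (L₁ L₂ : ℝ) (f : E3 → ℝ) : ℝ≥0∞ := ∫⁻ x, ‖f x‖ₑ ^ 2 ∂(boxMeas L₁ L₂)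

/-- `g` is the weak derivative `∂ⱼ f` of the periodic function `f`. -/
def HasWeakPartial (L₁ L₂ : ℝ) (j : Fin 3) (f g : E3 → ℝ) : Prop :=
  ∀ φ : E3 → ℝ, ContDiff ℝ ∞ φ → IsPeriodic L₁ L₂ φ →
    ∫ x, f x * pd j φ x ∂(boxMeas L₁ L₂) = -∫ x, g x * φ x ∂(boxMeas L₁ L₂)

/-- The space `L²_σ(Ω)`: square integrable, weakly divergence-free (in the periodic sense). -/
structure IsL2Sigma (L₁ L₂ : ℝ) (u : E3 → E3) : Prop where
  memLp : ∀ i, MemLp (fun x => u x i) 2 (boxMeas L₁ L₂)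
  div_free : ∀ ψ : E3 → ℝ, ContDiff ℝ ∞ ψ → IsPeriodic L₁ L₂ ψ →
    ∫ x, ∑ j : Fin 3, u x j * pd j ψ x ∂(boxMeas L₁ L₂) = 0

/-- `f ∈ L²(0, T; L²(Ω))`. -/
def InL2L2 (L₁ L₂ T : ℝ) (f : ℝ → E3 → ℝ) : Prop :=
  MemLp (fun q : ℝ × E3 => f q.1 q.2) 2 (cylMeas L₁ L₂ T)

/-- `f ∈ L²(0, T; H¹(Ω))` (periodic), with weak spatial gradient `g = (∂ⱼ f)ⱼ`. -/
structure InL2H1 (L₁ L₂ T : ℝ) (f : ℝ → E3 → ℝ) (g : ℝ → E3 → Fin 3 → ℝ) : Prop where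
  val : InL2L2 L₁ L₂ T f
  grad : ∀ j, InL2L2 L₁ L₂ T (fun t x => g t x j)
  weak : ∀ᵐ t ∂(volume.restrict (Ioo 0 T)), ∀ j,
    HasWeakPartial L₁ L₂ j (f t) (fun x => g t x j)

/-! ### Initial data -/

/-- An initial field `u = (ũ, u₃)`: the horizontal part `ũ` is in `H¹(Ω)` (with weak gradient
`D x i j = ∂ⱼ uᵢ`), everything is periodic and symmetric, the vertical mean of `ũ` is horizontally
divergence-free, and `u₃(x, y, z) = -∫₀ᶻ ∇_H · ũ(x, y, ξ) dξ`. -/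
structure InitialField (L₁ L₂ : ℝ) where
  u : E3 → E3
  D : E3 → Fin 2 → Fin 3 → ℝ
  periodic : IsPeriodic L₁ L₂ u
  symm : IsSymmetric u
  memLp : ∀ i : Fin 2, MemLp (fun x => u x i.castSucc) 2 (boxMeas L₁ L₂)
  memLp_grad : ∀ (i : Fin 2) (j : Fin 3), MemLp (fun x => D x i j) 2 (boxMeas L₁ L₂)
  weak_grad : ∀ (i : Fin 2) (j : Fin 3),
    HasWeakPartial L₁ L₂ j (fun x => u x i.castSucc) (fun x => D x i j)
  /-- `∇_H · ∫ ũ dz = 0` on `(0, L₁) × (0, L₂)`, tested with functions of `(x, y)` only. -/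
  mean_div_free : ∀ ψ : E3 → ℝ, ContDiff ℝ ∞ ψ → IsPeriodic L₁ L₂ ψ →
    (∀ (x : E3) (ξ : ℝ), ψ (Function.update x 2 ξ) = ψ x) →
    ∫ x, ∑ i : Fin 2, u x i.castSucc * pd i.castSucc ψ x ∂(boxMeas L₁ L₂) = 0
  vertical : ∀ᵐ x ∂(boxMeas L₁ L₂),
    u x 2 = -∫ ξ in (0 : ℝ)..(x 2), ∑ i : Fin 2, D (Function.update x 2 ξ) i i.castSucc

/-! ### Leray–Hopf weak solutions of the scaled system -/

/-- Weight of the `i`-th component: `1, 1, ε²`. -/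
noncomputable def wt (ε : ℝ) : Fin 3 → ℝ := ![1, 1, ε ^ 2]

/-- Diffusivity in the `j`-th direction: `1, 1, ε^(α-2)`. Note `wt ε 2 * visc ε α 2 = ε^α`. -/
noncomputable def visc (ε α : ℝ) : Fin 3 → ℝ := ![1, 1, ε ^ (α - 2)]

/-- Fields in the class `C_w([0, ∞); L²_σ(Ω)) ∩ L²_loc([0, ∞); H¹(Ω))`, periodic and symmetric,
together with the weak gradient `D t x i j = ∂ⱼ uᵢ`. -/
structure WeakField (L₁ L₂ : ℝ) where
  u : ℝ → E3 → E3
  D : ℝ → E3 → Fin 3 → Fin 3 → ℝ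
  periodic : ∀ t, 0 ≤ t → IsPeriodic L₁ L₂ (u t)
  symm : ∀ t, 0 ≤ t → IsSymmetric (u t)
  sigma : ∀ t, 0 ≤ t → IsL2Sigma L₁ L₂ (u t)
  weak_cont : ∀ (i : Fin 3) (g : E3 → ℝ), MemLp g 2 (boxMeas L₁ L₂) →
    ContinuousOn (fun t => ∫ x, u t x i * g x ∂(boxMeas L₁ L₂)) (Ici 0)
  l2h1 : ∀ T, 0 < T → ∀ i, InL2H1 L₁ L₂ T (fun t x => u t x i) (fun t x => D t x i)

/-- Test fields: smooth on `ℝ³ × [0, ∞)`, compactly supported in time, and for each `t ≥ 0`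
periodic, symmetric and divergence-free in space. -/
structure IsTestField (L₁ L₂ : ℝ) (φ : ℝ → E3 → E3) : Prop where
  smooth : ContDiff ℝ ∞ (fun q : ℝ × E3 => φ q.1 q.2)
  compact : ∃ R : ℝ, ∀ t, R ≤ t → ∀ x, φ t x = 0
  periodic : ∀ t, 0 ≤ t → IsPeriodic L₁ L₂ (φ t)
  symm : ∀ t, 0 ≤ t → IsSymmetric (φ t)
  div_free : ∀ t, 0 ≤ t → ∀ x, ∑ j : Fin 3, pd j (fun y => φ t y j) x = 0

/-- Integrand at `(t, x)` of the weak form of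
`wtᵢ (∂ₜ uᵢ + (v · ∇) uᵢ - ∑ⱼ viscⱼ ∂ⱼⱼ uᵢ) + ∂ᵢ p = 0`, tested with `φ`. -/
noncomputable def weakIntegrand {L₁ L₂ : ℝ} (ε α : ℝ) (U V : WeakField L₁ L₂)
    (φ : ℝ → E3 → E3) (t : ℝ) (x : E3) : ℝ :=
  ∑ i : Fin 3, wt ε i *
    (-(U.u t x i * deriv (fun s => φ s x i) t)
      + (∑ j : Fin 3, V.u t x j * U.D t x i j) * φ t x i
      + ∑ j : Fin 3, visc ε α j * U.D t x i j * pd j (fun y => φ t y i) x)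

/-- `(A, B)` is a Leray–Hopf weak solution of the scaled horizontal-viscous MHD system in
Elsässer variables with parameters `ε, α` and initial data `(A₀, B₀)`. -/
structure IsLerayHopf {L₁ L₂ : ℝ} (ε α : ℝ) (A₀ B₀ : InitialField L₁ L₂)
    (A B : WeakField L₁ L₂) : Prop where
  init_A : A.u 0 =ᵐ[boxMeas L₁ L₂] A₀.u
  init_B : B.u 0 =ᵐ[boxMeas L₁ L₂] B₀.u
  weak_form : ∀ φ χ : ℝ → E3 → E3, IsTestField L₁ L₂ φ → IsTestField L₁ L₂ χ →
    ∫ t in Ioi (0 : ℝ), ∫ x, (weakIntegrand ε α A B φ t x + weakIntegrand ε α B A χ t x)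
        ∂(boxMeas L₁ L₂)
      = ∫ x, ∑ i : Fin 3, wt ε i * (A₀.u x i * φ 0 x i + B₀.u x i * χ 0 x i) ∂(boxMeas L₁ L₂)

/-- `‖ũ‖₂² + ε² ‖u₃‖₂²`. -/
noncomputable def kin (L₁ L₂ ε : ℝ) (u : E3 → E3) : ℝ≥0∞ :=
  ∑ i : Fin 3, ENNReal.ofReal (wt ε i) * nsq L₁ L₂ (fun x => u x i)

/-- `‖∇_H ũ‖₂² + ε^(α-2) ‖∂_z ũ‖₂² + ε² ‖∇_H u₃‖₂² + ε^α ‖∂_z u₃‖₂²`, where `D x i j = ∂ⱼ uᵢ`. -/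
noncomputable def diss (L₁ L₂ ε α : ℝ) (D : E3 → Fin 3 → Fin 3 → ℝ) : ℝ≥0∞ :=
  ∑ i : Fin 3, ∑ j : Fin 3,
    ENNReal.ofReal (wt ε i * visc ε α j) * nsq L₁ L₂ (fun x => D x i j)

/-- The energy inequality, for almost every `t ≥ 0`. -/
def EnergyInequality {L₁ L₂ : ℝ} (ε α : ℝ) (A₀ B₀ : InitialField L₁ L₂)
    (A B : WeakField L₁ L₂) : Prop :=
  ∀ᵐ t ∂(volume.restrict (Ioi (0 : ℝ))),
    kin L₁ L₂ ε (A.u t) + kin L₁ L₂ ε (B.u t)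
      + 2 * ∫⁻ s in Ioo 0 t, (diss L₁ L₂ ε α (A.D s) + diss L₁ L₂ ε α (B.D s))
    ≤ kin L₁ L₂ ε A₀.u + kin L₁ L₂ ε B₀.u

/-! ### Strong solutions of the limit system (PEHM) -/

/-- `‖ũ‖²_{H¹(Ω)}` of the horizontal part. -/
noncomputable def h1sq (L₁ L₂ : ℝ) (u : E3 → E3) (D : E3 → Fin 3 → Fin 3 → ℝ) : ℝ≥0∞ :=
  ∑ i : Fin 2, (nsq L₁ L₂ (fun x => u x i.castSucc)
    + ∑ j : Fin 3, nsq L₁ L₂ (fun x => D x i.castSucc j))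

/-- The regularity class of strong solutions on `[0, T)`, for a periodic symmetric divergence-free
field `u = (ũ, u₃)`: `ũ ∈ L^∞(0, T; H¹) ∩ C([0, T); L²)`, `∇_H ũ ∈ L²(0, T; H¹)`,
`∂ₜ ũ ∈ L²(0, T; L²)`. Here `D t x i j = ∂ⱼ uᵢ`, `D2 t x i j k = ∂ₖ ∂ⱼ uᵢ` (`i, j` horizontal) and
`dt t x i = ∂ₜ uᵢ` (`i` horizontal). The vertical part `u₃` is determined by `ũ` through the
divergence constraint and oddness; its weak gradient is the row `i = 2` of `D`. -/
structure StrongField (L₁ L₂ T : ℝ) where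
  u : ℝ → E3 → E3
  D : ℝ → E3 → Fin 3 → Fin 3 → ℝ
  D2 : ℝ → E3 → Fin 2 → Fin 2 → Fin 3 → ℝ
  dt : ℝ → E3 → Fin 2 → ℝ
  periodic : ∀ t ∈ Ico 0 T, IsPeriodic L₁ L₂ (u t)
  symm : ∀ t ∈ Ico 0 T, IsSymmetric (u t)
  sigma : ∀ t ∈ Ico 0 T, IsL2Sigma L₁ L₂ (u t)
  cont : ∀ (i : Fin 2), ∀ t₀ ∈ Ico 0 T,
    Tendsto (fun t => nsq L₁ L₂ (fun x => u t x i.castSucc - u t₀ x i.castSucc))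
      (𝓝[Ico 0 T] t₀) (𝓝 0)
  l2h1 : ∀ i, InL2H1 L₁ L₂ T (fun t x => u t x i) (fun t x => D t x i)
  linf_h1 : essSup (fun t => h1sq L₁ L₂ (u t) (D t)) (volume.restrict (Ioo 0 T)) < ⊤
  l2h1_horizontal : ∀ i j : Fin 2,
    InL2H1 L₁ L₂ T (fun t x => D t x i.castSucc j.castSucc) (fun t x => D2 t x i j)
  l2_dt : ∀ i, InL2L2 L₁ L₂ T (fun t x => dt t x i)
  /-- `dt` is the weak time derivative of the horizontal part. -/
  weak_dt : ∀ (i : Fin 2) (φ : ℝ → E3 → ℝ), ContDiff ℝ ∞ (fun q : ℝ × E3 => φ q.1 q.2) →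
    (∀ t, IsPeriodic L₁ L₂ (φ t)) →
    (∃ a b : ℝ, 0 < a ∧ b < T ∧ ∀ t, t ∉ Icc a b → ∀ x, φ t x = 0) →
    ∫ t in Ioo 0 T, ∫ x, u t x i.castSucc * deriv (fun s => φ s x) t ∂(boxMeas L₁ L₂)
      = -∫ t in Ioo 0 T, ∫ x, dt t x i * φ t x ∂(boxMeas L₁ L₂)

/-- `(A, B)` is a strong solution on `[0, T)` of the primitive equations with only horizontal
viscosity and magnetic diffusivity, with initial data `(A₀, B₀)`:
`∂ₜ Ã + (B · ∇) Ã - Δ_H Ã + ∇_H p = 0`, `∂ₜ B̃ + (A · ∇) B̃ - Δ_H B̃ + ∇_H p = 0`, `∂_z p = 0`.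
(`Dp t x j = ∂ⱼ p`; the divergence constraints are part of `StrongField`.) -/
structure IsStrongPEHM {L₁ L₂ T : ℝ} (A₀ B₀ : InitialField L₁ L₂)
    (A B : StrongField L₁ L₂ T) : Prop where
  init_A : ∀ i : Fin 2,
    (fun x => A.u 0 x i.castSucc) =ᵐ[boxMeas L₁ L₂] fun x => A₀.u x i.castSucc
  init_B : ∀ i : Fin 2,
    (fun x => B.u 0 x i.castSucc) =ᵐ[boxMeas L₁ L₂] fun x => B₀.u x i.castSucc
  equations : ∃ (p : ℝ → E3 → ℝ) (Dp : ℝ → E3 → Fin 3 → ℝ), InL2H1 L₁ L₂ T p Dp ∧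
    ∀ᵐ q ∂(cylMeas L₁ L₂ T), Dp q.1 q.2 2 = 0 ∧ ∀ i : Fin 2,
      A.dt q.1 q.2 i + ∑ j : Fin 3, B.u q.1 q.2 j * A.D q.1 q.2 i.castSucc j
          - ∑ j : Fin 2, A.D2 q.1 q.2 i j j.castSucc + Dp q.1 q.2 i.castSucc = 0 ∧
      B.dt q.1 q.2 i + ∑ j : Fin 3, A.u q.1 q.2 j * B.D q.1 q.2 i.castSucc j
          - ∑ j : Fin 2, B.D2 q.1 q.2 i j j.castSucc + Dp q.1 q.2 i.castSucc = 0

/-- Squared norm of a pair in the class of strong solutions: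
`sup ‖(Ã, B̃)‖²_{H¹} + ∫₀ᵀ (‖∇_H Ã‖²_{H¹} + ‖∇_H B̃‖²_{H¹} + ‖(∂ₜ Ã, ∂ₜ B̃)‖₂²) dt`. It is finite for
every pair. -/
noncomputable def strongNormSq {L₁ L₂ T : ℝ} (A B : StrongField L₁ L₂ T) : ℝ≥0∞ :=
  essSup (fun t => h1sq L₁ L₂ (A.u t) (A.D t) + h1sq L₁ L₂ (B.u t) (B.D t))
      (volume.restrict (Ioo 0 T))
    + ∫⁻ t in Ioo 0 T, ∑ i : Fin 2,
        ((∑ j : Fin 2, (nsq L₁ L₂ (fun x => A.D t x i.castSucc j.castSucc)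
            + nsq L₁ L₂ (fun x => B.D t x i.castSucc j.castSucc)
            + ∑ k : Fin 3, (nsq L₁ L₂ (fun x => A.D2 t x i j k)
              + nsq L₁ L₂ (fun x => B.D2 t x i j k))))
          + nsq L₁ L₂ (fun x => A.dt t x i) + nsq L₁ L₂ (fun x => B.dt t x i))

/-! ### Error and convergence -/

/-- The error between `(Aε, Bε)` and `(A, B)` in the energy norm on `[0, T)`: with
`U = Aε - A`, `V = Bε - B`, the supremum over `0 ≤ t < T` of `‖(Ũ, ε U₃, Ṽ, ε V₃)‖₂²(t)` plus the time
integral over `(0, T)` of the dissipation of `U` and `V`. -/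
noncomputable def errorEnergy {L₁ L₂ T : ℝ} (ε α : ℝ) (Aε Bε : WeakField L₁ L₂)
    (A B : StrongField L₁ L₂ T) : ℝ≥0∞ :=
  (⨆ t ∈ Ico 0 T, (kin L₁ L₂ ε (Aε.u t - A.u t) + kin L₁ L₂ ε (Bε.u t - B.u t)))
    + ∫⁻ t in Ioo 0 T,
        (diss L₁ L₂ ε α (Aε.D t - A.D t) + diss L₁ L₂ ε α (Bε.D t - B.D t))

/-- The norm of `L^∞([0, T); L²(Ω))` (supremum over all times). -/
noncomputable def normSup (L₁ L₂ T : ℝ) (f : ℝ → E3 → ℝ) : ℝ≥0∞ :=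
  ⨆ t ∈ Ico 0 T, (nsq L₁ L₂ (f t)) ^ (1 / 2 : ℝ)

/-- The norm of `L²([0, T); L²(Ω))`. -/
noncomputable def normL2 (L₁ L₂ T : ℝ) (f : ℝ → E3 → ℝ) : ℝ≥0∞ :=
  (∫⁻ t in Ioo 0 T, nsq L₁ L₂ (f t)) ^ (1 / 2 : ℝ)

/-- `N ε → 0` as `ε → 0⁺`, and `N ε = O(ε^r)`. -/
def VanishesAtRate (r : ℝ) (N : ℝ → ℝ≥0∞) : Prop :=
  Tendsto N (𝓝[>] 0) (𝓝 0) ∧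
    ∃ C : ℝ, ∀ᶠ ε in 𝓝[>] (0 : ℝ), N ε ≤ ENNReal.ofReal (C * ε ^ r)

/-- As `ε → 0⁺`, with `O(ε^r)` errors,
`(Ũε, ε U₃ε) → (Ũ, 0)` in `L^∞([0, T); L²)` and
`(∇_H Ũε, ε^((α-2)/2) ∂_z Ũε, ε ∇_H U₃ε, ε^(α/2) ∂_z U₃ε, U₃ε) → (∇_H Ũ, 0, 0, 0, U₃)` in
`L²([0, T); L²)`. -/
structure ConvergesAtRate {L₁ L₂ T : ℝ} (α r : ℝ) (Uε : ℝ → WeakField L₁ L₂)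
    (U : StrongField L₁ L₂ T) : Prop where
  horizontal : ∀ i : Fin 2, VanishesAtRate r fun ε =>
    normSup L₁ L₂ T fun t x => (Uε ε).u t x i.castSucc - U.u t x i.castSucc
  vertical : VanishesAtRate r fun ε => normSup L₁ L₂ T fun t x => ε * (Uε ε).u t x 2
  gradH_horizontal : ∀ i j : Fin 2, VanishesAtRate r fun ε =>
    normL2 L₁ L₂ T fun t x => (Uε ε).D t x i.castSucc j.castSucc - U.D t x i.castSucc j.castSucc
  dz_horizontal : ∀ i : Fin 2, VanishesAtRate r fun ε =>
    normL2 L₁ L₂ T fun t x => ε ^ ((α - 2) / 2) * (Uε ε).D t x i.castSucc 2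
  gradH_vertical : ∀ j : Fin 2, VanishesAtRate r fun ε =>
    normL2 L₁ L₂ T fun t x => ε * (Uε ε).D t x 2 j.castSucc
  dz_vertical : VanishesAtRate r fun ε =>
    normL2 L₁ L₂ T fun t x => ε ^ (α / 2) * (Uε ε).D t x 2 2
  vertical_l2 : VanishesAtRate r fun ε =>
    normL2 L₁ L₂ T fun t x => (Uε ε).u t x 2 - U.u t x 2

end HydroMHD

/-! The proof is a relative energy argument. For `U = Aε - A` the energy of `U` is that of `Aε`,
minus twice the weighted pairing of `Aε` with `A`, plus that of `A`. The energy inequality bounds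
the first contribution, the weak formulation tested with the strong solution governs the second, and
the limit equation governs the horizontal part of the third. Adding the same computation for `V = Bε
- B` gives a differential inequality, which is closed by Grönwall's lemma.

The limit has neither vertical viscosity nor an evolution equation for its vertical component, and
this decides which estimates are available.

Transport. The identity `∫ (w · ∇f) g = -∫ (w · ∇g) f` for divergence-free `w`
(`transport_antisymm`) reduces the horizontal transport terms to `∫ (V · ∇Ã) · Ũ`. Neither the error
nor `∂_z Ã` has a usable vertical derivative, so isotropic Sobolev embeddings do not help. Two
anisotropic trilinear inequalities replace them: `trilinear_sup`, where two factors have horizontal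
derivatives and the third a vertical one, and `trilinear_L2`, where one factor is merely square
integrable. Both combine a one-dimensional sup bound in `z` with a two-dimensional Ladyzhenskaya
inequality for the column integrals of squares. The vertical velocity is always recovered from `∂_z
V₃ = -∇_H · Ṽ` and a Poincaré inequality for odd functions, at the cost of horizontal derivatives
only (`GoodW.l2_zz_le`, `GoodW.l2_vertical_le`).

Time derivative of `A₃`. The strong class does not provide `∂ₜ A₃` in `L²`, yet the weighted pairing
contains `ε² ⟨∂ₜ A₃, A₃ε⟩`. On the Fourier side `A₃` is the horizontal part multiplied by a ratio of
a horizontal and a vertical wave number. The horizontal factor can be moved to `A₃ε`, and the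
remainder is at most `ε² ‖∂ₜ Ã‖ ‖∇_H A₃ε‖` (`abs_vertPair_le`), which the dissipation absorbs.

Testing with the strong solution. Only smooth test fields are admissible, so `A` is replaced by its
Fourier truncations. These are finite combinations of divergence-free symmetric trigonometric fields
with absolutely continuous coefficients, so the product rule applies mode by mode. Truncation
commutes with weak derivatives (`pd_trunc`) and does not increase `L²` norms, hence dominated
convergence removes it (`IsLerayHopf.pair_strong`).

Rate. At a fixed time, `exists_relDensity_add_le` bounds the density by minus half the dissipation
of the error, plus an integrable multiple of the relative energy, plus sources. The sources are of
size `ε²` (everything concerning the vertical component) or `ε^(α-2)` (the vertical viscosity acting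
on the limit), hence of order `ε^γ`. The vertical transport term contributes products of the energy
and the dissipation of the weak solution; after integration in time these are quadratic in the
initial energy, which is why the squared data appear in the bound.

The energy inequality holds only for almost every time. The Fourier coefficients of the errors are
continuous in time, so Bessel and Parseval extend the bound to every time (`sum_sq_le_of_ae`). The
convergences then follow from the error estimate, because the weighted quantities of the limit are
themselves `O(ε^(γ/2))`. -/

namespace HydroMHD

/-! ### The norm of real `L²` functions -/

section L2

variable {X : Type*} [MeasurableSpace X] {μ : Measure X} {f g : X → ℝ}

/-- The `L²` norm as a real number. -/
noncomputable def l2 (μ : Measure X) (f : X → ℝ) : ℝ := √(∫ x, f x ^ 2 ∂μ)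

lemma l2_nonneg : 0 ≤ l2 μ f := Real.sqrt_nonneg _

lemma l2_sq : l2 μ f ^ 2 = ∫ x, f x ^ 2 ∂μ :=
  Real.sq_sqrt (integral_nonneg fun _ => sq_nonneg _)

lemma l2_congr (h : f =ᵐ[μ] g) : l2 μ f = l2 μ g := by
  unfold l2
  congr 1
  exact integral_congr_ae (h.mono fun x hx => by simp only [hx])

lemma ofReal_l2_sq (hf : MemLp f 2 μ) :
    ENNReal.ofReal (l2 μ f ^ 2) = ∫⁻ x, ‖f x‖ₑ ^ 2 ∂μ := by
  rw [l2_sq, ofReal_integral_eq_lintegral_ofReal hf.integrable_sq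
    (Eventually.of_forall fun _ => sq_nonneg _)]
  refine lintegral_congr fun x => ?_
  rw [← sq_abs, ENNReal.ofReal_pow (abs_nonneg _), Real.enorm_eq_ofReal_abs]

lemma l2_eq_toReal (hf : MemLp f 2 μ) : l2 μ f = (eLpNorm f 2 μ).toReal := by
  have h1 := hf.eLpNorm_eq_integral_rpow_norm (by norm_num) (by norm_num)
  rw [h1, ENNReal.toReal_ofReal (by positivity)]
  simp only [ENNReal.toReal_ofNat, Real.rpow_two, Real.norm_eq_abs, sq_abs]
  rw [l2, Real.sqrt_eq_rpow]; norm_num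

lemma ofReal_l2 (hf : MemLp f 2 μ) : ENNReal.ofReal (l2 μ f) = eLpNorm f 2 μ := by
  rw [l2_eq_toReal hf, ENNReal.ofReal_toReal hf.eLpNorm_ne_top]

lemma l2_add_le (hf : MemLp f 2 μ) (hg : MemLp g 2 μ) :
    l2 μ (fun x => f x + g x) ≤ l2 μ f + l2 μ g := by
  rw [l2_eq_toReal hf, l2_eq_toReal hg, l2_eq_toReal (f := fun x => f x + g x) (hf.add hg),
    ← ENNReal.toReal_add hf.eLpNorm_ne_top hg.eLpNorm_ne_top]
  exact ENNReal.toReal_mono (ENNReal.add_ne_top.2 ⟨hf.eLpNorm_ne_top, hg.eLpNorm_ne_top⟩)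
    (eLpNorm_add_le hf.1 hg.1 (by norm_num))

lemma l2_neg : l2 μ (fun x => -f x) = l2 μ f := by simp [l2]

lemma l2_sub_le (hf : MemLp f 2 μ) (hg : MemLp g 2 μ) :
    l2 μ (fun x => f x - g x) ≤ l2 μ f + l2 μ g := by
  have h1 := l2_add_le (g := fun x => -g x) hf hg.neg
  rw [l2_neg] at h1
  simpa only [sub_eq_add_neg] using h1

lemma l2_sub_comm : l2 μ (fun x => f x - g x) = l2 μ (fun x => g x - f x) := by
  rw [← l2_neg]; simp

lemma integral_abs_mul_le (hf : MemLp f 2 μ) (hg : MemLp g 2 μ) :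
    ∫ x, |f x * g x| ∂μ ≤ l2 μ f * l2 μ g := by
  have := integral_mul_norm_le_Lp_mul_Lq (μ := μ) (f := f) (g := g) (p := 2) (q := 2)
    (by constructor <;> norm_num) (by simpa using hf) (by simpa using hg)
  simpa [l2, Real.sqrt_eq_rpow, abs_mul] using this

lemma abs_integral_mul_le (hf : MemLp f 2 μ) (hg : MemLp g 2 μ) :
    |∫ x, f x * g x ∂μ| ≤ l2 μ f * l2 μ g :=
  (abs_integral_le_integral_abs).trans (integral_abs_mul_le hf hg)

lemma integrable_mul (hf : MemLp f 2 μ) (hg : MemLp g 2 μ) :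
    Integrable (fun x => f x * g x) μ := hf.integrable_mul hg

lemma ae_eq_zero_of_l2_eq_zero (hf : MemLp f 2 μ) (h0 : l2 μ f = 0) : f =ᵐ[μ] 0 := by
  rw [l2_eq_toReal hf, ENNReal.toReal_eq_zero_iff] at h0
  exact (eLpNorm_eq_zero_iff hf.1 (by norm_num)).1 (h0.resolve_right hf.eLpNorm_ne_top)

lemma l2_le_of_sq_le {C : ℝ} (hC : 0 ≤ C) (h : ∫ x, f x ^ 2 ∂μ ≤ C ^ 2) : l2 μ f ≤ C := by
  rw [← l2_sq] at h; exact (pow_le_pow_iff_left₀ l2_nonneg hC two_ne_zero).1 h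

/-- The inner product is continuous along `L²`-convergent sequences. -/
lemma tendsto_integral_mul {F : ℕ → X → ℝ} (hf : MemLp f 2 μ) (hF : ∀ n, MemLp (F n) 2 μ)
    (hg : MemLp g 2 μ) (hlim : Tendsto (fun n => l2 μ (fun x => f x - F n x)) atTop (𝓝 0)) :
    Tendsto (fun n => ∫ x, F n x * g x ∂μ) atTop (𝓝 (∫ x, f x * g x ∂μ)) := by
  rw [tendsto_iff_norm_sub_tendsto_zero]
  refine squeeze_zero (fun _ => norm_nonneg _) (fun n => ?_)
    (by simpa using hlim.mul_const (l2 μ g))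
  rw [← integral_sub (integrable_mul (hF n) hg) (integrable_mul hf hg), Real.norm_eq_abs]
  have := abs_integral_mul_le (hf.sub (hF n)) hg
  rw [← abs_neg, ← integral_neg]
  refine le_trans (le_of_eq ?_) this
  congr 1
  exact integral_congr_ae (Eventually.of_forall fun x => by simp; ring)

end L2

/-! ### The periodic box -/

/-- The periods in the three coordinate directions. -/
noncomputable def period (L₁ L₂ : ℝ) : Fin 3 → ℝ := ![L₁, L₂, 2]

lemma box_eq_pi (L₁ L₂ : ℝ) :
    box L₁ L₂ = univ.pi fun i => Ioo ((![0, 0, -1] : Fin 3 → ℝ) i) ((![L₁, L₂, 1] : Fin 3 → ℝ) i) := by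
  ext x
  simp [box, Set.mem_pi, Fin.forall_fin_succ]

lemma measurableSet_box (L₁ L₂ : ℝ) : MeasurableSet (box L₁ L₂) := by
  rw [box_eq_pi]; exact MeasurableSet.univ_pi fun i => measurableSet_Ioo

lemma boxMeas_eq_pi (L₁ L₂ : ℝ) :
    boxMeas L₁ L₂ = Measure.pi fun i => (volume : Measure ℝ).restrict
      (Ioo ((![0, 0, -1] : Fin 3 → ℝ) i) ((![L₁, L₂, 1] : Fin 3 → ℝ) i)) := by
  rw [boxMeas, box_eq_pi, volume_pi, Measure.restrict_pi_pi]

instance (L₁ L₂ : ℝ) : IsFiniteMeasure (boxMeas L₁ L₂) := by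
  rw [boxMeas_eq_pi]; infer_instance

/-- Fubini's theorem on the box. -/
lemma lintegral_box (L₁ L₂ : ℝ) {f : E3 → ℝ≥0∞} (hf : Measurable f) :
    ∫⁻ x, f x ∂(boxMeas L₁ L₂) =
      ∫⁻ a in Ioo 0 L₁, ∫⁻ b in Ioo 0 L₂, ∫⁻ c in Ioo (-1 : ℝ) 1, f ![a, b, c] := by
  let ν : Fin 3 → Measure ℝ := fun i => (volume : Measure ℝ).restrict
      (Ioo ((![0, 0, -1] : Fin 3 → ℝ) i) ((![L₁, L₂, 1] : Fin 3 → ℝ) i))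
  rw [boxMeas_eq_pi]
  have h1 := measurePreserving_piFinSuccAbove ν 0
  have h2 := measurePreserving_piFinTwo (fun i : Fin 2 => ν (Fin.succAbove 0 i))
  rw [← (h1.symm).lintegral_comp hf, lintegral_prod _ (by fun_prop)]
  refine lintegral_congr fun a => ?_
  rw [← (h2.symm).lintegral_comp (by fun_prop), lintegral_prod _ (by fun_prop)]
  refine lintegral_congr fun b => lintegral_congr fun c => ?_
  congr 1
  ext i
  fin_cases i <;> rfl

/-- Reflection in `z`. -/
def reflect (x : E3) : E3 := Function.update x 2 (-x 2)

lemma reflect_reflect (x : E3) : reflect (reflect x) = x := by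
  simp [reflect]

lemma measurePreserving_reflect (L₁ L₂ : ℝ) :
    MeasurePreserving reflect (boxMeas L₁ L₂) (boxMeas L₁ L₂) := by
  rw [boxMeas_eq_pi]
  have h : reflect = fun (x : E3) i => (![id, id, Neg.neg] : Fin 3 → ℝ → ℝ) i (x i) := by
    ext x i; fin_cases i <;> simp [reflect]
  rw [h]
  refine measurePreserving_pi _ _ fun i => ?_
  fin_cases i
  · exact MeasurePreserving.id _
  · exact MeasurePreserving.id _
  · have := (Measure.measurePreserving_neg (volume : Measure ℝ)).restrict_preimage
      (measurableSet_Ioo (a := (-1 : ℝ)) (b := 1))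
    simpa using! this

lemma measurable_reflect : Measurable reflect := by unfold reflect; fun_prop

/-- Reflection as a measurable equivalence. -/
def reflectEquiv : E3 ≃ᵐ E3 where
  toFun := reflect
  invFun := reflect
  left_inv := reflect_reflect
  right_inv := reflect_reflect
  measurable_toFun := measurable_reflect
  measurable_invFun := measurable_reflect

lemma integral_reflect (L₁ L₂ : ℝ) (f : E3 → ℝ) :
    ∫ x, f (reflect x) ∂(boxMeas L₁ L₂) = ∫ x, f x ∂(boxMeas L₁ L₂) :=
  (measurePreserving_reflect L₁ L₂).integral_comp reflectEquiv.measurableEmbedding f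

variable {L₁ L₂ : ℝ}

lemma exists_bound_on_box {f : E3 → ℝ} (hf : Continuous f) :
    ∃ C, 0 ≤ C ∧ ∀ x ∈ box L₁ L₂, |f x| ≤ C := by
  have hK : IsCompact (univ.pi fun i => Icc ((![0, 0, -1] : Fin 3 → ℝ) i)
      ((![L₁, L₂, 1] : Fin 3 → ℝ) i)) := isCompact_univ_pi fun i => isCompact_Icc
  obtain ⟨C, hC⟩ := hK.exists_bound_of_continuousOn hf.continuousOn
  refine ⟨max C 0, le_max_right _ _, fun x hx => (hC x ?_).trans (le_max_left _ _)⟩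
  rw [box_eq_pi] at hx
  exact fun i hi => Ioo_subset_Icc_self (hx i hi)

lemma ae_box {p : E3 → Prop} (h : ∀ x ∈ box L₁ L₂, p x) : ∀ᵐ x ∂(boxMeas L₁ L₂), p x :=
  (ae_restrict_iff' (measurableSet_box L₁ L₂)).2 (Eventually.of_forall h)

lemma memLp_of_continuous {f : E3 → ℝ} (hf : Continuous f) (p : ℝ≥0∞) :
    MemLp f p (boxMeas L₁ L₂) := by
  obtain ⟨C, -, hC⟩ := exists_bound_on_box (L₁ := L₁) (L₂ := L₂) hf
  exact MemLp.of_bound hf.aestronglyMeasurable C (ae_box hC)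

/-! ### Trigonometric modes -/

/-- The wave vector with integer index `k`. -/
noncomputable def wave (L₁ L₂ : ℝ) (k : Fin 3 → ℤ) (i : Fin 3) : ℝ :=
  2 * Real.pi * k i / period L₁ L₂ i

/-- The phase of the mode `k` at `x`. -/
noncomputable def phase (L₁ L₂ : ℝ) (k : Fin 3 → ℤ) (x : E3) : ℝ := ∑ i, wave L₁ L₂ k i * x i

/-- The real trigonometric modes: `cos` for `true`, `sin` for `false`. -/
noncomputable def mode (L₁ L₂ : ℝ) (k : Fin 3 → ℤ) (b : Bool) (x : E3) : ℝ :=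
  bif b then Real.cos (phase L₁ L₂ k x) else Real.sin (phase L₁ L₂ k x)

/-- The sign in the derivative of a mode. -/
def modeSign (b : Bool) : ℝ := bif b then -1 else 1

lemma contDiff_phase (k : Fin 3 → ℤ) : ContDiff ℝ ∞ (phase L₁ L₂ k) := by
  unfold phase; fun_prop

lemma contDiff_mode (k : Fin 3 → ℤ) (b : Bool) : ContDiff ℝ ∞ (mode L₁ L₂ k b) := by
  cases b
  · exact Real.contDiff_sin.comp (contDiff_phase k)
  · exact Real.contDiff_cos.comp (contDiff_phase k)

lemma period_pos (h₁ : 0 < L₁) (h₂ : 0 < L₂) (i : Fin 3) : 0 < period L₁ L₂ i := by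
  fin_cases i <;> simp [period, h₁, h₂]

lemma isPeriodic_mode (h₁ : 0 < L₁) (h₂ : 0 < L₂) (k : Fin 3 → ℤ) (b : Bool) :
    IsPeriodic L₁ L₂ (mode L₁ L₂ k b) := by
  intro i x
  have h : phase L₁ L₂ k (x + Pi.single i ((![L₁, L₂, 2] : Fin 3 → ℝ) i)) =
      phase L₁ L₂ k x + k i * (2 * Real.pi) := by
    have hp := (period_pos h₁ h₂ i).ne'
    simp only [phase, Pi.add_apply, mul_add, Finset.sum_add_distrib]
    congr 1
    rw [Finset.sum_eq_single i]
    · rw [Pi.single_eq_same]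
      change 2 * Real.pi * k i / period L₁ L₂ i * period L₁ L₂ i = _
      field_simp
    · intro j _ hj; simp [Pi.single_eq_of_ne hj]
    · simp
  cases b
  · simp [mode, h, Real.sin_add_int_mul_two_pi]
  · simp [mode, h, Real.cos_add_int_mul_two_pi]

lemma hasFDerivAt_phase (k : Fin 3 → ℤ) (x : E3) :
    HasFDerivAt (phase L₁ L₂ k)
      (∑ i, wave L₁ L₂ k i • (ContinuousLinearMap.proj i : E3 →L[ℝ] ℝ)) x := by
  unfold phase
  refine HasFDerivAt.fun_sum fun i _ => ?_
  exact (hasFDerivAt_apply i x).const_mul _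

lemma pd_mode (k : Fin 3 → ℤ) (b : Bool) (j : Fin 3) (x : E3) :
    pd j (mode L₁ L₂ k b) x = modeSign b * wave L₁ L₂ k j * mode L₁ L₂ k (!b) x := by
  have hs : (∑ i, wave L₁ L₂ k i • (ContinuousLinearMap.proj i : E3 →L[ℝ] ℝ)) (Pi.single j 1)
      = wave L₁ L₂ k j := by
    simp [Pi.single_apply]
  cases b
  · have := (hasFDerivAt_phase (L₁ := L₁) (L₂ := L₂) k x).sin.fderiv
    change fderiv ℝ (fun y => Real.sin (phase L₁ L₂ k y)) x (Pi.single j 1) = _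
    rw [this, smul_apply, hs]
    simp [modeSign, mode, mul_comm]
  · have := (hasFDerivAt_phase (L₁ := L₁) (L₂ := L₂) k x).cos.fderiv
    change fderiv ℝ (fun y => Real.cos (phase L₁ L₂ k y)) x (Pi.single j 1) = _
    rw [this, smul_apply, hs]
    simp [modeSign, mode, mul_comm]

lemma memLp_mode (k : Fin 3 → ℤ) (b : Bool) (p : ℝ≥0∞) :
    MemLp (mode L₁ L₂ k b) p (boxMeas L₁ L₂) :=
  memLp_of_continuous (contDiff_mode k b).continuous p

/-! ### Fourier coefficients and truncation -/

/-- The reciprocal of the volume of the box. -/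
noncomputable def volInv (L₁ L₂ : ℝ) : ℝ := (L₁ * L₂ * 2)⁻¹

/-- Unnormalised Fourier coefficients. -/
noncomputable def coef (L₁ L₂ : ℝ) (f : E3 → ℝ) (k : Fin 3 → ℤ) (b : Bool) : ℝ :=
  ∫ x, f x * mode L₁ L₂ k b x ∂(boxMeas L₁ L₂)

/-- The frequencies of size at most `N`. -/
noncomputable def freqs (N : ℕ) : Finset (Fin 3 → ℤ) := Fintype.piFinset fun _ => Finset.Icc (-(N : ℤ)) N

/-- The Fourier truncation of `f` to frequencies of size at most `N`. -/
noncomputable def trunc (L₁ L₂ : ℝ) (N : ℕ) (f : E3 → ℝ) (x : E3) : ℝ :=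
  volInv L₁ L₂ * ∑ k ∈ freqs N, ∑ b : Bool, coef L₁ L₂ f k b * mode L₁ L₂ k b x

lemma contDiff_trunc (N : ℕ) (f : E3 → ℝ) : ContDiff ℝ ∞ (trunc L₁ L₂ N f) := by
  unfold trunc
  exact contDiff_const.mul (ContDiff.sum fun k _ => ContDiff.sum fun b _ =>
    contDiff_const.mul (contDiff_mode k b))

lemma isPeriodic_trunc (h₁ : 0 < L₁) (h₂ : 0 < L₂) (N : ℕ) (f : E3 → ℝ) :
    IsPeriodic L₁ L₂ (trunc L₁ L₂ N f) := by
  intro i x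
  simp only [trunc, isPeriodic_mode h₁ h₂ _ _ i x]

lemma memLp_trunc (N : ℕ) (f : E3 → ℝ) (p : ℝ≥0∞) :
    MemLp (trunc L₁ L₂ N f) p (boxMeas L₁ L₂) :=
  memLp_of_continuous (contDiff_trunc N f).continuous p

lemma coef_congr {f g : E3 → ℝ} (h : f =ᵐ[boxMeas L₁ L₂] g) (k : Fin 3 → ℤ) (b : Bool) :
    coef L₁ L₂ f k b = coef L₁ L₂ g k b :=
  integral_congr_ae (h.mono fun x hx => by simp only [hx])

lemma integrable_mul_mode {f : E3 → ℝ} (hf : MemLp f 2 (boxMeas L₁ L₂)) (k : Fin 3 → ℤ)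
    (b : Bool) : Integrable (fun x => f x * mode L₁ L₂ k b x) (boxMeas L₁ L₂) :=
  integrable_mul hf (memLp_mode k b 2)

lemma coef_sub {f g : E3 → ℝ} (hf : MemLp f 2 (boxMeas L₁ L₂)) (hg : MemLp g 2 (boxMeas L₁ L₂))
    (k : Fin 3 → ℤ) (b : Bool) :
    coef L₁ L₂ (fun x => f x - g x) k b = coef L₁ L₂ f k b - coef L₁ L₂ g k b := by
  simp only [coef, sub_mul]
  exact integral_sub (integrable_mul_mode hf k b) (integrable_mul_mode hg k b)

lemma coef_neg (f : E3 → ℝ) (k : Fin 3 → ℤ) (b : Bool) :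
    coef L₁ L₂ (fun x => -f x) k b = -coef L₁ L₂ f k b := by
  simp only [coef, neg_mul, integral_neg]

lemma coef_weakPartial (h₁ : 0 < L₁) (h₂ : 0 < L₂) {j : Fin 3} {f g : E3 → ℝ}
    (h : HasWeakPartial L₁ L₂ j f g) (k : Fin 3 → ℤ) (b : Bool) :
    coef L₁ L₂ g k b = -(modeSign b * wave L₁ L₂ k j * coef L₁ L₂ f k (!b)) := by
  have := h _ (contDiff_mode k b) (isPeriodic_mode h₁ h₂ k b)
  simp only [pd_mode] at this
  rw [coef, coef, ← neg_eq_iff_eq_neg, ← this, ← integral_const_mul]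
  congr 1; ext x; ring

lemma pd_trunc_apply (N : ℕ) (f : E3 → ℝ) (j : Fin 3) (x : E3) :
    pd j (trunc L₁ L₂ N f) x = volInv L₁ L₂ * ∑ k ∈ freqs N, ∑ b : Bool,
      coef L₁ L₂ f k b * (modeSign b * wave L₁ L₂ k j * mode L₁ L₂ k (!b) x) := by
  have hd : ∀ k b, DifferentiableAt ℝ (mode L₁ L₂ k b) x := fun k b =>
    (contDiff_mode k b).differentiable (by simp) x
  simp only [← pd_mode]
  unfold pd trunc
  rw [fderiv_const_mul (by fun_prop), fderiv_fun_sum (by fun_prop)]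
  simp only [smul_apply, sum_apply, smul_eq_mul]
  congr 1
  refine Finset.sum_congr rfl fun k _ => ?_
  rw [fderiv_fun_sum (by fun_prop)]
  simp only [sum_apply]
  refine Finset.sum_congr rfl fun b _ => ?_
  rw [fderiv_const_mul (by fun_prop)]
  simp

/-- Modes are admissible test functions, so integrating by parts against them expresses the
coefficients of `g` by those of `f` with sine and cosine exchanged. As a consequence one smooth
function approximates `f` together with all its weak derivatives. -/
lemma pd_trunc (h₁ : 0 < L₁) (h₂ : 0 < L₂) {j : Fin 3} {f g : E3 → ℝ}
    (h : HasWeakPartial L₁ L₂ j f g) (N : ℕ) :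
    pd j (trunc L₁ L₂ N f) = trunc L₁ L₂ N g := by
  ext x
  rw [pd_trunc_apply, trunc]
  congr 1
  refine Finset.sum_congr rfl fun k _ => ?_
  simp only [Fintype.sum_bool, coef_weakPartial h₁ h₂ h, modeSign]
  simp; ring

/-- The truncated Parseval identity. It turns pairings with truncations into finite sums that can be
differentiated in time term by term. -/
lemma integral_trunc_mul {f g : E3 → ℝ} (hg : MemLp g 2 (boxMeas L₁ L₂)) (N : ℕ) :
    ∫ x, trunc L₁ L₂ N f x * g x ∂(boxMeas L₁ L₂) =
      volInv L₁ L₂ * ∑ k ∈ freqs N, ∑ b : Bool, coef L₁ L₂ f k b * coef L₁ L₂ g k b := by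
  have : ∀ x, trunc L₁ L₂ N f x * g x = volInv L₁ L₂ * ∑ k ∈ freqs N, ∑ b : Bool,
      coef L₁ L₂ f k b * (g x * mode L₁ L₂ k b x) := by
    intro x
    rw [trunc, mul_assoc, Finset.sum_mul]
    congr 1
    refine Finset.sum_congr rfl fun k _ => ?_
    rw [Finset.sum_mul]
    exact Finset.sum_congr rfl fun b _ => by ring
  simp only [this]
  rw [integral_const_mul, integral_finsetSum _ fun k _ => integrable_finsetSum _ fun b _ =>
    (integrable_mul_mode hg k b).const_mul _]
  congr 1
  refine Finset.sum_congr rfl fun k _ => ?_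
  rw [integral_finsetSum _ fun b _ => (integrable_mul_mode hg k b).const_mul _]
  exact Finset.sum_congr rfl fun b _ => by rw [integral_const_mul]; rfl

/-! ### Parity -/

/-- The index of the reflected mode. -/
def flip (k : Fin 3 → ℤ) : Fin 3 → ℤ := Function.update k 2 (-k 2)

lemma phase_reflect (k : Fin 3 → ℤ) (x : E3) :
    phase L₁ L₂ k (reflect x) = phase L₁ L₂ (flip k) x := by
  simp [phase, reflect, flip, Fin.sum_univ_three, wave]
  ring

lemma mode_reflect (k : Fin 3 → ℤ) (b : Bool) (x : E3) :
    mode L₁ L₂ k b (reflect x) = mode L₁ L₂ (flip k) b x := by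
  simp only [mode, phase_reflect]

lemma coef_reflect (f : E3 → ℝ) (k : Fin 3 → ℤ) (b : Bool) :
    coef L₁ L₂ (fun x => f (reflect x)) k b = coef L₁ L₂ f (flip k) b := by
  rw [coef, ← integral_reflect]
  simp only [reflect_reflect, mode_reflect]
  rfl

lemma flip_flip (k : Fin 3 → ℤ) : flip (flip k) = k := by simp [flip]

lemma flip_mem_freqs {N : ℕ} {k : Fin 3 → ℤ} (hk : k ∈ freqs N) : flip k ∈ freqs N := by
  simp only [freqs, Fintype.mem_piFinset, Finset.mem_Icc, Fin.forall_fin_succ] at hk ⊢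
  simp [flip] at hk ⊢
  omega

/-- The cube of frequencies is invariant under flipping the sign of the vertical index, so the sum
can be reindexed. Hence truncation respects parity in `z`. -/
lemma trunc_reflect (N : ℕ) (f : E3 → ℝ) (x : E3) :
    trunc L₁ L₂ N (fun x => f (reflect x)) x = trunc L₁ L₂ N f (reflect x) := by
  simp only [trunc, coef_reflect, mode_reflect]
  congr 1
  refine Finset.sum_nbij' flip flip (fun _ => flip_mem_freqs) (fun _ => flip_mem_freqs)
    (fun k _ => flip_flip k) (fun k _ => flip_flip k) fun k _ => ?_
  simp only [flip_flip]

lemma trunc_neg (N : ℕ) (f : E3 → ℝ) (x : E3) :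
    trunc L₁ L₂ N (fun x => -f x) x = -trunc L₁ L₂ N f x := by
  simp [trunc, coef_neg, Finset.sum_add_distrib]; ring

lemma trunc_even {f : E3 → ℝ} (hf : ∀ x, f (reflect x) = f x) (N : ℕ) (x : E3) :
    trunc L₁ L₂ N f (reflect x) = trunc L₁ L₂ N f x := by
  rw [← trunc_reflect]; simp only [hf]

lemma trunc_odd {f : E3 → ℝ} (hf : ∀ x, f (reflect x) = -f x) (N : ℕ) (x : E3) :
    trunc L₁ L₂ N f (reflect x) = -trunc L₁ L₂ N f x := by
  rw [← trunc_reflect, ← trunc_neg]; simp only [hf]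

/-! ### Transfer to the unit torus -/

section Torus

noncomputable local instance : MeasureSpace UnitAddCircle := ⟨AddCircle.haarAddCircle⟩

local instance : Measure.IsAddHaarMeasure (volume : Measure UnitAddCircle) :=
  inferInstanceAs (Measure.IsAddHaarMeasure AddCircle.haarAddCircle)

local instance : IsProbabilityMeasure (volume : Measure UnitAddCircle) :=
  inferInstanceAs (IsProbabilityMeasure AddCircle.haarAddCircle)

variable {L₁ L₂ : ℝ}

/-- The lower corner of the unit cell. -/
noncomputable def cellCorner : Fin 3 → ℝ := ![0, 0, -1 / 2]

/-- The rescaling of the unit cell to the box. -/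
noncomputable def cellScale (L₁ L₂ : ℝ) (y : E3) : E3 := fun i => period L₁ L₂ i * y i

/-- The section of the quotient map from the box to the unit torus. -/
noncomputable def torusSection (L₁ L₂ : ℝ) (θ : UnitAddTorus (Fin 3)) : E3 :=
  cellScale L₁ L₂ (UnitAddTorus.measurableEquivPiIoc cellCorner θ).1

lemma map_cellScale (h₁ : 0 < L₁) (h₂ : 0 < L₂) :
    Measure.map (cellScale L₁ L₂) volume = ENNReal.ofReal (volInv L₁ L₂) • volume := by
  have hdet : (Matrix.diagonal (period L₁ L₂)).det = L₁ * L₂ * 2 := by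
    rw [Matrix.det_diagonal, Fin.prod_univ_three]; rfl
  have hpos : 0 < L₁ * L₂ * 2 := by positivity
  have h := Real.smul_map_diagonal_volume_pi (D := period L₁ L₂) (by rw [hdet]; exact hpos.ne')
  have hs : ⇑(Matrix.toLin' (Matrix.diagonal (period L₁ L₂))) = cellScale L₁ L₂ := by
    ext y i; simp [cellScale, Matrix.mulVec_diagonal]
  rw [hdet, hs, abs_of_pos hpos] at h
  conv_rhs => rw [← h]
  rw [smul_smul, volInv, ← ENNReal.ofReal_mul (by positivity), inv_mul_cancel₀ hpos.ne']
  simp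

lemma measurable_cellScale : Measurable (cellScale L₁ L₂) := by
  unfold cellScale; fun_prop

/-- The unit cell is chosen so that scaling by the periods carries it onto the box up to a null set.
Haar probability measure then becomes normalised Lebesgue measure, and the `L²` theory of Fourier
series on the torus transfers to the box. -/
lemma measurePreserving_torusSection (h₁ : 0 < L₁) (h₂ : 0 < L₂) :
    MeasurePreserving (torusSection L₁ L₂) volume
      (ENNReal.ofReal (volInv L₁ L₂) • boxMeas L₁ L₂) := by
  set Q : Set E3 := {x | ∀ i, x i ∈ Ioc (cellCorner i) (cellCorner i + 1)} with hQ
  have hQm : MeasurableSet Q := MeasurableSet.univ_pi' fun i => measurableSet_Ioc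
  have e1 := UnitAddTorus.measurePreserving_equivPiIoc cellCorner
  have e2 : MeasurePreserving (Subtype.val : Q → E3) (Measure.comap Subtype.val volume)
      (volume.restrict Q) :=
    ⟨measurable_subtype_coe, map_comap_subtype_coe hQm volume⟩
  have e3 : MeasurePreserving (cellScale L₁ L₂) (volume.restrict Q)
      (ENNReal.ofReal (volInv L₁ L₂) • boxMeas L₁ L₂) := by
    refine ⟨measurable_cellScale, ?_⟩
    set R : Set E3 := univ.pi fun i => Ioc ((![0, 0, -1] : Fin 3 → ℝ) i)
      ((![L₁, L₂, 1] : Fin 3 → ℝ) i) with hR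
    have hQR : Q = cellScale L₁ L₂ ⁻¹' R := by
      ext y
      simp only [hQ, hR, mem_ofPred_eq, mem_preimage, Set.mem_pi, mem_univ, true_imp_iff,
        Fin.forall_fin_succ]
      simp [cellScale, cellCorner, period, mul_pos_iff_of_pos_left, h₁, h₂]
      intro _ _ _ _
      constructor <;> rintro ⟨a, b⟩ <;> constructor <;> linarith
    have hRm : MeasurableSet R := MeasurableSet.univ_pi fun i => measurableSet_Ioc
    have hbox : boxMeas L₁ L₂ = volume.restrict R := by
      rw [boxMeas, box_eq_pi, hR]
      exact Measure.restrict_congr_set Measure.univ_pi_Ioo_ae_eq_Icc |>.trans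
        (Measure.restrict_congr_set Measure.univ_pi_Ioc_ae_eq_Icc).symm
    rw [hQR, ← Measure.restrict_map measurable_cellScale hRm, map_cellScale h₁ h₂,
      Measure.restrict_smul, hbox]
  exact (e3.comp e2).comp e1

/-- The complex exponential with index `k`. -/
noncomputable def cmode (L₁ L₂ : ℝ) (k : Fin 3 → ℤ) (x : E3) : ℂ :=
  Complex.exp (phase L₁ L₂ k x * Complex.I)

lemma cmode_eq (k : Fin 3 → ℤ) (x : E3) :
    cmode L₁ L₂ k x = mode L₁ L₂ k true x + mode L₁ L₂ k false x * Complex.I := by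
  simp [cmode, Complex.exp_mul_I, mode]

lemma mFourier_eq (h₁ : 0 < L₁) (h₂ : 0 < L₂) (k : Fin 3 → ℤ) (θ : UnitAddTorus (Fin 3)) :
    UnitAddTorus.mFourier k θ = cmode L₁ L₂ k (torusSection L₁ L₂ θ) := by
  have hθ : ∀ i, θ i = (((UnitAddTorus.measurableEquivPiIoc cellCorner θ).1 i : ℝ) :
      UnitAddCircle) := fun i =>
    congrFun ((UnitAddTorus.measurableEquivPiIoc cellCorner).symm_apply_apply θ).symm i
  have : UnitAddTorus.mFourier k θ = ∏ i, fourier (k i) (θ i) := rfl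
  rw [this, cmode, phase, Complex.ofReal_sum, Finset.sum_mul, Complex.exp_sum]
  refine Finset.prod_congr rfl fun i _ => ?_
  conv_lhs => rw [hθ i]
  rw [fourier_coe_apply]
  congr 1
  have hp : ((period L₁ L₂ i : ℝ) : ℂ) ≠ 0 := by exact_mod_cast (period_pos h₁ h₂ i).ne'
  simp only [torusSection, cellScale, wave]
  push_cast
  field_simp

/-- The complex function on the torus corresponding to `f`. -/
noncomputable def torusFun (L₁ L₂ : ℝ) (f : E3 → ℝ) (θ : UnitAddTorus (Fin 3)) : ℂ :=
  (f (torusSection L₁ L₂ θ) : ℂ)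

lemma volInv_pos (h₁ : 0 < L₁) (h₂ : 0 < L₂) : 0 < volInv L₁ L₂ := by
  unfold volInv; positivity

lemma integral_torusSection {E : Type*} [NormedAddCommGroup E] [NormedSpace ℝ E]
    (h₁ : 0 < L₁) (h₂ : 0 < L₂) {F : E3 → E} (hF : AEStronglyMeasurable F (boxMeas L₁ L₂)) :
    ∫ θ, F (torusSection L₁ L₂ θ) = volInv L₁ L₂ • ∫ x, F x ∂(boxMeas L₁ L₂) := by
  have hp := measurePreserving_torusSection h₁ h₂
  rw [← integral_map (μ := volume) hp.measurable.aemeasurable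
    (by rw [hp.map_eq]; exact hF.smul_measure _), hp.map_eq,
    integral_smul_measure, ENNReal.toReal_ofReal (volInv_pos h₁ h₂).le]

lemma memLp_torusFun (h₁ : 0 < L₁) (h₂ : 0 < L₂) {f : E3 → ℝ} (hf : MemLp f 2 (boxMeas L₁ L₂)) :
    MemLp (torusFun L₁ L₂ f) 2 (volume : Measure (UnitAddTorus (Fin 3))) :=
  (((hf.ofReal (K := ℂ)).smul_measure ENNReal.ofReal_ne_top).comp_measurePreserving
    (measurePreserving_torusSection h₁ h₂))

/-- For real `f` the conjugate character splits into a cosine and a sine part; the factor `volInv`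
comes from the normalisation of Haar measure. -/
lemma mFourierCoeff_torusFun (h₁ : 0 < L₁) (h₂ : 0 < L₂) {f : E3 → ℝ}
    (hf : MemLp f 2 (boxMeas L₁ L₂)) (k : Fin 3 → ℤ) :
    UnitAddTorus.mFourierCoeff (torusFun L₁ L₂ f) k =
      volInv L₁ L₂ * (coef L₁ L₂ f k true - coef L₁ L₂ f k false * Complex.I) := by
  have hi : ∀ b, Integrable (fun x => ((f x * mode L₁ L₂ k b x : ℝ) : ℂ)) (boxMeas L₁ L₂) :=
    fun b => (integrable_mul_mode hf k b).ofReal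
  have hpt : ∀ θ, UnitAddTorus.mFourier (-k) θ • torusFun L₁ L₂ f θ =
      (fun x => ((f x * mode L₁ L₂ k true x : ℝ) : ℂ) - ((f x * mode L₁ L₂ k false x : ℝ) : ℂ)
        * Complex.I) (torusSection L₁ L₂ θ) := by
    intro θ
    rw [UnitAddTorus.mFourier_neg, mFourier_eq h₁ h₂, cmode_eq]
    simp [torusFun]
    ring
  unfold UnitAddTorus.mFourierCoeff
  simp only [hpt]
  rw [integral_torusSection h₁ h₂ (F := fun x => ((f x * mode L₁ L₂ k true x : ℝ) : ℂ) -
    ((f x * mode L₁ L₂ k false x : ℝ) : ℂ) * Complex.I)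
    (((hi true).sub ((hi false).mul_const _)).aestronglyMeasurable),
    integral_sub (hi true) ((hi false).mul_const _), integral_mul_const, integral_complex_ofReal,
    integral_complex_ofReal]
  simp [coef]

lemma trunc_torusSection (h₁ : 0 < L₁) (h₂ : 0 < L₂) {f : E3 → ℝ}
    (hf : MemLp f 2 (boxMeas L₁ L₂)) (N : ℕ) (θ : UnitAddTorus (Fin 3)) :
    trunc L₁ L₂ N f (torusSection L₁ L₂ θ) = (∑ k ∈ freqs N,
      UnitAddTorus.mFourierCoeff (torusFun L₁ L₂ f) k * UnitAddTorus.mFourier k θ).re := by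
  rw [Complex.re_sum, trunc, Finset.mul_sum]
  refine Finset.sum_congr rfl fun k _ => ?_
  rw [mFourierCoeff_torusFun h₁ h₂ hf, mFourier_eq h₁ h₂, cmode_eq]
  simp
  ring

/-- The partial Fourier sums on the torus as elements of `L²`. -/
noncomputable def partialSum (L₁ L₂ : ℝ) (f : E3 → ℝ) (N : ℕ) :
    Lp ℂ 2 (volume : Measure (UnitAddTorus (Fin 3))) :=
  ∑ k ∈ freqs N, UnitAddTorus.mFourierCoeff (torusFun L₁ L₂ f) k • UnitAddTorus.mFourierLp 2 k

lemma coeFn_partialSum (f : E3 → ℝ) (N : ℕ) :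
    (partialSum L₁ L₂ f N : UnitAddTorus (Fin 3) → ℂ) =ᵐ[volume] fun θ => ∑ k ∈ freqs N,
      UnitAddTorus.mFourierCoeff (torusFun L₁ L₂ f) k * UnitAddTorus.mFourier k θ := by
  unfold partialSum
  refine (Lp.coeFn_finsetSum _ _).trans ?_
  have : ∀ k ∈ freqs N, (UnitAddTorus.mFourierCoeff (torusFun L₁ L₂ f) k •
      UnitAddTorus.mFourierLp 2 k : Lp ℂ 2 (volume : Measure (UnitAddTorus (Fin 3))))
      =ᵐ[volume] fun θ => UnitAddTorus.mFourierCoeff (torusFun L₁ L₂ f) k *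
        UnitAddTorus.mFourier k θ := fun k _ => by
    filter_upwards [Lp.coeFn_smul (UnitAddTorus.mFourierCoeff (torusFun L₁ L₂ f) k)
      (UnitAddTorus.mFourierLp 2 k), UnitAddTorus.coeFn_mFourierLp 2 k] with θ ha hb
    rw [ha, Pi.smul_apply, hb, smul_eq_mul]
  filter_upwards [(Finset.eventually_all _).2 this] with θ hθ
  rw [Finset.sum_apply]
  exact Finset.sum_congr rfl hθ

lemma Lp_norm_sq (F : Lp ℂ 2 (volume : Measure (UnitAddTorus (Fin 3)))) :
    ‖F‖ ^ 2 = ∫ θ, ‖F θ‖ ^ 2 := by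
  rw [← inner_self_eq_norm_sq (𝕜 := ℂ), L2.inner_def, ← integral_re (L2.integrable_inner F F)]
  simp only [inner_self_eq_norm_sq]

/-- Real truncations are real parts of complex partial sums, so a pointwise domination by an `L²`
element on the torus is all that is needed to transfer norm bounds and convergence. -/
lemma sq_integral_le_norm (h₁ : 0 < L₁) (h₂ : 0 < L₂) {g : E3 → ℝ}
    (hg : MemLp g 2 (boxMeas L₁ L₂))
    (F : Lp ℂ 2 (volume : Measure (UnitAddTorus (Fin 3))))
    (h : ∀ᵐ θ, |g (torusSection L₁ L₂ θ)| ≤ ‖F θ‖) :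
    volInv L₁ L₂ * l2 (boxMeas L₁ L₂) g ^ 2 ≤ ‖F‖ ^ 2 := by
  rw [l2_sq, ← smul_eq_mul, ← integral_torusSection h₁ h₂ (F := fun x => g x ^ 2)
    hg.integrable_sq.aestronglyMeasurable, Lp_norm_sq]
  refine integral_mono_of_nonneg (Eventually.of_forall fun _ => sq_nonneg _)
    ((memLp_two_iff_integrable_sq_norm (Lp.aestronglyMeasurable F)).1 (Lp.memLp F)) ?_
  filter_upwards [h] with θ hθ
  rw [← sq_abs]
  exact pow_le_pow_left₀ (abs_nonneg _) hθ 2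

lemma norm_toLp_torusFun (h₁ : 0 < L₁) (h₂ : 0 < L₂) {f : E3 → ℝ}
    (hf : MemLp f 2 (boxMeas L₁ L₂)) :
    ‖(memLp_torusFun h₁ h₂ hf).toLp‖ ^ 2 = volInv L₁ L₂ * l2 (boxMeas L₁ L₂) f ^ 2 := by
  rw [l2_sq, ← smul_eq_mul, ← integral_torusSection h₁ h₂ (F := fun x => f x ^ 2)
    hf.integrable_sq.aestronglyMeasurable, Lp_norm_sq]
  refine integral_congr_ae ?_
  filter_upwards [(memLp_torusFun h₁ h₂ hf).coeFn_toLp] with θ hθ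
  rw [hθ]; simp [torusFun]

lemma mFourierCoeff_toLp (h₁ : 0 < L₁) (h₂ : 0 < L₂) {f : E3 → ℝ}
    (hf : MemLp f 2 (boxMeas L₁ L₂)) (k : Fin 3 → ℤ) :
    UnitAddTorus.mFourierCoeff ((memLp_torusFun h₁ h₂ hf).toLp :
      UnitAddTorus (Fin 3) → ℂ) k = UnitAddTorus.mFourierCoeff (torusFun L₁ L₂ f) k := by
  refine integral_congr_ae ?_
  filter_upwards [(memLp_torusFun h₁ h₂ hf).coeFn_toLp] with θ hθ
  rw [hθ]

/-- Bessel's inequality for the real Fourier coefficients. -/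
lemma bessel (h₁ : 0 < L₁) (h₂ : 0 < L₂) {f : E3 → ℝ} (hf : MemLp f 2 (boxMeas L₁ L₂)) (N : ℕ) :
    volInv L₁ L₂ * ∑ k ∈ freqs N, ∑ b : Bool, coef L₁ L₂ f k b ^ 2
      ≤ l2 (boxMeas L₁ L₂) f ^ 2 := by
  have hc := volInv_pos h₁ h₂
  have h := sum_le_hasSum (freqs N) (fun k _ => by positivity)
    (UnitAddTorus.hasSum_sq_mFourierCoeff (memLp_torusFun h₁ h₂ hf).toLp)
  rw [← Lp_norm_sq, norm_toLp_torusFun h₁ h₂ hf] at h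
  have e : ∀ k, ‖UnitAddTorus.mFourierCoeff ((memLp_torusFun h₁ h₂ hf).toLp :
      UnitAddTorus (Fin 3) → ℂ) k‖ ^ 2 =
      volInv L₁ L₂ ^ 2 * ∑ b : Bool, coef L₁ L₂ f k b ^ 2 := by
    intro k
    rw [mFourierCoeff_toLp h₁ h₂ hf, mFourierCoeff_torusFun h₁ h₂ hf, ← Complex.normSq_eq_norm_sq,
      Complex.normSq_apply]
    simp
    ring
  simp only [e, ← Finset.mul_sum] at h
  rw [pow_two, mul_assoc] at h
  exact le_of_mul_le_mul_left h hc

lemma norm_partialSum_le (h₁ : 0 < L₁) (h₂ : 0 < L₂) {f : E3 → ℝ}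
    (hf : MemLp f 2 (boxMeas L₁ L₂)) (N : ℕ) :
    ‖partialSum L₁ L₂ f N‖ ≤ ‖(memLp_torusFun h₁ h₂ hf).toLp‖ := by
  have h := sum_le_hasSum (freqs N) (fun k _ => by positivity)
    (UnitAddTorus.hasSum_sq_mFourierCoeff (memLp_torusFun h₁ h₂ hf).toLp)
  rw [← Lp_norm_sq] at h
  refine (pow_le_pow_iff_left₀ (norm_nonneg _) (norm_nonneg _) two_ne_zero).1 (le_trans ?_ h)
  rw [← inner_self_eq_norm_sq (𝕜 := ℂ), partialSum,
    UnitAddTorus.orthonormal_mFourier.inner_sum]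
  simp only [map_sum]
  refine Finset.sum_le_sum fun k _ => le_of_eq ?_
  rw [RCLike.conj_mul, mFourierCoeff_toLp h₁ h₂ hf]
  norm_cast

lemma l2_trunc_le (h₁ : 0 < L₁) (h₂ : 0 < L₂) {f : E3 → ℝ} (hf : MemLp f 2 (boxMeas L₁ L₂))
    (N : ℕ) : l2 (boxMeas L₁ L₂) (trunc L₁ L₂ N f) ≤ l2 (boxMeas L₁ L₂) f := by
  have hc := volInv_pos h₁ h₂
  have h := sq_integral_le_norm h₁ h₂ (memLp_trunc N f 2) (partialSum L₁ L₂ f N) (by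
    filter_upwards [coeFn_partialSum (L₁ := L₁) (L₂ := L₂) f N] with θ hθ
    rw [hθ, trunc_torusSection h₁ h₂ hf]
    exact Complex.abs_re_le_norm _)
  have h' := pow_le_pow_left₀ (norm_nonneg _) (norm_partialSum_le h₁ h₂ hf N) 2
  rw [norm_toLp_torusFun h₁ h₂ hf] at h'
  exact (pow_le_pow_iff_left₀ l2_nonneg l2_nonneg two_ne_zero).1
    (le_of_mul_le_mul_left (h.trans h') hc)

/-- The Fourier series converges unconditionally in `L²`, hence along every exhausting sequence of
finite sets, in particular along these reflection-invariant cubes. -/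
lemma tendsto_freqs : Tendsto freqs atTop atTop := by
  refine tendsto_atTop_finset_of_monotone (fun m n hmn k hk => ?_) fun k => ?_
  · simp only [freqs, Fintype.mem_piFinset, Finset.mem_Icc] at hk ⊢
    intro i
    have := hk i
    omega
  · refine ⟨∑ i, (k i).natAbs, ?_⟩
    simp only [freqs, Fintype.mem_piFinset, Finset.mem_Icc]
    intro i
    have : (k i).natAbs ≤ ∑ i, (k i).natAbs :=
      Finset.single_le_sum (f := fun i => (k i).natAbs) (fun _ _ => Nat.zero_le _)
        (Finset.mem_univ i)
    omega

/-- Fourier truncations converge in `L²`. -/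
lemma tendsto_trunc (h₁ : 0 < L₁) (h₂ : 0 < L₂) {f : E3 → ℝ} (hf : MemLp f 2 (boxMeas L₁ L₂)) :
    Tendsto (fun N => l2 (boxMeas L₁ L₂) (fun x => f x - trunc L₁ L₂ N f x)) atTop (𝓝 0) := by
  have hc := volInv_pos h₁ h₂
  set F := (memLp_torusFun h₁ h₂ hf).toLp with hF
  have h1 : Tendsto (fun N => partialSum L₁ L₂ f N) atTop (𝓝 F) := by
    have := (UnitAddTorus.hasSum_mFourier_series_L2 F).comp tendsto_freqs
    simpa only [partialSum, hF, mFourierCoeff_toLp h₁ h₂ hf] using! this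
  have h2 : Tendsto (fun N => ‖F - partialSum L₁ L₂ f N‖) atTop (𝓝 0) := by
    simpa using ((tendsto_const_nhds (x := F)).sub h1).norm
  have h3 : ∀ N, l2 (boxMeas L₁ L₂) (fun x => f x - trunc L₁ L₂ N f x) ≤
      (√(volInv L₁ L₂))⁻¹ * ‖F - partialSum L₁ L₂ f N‖ := by
    intro N
    have h := sq_integral_le_norm h₁ h₂ (hf.sub (memLp_trunc N f 2)) (F - partialSum L₁ L₂ f N) (by
      filter_upwards [coeFn_partialSum (L₁ := L₁) (L₂ := L₂) f N,
        (memLp_torusFun h₁ h₂ hf).coeFn_toLp, Lp.coeFn_sub F (partialSum L₁ L₂ f N)] with θ ha hb hd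
      rw [hd, Pi.sub_apply, hF, Pi.sub_apply, hb, ha, trunc_torusSection h₁ h₂ hf]
      refine le_trans (le_of_eq ?_) (Complex.abs_re_le_norm _)
      simp [torusFun])
    have hs : 0 < √(volInv L₁ L₂) := Real.sqrt_pos.2 hc
    rw [inv_mul_eq_div, le_div_iff₀ hs]
    refine (pow_le_pow_iff_left₀ (by have := l2_nonneg (μ := boxMeas L₁ L₂) (f := fun x => f x - trunc L₁ L₂ N f x); positivity) (norm_nonneg _) two_ne_zero).1 ?_
    rw [mul_pow, Real.sq_sqrt hc.le, mul_comm]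
    exact h
  refine squeeze_zero (fun _ => l2_nonneg) h3 ?_
  simpa using h2.const_mul (√(volInv L₁ L₂))⁻¹

end Torus

/-! ### Anisotropic trilinear estimates for smooth functions -/

section Trilinear

variable {L₁ L₂ : ℝ}

/-- The fundamental theorem of calculus bounds `|φ s|` by `|φ r| + ∫ |φ'|` for each `r`; averaging
over `r` gives the claim. No boundary condition is needed, which makes it usable on the open box. -/
lemma enorm_le_average_add {φ : ℝ → ℝ} (hφ : ContDiff ℝ 1 φ) {a b s : ℝ} (hs : s ∈ Ioo a b) :
    ‖φ s‖ₑ ≤ ENNReal.ofReal (b - a)⁻¹ * (∫⁻ r in Ioo a b, ‖φ r‖ₑ)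
      + ∫⁻ r in Ioo a b, ‖deriv φ r‖ₑ := by
  have hab : 0 < b - a := by linarith [hs.1, hs.2]
  have key : ∀ r ∈ Ioo a b, ‖φ s‖ₑ ≤ ‖φ r‖ₑ + ∫⁻ r in Ioo a b, ‖deriv φ r‖ₑ := by
    intro r hr
    have h1 : ∫ t in r..s, deriv φ t = φ s - φ r :=
      intervalIntegral.integral_deriv_eq_sub (fun x _ => hφ.differentiable (by simp) x)
        ((hφ.continuous_deriv le_rfl).intervalIntegrable _ _)
    have h2 : φ s = φ r + ∫ t in r..s, deriv φ t := by rw [h1]; ring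
    have hsub : uIoc r s ⊆ Ioo a b := uIoc_subset_uIcc.trans
      (ordConnected_Ioo.uIcc_subset hr hs)
    calc ‖φ s‖ₑ = ‖φ r + ∫ t in r..s, deriv φ t‖ₑ := by rw [← h2]
      _ ≤ ‖φ r‖ₑ + ‖∫ t in r..s, deriv φ t‖ₑ := enorm_add_le _ _
      _ ≤ _ := by
        gcongr
        rw [← ofReal_norm, intervalIntegral.norm_intervalIntegral_eq, ofReal_norm]
        exact (enorm_integral_le_lintegral_enorm _).trans (lintegral_mono_set hsub)
  have h3 : ∫⁻ _r in Ioo a b, ‖φ s‖ₑ ≤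
      ∫⁻ r in Ioo a b, (‖φ r‖ₑ + ∫⁻ r in Ioo a b, ‖deriv φ r‖ₑ) :=
    setLIntegral_mono' measurableSet_Ioo key
  rw [lintegral_add_right _ measurable_const, lintegral_const, lintegral_const] at h3
  simp only [Measure.restrict_apply_univ, Real.volume_Ioo] at h3
  have h0 : ENNReal.ofReal (b - a)⁻¹ * ENNReal.ofReal (b - a) = 1 := by
    rw [← ENNReal.ofReal_mul (by positivity), inv_mul_cancel₀ hab.ne', ENNReal.ofReal_one]
  calc ‖φ s‖ₑ = ENNReal.ofReal (b - a)⁻¹ * (‖φ s‖ₑ * ENNReal.ofReal (b - a)) := by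
        rw [mul_left_comm, h0, mul_one]
    _ ≤ ENNReal.ofReal (b - a)⁻¹ * ((∫⁻ r in Ioo a b, ‖φ r‖ₑ) +
        (∫⁻ r in Ioo a b, ‖deriv φ r‖ₑ) * ENNReal.ofReal (b - a)) := by gcongr
    _ = _ := by rw [mul_add, mul_left_comm (ENNReal.ofReal (b - a)⁻¹), h0, mul_one]

lemma lintegral_mul_sq_le {X : Type*} [MeasurableSpace X] (μ : Measure X) {f g : X → ℝ≥0∞}
    (hf : Measurable f) (hg : Measurable g) :
    (∫⁻ x, f x * g x ∂μ) ^ 2 ≤ (∫⁻ x, f x ^ 2 ∂μ) * ∫⁻ x, g x ^ 2 ∂μ := by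
  have h := ENNReal.lintegral_mul_le_Lp_mul_Lq μ (p := 2) (q := 2)
    (by constructor <;> norm_num) hf.aemeasurable hg.aemeasurable
  simp only [Pi.mul_apply, ENNReal.rpow_two] at h
  refine (pow_le_pow_left' h 2).trans (le_of_eq ?_)
  rw [mul_pow, ← ENNReal.rpow_natCast, ← ENNReal.rpow_natCast, ← ENNReal.rpow_mul,
    ← ENNReal.rpow_mul]
  norm_num

lemma lintegral_enorm_mul_le {X : Type*} [MeasurableSpace X] {μ : Measure X} {f g : X → ℝ}
    (hf : MemLp f 2 μ) (hg : MemLp g 2 μ) :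
    ∫⁻ x, ‖f x * g x‖ₑ ∂μ ≤ ENNReal.ofReal (l2 μ f * l2 μ g) := by
  rw [← ofReal_integral_norm_eq_lintegral_enorm (integrable_mul hf hg)]
  exact ENNReal.ofReal_le_ofReal (integral_abs_mul_le hf hg)

lemma hasDerivAt_slice {f : E3 → ℝ} (hf : ContDiff ℝ 1 f) (x : E3) (j : Fin 3) (s : ℝ) :
    HasDerivAt (fun s => f (Function.update x j s)) (pd j f (Function.update x j s)) s :=
  ((hf.differentiable (by simp) _).hasFDerivAt).comp_hasDerivAt s (hasDerivAt_update x j s)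

lemma contDiff_slice {f : E3 → ℝ} (hf : ContDiff ℝ 1 f) (x : E3) (j : Fin 3) :
    ContDiff ℝ 1 (fun s => f (Function.update x j s)) :=
  hf.comp (contDiff_update 1 x j)

lemma slice_le {f : E3 → ℝ} (hf : ContDiff ℝ 1 f) (x : E3) (j : Fin 3) {a b s : ℝ}
    (hs : s ∈ Ioo a b) :
    ‖f (Function.update x j s)‖ₑ ≤
      ENNReal.ofReal (b - a)⁻¹ * (∫⁻ r in Ioo a b, ‖f (Function.update x j r)‖ₑ)
        + ∫⁻ r in Ioo a b, ‖pd j f (Function.update x j r)‖ₑ := by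
  have h := enorm_le_average_add (contDiff_slice hf x j) hs
  simpa only [(hasDerivAt_slice hf x j _).deriv] using h

lemma continuous_pd {f : E3 → ℝ} (hf : ContDiff ℝ 1 f) (j : Fin 3) : Continuous (pd j f) := by
  unfold pd
  exact (hf.continuous_fderiv (by simp)).clm_apply continuous_const

lemma update_vec0 (a b c s : ℝ) : Function.update (![a, b, c] : E3) 0 s = ![s, b, c] := by
  ext i; fin_cases i <;> rfl

lemma update_vec1 (a b c s : ℝ) : Function.update (![a, b, c] : E3) 1 s = ![a, s, c] := by
  ext i; fin_cases i <;> rfl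

lemma update_vec2 (a b c s : ℝ) : Function.update (![a, b, c] : E3) 2 s = ![a, b, s] := by
  ext i; fin_cases i <;> rfl

@[fun_prop]
lemma measurable_vec3 {X : Type*} [MeasurableSpace X] {a b c : X → ℝ} (ha : Measurable a)
    (hb : Measurable b) (hc : Measurable c) : Measurable fun x => (![a x, b x, c x] : E3) := by
  refine measurable_pi_lambda _ fun i => ?_
  fin_cases i
  · exact ha
  · exact hb
  · exact hc

/-- The density whose integral controls the columns of `f²`. -/
noncomputable def ladDensity (r : ℝ) (f f' : E3 → ℝ) (x : E3) : ℝ≥0∞ :=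
  ENNReal.ofReal r⁻¹ * ‖f x‖ₑ ^ 2 + 2 * (‖f x‖ₑ * ‖f' x‖ₑ)

lemma measurable_ladDensity {r : ℝ} {f f' : E3 → ℝ} (hf : Measurable f) (hf' : Measurable f') :
    Measurable (ladDensity r f f') := by
  unfold ladDensity; fun_prop

lemma pd_sq {f : E3 → ℝ} (hf : ContDiff ℝ 1 f) (j : Fin 3) (x : E3) :
    pd j (fun y => f y ^ 2) x = 2 * (f x * pd j f x) := by
  have hd := (hf.differentiable (by simp) x).hasFDerivAt
  unfold pd
  rw [(hd.pow 2).fderiv]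
  simp; ring

/-- The one-dimensional sup bound applied to `f²`, whose derivative is `2 f ∂ⱼ f`. Working with the
square is what produces the product `‖f‖ ‖∂ⱼ f‖` of Ladyzhenskaya type. -/
lemma slice_sq_le {f : E3 → ℝ} (hf : ContDiff ℝ 1 f) (x : E3) (j : Fin 3) {a b s : ℝ}
    (hs : s ∈ Ioo a b) :
    ‖f (Function.update x j s)‖ₑ ^ 2 ≤
      ∫⁻ r in Ioo a b, ladDensity (b - a) f (pd j f) (Function.update x j r) := by
  have h := slice_le (hf.pow 2) x j hs
  have hm : Measurable fun r : ℝ => ‖f (Function.update x j r)‖ₑ ^ 2 :=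
    ((contDiff_slice hf x j).continuous.measurable.enorm).pow_const 2
  unfold ladDensity
  rw [lintegral_add_left (hm.const_mul _), lintegral_const_mul _ hm]
  simp only [pd_sq hf, enorm_mul, enorm_pow] at h
  have h2 : ‖(2 : ℝ)‖ₑ = 2 := by simp [Real.enorm_eq_ofReal_abs]
  rw [h2] at h
  exact h

lemma lintegral_ladDensity_le {r : ℝ} (hr : 0 < r) {f f' : E3 → ℝ}
    (hf : Continuous f) (hf' : Continuous f') :
    ∫⁻ x, ladDensity r f f' x ∂(boxMeas L₁ L₂) ≤
      ENNReal.ofReal (r⁻¹ * l2 (boxMeas L₁ L₂) f ^ 2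
        + 2 * (l2 (boxMeas L₁ L₂) f * l2 (boxMeas L₁ L₂) f')) := by
  have hm := hf.measurable
  have hm' := hf'.measurable
  have i1 := memLp_of_continuous (L₁ := L₁) (L₂ := L₂) hf 2
  have i2 := memLp_of_continuous (L₁ := L₁) (L₂ := L₂) hf' 2
  have hr' : 0 ≤ r⁻¹ := by positivity
  have n1 : 0 ≤ l2 (boxMeas L₁ L₂) f := l2_nonneg
  have n2 : 0 ≤ l2 (boxMeas L₁ L₂) f' := l2_nonneg
  unfold ladDensity
  rw [lintegral_add_left (by fun_prop), lintegral_const_mul _ (by fun_prop),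
    lintegral_const_mul _ (by fun_prop), ENNReal.ofReal_add (by positivity) (by positivity),
    ENNReal.ofReal_mul hr', ENNReal.ofReal_mul zero_le_two, ofReal_l2_sq i1, ENNReal.ofReal_ofNat]
  gcongr
  simpa only [enorm_mul] using lintegral_enorm_mul_le i1 i2

/-- The column integral of `f²`. -/
noncomputable def colSq (f : E3 → ℝ) (a b : ℝ) : ℝ≥0∞ := ∫⁻ c in Ioo (-1 : ℝ) 1, ‖f ![a, b, c]‖ₑ ^ 2

/-- The ladder functional `‖f‖² + ‖f‖ (‖∂ₓ f‖ + ‖∂_y f‖)`. -/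
noncomputable def lad (L₁ L₂ : ℝ) (f fx fy : E3 → ℝ) : ℝ :=
  l2 (boxMeas L₁ L₂) f ^ 2
    + l2 (boxMeas L₁ L₂) f * (l2 (boxMeas L₁ L₂) fx + l2 (boxMeas L₁ L₂) fy)

lemma lad_nonneg (f fx fy : E3 → ℝ) : 0 ≤ lad L₁ L₂ f fx fy := by
  have n1 : 0 ≤ l2 (boxMeas L₁ L₂) f := l2_nonneg
  have n2 : 0 ≤ l2 (boxMeas L₁ L₂) fx := l2_nonneg
  have n3 : 0 ≤ l2 (boxMeas L₁ L₂) fy := l2_nonneg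
  unfold lad; positivity

/-- The geometric constant in the trilinear estimates. -/
noncomputable def ladConst (L₁ L₂ : ℝ) : ℝ := L₁⁻¹ + L₂⁻¹ + 2

lemma ladConst_pos (h₁ : 0 < L₁) (h₂ : 0 < L₂) : 0 < ladConst L₁ L₂ := by
  unfold ladConst; positivity

lemma measurable_colSq {f : E3 → ℝ} (hf : Measurable f) :
    Measurable fun p : ℝ × ℝ => colSq f p.1 p.2 := by
  unfold colSq
  exact Measurable.lintegral_prod_right' (f := fun q : (ℝ × ℝ) × ℝ => ‖f ![q.1.1, q.1.2, q.2]‖ₑ ^ 2)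
    (by fun_prop)

lemma lintegral_box_prod {f : E3 → ℝ≥0∞} (hf : Measurable f) :
    ∫⁻ x, f x ∂(boxMeas L₁ L₂) =
      ∫⁻ p, (∫⁻ c in Ioo (-1 : ℝ) 1, f ![p.1, p.2, c])
        ∂((volume.restrict (Ioo 0 L₁)).prod (volume.restrict (Ioo 0 L₂))) := by
  rw [lintegral_box L₁ L₂ hf, lintegral_prod _ (Measurable.aemeasurable ?_)]
  exact Measurable.lintegral_prod_right' (f := fun q : (ℝ × ℝ) × ℝ => f ![q.1.1, q.1.2, q.2])
    (by fun_prop)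

lemma lintegral_colSq {f : E3 → ℝ} (hf : Continuous f) :
    ∫⁻ p, colSq f p.1 p.2 ∂((volume.restrict (Ioo 0 L₁)).prod (volume.restrict (Ioo 0 L₂))) =
      ENNReal.ofReal (l2 (boxMeas L₁ L₂) f ^ 2) := by
  have := hf.measurable
  rw [ofReal_l2_sq (memLp_of_continuous hf 2), lintegral_box_prod (by fun_prop)]
  rfl

lemma colSq_le_x {f : E3 → ℝ} (hf : ContDiff ℝ 1 f) {a : ℝ} (ha : a ∈ Ioo 0 L₁) (b : ℝ) :
    colSq f a b ≤ ∫⁻ c in Ioo (-1 : ℝ) 1, ∫⁻ r in Ioo 0 L₁,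
      ladDensity L₁ f (pd 0 f) ![r, b, c] := by
  refine lintegral_mono fun c => ?_
  simpa only [update_vec0, sub_zero] using slice_sq_le hf ![0, b, c] 0 ha

lemma colSq_le_y {f : E3 → ℝ} (hf : ContDiff ℝ 1 f) (a : ℝ) {b : ℝ} (hb : b ∈ Ioo 0 L₂) :
    colSq f a b ≤ ∫⁻ c in Ioo (-1 : ℝ) 1, ∫⁻ r in Ioo 0 L₂,
      ladDensity L₂ f (pd 1 f) ![a, r, c] := by
  refine lintegral_mono fun c => ?_
  simpa only [update_vec1, sub_zero] using slice_sq_le hf ![a, 0, c] 1 hb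

lemma ae_prod_Ioo (L₁ L₂ : ℝ) :
    ∀ᵐ p ∂((volume.restrict (Ioo 0 L₁)).prod (volume.restrict (Ioo 0 L₂)) : Measure (ℝ × ℝ)),
      p.1 ∈ Ioo 0 L₁ ∧ p.2 ∈ Ioo 0 L₂ := by
  rw [Measure.prod_restrict]
  exact ae_restrict_mem (measurableSet_Ioo.prod measurableSet_Ioo)

/-- The two-dimensional Ladyzhenskaya inequality for columns. -/
lemma lintegral_colSq_mul_le (h₁ : 0 < L₁) (h₂ : 0 < L₂) {f g : E3 → ℝ} (hf : ContDiff ℝ 1 f)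
    (hg : ContDiff ℝ 1 g) :
    ∫⁻ p, colSq f p.1 p.2 * colSq g p.1 p.2
        ∂((volume.restrict (Ioo 0 L₁)).prod (volume.restrict (Ioo 0 L₂))) ≤
      ENNReal.ofReal (ladConst L₁ L₂ ^ 2 * lad L₁ L₂ f (pd 0 f) (pd 1 f)
        * lad L₁ L₂ g (pd 0 g) (pd 1 g)) := by
  have mf := measurable_ladDensity (r := L₁) hf.continuous.measurable
    (continuous_pd hf 0).measurable
  have mg := measurable_ladDensity (r := L₂) hg.continuous.measurable
    (continuous_pd hg 1).measurable
  have mF : Measurable fun b : ℝ => ∫⁻ c in Ioo (-1 : ℝ) 1, ∫⁻ r in Ioo 0 L₁,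
      ladDensity L₁ f (pd 0 f) ![r, b, c] := by
    refine Measurable.lintegral_prod_right' (f := fun q : ℝ × ℝ => ∫⁻ r in Ioo 0 L₁,
      ladDensity L₁ f (pd 0 f) ![r, q.1, q.2]) ?_
    exact Measurable.lintegral_prod_right' (f := fun q : (ℝ × ℝ) × ℝ =>
      ladDensity L₁ f (pd 0 f) ![q.2, q.1.1, q.1.2]) (by fun_prop)
  have mG : Measurable fun a : ℝ => ∫⁻ c in Ioo (-1 : ℝ) 1, ∫⁻ r in Ioo 0 L₂,
      ladDensity L₂ g (pd 1 g) ![a, r, c] := by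
    refine Measurable.lintegral_prod_right' (f := fun q : ℝ × ℝ => ∫⁻ r in Ioo 0 L₂,
      ladDensity L₂ g (pd 1 g) ![q.1, r, q.2]) ?_
    exact Measurable.lintegral_prod_right' (f := fun q : (ℝ × ℝ) × ℝ =>
      ladDensity L₂ g (pd 1 g) ![q.1.1, q.2, q.1.2]) (by fun_prop)
  -- Bounding the column of `g` along `y` leaves a function of `x` alone, and bounding that of `f`
  -- along `x` leaves a function of `y` alone. The integral of the product therefore factorises.
  calc _ ≤ ∫⁻ p, (∫⁻ c in Ioo (-1 : ℝ) 1, ∫⁻ r in Ioo 0 L₂, ladDensity L₂ g (pd 1 g) ![p.1, r, c]) *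
            (∫⁻ c in Ioo (-1 : ℝ) 1, ∫⁻ r in Ioo 0 L₁, ladDensity L₁ f (pd 0 f) ![r, p.2, c])
        ∂((volume.restrict (Ioo 0 L₁)).prod (volume.restrict (Ioo 0 L₂))) := by
        refine lintegral_mono_ae ?_
        filter_upwards [ae_prod_Ioo L₁ L₂] with p hp
        rw [mul_comm]
        exact mul_le_mul' (colSq_le_y hg _ hp.2) (colSq_le_x hf hp.1 _)
    _ = (∫⁻ x, ladDensity L₂ g (pd 1 g) x ∂(boxMeas L₁ L₂)) *
          ∫⁻ x, ladDensity L₁ f (pd 0 f) x ∂(boxMeas L₁ L₂) := by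
        rw [lintegral_prod_mul mG.aemeasurable mF.aemeasurable, lintegral_box L₁ L₂ mg,
          lintegral_box L₁ L₂ mf]
        congr 1
        · refine lintegral_congr fun a => ?_
          exact lintegral_lintegral_swap (Measurable.aemeasurable (by fun_prop))
        · rw [lintegral_lintegral_swap (μ := volume.restrict (Ioo 0 L₁))]
          · refine lintegral_congr fun b => ?_
            exact lintegral_lintegral_swap (Measurable.aemeasurable (by fun_prop))
          · exact (Measurable.lintegral_prod_right' (f := fun q : (ℝ × ℝ) × ℝ =>
              ladDensity L₁ f (pd 0 f) ![q.1.1, q.1.2, q.2]) (by fun_prop)).aemeasurable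
    _ ≤ ENNReal.ofReal (ladConst L₁ L₂ * lad L₁ L₂ g (pd 0 g) (pd 1 g)) *
          ENNReal.ofReal (ladConst L₁ L₂ * lad L₁ L₂ f (pd 0 f) (pd 1 f)) := by
        have hi1 : 0 ≤ L₁⁻¹ := by positivity
        have hi2 : 0 ≤ L₂⁻¹ := by positivity
        have a0 : 0 ≤ l2 (boxMeas L₁ L₂) f := l2_nonneg
        have a1 : 0 ≤ l2 (boxMeas L₁ L₂) (pd 0 f) := l2_nonneg
        have a2 : 0 ≤ l2 (boxMeas L₁ L₂) (pd 1 f) := l2_nonneg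
        have b0 : 0 ≤ l2 (boxMeas L₁ L₂) g := l2_nonneg
        have b1 : 0 ≤ l2 (boxMeas L₁ L₂) (pd 0 g) := l2_nonneg
        have b2 : 0 ≤ l2 (boxMeas L₁ L₂) (pd 1 g) := l2_nonneg
        gcongr
        · refine (lintegral_ladDensity_le h₂ hg.continuous (continuous_pd hg 1)).trans ?_
          refine ENNReal.ofReal_le_ofReal ?_
          unfold ladConst lad
          nlinarith [mul_nonneg hi1 (sq_nonneg (l2 (boxMeas L₁ L₂) g)), mul_nonneg b0 b1,
            mul_nonneg b0 b2, mul_nonneg hi1 (mul_nonneg b0 b1), mul_nonneg hi2 (mul_nonneg b0 b1),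
            mul_nonneg hi1 (mul_nonneg b0 b2), mul_nonneg hi2 (mul_nonneg b0 b2), sq_nonneg (l2 (boxMeas L₁ L₂) g)]
        · refine (lintegral_ladDensity_le h₁ hf.continuous (continuous_pd hf 0)).trans ?_
          refine ENNReal.ofReal_le_ofReal ?_
          unfold ladConst lad
          nlinarith [mul_nonneg hi2 (sq_nonneg (l2 (boxMeas L₁ L₂) f)), mul_nonneg a0 a1,
            mul_nonneg a0 a2, mul_nonneg hi1 (mul_nonneg a0 a1), mul_nonneg hi2 (mul_nonneg a0 a1),
            mul_nonneg hi1 (mul_nonneg a0 a2), mul_nonneg hi2 (mul_nonneg a0 a2), sq_nonneg (l2 (boxMeas L₁ L₂) f)]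
    _ = _ := by
        have := (ladConst_pos h₁ h₂).le
        have := lad_nonneg (L₁ := L₁) (L₂ := L₂) g (pd 0 g) (pd 1 g)
        rw [← ENNReal.ofReal_mul (by positivity)]
        congr 1; ring

lemma ennreal_add_sq_le (a b : ℝ≥0∞) : (a + b) ^ 2 ≤ 2 * (a ^ 2 + b ^ 2) := by
  have := ENNReal.rpow_add_le_mul_rpow_add_rpow a b (p := 2) (by norm_num)
  norm_num at this
  simpa using this

/-- The bound for the supremum of `|h|` over a column. -/
noncomputable def colSup (h : E3 → ℝ) (a b : ℝ) : ℝ≥0∞ :=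
  (∫⁻ c in Ioo (-1 : ℝ) 1, ‖h ![a, b, c]‖ₑ) + ∫⁻ c in Ioo (-1 : ℝ) 1, ‖pd 2 h ![a, b, c]‖ₑ

lemma measurable_colSup {h : E3 → ℝ} (hh : ContDiff ℝ 1 h) :
    Measurable fun p : ℝ × ℝ => colSup h p.1 p.2 := by
  have m1 := hh.continuous.measurable
  have m2 := (continuous_pd hh 2).measurable
  unfold colSup
  refine Measurable.add ?_ ?_
  · exact Measurable.lintegral_prod_right' (f := fun q : (ℝ × ℝ) × ℝ => ‖h ![q.1.1, q.1.2, q.2]‖ₑ)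
      (by fun_prop)
  · exact Measurable.lintegral_prod_right'
      (f := fun q : (ℝ × ℝ) × ℝ => ‖pd 2 h ![q.1.1, q.1.2, q.2]‖ₑ) (by fun_prop)

lemma enorm_le_colSup {h : E3 → ℝ} (hh : ContDiff ℝ 1 h) (a b : ℝ) {c : ℝ}
    (hc : c ∈ Ioo (-1 : ℝ) 1) : ‖h ![a, b, c]‖ₑ ≤ colSup h a b := by
  have := slice_le hh ![a, b, 0] 2 hc
  simp only [update_vec2] at this
  refine this.trans ?_
  unfold colSup
  gcongr
  refine mul_le_of_le_one_left' (ENNReal.ofReal_le_one.2 (by norm_num))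

/-- Cauchy–Schwarz on a vertical interval of length `2` gives a factor `2`, and the square of a sum
gives another. -/
lemma colSup_sq_le {h : E3 → ℝ} (hh : ContDiff ℝ 1 h) (a b : ℝ) :
    colSup h a b ^ 2 ≤ 4 * (colSq h a b + colSq (pd 2 h) a b) := by
  have m1 := hh.continuous.measurable
  have m2 := (continuous_pd hh 2).measurable
  have key : ∀ {g : E3 → ℝ}, Measurable g →
      (∫⁻ c in Ioo (-1 : ℝ) 1, ‖g ![a, b, c]‖ₑ) ^ 2 ≤ 2 * colSq g a b := by
    intro g hg
    have := lintegral_mul_sq_le (volume.restrict (Ioo (-1 : ℝ) 1)) (f := fun _ => 1)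
      (g := fun c => ‖g ![a, b, c]‖ₑ) measurable_const (by fun_prop)
    simp only [one_mul, one_pow, lintegral_const, Measure.restrict_apply_univ,
      Real.volume_Ioo] at this
    refine this.trans (le_of_eq ?_)
    norm_num [colSq]
  unfold colSup
  calc _ ≤ 2 * ((∫⁻ c in Ioo (-1 : ℝ) 1, ‖h ![a, b, c]‖ₑ) ^ 2
        + (∫⁻ c in Ioo (-1 : ℝ) 1, ‖pd 2 h ![a, b, c]‖ₑ) ^ 2) := by
        exact ennreal_add_sq_le _ _
    _ ≤ 2 * (2 * colSq h a b + 2 * colSq (pd 2 h) a b) := by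
        gcongr
        · exact key m1
        · exact key m2
    _ = _ := by ring

lemma lintegral_mul_mul_le_columns {f g h : E3 → ℝ} (hf : Continuous f) (hg : Continuous g)
    (hh : ContDiff ℝ 1 h) :
    ∫⁻ x, ‖f x * g x * h x‖ₑ ∂(boxMeas L₁ L₂) ≤
      ∫⁻ p, colSup h p.1 p.2 * (∫⁻ c in Ioo (-1 : ℝ) 1, ‖f ![p.1, p.2, c]‖ₑ * ‖g ![p.1, p.2, c]‖ₑ)
        ∂((volume.restrict (Ioo 0 L₁)).prod (volume.restrict (Ioo 0 L₂))) := by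
  have m1 := hf.measurable
  have m2 := hg.measurable
  have m3 := hh.continuous.measurable
  rw [lintegral_box_prod (by fun_prop)]
  refine lintegral_mono fun p => ?_
  dsimp only
  rw [← lintegral_const_mul _ (by fun_prop)]
  refine setLIntegral_mono' measurableSet_Ioo fun c hc => ?_
  rw [enorm_mul, enorm_mul, mul_comm]
  gcongr
  exact enorm_le_colSup hh _ _ hc

lemma column_mul_sq_le {f g : E3 → ℝ} (hf : Continuous f) (hg : Continuous g) (a b : ℝ) :
    (∫⁻ c in Ioo (-1 : ℝ) 1, ‖f ![a, b, c]‖ₑ * ‖g ![a, b, c]‖ₑ) ^ 2 ≤ colSq f a b * colSq g a b := by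
  have m1 := hf.measurable
  have m2 := hg.measurable
  exact lintegral_mul_sq_le _ (by fun_prop) (by fun_prop)

lemma measurable_column_mul {f g : E3 → ℝ} (hf : Continuous f) (hg : Continuous g) :
    Measurable fun p : ℝ × ℝ =>
      ∫⁻ c in Ioo (-1 : ℝ) 1, ‖f ![p.1, p.2, c]‖ₑ * ‖g ![p.1, p.2, c]‖ₑ := by
  have m1 := hf.measurable
  have m2 := hg.measurable
  exact Measurable.lintegral_prod_right' (f := fun q : (ℝ × ℝ) × ℝ =>
    ‖f ![q.1.1, q.1.2, q.2]‖ₑ * ‖g ![q.1.1, q.1.2, q.2]‖ₑ) (by fun_prop)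

lemma le_of_sq_le_sq' {x y : ℝ≥0∞} (h : x ^ 2 ≤ y ^ 2) : x ≤ y :=
  (ENNReal.pow_le_pow_left_iff two_ne_zero).1 h

/-- Trilinear estimate with `h` bounded in the vertical direction. -/
lemma trilinear_sup_smooth (h₁ : 0 < L₁) (h₂ : 0 < L₂) {f g h : E3 → ℝ} (hf : ContDiff ℝ 1 f)
    (hg : ContDiff ℝ 1 g) (hh : ContDiff ℝ 1 h) :
    ∫⁻ x, ‖f x * g x * h x‖ₑ ∂(boxMeas L₁ L₂) ≤
      ENNReal.ofReal (2 * ladConst L₁ L₂ * (√(lad L₁ L₂ f (pd 0 f) (pd 1 f)) *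
        √(lad L₁ L₂ g (pd 0 g) (pd 1 g))) *
        (l2 (boxMeas L₁ L₂) h + l2 (boxMeas L₁ L₂) (pd 2 h))) := by
  have n1 : 0 ≤ l2 (boxMeas L₁ L₂) h := l2_nonneg
  have n2 : 0 ≤ l2 (boxMeas L₁ L₂) (pd 2 h) := l2_nonneg
  have nf := lad_nonneg (L₁ := L₁) (L₂ := L₂) f (pd 0 f) (pd 1 f)
  have ng := lad_nonneg (L₁ := L₁) (L₂ := L₂) g (pd 0 g) (pd 1 g)
  have nc := (ladConst_pos h₁ h₂).le
  refine le_of_sq_le_sq' ?_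
  have ms := measurable_colSup hh
  have mp := measurable_column_mul hf.continuous hg.continuous
  -- The factor `h` is taken out of each column by its supremum. Cauchy–Schwarz over the horizontal
  -- rectangle then separates `h` from `f g`, and the latter is handled by the Ladyzhenskaya
  -- inequality for columns.
  calc _ ≤ (∫⁻ p, colSup h p.1 p.2 *
          (∫⁻ c in Ioo (-1 : ℝ) 1, ‖f ![p.1, p.2, c]‖ₑ * ‖g ![p.1, p.2, c]‖ₑ)
        ∂((volume.restrict (Ioo 0 L₁)).prod (volume.restrict (Ioo 0 L₂)))) ^ 2 := by
        gcongr
        exact lintegral_mul_mul_le_columns hf.continuous hg.continuous hh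
    _ ≤ (∫⁻ p, colSup h p.1 p.2 ^ 2
          ∂((volume.restrict (Ioo 0 L₁)).prod (volume.restrict (Ioo 0 L₂)))) *
        ∫⁻ p, (∫⁻ c in Ioo (-1 : ℝ) 1, ‖f ![p.1, p.2, c]‖ₑ * ‖g ![p.1, p.2, c]‖ₑ) ^ 2
          ∂((volume.restrict (Ioo 0 L₁)).prod (volume.restrict (Ioo 0 L₂))) :=
        lintegral_mul_sq_le _ ms mp
    _ ≤ (∫⁻ p, 4 * (colSq h p.1 p.2 + colSq (pd 2 h) p.1 p.2)
          ∂((volume.restrict (Ioo 0 L₁)).prod (volume.restrict (Ioo 0 L₂)))) *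
        ∫⁻ p, colSq f p.1 p.2 * colSq g p.1 p.2
          ∂((volume.restrict (Ioo 0 L₁)).prod (volume.restrict (Ioo 0 L₂))) := by
        gcongr
        · exact colSup_sq_le hh _ _
        · exact column_mul_sq_le hf.continuous hg.continuous _ _
    _ ≤ (ENNReal.ofReal (4 * (l2 (boxMeas L₁ L₂) h ^ 2 + l2 (boxMeas L₁ L₂) (pd 2 h) ^ 2))) *
        ENNReal.ofReal (ladConst L₁ L₂ ^ 2 * lad L₁ L₂ f (pd 0 f) (pd 1 f)
        * lad L₁ L₂ g (pd 0 g) (pd 1 g)) := by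
        gcongr
        · have mh := measurable_colSq hh.continuous.measurable
          have mh' := measurable_colSq (continuous_pd hh 2).measurable
          rw [lintegral_const_mul _ (by fun_prop), lintegral_add_left mh,
            lintegral_colSq hh.continuous, lintegral_colSq (continuous_pd hh 2),
            ENNReal.ofReal_mul (by norm_num), ENNReal.ofReal_add (by positivity) (by positivity),
            ENNReal.ofReal_ofNat]
        · exact lintegral_colSq_mul_le h₁ h₂ hf hg
    _ ≤ _ := by
        rw [← ENNReal.ofReal_mul (by positivity), ← ENNReal.ofReal_pow (by positivity)]
        refine ENNReal.ofReal_le_ofReal ?_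
        rw [mul_pow, mul_pow, mul_pow, mul_pow, Real.sq_sqrt nf, Real.sq_sqrt ng]
        have : l2 (boxMeas L₁ L₂) h ^ 2 + l2 (boxMeas L₁ L₂) (pd 2 h) ^ 2 ≤
          (l2 (boxMeas L₁ L₂) h + l2 (boxMeas L₁ L₂) (pd 2 h)) ^ 2 := by nlinarith
        calc _ = (4 * ladConst L₁ L₂ ^ 2 * (lad L₁ L₂ f (pd 0 f) (pd 1 f) *
              lad L₁ L₂ g (pd 0 g) (pd 1 g))) *
              (l2 (boxMeas L₁ L₂) h ^ 2 + l2 (boxMeas L₁ L₂) (pd 2 h) ^ 2) := by ring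
          _ ≤ (4 * ladConst L₁ L₂ ^ 2 * (lad L₁ L₂ f (pd 0 f) (pd 1 f) *
              lad L₁ L₂ g (pd 0 g) (pd 1 g))) *
              (l2 (boxMeas L₁ L₂) h + l2 (boxMeas L₁ L₂) (pd 2 h)) ^ 2 := by gcongr
          _ = _ := by ring

/-- Trilinear estimate with `g` only square integrable. -/
lemma trilinear_L2_smooth (h₁ : 0 < L₁) (h₂ : 0 < L₂) {f g h : E3 → ℝ} (hf : ContDiff ℝ 1 f)
    (hg : Continuous g) (hh : ContDiff ℝ 1 h) (hh' : ContDiff ℝ 1 (pd 2 h)) :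
    ∫⁻ x, ‖f x * g x * h x‖ₑ ∂(boxMeas L₁ L₂) ≤
      ENNReal.ofReal (2 * ladConst L₁ L₂ * (√(lad L₁ L₂ f (pd 0 f) (pd 1 f)) *
        √(lad L₁ L₂ h (pd 0 h) (pd 1 h) + lad L₁ L₂ (pd 2 h) (pd 0 (pd 2 h)) (pd 1 (pd 2 h)))) *
        l2 (boxMeas L₁ L₂) g) := by
  have n1 : 0 ≤ l2 (boxMeas L₁ L₂) g := l2_nonneg
  have nf := lad_nonneg (L₁ := L₁) (L₂ := L₂) f (pd 0 f) (pd 1 f)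
  have nh := lad_nonneg (L₁ := L₁) (L₂ := L₂) h (pd 0 h) (pd 1 h)
  have nh' := lad_nonneg (L₁ := L₁) (L₂ := L₂) (pd 2 h) (pd 0 (pd 2 h)) (pd 1 (pd 2 h))
  have nc := (ladConst_pos h₁ h₂).le
  have ms := measurable_colSup hh
  have mf := measurable_colSq hf.continuous.measurable
  have mg := measurable_colSq hg.measurable
  have mh := measurable_colSq hh.continuous.measurable
  have mh' := measurable_colSq hh'.continuous.measurable
  have hroot : ∀ x : ℝ≥0∞, (x ^ (1 / 2 : ℝ)) ^ 2 = x := fun x => by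
    rw [← ENNReal.rpow_natCast, ← ENNReal.rpow_mul]; norm_num
  refine le_of_sq_le_sq' ?_
  -- Now `g` must stand alone in Cauchy–Schwarz, so the column of `f` is grouped with the supremum
  -- of `h`. The Ladyzhenskaya inequality is applied twice, to `h` and to `∂_z h`, each paired with
  -- `f`.
  calc _ ≤ (∫⁻ p, (colSup h p.1 p.2 * colSq f p.1 p.2 ^ (1 / 2 : ℝ)) *
          (colSq g p.1 p.2 ^ (1 / 2 : ℝ))
        ∂((volume.restrict (Ioo 0 L₁)).prod (volume.restrict (Ioo 0 L₂)))) ^ 2 := by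
        gcongr
        refine (lintegral_mul_mul_le_columns hf.continuous hg hh).trans ?_
        refine lintegral_mono fun p => ?_
        dsimp only
        rw [mul_assoc]
        gcongr
        refine le_of_sq_le_sq' ?_
        rw [mul_pow, hroot, hroot]
        exact column_mul_sq_le hf.continuous hg _ _
    _ ≤ (∫⁻ p, (colSup h p.1 p.2 * colSq f p.1 p.2 ^ (1 / 2 : ℝ)) ^ 2
          ∂((volume.restrict (Ioo 0 L₁)).prod (volume.restrict (Ioo 0 L₂)))) *
        ∫⁻ p, (colSq g p.1 p.2 ^ (1 / 2 : ℝ)) ^ 2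
          ∂((volume.restrict (Ioo 0 L₁)).prod (volume.restrict (Ioo 0 L₂))) :=
        lintegral_mul_sq_le _ (by fun_prop) (by fun_prop)
    _ ≤ (∫⁻ p, 4 * (colSq h p.1 p.2 * colSq f p.1 p.2 + colSq (pd 2 h) p.1 p.2 * colSq f p.1 p.2)
          ∂((volume.restrict (Ioo 0 L₁)).prod (volume.restrict (Ioo 0 L₂)))) *
        ENNReal.ofReal (l2 (boxMeas L₁ L₂) g ^ 2) := by
        simp only [hroot]
        rw [lintegral_colSq hg]
        gcongr with p
        rw [mul_pow, hroot, ← add_mul, ← mul_assoc]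
        gcongr
        exact colSup_sq_le hh _ _
    _ ≤ ENNReal.ofReal (4 * (ladConst L₁ L₂ ^ 2 * lad L₁ L₂ h (pd 0 h) (pd 1 h)
          * lad L₁ L₂ f (pd 0 f) (pd 1 f) + ladConst L₁ L₂ ^ 2 *
          lad L₁ L₂ (pd 2 h) (pd 0 (pd 2 h)) (pd 1 (pd 2 h)) * lad L₁ L₂ f (pd 0 f) (pd 1 f))) *
        ENNReal.ofReal (l2 (boxMeas L₁ L₂) g ^ 2) := by
        gcongr
        rw [lintegral_const_mul _ (by fun_prop), lintegral_add_left (by fun_prop),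
          ENNReal.ofReal_mul (by norm_num), ENNReal.ofReal_add (by positivity) (by positivity),
          ENNReal.ofReal_ofNat]
        gcongr
        · exact lintegral_colSq_mul_le h₁ h₂ hh hf
        · exact lintegral_colSq_mul_le h₁ h₂ hh' hf
    _ = _ := by
        rw [← ENNReal.ofReal_mul (by positivity), ← ENNReal.ofReal_pow (by positivity)]
        congr 1
        rw [mul_pow, mul_pow, mul_pow, mul_pow, Real.sq_sqrt nf, Real.sq_sqrt (by positivity)]
        ring

end Trilinear

/-! ### Anisotropic Sobolev classes -/

section Sobolev

variable {L₁ L₂ : ℝ}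

/-- `F n → f` in `L²` of the box. -/
def TendstoL2 (L₁ L₂ : ℝ) (F : ℕ → E3 → ℝ) (f : E3 → ℝ) : Prop :=
  Tendsto (fun n => l2 (boxMeas L₁ L₂) (fun x => f x - F n x)) atTop (𝓝 0)

/-- Functions with horizontal derivatives `fx`, `fy` that are limits of smooth functions. -/
structure WH (L₁ L₂ : ℝ) (f fx fy : E3 → ℝ) : Prop where
  memLp : MemLp f 2 (boxMeas L₁ L₂)
  memLp_x : MemLp fx 2 (boxMeas L₁ L₂)
  memLp_y : MemLp fy 2 (boxMeas L₁ L₂)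
  approx : ∃ F : ℕ → E3 → ℝ, (∀ n, ContDiff ℝ ∞ (F n)) ∧ TendstoL2 L₁ L₂ F f ∧
    TendstoL2 L₁ L₂ (fun n => pd 0 (F n)) fx ∧ TendstoL2 L₁ L₂ (fun n => pd 1 (F n)) fy

/-- Functions with vertical derivative `fz` that are limits of smooth functions. -/
structure WV (L₁ L₂ : ℝ) (f fz : E3 → ℝ) : Prop where
  memLp : MemLp f 2 (boxMeas L₁ L₂)
  memLp_z : MemLp fz 2 (boxMeas L₁ L₂)
  approx : ∃ F : ℕ → E3 → ℝ, (∀ n, ContDiff ℝ ∞ (F n)) ∧ TendstoL2 L₁ L₂ F f ∧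
    TendstoL2 L₁ L₂ (fun n => pd 2 (F n)) fz

/-- Functions `f` such that `f` and `∂_z f` have horizontal derivatives. -/
structure WHV (L₁ L₂ : ℝ) (f fx fy fz fzx fzy : E3 → ℝ) : Prop where
  memLp : MemLp f 2 (boxMeas L₁ L₂)
  memLp_x : MemLp fx 2 (boxMeas L₁ L₂)
  memLp_y : MemLp fy 2 (boxMeas L₁ L₂)
  memLp_z : MemLp fz 2 (boxMeas L₁ L₂)
  memLp_zx : MemLp fzx 2 (boxMeas L₁ L₂)
  memLp_zy : MemLp fzy 2 (boxMeas L₁ L₂)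
  approx : ∃ F : ℕ → E3 → ℝ, (∀ n, ContDiff ℝ ∞ (F n)) ∧ TendstoL2 L₁ L₂ F f ∧
    TendstoL2 L₁ L₂ (fun n => pd 0 (F n)) fx ∧ TendstoL2 L₁ L₂ (fun n => pd 1 (F n)) fy ∧
    TendstoL2 L₁ L₂ (fun n => pd 2 (F n)) fz ∧
    TendstoL2 L₁ L₂ (fun n => pd 0 (pd 2 (F n))) fzx ∧
    TendstoL2 L₁ L₂ (fun n => pd 1 (pd 2 (F n))) fzy

lemma contDiff_pd {f : E3 → ℝ} (hf : ContDiff ℝ ∞ f) (j : Fin 3) : ContDiff ℝ ∞ (pd j f) := by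
  unfold pd
  exact (hf.fderiv_right (m := ∞) (by simp)).clm_apply contDiff_const

lemma memLp_smooth {f : E3 → ℝ} (hf : ContDiff ℝ ∞ f) : MemLp f 2 (boxMeas L₁ L₂) :=
  memLp_of_continuous hf.continuous 2

lemma TendstoL2.tendsto_norm {F : ℕ → E3 → ℝ} {f : E3 → ℝ} (h : TendstoL2 L₁ L₂ F f)
    (hf : MemLp f 2 (boxMeas L₁ L₂)) (hF : ∀ n, MemLp (F n) 2 (boxMeas L₁ L₂)) :
    Tendsto (fun n => l2 (boxMeas L₁ L₂) (F n)) atTop (𝓝 (l2 (boxMeas L₁ L₂) f)) := by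
  rw [tendsto_iff_norm_sub_tendsto_zero]
  refine squeeze_zero (fun _ => norm_nonneg _) (fun n => ?_) h
  rw [Real.norm_eq_abs, abs_le]
  have e1 := l2_add_le (hf.sub (hF n)) (hF n)
  have e2 := l2_sub_le hf (hf.sub (hF n))
  simp only [Pi.sub_apply, sub_add_cancel, sub_sub_cancel] at e1 e2
  constructor
  · change l2 _ f ≤ l2 _ (fun x => f x - F n x) + _ at e1
    linarith
  · change _ ≤ _ + l2 _ (fun x => f x - F n x) at e2
    linarith

lemma tendsto_lad {F Fx Fy : ℕ → E3 → ℝ} {f fx fy : E3 → ℝ}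
    (h : Tendsto (fun n => l2 (boxMeas L₁ L₂) (F n)) atTop (𝓝 (l2 (boxMeas L₁ L₂) f)))
    (hx : Tendsto (fun n => l2 (boxMeas L₁ L₂) (Fx n)) atTop (𝓝 (l2 (boxMeas L₁ L₂) fx)))
    (hy : Tendsto (fun n => l2 (boxMeas L₁ L₂) (Fy n)) atTop (𝓝 (l2 (boxMeas L₁ L₂) fy))) :
    Tendsto (fun n => lad L₁ L₂ (F n) (Fx n) (Fy n)) atTop (𝓝 (lad L₁ L₂ f fx fy)) :=
  (h.pow 2).add (h.mul (hx.add hy))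

lemma TendstoL2.subseq_ae {F : ℕ → E3 → ℝ} {f : E3 → ℝ} (h : TendstoL2 L₁ L₂ F f)
    (hf : MemLp f 2 (boxMeas L₁ L₂)) (hF : ∀ n, MemLp (F n) 2 (boxMeas L₁ L₂)) :
    ∃ ns : ℕ → ℕ, StrictMono ns ∧
      ∀ᵐ x ∂(boxMeas L₁ L₂), Tendsto (fun i => F (ns i) x) atTop (𝓝 (f x)) := by
  refine TendstoInMeasure.exists_seq_tendsto_ae (tendstoInMeasure_of_tendsto_eLpNorm
    (p := 2) two_ne_zero (fun n => (hF n).1) hf.1 ?_)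
  have : ∀ n, eLpNorm (F n - f) 2 (boxMeas L₁ L₂) =
      ENNReal.ofReal (l2 (boxMeas L₁ L₂) (fun x => f x - F n x)) := by
    intro n
    rw [l2_sub_comm, ofReal_l2 (f := fun x => F n x - f x) ((hF n).sub hf)]
    rfl
  simp only [this]
  simpa using ENNReal.tendsto_ofReal h

lemma TendstoL2.comp {F : ℕ → E3 → ℝ} {f : E3 → ℝ} (h : TendstoL2 L₁ L₂ F f) {ns : ℕ → ℕ}
    (hns : StrictMono ns) : TendstoL2 L₁ L₂ (fun n => F (ns n)) f := by
  have h' : Tendsto (fun n => l2 (boxMeas L₁ L₂) fun x => f x - F n x) atTop (𝓝 0) := h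
  exact h'.comp hns.tendsto_atTop

/-- Fatou's lemma for triple products. -/
lemma lintegral_triple_le_of_tendsto {F G H : ℕ → E3 → ℝ} {f g h : E3 → ℝ} {B : ℕ → ℝ} {B' : ℝ}
    (hf : MemLp f 2 (boxMeas L₁ L₂)) (hg : MemLp g 2 (boxMeas L₁ L₂))
    (hh : MemLp h 2 (boxMeas L₁ L₂)) (sF : ∀ n, Continuous (F n)) (sG : ∀ n, Continuous (G n))
    (sH : ∀ n, Continuous (H n)) (tF : TendstoL2 L₁ L₂ F f) (tG : TendstoL2 L₁ L₂ G g)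
    (tH : TendstoL2 L₁ L₂ H h) (hB : Tendsto B atTop (𝓝 B'))
    (hle : ∀ n, ∫⁻ x, ‖F n x * G n x * H n x‖ₑ ∂(boxMeas L₁ L₂) ≤ ENNReal.ofReal (B n)) :
    ∫⁻ x, ‖f x * g x * h x‖ₑ ∂(boxMeas L₁ L₂) ≤ ENNReal.ofReal B' := by
  -- Subsequences are extracted successively, so that along the last one all three factors converge
  -- almost everywhere.
  obtain ⟨n1, m1, a1⟩ := tF.subseq_ae hf fun n => memLp_of_continuous (sF n) 2
  obtain ⟨n2, m2, a2⟩ := (tG.comp m1).subseq_ae hg fun n => memLp_of_continuous (sG _) 2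
  obtain ⟨n3, m3, a3⟩ := (tH.comp (m1.comp m2)).subseq_ae hh fun n => memLp_of_continuous (sH _) 2
  set ns := fun i => n1 (n2 (n3 i)) with hns
  have hm : StrictMono ns := (m1.comp m2).comp m3
  have hlim : ∀ᵐ x ∂(boxMeas L₁ L₂), Tendsto
      (fun i => ‖F (ns i) x * G (ns i) x * H (ns i) x‖ₑ) atTop (𝓝 ‖f x * g x * h x‖ₑ) := by
    filter_upwards [a1, a2, a3] with x b1 b2 b3
    exact (((b1.comp (m2.comp m3).tendsto_atTop).mul (b2.comp m3.tendsto_atTop)).mul b3).enorm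
  calc ∫⁻ x, ‖f x * g x * h x‖ₑ ∂(boxMeas L₁ L₂)
      = ∫⁻ x, liminf (fun i => ‖F (ns i) x * G (ns i) x * H (ns i) x‖ₑ) atTop
          ∂(boxMeas L₁ L₂) := by
        refine lintegral_congr_ae ?_
        filter_upwards [hlim] with x hx
        exact hx.liminf_eq.symm
    _ ≤ liminf (fun i => ∫⁻ x, ‖F (ns i) x * G (ns i) x * H (ns i) x‖ₑ ∂(boxMeas L₁ L₂)) atTop := by
        refine lintegral_liminf_le fun i => ?_
        exact (((sF _).mul (sG _)).mul (sH _)).measurable.enorm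
    _ ≤ liminf (fun i => ENNReal.ofReal (B (ns i))) atTop :=
        liminf_le_liminf (Eventually.of_forall fun i => hle _)
    _ = ENNReal.ofReal B' :=
        (ENNReal.tendsto_ofReal (hB.comp hm.tendsto_atTop)).liminf_eq

lemma integrable_and_integral_abs_le {X : Type*} [MeasurableSpace X] {μ : Measure X} {f : X → ℝ}
    {B : ℝ} (hm : AEStronglyMeasurable f μ) (hB : 0 ≤ B)
    (h : ∫⁻ x, ‖f x‖ₑ ∂μ ≤ ENNReal.ofReal B) : Integrable f μ ∧ ∫ x, |f x| ∂μ ≤ B := by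
  have hi : Integrable f μ := ⟨hm, h.trans_lt ENNReal.ofReal_lt_top⟩
  refine ⟨hi, ?_⟩
  rw [← ofReal_integral_norm_eq_lintegral_enorm hi] at h
  exact (ENNReal.ofReal_le_ofReal_iff hB).1 h

/-- The smooth estimate passes to limits: the right side is continuous in the `L²` norms involved,
and the left side is lower semicontinuous by Fatou. Only the derivatives that occur in the bound
have to be approximated. -/
theorem trilinear_sup (h₁ : 0 < L₁) (h₂ : 0 < L₂) {f fx fy g gx gy h hz : E3 → ℝ}
    (hf : WH L₁ L₂ f fx fy) (hg : WH L₁ L₂ g gx gy) (hh : WV L₁ L₂ h hz) :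
    Integrable (fun x => f x * g x * h x) (boxMeas L₁ L₂) ∧
    ∫ x, |f x * g x * h x| ∂(boxMeas L₁ L₂) ≤
      2 * ladConst L₁ L₂ * (√(lad L₁ L₂ f fx fy) * √(lad L₁ L₂ g gx gy)) *
        (l2 (boxMeas L₁ L₂) h + l2 (boxMeas L₁ L₂) hz) := by
  obtain ⟨F, sF, tF, tFx, tFy⟩ := hf.approx
  obtain ⟨G, sG, tG, tGx, tGy⟩ := hg.approx
  obtain ⟨H, sH, tH, tHz⟩ := hh.approx
  have n1 : 0 ≤ l2 (boxMeas L₁ L₂) h := l2_nonneg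
  have n2 : 0 ≤ l2 (boxMeas L₁ L₂) hz := l2_nonneg
  have nc := (ladConst_pos h₁ h₂).le
  refine integrable_and_integral_abs_le ((hf.memLp.1.mul hg.memLp.1).mul hh.memLp.1)
    (by positivity) ?_
  have l1 : ∀ {f : E3 → ℝ}, ContDiff ℝ ∞ f → ContDiff ℝ 1 f := fun h => h.of_le (by simp)
  have lF := tendsto_lad (tF.tendsto_norm hf.memLp fun n => memLp_smooth (sF n))
    (tFx.tendsto_norm hf.memLp_x fun n => memLp_smooth (contDiff_pd (sF n) 0))
    (tFy.tendsto_norm hf.memLp_y fun n => memLp_smooth (contDiff_pd (sF n) 1))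
  have lG := tendsto_lad (tG.tendsto_norm hg.memLp fun n => memLp_smooth (sG n))
    (tGx.tendsto_norm hg.memLp_x fun n => memLp_smooth (contDiff_pd (sG n) 0))
    (tGy.tendsto_norm hg.memLp_y fun n => memLp_smooth (contDiff_pd (sG n) 1))
  refine lintegral_triple_le_of_tendsto hf.memLp hg.memLp hh.memLp
    (fun n => (sF n).continuous) (fun n => (sG n).continuous) (fun n => (sH n).continuous)
    tF tG tH (((tendsto_const_nhds.mul (lF.sqrt.mul lG.sqrt)).mul
      ((tH.tendsto_norm hh.memLp fun n => memLp_smooth (sH n)).add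
        (tHz.tendsto_norm hh.memLp_z fun n => memLp_smooth (contDiff_pd (sH n) 2)))))
    fun n => trilinear_sup_smooth h₁ h₂ (l1 (sF n)) (l1 (sG n)) (l1 (sH n))

lemma trunc_tendstoL2 (h₁ : 0 < L₁) (h₂ : 0 < L₂) {f : E3 → ℝ} (hf : MemLp f 2 (boxMeas L₁ L₂)) :
    TendstoL2 L₁ L₂ (fun N => trunc L₁ L₂ N f) f := tendsto_trunc h₁ h₂ hf

/-- The same passage to the limit. As no derivative of `g` enters, its Fourier truncations serve as
approximations. -/
theorem trilinear_L2 (h₁ : 0 < L₁) (h₂ : 0 < L₂) {f fx fy g h hx hy hz hzx hzy : E3 → ℝ}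
    (hf : WH L₁ L₂ f fx fy) (hg : MemLp g 2 (boxMeas L₁ L₂)) (hh : WHV L₁ L₂ h hx hy hz hzx hzy) :
    Integrable (fun x => f x * g x * h x) (boxMeas L₁ L₂) ∧
    ∫ x, |f x * g x * h x| ∂(boxMeas L₁ L₂) ≤
      2 * ladConst L₁ L₂ * (√(lad L₁ L₂ f fx fy) *
        √(lad L₁ L₂ h hx hy + lad L₁ L₂ hz hzx hzy)) * l2 (boxMeas L₁ L₂) g := by
  obtain ⟨F, sF, tF, tFx, tFy⟩ := hf.approx
  obtain ⟨H, sH, tH, tHx, tHy, tHz, tHzx, tHzy⟩ := hh.approx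
  have n1 : 0 ≤ l2 (boxMeas L₁ L₂) g := l2_nonneg
  have nc := (ladConst_pos h₁ h₂).le
  refine integrable_and_integral_abs_le ((hf.memLp.1.mul hg.1).mul hh.memLp.1)
    (by positivity) ?_
  have l1 : ∀ {f : E3 → ℝ}, ContDiff ℝ ∞ f → ContDiff ℝ 1 f := fun h => h.of_le (by simp)
  have tG := trunc_tendstoL2 h₁ h₂ hg
  have lF := tendsto_lad (tF.tendsto_norm hf.memLp fun n => memLp_smooth (sF n))
    (tFx.tendsto_norm hf.memLp_x fun n => memLp_smooth (contDiff_pd (sF n) 0))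
    (tFy.tendsto_norm hf.memLp_y fun n => memLp_smooth (contDiff_pd (sF n) 1))
  have lH := tendsto_lad (tH.tendsto_norm hh.memLp fun n => memLp_smooth (sH n))
    (tHx.tendsto_norm hh.memLp_x fun n => memLp_smooth (contDiff_pd (sH n) 0))
    (tHy.tendsto_norm hh.memLp_y fun n => memLp_smooth (contDiff_pd (sH n) 1))
  have lHz := tendsto_lad (tHz.tendsto_norm hh.memLp_z fun n => memLp_smooth (contDiff_pd (sH n) 2))
    (tHzx.tendsto_norm hh.memLp_zx fun n => memLp_smooth (contDiff_pd (contDiff_pd (sH n) 2) 0))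
    (tHzy.tendsto_norm hh.memLp_zy fun n => memLp_smooth (contDiff_pd (contDiff_pd (sH n) 2) 1))
  refine lintegral_triple_le_of_tendsto hf.memLp hg hh.memLp
    (fun n => (sF n).continuous) (fun n => (contDiff_trunc n g).continuous)
    (fun n => (sH n).continuous) tF tG tH
    ((tendsto_const_nhds.mul (lF.sqrt.mul (lH.add lHz).sqrt)).mul
      (tG.tendsto_norm hg fun n => memLp_trunc n g 2))
    fun n => trilinear_L2_smooth h₁ h₂ (l1 (sF n)) (contDiff_trunc n g).continuous (l1 (sH n))
      (l1 (contDiff_pd (sH n) 2))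

/-! Weakly differentiable functions and their truncation errors belong to these classes. -/

lemma WH.of_weak (h₁ : 0 < L₁) (h₂ : 0 < L₂) {f fx fy : E3 → ℝ}
    (hf : MemLp f 2 (boxMeas L₁ L₂)) (hx : MemLp fx 2 (boxMeas L₁ L₂))
    (hy : MemLp fy 2 (boxMeas L₁ L₂)) (wx : HasWeakPartial L₁ L₂ 0 f fx)
    (wy : HasWeakPartial L₁ L₂ 1 f fy) : WH L₁ L₂ f fx fy where
  memLp := hf
  memLp_x := hx
  memLp_y := hy
  approx := by
    refine ⟨fun N => trunc L₁ L₂ N f, fun N => contDiff_trunc N f, trunc_tendstoL2 h₁ h₂ hf, ?_, ?_⟩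
    · simpa only [pd_trunc h₁ h₂ wx] using trunc_tendstoL2 h₁ h₂ hx
    · simpa only [pd_trunc h₁ h₂ wy] using trunc_tendstoL2 h₁ h₂ hy

lemma WV.of_weak (h₁ : 0 < L₁) (h₂ : 0 < L₂) {f fz : E3 → ℝ}
    (hf : MemLp f 2 (boxMeas L₁ L₂)) (hz : MemLp fz 2 (boxMeas L₁ L₂))
    (wz : HasWeakPartial L₁ L₂ 2 f fz) : WV L₁ L₂ f fz where
  memLp := hf
  memLp_z := hz
  approx := by
    refine ⟨fun N => trunc L₁ L₂ N f, fun N => contDiff_trunc N f, trunc_tendstoL2 h₁ h₂ hf, ?_⟩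
    simpa only [pd_trunc h₁ h₂ wz] using trunc_tendstoL2 h₁ h₂ hz

lemma WHV.of_weak (h₁ : 0 < L₁) (h₂ : 0 < L₂) {f fx fy fz fzx fzy : E3 → ℝ}
    (hf : MemLp f 2 (boxMeas L₁ L₂)) (hx : MemLp fx 2 (boxMeas L₁ L₂))
    (hy : MemLp fy 2 (boxMeas L₁ L₂)) (hz : MemLp fz 2 (boxMeas L₁ L₂))
    (hzx : MemLp fzx 2 (boxMeas L₁ L₂)) (hzy : MemLp fzy 2 (boxMeas L₁ L₂))
    (wx : HasWeakPartial L₁ L₂ 0 f fx) (wy : HasWeakPartial L₁ L₂ 1 f fy)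
    (wz : HasWeakPartial L₁ L₂ 2 f fz) (wzx : HasWeakPartial L₁ L₂ 0 fz fzx)
    (wzy : HasWeakPartial L₁ L₂ 1 fz fzy) : WHV L₁ L₂ f fx fy fz fzx fzy where
  memLp := hf
  memLp_x := hx
  memLp_y := hy
  memLp_z := hz
  memLp_zx := hzx
  memLp_zy := hzy
  approx := by
    refine ⟨fun N => trunc L₁ L₂ N f, fun N => contDiff_trunc N f, trunc_tendstoL2 h₁ h₂ hf,
      ?_, ?_, ?_, ?_, ?_⟩
    · simpa only [pd_trunc h₁ h₂ wx] using trunc_tendstoL2 h₁ h₂ hx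
    · simpa only [pd_trunc h₁ h₂ wy] using trunc_tendstoL2 h₁ h₂ hy
    · simpa only [pd_trunc h₁ h₂ wz] using trunc_tendstoL2 h₁ h₂ hz
    · simpa only [pd_trunc h₁ h₂ wz, pd_trunc h₁ h₂ wzx] using trunc_tendstoL2 h₁ h₂ hzx
    · simpa only [pd_trunc h₁ h₂ wz, pd_trunc h₁ h₂ wzy] using trunc_tendstoL2 h₁ h₂ hzy

lemma TendstoL2.sub_const {F : ℕ → E3 → ℝ} {f : E3 → ℝ} (h : TendstoL2 L₁ L₂ F f) (s : E3 → ℝ) :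
    TendstoL2 L₁ L₂ (fun n x => F n x - s x) (fun x => f x - s x) := by
  unfold TendstoL2 at h ⊢
  simpa using h

lemma pd_sub {f g : E3 → ℝ} (hf : ContDiff ℝ ∞ f) (hg : ContDiff ℝ ∞ g) (j : Fin 3) :
    pd j (fun x => f x - g x) = fun x => pd j f x - pd j g x := by
  ext x
  unfold pd
  rw [fderiv_fun_sub (hf.differentiable (by simp) x) (hg.differentiable (by simp) x)]
  rfl

/-- Truncation errors stay in the class, so the trilinear estimates apply to them and show that they
vanish in the limit. -/
lemma WH.sub_smooth {f fx fy s : E3 → ℝ} (h : WH L₁ L₂ f fx fy) (hs : ContDiff ℝ ∞ s) :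
    WH L₁ L₂ (fun x => f x - s x) (fun x => fx x - pd 0 s x) (fun x => fy x - pd 1 s x) where
  memLp := h.memLp.sub (memLp_smooth hs)
  memLp_x := h.memLp_x.sub (memLp_smooth (contDiff_pd hs 0))
  memLp_y := h.memLp_y.sub (memLp_smooth (contDiff_pd hs 1))
  approx := by
    obtain ⟨F, sF, tF, tx, ty⟩ := h.approx
    refine ⟨fun n x => F n x - s x, fun n => (sF n).sub hs, tF.sub_const s, ?_, ?_⟩
    · simpa only [pd_sub (sF _) hs] using tx.sub_const (pd 0 s)
    · simpa only [pd_sub (sF _) hs] using ty.sub_const (pd 1 s)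

lemma WHV.sub_smooth {f fx fy fz fzx fzy s : E3 → ℝ} (h : WHV L₁ L₂ f fx fy fz fzx fzy)
    (hs : ContDiff ℝ ∞ s) :
    WHV L₁ L₂ (fun x => f x - s x) (fun x => fx x - pd 0 s x) (fun x => fy x - pd 1 s x)
      (fun x => fz x - pd 2 s x) (fun x => fzx x - pd 0 (pd 2 s) x)
      (fun x => fzy x - pd 1 (pd 2 s) x) where
  memLp := h.memLp.sub (memLp_smooth hs)
  memLp_x := h.memLp_x.sub (memLp_smooth (contDiff_pd hs 0))
  memLp_y := h.memLp_y.sub (memLp_smooth (contDiff_pd hs 1))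
  memLp_z := h.memLp_z.sub (memLp_smooth (contDiff_pd hs 2))
  memLp_zx := h.memLp_zx.sub (memLp_smooth (contDiff_pd (contDiff_pd hs 2) 0))
  memLp_zy := h.memLp_zy.sub (memLp_smooth (contDiff_pd (contDiff_pd hs 2) 1))
  approx := by
    obtain ⟨F, sF, tF, tx, ty, tz, tzx, tzy⟩ := h.approx
    refine ⟨fun n x => F n x - s x, fun n => (sF n).sub hs, tF.sub_const s, ?_, ?_, ?_, ?_, ?_⟩
    · simpa only [pd_sub (sF _) hs] using tx.sub_const (pd 0 s)
    · simpa only [pd_sub (sF _) hs] using ty.sub_const (pd 1 s)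
    · simpa only [pd_sub (sF _) hs] using tz.sub_const (pd 2 s)
    · simpa only [pd_sub (sF _) hs, pd_sub (contDiff_pd (sF _) 2) (contDiff_pd hs 2)]
        using tzx.sub_const (pd 0 (pd 2 s))
    · simpa only [pd_sub (sF _) hs, pd_sub (contDiff_pd (sF _) 2) (contDiff_pd hs 2)]
        using tzy.sub_const (pd 1 (pd 2 s))

end Sobolev

/-! ### Weak derivatives and divergence-free fields -/

section Weak

variable {L₁ L₂ : ℝ}

lemma HasWeakPartial.sub {j : Fin 3} {f g f' g' : E3 → ℝ} (hf : HasWeakPartial L₁ L₂ j f f')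
    (hg : HasWeakPartial L₁ L₂ j g g') (mf : MemLp f 2 (boxMeas L₁ L₂))
    (mg : MemLp g 2 (boxMeas L₁ L₂)) (mf' : MemLp f' 2 (boxMeas L₁ L₂))
    (mg' : MemLp g' 2 (boxMeas L₁ L₂)) :
    HasWeakPartial L₁ L₂ j (fun x => f x - g x) (fun x => f' x - g' x) := by
  intro φ hφ pφ
  have m1 := memLp_smooth (L₁ := L₁) (L₂ := L₂) hφ
  have m2 := memLp_smooth (L₁ := L₁) (L₂ := L₂) (contDiff_pd hφ j)
  simp only [sub_mul]
  rw [integral_sub (integrable_mul mf m2) (integrable_mul mg m2),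
    integral_sub (integrable_mul mf' m1) (integrable_mul mg' m1), hf φ hφ pφ, hg φ hφ pφ]
  ring

lemma HasWeakPartial.congr {j : Fin 3} {f f' g g' : E3 → ℝ} (h : HasWeakPartial L₁ L₂ j f f')
    (hf : f =ᵐ[boxMeas L₁ L₂] g) (hf' : f' =ᵐ[boxMeas L₁ L₂] g') :
    HasWeakPartial L₁ L₂ j g g' := by
  intro φ hφ pφ
  have e1 : ∫ x, f x * pd j φ x ∂(boxMeas L₁ L₂) = ∫ x, g x * pd j φ x ∂(boxMeas L₁ L₂) :=
    integral_congr_ae (hf.mono fun x hx => by simp only [hx])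
  have e2 : ∫ x, f' x * φ x ∂(boxMeas L₁ L₂) = ∫ x, g' x * φ x ∂(boxMeas L₁ L₂) :=
    integral_congr_ae (hf'.mono fun x hx => by simp only [hx])
  rw [← e1, ← e2]
  exact h φ hφ pφ

lemma isPeriodic_pd {φ : E3 → ℝ} (hp : IsPeriodic L₁ L₂ φ) (j : Fin 3) :
    IsPeriodic L₁ L₂ (pd j φ) := by
  intro i x
  have : (fun y => φ (y + Pi.single i ((![L₁, L₂, 2] : Fin 3 → ℝ) i))) = φ := funext fun y => hp i y
  unfold pd
  rw [← fderiv_comp_add_right, this]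

lemma pd_comm {φ : E3 → ℝ} (hφ : ContDiff ℝ ∞ φ) (i j : Fin 3) (x : E3) :
    pd i (pd j φ) x = pd j (pd i φ) x := by
  have hd : DifferentiableAt ℝ (fderiv ℝ φ) x :=
    (hφ.fderiv_right (m := ∞) (by simp)).differentiable (by simp) x
  have hs : IsSymmSndFDerivAt ℝ φ x :=
    (hφ.contDiffAt (x := x)).isSymmSndFDerivAt
      (by rw [minSmoothness_of_isRCLikeNormedField]; exact WithTop.coe_le_coe.2 (le_top : (2 : ℕ∞) ≤ ⊤))
  have key : ∀ a b : Fin 3, pd a (pd b φ) x =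
      fderiv ℝ (fderiv ℝ φ) x (Pi.single a 1) (Pi.single b 1) := by
    intro a b
    unfold pd
    rw [fderiv_clm_apply hd (differentiableAt_const _)]
    simp
  rw [key, key]
  exact hs _ _

/-- Weak derivatives commute. -/
lemma HasWeakPartial.comm {i j : Fin 3} {f fi fj fij : E3 → ℝ} (hi : HasWeakPartial L₁ L₂ i f fi)
    (hj : HasWeakPartial L₁ L₂ j f fj) (hij : HasWeakPartial L₁ L₂ j fi fij) :
    HasWeakPartial L₁ L₂ i fj fij := by
  intro φ hφ pφ
  have e1 := hj _ (contDiff_pd hφ i) (isPeriodic_pd pφ i)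
  have e2 := hi _ (contDiff_pd hφ j) (isPeriodic_pd pφ j)
  have e3 := hij φ hφ pφ
  have e4 : ∫ x, f x * pd j (pd i φ) x ∂(boxMeas L₁ L₂) =
      ∫ x, f x * pd i (pd j φ) x ∂(boxMeas L₁ L₂) := by simp only [pd_comm hφ i j]
  linarith

/-- Integration by parts for weakly differentiable functions. -/
lemma weak_ibp (h₁ : 0 < L₁) (h₂ : 0 < L₂) {j : Fin 3} {f f' g g' : E3 → ℝ}
    (hf : HasWeakPartial L₁ L₂ j f f') (hg : HasWeakPartial L₁ L₂ j g g')
    (mf : MemLp f 2 (boxMeas L₁ L₂)) (mg : MemLp g 2 (boxMeas L₁ L₂))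
    (mf' : MemLp f' 2 (boxMeas L₁ L₂)) (mg' : MemLp g' 2 (boxMeas L₁ L₂)) :
    ∫ x, f x * g' x ∂(boxMeas L₁ L₂) = -∫ x, f' x * g x ∂(boxMeas L₁ L₂) := by
  have t1 := tendsto_integral_mul mg' (fun n => memLp_trunc n g' 2) mf (tendsto_trunc h₁ h₂ mg')
  have t2 := (tendsto_integral_mul mg (fun n => memLp_trunc n g 2) mf' (tendsto_trunc h₁ h₂ mg)).neg
  simp only [mul_comm _ (f _), mul_comm _ (f' _)] at t1 t2
  refine tendsto_nhds_unique (t1.congr fun n => ?_) t2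
  rw [← hf _ (contDiff_trunc n g) (isPeriodic_trunc h₁ h₂ n g), pd_trunc h₁ h₂ hg]

lemma ae_zero_of_coef (h₁ : 0 < L₁) (h₂ : 0 < L₂) {f : E3 → ℝ} (hf : MemLp f 2 (boxMeas L₁ L₂))
    (h : ∀ k b, coef L₁ L₂ f k b = 0) : f =ᵐ[boxMeas L₁ L₂] 0 := by
  refine ae_eq_zero_of_l2_eq_zero hf (tendsto_nhds_unique (tendsto_const_nhds.congr fun n => ?_)
    (tendsto_trunc h₁ h₂ hf))
  simp [trunc, h]

/-- Testing the weak divergence condition with the modes shows that all Fourier coefficients of the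
trace vanish; completeness of the modes concludes. -/
lemma div_ae_zero (h₁ : 0 < L₁) (h₂ : 0 < L₂) {u : E3 → E3} {D : E3 → Fin 3 → Fin 3 → ℝ}
    (hu : IsL2Sigma L₁ L₂ u) (mD : ∀ j, MemLp (fun x => D x j j) 2 (boxMeas L₁ L₂))
    (hD : ∀ j, HasWeakPartial L₁ L₂ j (fun x => u x j) (fun x => D x j j)) :
    (fun x => ∑ j, D x j j) =ᵐ[boxMeas L₁ L₂] 0 := by
  refine ae_zero_of_coef h₁ h₂ (memLp_finsetSum _ fun j _ => mD j) fun k b => ?_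
  unfold coef
  simp only [Finset.sum_mul]
  rw [integral_finsetSum _ fun j _ => integrable_mul_mode (mD j) k b]
  have h0 := hu.div_free _ (contDiff_mode (L₁ := L₁) (L₂ := L₂) k b) (isPeriodic_mode h₁ h₂ k b)
  rw [integral_finsetSum _ fun j _ =>
    integrable_mul (hu.memLp j) (memLp_smooth (contDiff_pd (contDiff_mode k b) j))] at h0
  have e := fun j => hD j _ (contDiff_mode (L₁ := L₁) (L₂ := L₂) k b) (isPeriodic_mode h₁ h₂ k b)
  simp only [e, Finset.sum_neg_distrib, neg_eq_zero] at h0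
  exact h0

/-- A divergence-free field is orthogonal to weak gradients. -/
lemma sigma_orthogonal (h₁ : 0 < L₁) (h₂ : 0 < L₂) {u : E3 → E3} (hu : IsL2Sigma L₁ L₂ u)
    {p : E3 → ℝ} {Dp : E3 → Fin 3 → ℝ} (mDp : ∀ j, MemLp (fun x => Dp x j) 2 (boxMeas L₁ L₂))
    (hD : ∀ j, HasWeakPartial L₁ L₂ j p (fun x => Dp x j)) :
    ∑ j, ∫ x, u x j * Dp x j ∂(boxMeas L₁ L₂) = 0 := by
  have t : Tendsto (fun n => ∑ j, ∫ x, trunc L₁ L₂ n (fun x => Dp x j) x * u x j ∂(boxMeas L₁ L₂))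
      atTop (𝓝 (∑ j, ∫ x, Dp x j * u x j ∂(boxMeas L₁ L₂))) :=
    tendsto_finsetSum _ fun j _ => tendsto_integral_mul (mDp j) (fun n => memLp_trunc n _ 2)
      (hu.memLp j) (tendsto_trunc h₁ h₂ (mDp j))
  simp only [mul_comm _ (u _ _)] at t
  refine (tendsto_nhds_unique (tendsto_const_nhds.congr fun n => ?_) t).symm
  have h0 := hu.div_free _ (contDiff_trunc (L₁ := L₁) (L₂ := L₂) n p) (isPeriodic_trunc h₁ h₂ n p)
  rw [integral_finsetSum _ fun j _ =>
    integrable_mul (hu.memLp j) (memLp_smooth (contDiff_pd (contDiff_trunc n p) j))] at h0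
  simp only [pd_trunc h₁ h₂ (hD _)] at h0
  exact h0.symm

/-! ### Vertical components -/

/-- The test function is the mode with sine and cosine exchanged, since differentiation exchanges
them back. -/
lemma coef_sigma (h₁ : 0 < L₁) (h₂ : 0 < L₂) {u : E3 → E3} (hu : IsL2Sigma L₁ L₂ u)
    (k : Fin 3 → ℤ) (b : Bool) :
    ∑ j, wave L₁ L₂ k j * coef L₁ L₂ (fun x => u x j) k b = 0 := by
  have h0 := hu.div_free _ (contDiff_mode (L₁ := L₁) (L₂ := L₂) k (!b)) (isPeriodic_mode h₁ h₂ k _)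
  rw [integral_finsetSum _ fun j _ =>
    integrable_mul (hu.memLp j) (memLp_smooth (contDiff_pd (contDiff_mode k _) j))] at h0
  simp only [pd_mode, Bool.not_not] at h0
  have e : ∀ j, ∫ x, u x j * (modeSign (!b) * wave L₁ L₂ k j * mode L₁ L₂ k b x) ∂(boxMeas L₁ L₂)
      = modeSign (!b) * (wave L₁ L₂ k j * coef L₁ L₂ (fun x => u x j) k b) := by
    intro j
    unfold coef
    rw [← integral_const_mul, ← integral_const_mul]
    congr 1; ext x; ring
  simp only [e, ← Finset.mul_sum] at h0
  have hs : modeSign (!b) ≠ 0 := by cases b <;> simp [modeSign]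
  exact (mul_eq_zero.1 h0).resolve_left hs

/-- A mode independent of `z` is invariant under reflection, so the coefficient equals its own
negative. -/
lemma coef_odd {f : E3 → ℝ} (hf : ∀ x, f (reflect x) = -f x) {k : Fin 3 → ℤ} (hk : k 2 = 0)
    (b : Bool) : coef L₁ L₂ f k b = 0 := by
  have h1 := coef_reflect (L₁ := L₁) (L₂ := L₂) f k b
  have h2 : flip k = k := by simp [flip, hk, Function.update_eq_self_iff]
  simp only [hf, coef_neg, h2] at h1
  linarith

lemma wave_two (k : Fin 3 → ℤ) : wave L₁ L₂ k 2 = Real.pi * k 2 := by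
  simp [wave, period]; ring

lemma one_le_abs_wave {k : Fin 3 → ℤ} (hk : k 2 ≠ 0) : 1 ≤ |wave L₁ L₂ k 2| := by
  rw [wave_two, abs_mul, abs_of_pos Real.pi_pos]
  have : (1 : ℝ) ≤ |(k 2 : ℝ)| := by exact_mod_cast Int.one_le_abs hk
  nlinarith [Real.pi_gt_three]

/-- The vertical coefficients in terms of the horizontal ones. -/
noncomputable def vertCoef (L₁ L₂ : ℝ) (k : Fin 3 → ℤ) (a : Fin 2 → ℝ) : ℝ :=
  if k 2 = 0 then 0
  else -(wave L₁ L₂ k 0 * a 0 + wave L₁ L₂ k 1 * a 1) / wave L₁ L₂ k 2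

lemma coef_vertical (h₁ : 0 < L₁) (h₂ : 0 < L₂) {u : E3 → E3} (hu : IsL2Sigma L₁ L₂ u)
    (ho : ∀ x, u (reflect x) 2 = -u x 2) (k : Fin 3 → ℤ) (b : Bool) :
    coef L₁ L₂ (fun x => u x 2) k b =
      vertCoef L₁ L₂ k fun i => coef L₁ L₂ (fun x => u x i.castSucc) k b := by
  unfold vertCoef
  split_ifs with hk
  · exact coef_odd ho hk b
  · have h := coef_sigma h₁ h₂ hu k b
    rw [Fin.sum_univ_three] at h
    have hw : wave L₁ L₂ k 2 ≠ 0 := fun h0 => by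
      have := one_le_abs_wave (L₁ := L₁) (L₂ := L₂) hk
      rw [h0] at this; norm_num at this
    rw [eq_div_iff hw]
    simp only [Fin.castSucc_zero, Fin.castSucc_one]
    linarith

/-- Incompressibility and oddness determine every vertical coefficient from the horizontal ones.
This is needed because the limit system prescribes only horizontal initial values. -/
lemma vertical_unique (h₁ : 0 < L₁) (h₂ : 0 < L₂) {u v : E3 → E3} (hu : IsL2Sigma L₁ L₂ u)
    (hv : IsL2Sigma L₁ L₂ v) (ou : ∀ x, u (reflect x) 2 = -u x 2)
    (ov : ∀ x, v (reflect x) 2 = -v x 2)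
    (h : ∀ i : Fin 2, (fun x => u x i.castSucc) =ᵐ[boxMeas L₁ L₂] fun x => v x i.castSucc) :
    (fun x => u x 2) =ᵐ[boxMeas L₁ L₂] fun x => v x 2 := by
  have := ae_zero_of_coef h₁ h₂ ((hu.memLp 2).sub (hv.memLp 2)) fun k b => by
    have := coef_sub (hu.memLp 2) (hv.memLp 2) k b
    rw [coef_vertical h₁ h₂ hu ou, coef_vertical h₁ h₂ hv ov] at this
    simp only [fun i => coef_congr (h i) k b, sub_self] at this
    exact this
  filter_upwards [this] with x hx
  exact sub_eq_zero.1 hx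

/-- The Poincaré inequality for functions that are odd in `z`. -/
lemma poincare_of_coef (h₁ : 0 < L₁) (h₂ : 0 < L₂) {f fz : E3 → ℝ} (hf : MemLp f 2 (boxMeas L₁ L₂))
    (hz : MemLp fz 2 (boxMeas L₁ L₂)) (hw : HasWeakPartial L₁ L₂ 2 f fz)
    (h0 : ∀ k b, k 2 = 0 → coef L₁ L₂ f k b = 0) : l2 (boxMeas L₁ L₂) f ≤ l2 (boxMeas L₁ L₂) fz := by
  refine l2_le_of_sq_le l2_nonneg ?_
  have t := tendsto_integral_mul hf (fun n => memLp_trunc n f 2) hf (tendsto_trunc h₁ h₂ hf)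
  simp only [← pow_two] at t
  refine le_of_tendsto t (Eventually.of_forall fun n => ?_)
  rw [integral_trunc_mul hf]
  refine le_trans ?_ (bessel h₁ h₂ hz n)
  have hc := (volInv_pos h₁ h₂).le
  refine mul_le_mul_of_nonneg_left (Finset.sum_le_sum fun k _ => ?_) hc
  -- Differentiation in `z` multiplies a coefficient by `±π k₂`, of modulus at least `1` unless `k₂
  -- = 0`, where the coefficient of `f` vanishes by assumption. The Poincaré constant is therefore
  -- at most `1`.
  have hb : ∀ b, coef L₁ L₂ f k b * coef L₁ L₂ f k b ≤ coef L₁ L₂ fz k (!b) ^ 2 := by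
    intro b
    by_cases hk2 : k 2 = 0
    · rw [h0 k b hk2, mul_zero]; positivity
    · rw [coef_weakPartial h₁ h₂ hw, Bool.not_not]
      have h1 := one_le_abs_wave (L₁ := L₁) (L₂ := L₂) hk2
      have h2 : 1 ≤ wave L₁ L₂ k 2 ^ 2 := by rw [← sq_abs]; exact one_le_pow₀ h1
      have h3 : modeSign (!b) ^ 2 = 1 := by cases b <;> simp [modeSign]
      rw [neg_sq, mul_pow, mul_pow, h3, one_mul, ← pow_two]
      exact le_mul_of_one_le_left (sq_nonneg _) h2
  have ht := hb true
  have hf' := hb false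
  simp only [Fintype.sum_bool, Bool.not_true, Bool.not_false] at ht hf' ⊢
  linarith

lemma poincare_odd (h₁ : 0 < L₁) (h₂ : 0 < L₂) {f fz : E3 → ℝ} (hf : MemLp f 2 (boxMeas L₁ L₂))
    (hz : MemLp fz 2 (boxMeas L₁ L₂)) (hw : HasWeakPartial L₁ L₂ 2 f fz)
    (ho : ∀ x, f (reflect x) = -f x) : l2 (boxMeas L₁ L₂) f ≤ l2 (boxMeas L₁ L₂) fz :=
  poincare_of_coef h₁ h₂ hf hz hw fun _ b hk => coef_odd ho hk b

end Weak

/-! ### Regularity of time slices -/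

section Slices

variable {L₁ L₂ : ℝ}

/-- A divergence-free `H¹` field `u` with gradient `D` and odd vertical component. -/
structure GoodW (L₁ L₂ : ℝ) (u : E3 → E3) (D : E3 → Fin 3 → Fin 3 → ℝ) : Prop where
  sigma : IsL2Sigma L₁ L₂ u
  odd : ∀ x, u (reflect x) 2 = -u x 2
  memD : ∀ i j, MemLp (fun x => D x i j) 2 (boxMeas L₁ L₂)
  weak : ∀ i j, HasWeakPartial L₁ L₂ j (fun x => u x i) (fun x => D x i j)

/-- A field as in `GoodW` whose horizontal gradient is in `H¹`. -/
structure GoodS (L₁ L₂ : ℝ) (u : E3 → E3) (D : E3 → Fin 3 → Fin 3 → ℝ)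
    (D2 : E3 → Fin 2 → Fin 2 → Fin 3 → ℝ) : Prop extends GoodW L₁ L₂ u D where
  memD2 : ∀ i j k, MemLp (fun x => D2 x i j k) 2 (boxMeas L₁ L₂)
  weak2 : ∀ i j k, HasWeakPartial L₁ L₂ k (fun x => D x i.castSucc j.castSucc)
    (fun x => D2 x i j k)

/-- The mixed derivative `∂ⱼ ∂_z uᵢ` in terms of the second derivatives of the horizontal part. -/
def dzh (D2 : E3 → Fin 2 → Fin 2 → Fin 3 → ℝ) (i : Fin 3) (j : Fin 2) (x : E3) : ℝ :=
  (![D2 x 0 j 2, D2 x 1 j 2, -(D2 x 0 0 j.castSucc + D2 x 1 1 j.castSucc)] : Fin 3 → ℝ) i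

variable {u : E3 → E3} {D : E3 → Fin 3 → Fin 3 → ℝ} {D2 : E3 → Fin 2 → Fin 2 → Fin 3 → ℝ}

namespace GoodW

lemma wh (h₁ : 0 < L₁) (h₂ : 0 < L₂) (h : GoodW L₁ L₂ u D) (i : Fin 3) :
    WH L₁ L₂ (fun x => u x i) (fun x => D x i 0) (fun x => D x i 1) :=
  WH.of_weak h₁ h₂ (h.sigma.memLp i) (h.memD i 0) (h.memD i 1) (h.weak i 0) (h.weak i 1)

lemma wv (h₁ : 0 < L₁) (h₂ : 0 < L₂) (h : GoodW L₁ L₂ u D) (i : Fin 3) :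
    WV L₁ L₂ (fun x => u x i) (fun x => D x i 2) :=
  WV.of_weak h₁ h₂ (h.sigma.memLp i) (h.memD i 2) (h.weak i 2)

lemma vertical_eq (h₁ : 0 < L₁) (h₂ : 0 < L₂) (h : GoodW L₁ L₂ u D) :
    (fun x => D x 2 2) =ᵐ[boxMeas L₁ L₂] fun x => -(D x 0 0 + D x 1 1) := by
  filter_upwards [div_ae_zero h₁ h₂ h.sigma (fun j => h.memD j j) fun j => h.weak j j] with x hx
  simp only [Fin.sum_univ_three, Pi.zero_apply] at hx
  linarith

lemma l2_zz_le (h₁ : 0 < L₁) (h₂ : 0 < L₂) (h : GoodW L₁ L₂ u D) :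
    l2 (boxMeas L₁ L₂) (fun x => D x 2 2) ≤
      l2 (boxMeas L₁ L₂) (fun x => D x 0 0) + l2 (boxMeas L₁ L₂) (fun x => D x 1 1) := by
  rw [l2_congr (h.vertical_eq h₁ h₂), l2_neg]
  exact l2_add_le (h.memD 0 0) (h.memD 1 1)

/-- Together with the divergence constraint, this controls the vertical velocity by horizontal
derivatives of horizontal components, hence without any factor `ε`. -/
lemma l2_vertical_le (h₁ : 0 < L₁) (h₂ : 0 < L₂) (h : GoodW L₁ L₂ u D) :
    l2 (boxMeas L₁ L₂) (fun x => u x 2) ≤ l2 (boxMeas L₁ L₂) (fun x => D x 2 2) :=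
  poincare_odd h₁ h₂ (h.sigma.memLp 2) (h.memD 2 2) (h.weak 2 2) h.odd

lemma sub {v : E3 → E3} {D' : E3 → Fin 3 → Fin 3 → ℝ} (h : GoodW L₁ L₂ u D)
    (h' : GoodW L₁ L₂ v D') : GoodW L₁ L₂ (u - v) (D - D') where
  sigma := by
    refine ⟨fun i => (h.sigma.memLp i).sub (h'.sigma.memLp i), fun ψ hψ pψ => ?_⟩
    have e := h.sigma.div_free ψ hψ pψ
    have e' := h'.sigma.div_free ψ hψ pψ
    have m := fun j => memLp_smooth (L₁ := L₁) (L₂ := L₂) (contDiff_pd hψ j)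
    have : ∀ x, ∑ j, (u - v) x j * pd j ψ x =
        ∑ j, u x j * pd j ψ x - ∑ j, v x j * pd j ψ x := by
      intro x; rw [← Finset.sum_sub_distrib]; simp only [Pi.sub_apply, sub_mul]
    simp only [this]
    rw [integral_sub (integrable_finsetSum _ fun j _ => integrable_mul (h.sigma.memLp j) (m j))
      (integrable_finsetSum _ fun j _ => integrable_mul (h'.sigma.memLp j) (m j)), e, e', sub_zero]
  odd x := by simp only [Pi.sub_apply, h.odd, h'.odd]; ring
  memD i j := (h.memD i j).sub (h'.memD i j)
  weak i j := (h.weak i j).sub (h'.weak i j) (h.sigma.memLp i) (h'.sigma.memLp i) (h.memD i j)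
    (h'.memD i j)

end GoodW

namespace GoodS

lemma memLp_dzh (h : GoodS L₁ L₂ u D D2) (i : Fin 3) (j : Fin 2) :
    MemLp (dzh D2 i j) 2 (boxMeas L₁ L₂) := by
  unfold dzh
  fin_cases i
  · exact h.memD2 0 j 2
  · exact h.memD2 1 j 2
  · exact ((h.memD2 0 0 _).add (h.memD2 1 1 _)).neg

/-- For horizontal components weak derivatives commute. For the vertical one `∂_z u₃ = -∇_H · ũ`,
whose horizontal derivatives belong to the strong class. In this way `u₃` has enough regularity for
`trilinear_L2`. -/
lemma weak_dzh (h₁ : 0 < L₁) (h₂ : 0 < L₂) (h : GoodS L₁ L₂ u D D2) (i : Fin 3) (j : Fin 2) :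
    HasWeakPartial L₁ L₂ j.castSucc (fun x => D x i 2) (dzh D2 i j) := by
  unfold dzh
  fin_cases i
  · exact (h.weak 0 j.castSucc).comm (h.weak 0 2) (h.weak2 0 j 2)
  · exact (h.weak 1 j.castSucc).comm (h.weak 1 2) (h.weak2 1 j 2)
  · have h0 : HasWeakPartial L₁ L₂ j.castSucc (fun x => -(D x 0 0 + D x 1 1))
        (fun x => -(D2 x 0 0 j.castSucc + D2 x 1 1 j.castSucc)) := by
      intro φ hφ pφ
      have e1 := h.weak2 0 0 j.castSucc φ hφ pφ
      have e2 := h.weak2 1 1 j.castSucc φ hφ pφ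
      have m1 := memLp_smooth (L₁ := L₁) (L₂ := L₂) hφ
      have m2 := memLp_smooth (L₁ := L₁) (L₂ := L₂) (contDiff_pd hφ j.castSucc)
      simp only [neg_mul, add_mul, integral_neg]
      rw [integral_add (integrable_mul (h.memD 0 0) m2) (integrable_mul (h.memD 1 1) m2),
        integral_add (integrable_mul (h.memD2 0 0 _) m1) (integrable_mul (h.memD2 1 1 _) m1)]
      simp only [Fin.castSucc_zero, Fin.castSucc_one] at e1 e2
      linarith
    exact h0.congr (h.vertical_eq h₁ h₂).symm (ae_eq_refl _)

lemma whv (h₁ : 0 < L₁) (h₂ : 0 < L₂) (h : GoodS L₁ L₂ u D D2) (i : Fin 3) :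
    WHV L₁ L₂ (fun x => u x i) (fun x => D x i 0) (fun x => D x i 1) (fun x => D x i 2)
      (dzh D2 i 0) (dzh D2 i 1) :=
  WHV.of_weak h₁ h₂ (h.sigma.memLp i) (h.memD i 0) (h.memD i 1) (h.memD i 2) (h.memLp_dzh i 0)
    (h.memLp_dzh i 1) (h.weak i 0) (h.weak i 1) (h.weak i 2) (h.weak_dzh h₁ h₂ i 0)
    (h.weak_dzh h₁ h₂ i 1)

lemma wh_z (h₁ : 0 < L₁) (h₂ : 0 < L₂) (h : GoodS L₁ L₂ u D D2) (i : Fin 3) :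
    WH L₁ L₂ (fun x => D x i 2) (dzh D2 i 0) (dzh D2 i 1) :=
  WH.of_weak h₁ h₂ (h.memD i 2) (h.memLp_dzh i 0) (h.memLp_dzh i 1) (h.weak_dzh h₁ h₂ i 0)
    (h.weak_dzh h₁ h₂ i 1)

lemma wv_h (h₁ : 0 < L₁) (h₂ : 0 < L₂) (h : GoodS L₁ L₂ u D D2) (i j : Fin 2) :
    WV L₁ L₂ (fun x => D x i.castSucc j.castSucc) (fun x => D2 x i j 2) :=
  WV.of_weak h₁ h₂ (h.memD _ _) (h.memD2 i j 2) (h.weak2 i j 2)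

end GoodS

/-! ### Antisymmetry of the transport term -/

lemma tendsto_integral_of_abs_sub {X : Type*} [MeasurableSpace X] {μ : Measure X} {F : ℕ → X → ℝ}
    {f : X → ℝ} {e : ℕ → ℝ} (hf : Integrable f μ)
    (hF : ∀ n, Integrable (fun x => f x - F n x) μ)
    (he : ∀ n, ∫ x, |f x - F n x| ∂μ ≤ e n) (h0 : Tendsto e atTop (𝓝 0)) :
    Tendsto (fun n => ∫ x, F n x ∂μ) atTop (𝓝 (∫ x, f x ∂μ)) := by
  have key : ∀ n, ∫ x, F n x ∂μ = ∫ x, f x ∂μ - ∫ x, (f x - F n x) ∂μ := by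
    intro n
    rw [← integral_sub hf (hF n)]; simp
  simp only [key]
  have : Tendsto (fun n => ∫ x, (f x - F n x) ∂μ) atTop (𝓝 0) :=
    squeeze_zero_norm (fun n => (abs_integral_le_integral_abs).trans (he n)) h0
  simpa using (tendsto_const_nhds (x := ∫ x, f x ∂μ)).sub this

lemma tendsto_lad_zero {F Fx Fy : ℕ → E3 → ℝ} (h : Tendsto (fun n => l2 (boxMeas L₁ L₂) (F n)) atTop (𝓝 0))
    (hx : Tendsto (fun n => l2 (boxMeas L₁ L₂) (Fx n)) atTop (𝓝 0))
    (hy : Tendsto (fun n => l2 (boxMeas L₁ L₂) (Fy n)) atTop (𝓝 0)) :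
    Tendsto (fun n => lad L₁ L₂ (F n) (Fx n) (Fy n)) atTop (𝓝 0) := by
  simpa [lad] using (h.pow 2).add (h.mul (hx.add hy))

lemma tendsto_lad_sub_trunc (h₁ : 0 < L₁) (h₂ : 0 < L₂) {f fx fy : E3 → ℝ}
    (hf : MemLp f 2 (boxMeas L₁ L₂)) (hx : MemLp fx 2 (boxMeas L₁ L₂))
    (hy : MemLp fy 2 (boxMeas L₁ L₂)) (wx : HasWeakPartial L₁ L₂ 0 f fx)
    (wy : HasWeakPartial L₁ L₂ 1 f fy) :
    Tendsto (fun n => lad L₁ L₂ (fun x => f x - trunc L₁ L₂ n f x)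
      (fun x => fx x - pd 0 (trunc L₁ L₂ n f) x) (fun x => fy x - pd 1 (trunc L₁ L₂ n f) x))
      atTop (𝓝 0) := by
  simp only [pd_trunc h₁ h₂ wx, pd_trunc h₁ h₂ wy]
  exact tendsto_lad_zero (tendsto_trunc h₁ h₂ hf) (tendsto_trunc h₁ h₂ hx) (tendsto_trunc h₁ h₂ hy)

/-- Convergence of the transport term tested with truncations. -/
lemma tendsto_transport_trunc (h₁ : 0 < L₁) (h₂ : 0 < L₂) {w : E3 → E3}
    {Dw : E3 → Fin 3 → Fin 3 → ℝ} (hw : GoodW L₁ L₂ w Dw) {g : E3 → ℝ}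
    (hg : MemLp g 2 (boxMeas L₁ L₂)) (hS : GoodS L₁ L₂ u D D2) (i j : Fin 3) :
    Tendsto (fun n => ∫ x, w x j * g x * trunc L₁ L₂ n (fun x => u x i) x ∂(boxMeas L₁ L₂)) atTop
      (𝓝 (∫ x, w x j * g x * u x i ∂(boxMeas L₁ L₂))) := by
  have hW := hw.wh h₁ h₂ j
  have hH := hS.whv h₁ h₂ i
  have est := fun n => trilinear_L2 h₁ h₂ hW hg
    (hH.sub_smooth (contDiff_trunc (L₁ := L₁) (L₂ := L₂) n (fun x => u x i)))
  have l1 := tendsto_lad_sub_trunc h₁ h₂ (hS.sigma.memLp i) (hS.memD i 0) (hS.memD i 1)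
    (hS.weak i 0) (hS.weak i 1)
  have l2' := tendsto_lad_sub_trunc h₁ h₂ (hS.memD i 2) (hS.memLp_dzh i 0) (hS.memLp_dzh i 1)
    (hS.weak_dzh h₁ h₂ i 0) (hS.weak_dzh h₁ h₂ i 1)
  simp only [← pd_trunc h₁ h₂ (hS.weak i 2)] at l2'
  have hlim := (((l1.add l2').sqrt.const_mul (√(lad L₁ L₂ (fun x => w x j) (fun x => Dw x j 0)
      (fun x => Dw x j 1)))).const_mul (2 * ladConst L₁ L₂)).mul_const (l2 (boxMeas L₁ L₂) g)
  simp only [add_zero, Real.sqrt_zero, mul_zero, zero_mul] at hlim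
  exact tendsto_integral_of_abs_sub (trilinear_L2 h₁ h₂ hW hg hH).1
    (fun n => by simpa only [mul_sub] using (est n).1)
    (fun n => by simpa only [mul_sub] using (est n).2) hlim

lemma transport_integrable (h₁ : 0 < L₁) (h₂ : 0 < L₂) {w : E3 → E3}
    {Dw : E3 → Fin 3 → Fin 3 → ℝ} (hw : GoodW L₁ L₂ w Dw) {g : E3 → ℝ}
    (hg : MemLp g 2 (boxMeas L₁ L₂)) (hS : GoodS L₁ L₂ u D D2) (i j : Fin 3) :
    Integrable (fun x => w x j * g x * u x i) (boxMeas L₁ L₂) :=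
  (trilinear_L2 h₁ h₂ (hw.wh h₁ h₂ j) hg (hS.whv h₁ h₂ i)).1

/-- The transported quantity `wⱼ (∂ⱼ uᵢ) f` is controlled by the trilinear estimate with the
factor bounded in the vertical direction. -/
lemma gradient_estimate (h₁ : 0 < L₁) (h₂ : 0 < L₂) {w : E3 → E3}
    {Dw : E3 → Fin 3 → Fin 3 → ℝ} (hw : GoodW L₁ L₂ w Dw) (hS : GoodS L₁ L₂ u D D2)
    (i : Fin 2) (j : Fin 3) : ∃ B : ℝ, ∀ f fx fy : E3 → ℝ, WH L₁ L₂ f fx fy →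
      Integrable (fun x => w x j * D x i.castSucc j * f x) (boxMeas L₁ L₂) ∧
      ∫ x, |w x j * D x i.castSucc j * f x| ∂(boxMeas L₁ L₂) ≤ √(lad L₁ L₂ f fx fy) * B := by
  -- In the vertical direction `∂_z u` may have no vertical derivative, so `w₃` takes the role of
  -- the factor bounded along columns. In a horizontal direction this role goes to `∂ⱼ u`, whose
  -- vertical derivative is part of the strong class.
  induction j using Fin.lastCases with
  | last =>
    have e1 := hS.wh_z h₁ h₂ i.castSucc
    have e2 := hw.wv h₁ h₂ 2
    refine ⟨2 * ladConst L₁ L₂ * √(lad L₁ L₂ (fun x => D x i.castSucc 2) (dzh D2 i.castSucc 0)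
      (dzh D2 i.castSucc 1)) * (l2 (boxMeas L₁ L₂) (fun x => w x 2) +
        l2 (boxMeas L₁ L₂) (fun x => Dw x 2 2)), fun f fx fy hf => ?_⟩
    have := trilinear_sup h₁ h₂ hf e1 e2
    have e : ∀ x, w x (Fin.last 2) * D x i.castSucc (Fin.last 2) * f x =
        f x * D x i.castSucc 2 * w x 2 := fun x => by
      rw [show (Fin.last 2) = (2 : Fin 3) from rfl]; ring
    simp only [e]
    refine ⟨this.1, this.2.trans (le_of_eq ?_)⟩
    ring
  | cast j =>
    have e1 := hw.wh h₁ h₂ j.castSucc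
    have e2 := hS.wv_h h₁ h₂ i j
    refine ⟨2 * ladConst L₁ L₂ * √(lad L₁ L₂ (fun x => w x j.castSucc)
      (fun x => Dw x j.castSucc 0) (fun x => Dw x j.castSucc 1)) *
        (l2 (boxMeas L₁ L₂) (fun x => D x i.castSucc j.castSucc) +
        l2 (boxMeas L₁ L₂) (fun x => D2 x i j 2)), fun f fx fy hf => ?_⟩
    have := trilinear_sup h₁ h₂ hf e1 e2
    have e : ∀ x, w x j.castSucc * D x i.castSucc j.castSucc * f x =
        f x * w x j.castSucc * D x i.castSucc j.castSucc := fun x => by ring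
    simp only [e]
    refine ⟨this.1, this.2.trans (le_of_eq ?_)⟩
    ring

lemma pd_mul {f g : E3 → ℝ} (hf : ContDiff ℝ ∞ f) (hg : ContDiff ℝ ∞ g) (j : Fin 3) (x : E3) :
    pd j (fun x => f x * g x) x = pd j f x * g x + f x * pd j g x := by
  unfold pd
  rw [fderiv_fun_mul (hf.differentiable (by simp) x) (hg.differentiable (by simp) x)]
  simp; ring

lemma memLp_mul_smooth {f s : E3 → ℝ} (hf : MemLp f 2 (boxMeas L₁ L₂)) (hs : ContDiff ℝ ∞ s) :
    MemLp (fun x => f x * s x) 2 (boxMeas L₁ L₂) :=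
  MemLp.mul (p := 2) (q := ⊤) (memLp_of_continuous hs.continuous ⊤) hf

/-- Antisymmetry of the transport term. -/
theorem transport_antisymm (h₁ : 0 < L₁) (h₂ : 0 < L₂) {w : E3 → E3}
    {Dw : E3 → Fin 3 → Fin 3 → ℝ} (hw : GoodW L₁ L₂ w Dw) (hS : GoodS L₁ L₂ u D D2)
    {f : E3 → ℝ} {Df : Fin 3 → E3 → ℝ} (hf : MemLp f 2 (boxMeas L₁ L₂))
    (mf : ∀ j, MemLp (Df j) 2 (boxMeas L₁ L₂)) (wf : ∀ j, HasWeakPartial L₁ L₂ j f (Df j))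
    (i : Fin 2) :
    ∑ j, ∫ x, w x j * Df j x * u x i.castSucc ∂(boxMeas L₁ L₂) +
      ∑ j, ∫ x, w x j * D x i.castSucc j * f x ∂(boxMeas L₁ L₂) = 0 := by
  -- For smooth `φ`, the product of `φ` with a truncation of `u` is a legitimate test function for
  -- the divergence constraint of `w`. Plain `L²` convergence then removes the truncation.
  have smooth_case : ∀ φ : E3 → ℝ, ContDiff ℝ ∞ φ → IsPeriodic L₁ L₂ φ →
      ∑ j, ∫ x, w x j * pd j φ x * u x i.castSucc ∂(boxMeas L₁ L₂) +
      ∑ j, ∫ x, w x j * D x i.castSucc j * φ x ∂(boxMeas L₁ L₂) = 0 := by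
    intro φ hφ pφ
    set g : E3 → ℝ := fun x => u x i.castSucc
    have hg := hS.sigma.memLp i.castSucc
    have t : Tendsto (fun n => ∑ j, ∫ x, trunc L₁ L₂ n g x * (w x j * pd j φ x) ∂(boxMeas L₁ L₂) +
        ∑ j, ∫ x, trunc L₁ L₂ n (fun x => D x i.castSucc j) x * (w x j * φ x) ∂(boxMeas L₁ L₂)) atTop
        (𝓝 (∑ j, ∫ x, g x * (w x j * pd j φ x) ∂(boxMeas L₁ L₂) +
        ∑ j, ∫ x, D x i.castSucc j * (w x j * φ x) ∂(boxMeas L₁ L₂))) := by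
      refine (tendsto_finsetSum _ fun j _ => ?_).add (tendsto_finsetSum _ fun j _ => ?_)
      · exact tendsto_integral_mul hg (fun n => memLp_trunc n g 2)
          (memLp_mul_smooth (hw.sigma.memLp j) (contDiff_pd hφ j)) (tendsto_trunc h₁ h₂ hg)
      · exact tendsto_integral_mul (hS.memD _ j) (fun n => memLp_trunc n _ 2)
          (memLp_mul_smooth (hw.sigma.memLp j) hφ) (tendsto_trunc h₁ h₂ (hS.memD _ j))
    have z : ∀ n, ∑ j, ∫ x, trunc L₁ L₂ n g x * (w x j * pd j φ x) ∂(boxMeas L₁ L₂) +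
        ∑ j, ∫ x, trunc L₁ L₂ n (fun x => D x i.castSucc j) x * (w x j * φ x) ∂(boxMeas L₁ L₂)
        = 0 := by
      intro n
      have st := contDiff_trunc (L₁ := L₁) (L₂ := L₂) n g
      have h0 := hw.sigma.div_free (fun x => φ x * trunc L₁ L₂ n g x) (hφ.mul st) (fun i x => by
        simp only [pφ i x, isPeriodic_trunc h₁ h₂ n g i x])
      simp only [pd_mul hφ st] at h0
      rw [← Finset.sum_add_distrib, ← h0, integral_finsetSum _ fun j _ =>
        integrable_mul (hw.sigma.memLp j) (memLp_smooth (((contDiff_pd hφ j).mul st).add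
          (hφ.mul (contDiff_pd st j))))]
      refine Finset.sum_congr rfl fun j _ => ?_
      rw [← integral_add (integrable_mul (memLp_trunc n g 2)
          (memLp_mul_smooth (hw.sigma.memLp j) (contDiff_pd hφ j)))
        (integrable_mul (memLp_trunc n _ 2) (memLp_mul_smooth (hw.sigma.memLp j) hφ)),
        ← pd_trunc h₁ h₂ (hS.weak i.castSucc j)]
      congr 1; ext x; ring
    have := tendsto_nhds_unique t (by simp only [z]; exact tendsto_const_nhds)
    rw [← this]
    congr 1 <;> refine Finset.sum_congr rfl fun j _ => ?_ <;> congr 1 <;> ext x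
    · simp only [g]; ring
    · ring
  have wh := WH.of_weak h₁ h₂ hf (mf 0) (mf 1) (wf 0) (wf 1)
  -- The second approximation, of `f`, is beyond plain `L²` convergence. The first sum converges by
  -- `trilinear_L2` with the error of `∇f` as the square integrable factor, the second by
  -- `gradient_estimate`.
  have t : Tendsto (fun n =>
      ∑ j, ∫ x, w x j * trunc L₁ L₂ n (Df j) x * u x i.castSucc ∂(boxMeas L₁ L₂) +
      ∑ j, ∫ x, w x j * D x i.castSucc j * trunc L₁ L₂ n f x ∂(boxMeas L₁ L₂)) atTop
      (𝓝 (∑ j, ∫ x, w x j * Df j x * u x i.castSucc ∂(boxMeas L₁ L₂) +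
      ∑ j, ∫ x, w x j * D x i.castSucc j * f x ∂(boxMeas L₁ L₂))) := by
    refine (tendsto_finsetSum _ fun j _ => ?_).add (tendsto_finsetSum _ fun j _ => ?_)
    · have est := fun n => trilinear_L2 h₁ h₂ (hw.wh h₁ h₂ j)
        ((mf j).sub (memLp_trunc n (Df j) 2)) (hS.whv h₁ h₂ i.castSucc)
      have hlim := (tendsto_trunc h₁ h₂ (mf j)).const_mul (2 * ladConst L₁ L₂ *
        (√(lad L₁ L₂ (fun x => w x j) (fun x => Dw x j 0) fun x => Dw x j 1) *
          √((lad L₁ L₂ (fun x => u x i.castSucc) (fun x => D x i.castSucc 0)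
              fun x => D x i.castSucc 1) + lad L₁ L₂ (fun x => D x i.castSucc 2)
                (dzh D2 i.castSucc 0) (dzh D2 i.castSucc 1))))
      simp only [mul_zero] at hlim
      exact tendsto_integral_of_abs_sub (transport_integrable h₁ h₂ hw (mf j) hS _ j)
        (fun n => by simpa only [Pi.sub_apply, mul_sub, sub_mul] using (est n).1)
        (fun n => by
          have := (est n).2
          simp only [Pi.sub_apply, mul_sub, sub_mul] at this
          exact this) hlim
    · obtain ⟨B, hB⟩ := gradient_estimate h₁ h₂ hw hS i j
      have est := fun n => hB _ _ _ (wh.sub_smooth (contDiff_trunc (L₁ := L₁) (L₂ := L₂) n f))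
      have hlim := (tendsto_lad_sub_trunc h₁ h₂ hf (mf 0) (mf 1) (wf 0) (wf 1)).sqrt.mul_const B
      simp only [Real.sqrt_zero, zero_mul] at hlim
      exact tendsto_integral_of_abs_sub (hB _ _ _ wh).1
        (fun n => by simpa only [mul_sub] using (est n).1)
        (fun n => by simpa only [mul_sub] using (est n).2) hlim
  refine tendsto_nhds_unique t (tendsto_const_nhds.congr fun n => ?_)
  rw [← smooth_case _ (contDiff_trunc n f) (isPeriodic_trunc h₁ h₂ n f)]
  simp only [fun j => pd_trunc h₁ h₂ (wf j) n]

end Slices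

/-! ### Functions of time -/

/-- A test function in time: smooth and supported in `[a, b] ⊆ (0, T)`. -/
structure IsTimeTest (T : ℝ) (θ : ℝ → ℝ) : Prop where
  smooth : ContDiff ℝ ∞ θ
  supp : ∃ a b : ℝ, 0 < a ∧ b < T ∧ ∀ t, t ∉ Icc a b → θ t = 0

lemma exists_Icc_of_tsupport {T : ℝ} {ψ : ℝ → ℝ} (hc : HasCompactSupport ψ)
    (hs : tsupport ψ ⊆ Ioo 0 T) :
    ∃ a b : ℝ, 0 < a ∧ b < T ∧ ∀ t, t ∉ Icc a b → ψ t = 0 := by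
  rcases (tsupport ψ).eq_empty_or_nonempty with h | h
  · refine ⟨1, T - 1, one_pos, by linarith, fun t _ => ?_⟩
    exact image_eq_zero_of_notMem_tsupport (by simp [h])
  · have hk : IsCompact (tsupport ψ) := hc
    refine ⟨sInf (tsupport ψ), sSup (tsupport ψ), (hs (hk.sInf_mem h)).1, (hs (hk.sSup_mem h)).2,
      fun t ht => image_eq_zero_of_notMem_tsupport fun h' => ht ?_⟩
    exact ⟨csInf_le hk.bddBelow h', le_csSup hk.bddAbove h'⟩

lemma integral_timeTest {T : ℝ} {f θ : ℝ → ℝ} {b t₁ : ℝ} (hb : b ≤ t₁) (h1 : t₁ ≤ T) (h0 : 0 ≤ t₁)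
    (h : ∀ t, b < t → θ t = 0) :
    ∫ t in Ioo 0 T, f t * θ t = ∫ t in (0 : ℝ)..t₁, f t * θ t := by
  rw [intervalIntegral.integral_of_le h0]
  have e : ∀ S : Set ℝ, ∫ t in S ∩ Iic t₁, f t * θ t = ∫ t in S, f t * θ t := by
    intro S
    rw [inter_comm, ← Measure.restrict_restrict measurableSet_Iic]
    refine setIntegral_eq_integral_of_forall_compl_eq_zero fun t ht => ?_
    rw [h t (lt_of_le_of_lt hb (not_le.1 ht)), mul_zero]
  rw [setIntegral_congr_set (Ioo_ae_eq_Ioc (μ := volume)), ← e (Ioc 0 T)]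
  congr 2
  ext t
  simp only [mem_inter_iff, mem_Ioc, mem_Iic]
  exact ⟨fun h => ⟨h.1.1, h.2⟩, fun h => ⟨⟨h.1, h.2.trans h1⟩, h.2⟩⟩

/-- The integral of the derivative along an absolutely continuous primitive. -/
lemma integral_primitive_mul_deriv {g θ : ℝ → ℝ} {t₁ : ℝ}
    (hg : IntervalIntegrable g volume 0 t₁) (hθ : ContDiff ℝ ∞ θ) :
    ∫ t in (0 : ℝ)..t₁, (∫ s in (0 : ℝ)..t, g s) * deriv θ t =
      (∫ s in (0 : ℝ)..t₁, g s) * θ t₁ - ∫ t in (0 : ℝ)..t₁, g t * θ t := by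
  have hG := hg.absolutelyContinuousOnInterval_intervalIntegral (c := 0) (by simp)
  have hθ' : AbsolutelyContinuousOnInterval θ 0 t₁ :=
    ContDiffOn.absolutelyContinuousOnInterval (hθ.of_le (by simp)).contDiffOn
  rw [hG.integral_mul_deriv_eq_deriv_mul hθ']
  simp only [intervalIntegral.integral_same, zero_mul, sub_zero]
  congr 1
  refine intervalIntegral.integral_congr_ae ?_
  filter_upwards [hg.ae_hasDerivAt_integral] with x hx hx'
  rw [(hx (uIoc_subset_uIcc hx') 0 (by simp)).deriv]

lemma exists_timeTest_integral_one {T : ℝ} (hT : 0 < T) : ∃ ρ : ℝ → ℝ, ContDiff ℝ ∞ ρ ∧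
    (∃ a b : ℝ, 0 < a ∧ b < T ∧ ∀ t, t ∉ Icc a b → ρ t = 0) ∧ ∫ t, ρ t = 1 := by
  let B : ContDiffBump (T / 2) := ⟨T / 8, T / 4, by positivity, by linarith⟩
  refine ⟨B.normed volume, B.contDiff_normed, ⟨T / 4, 3 * T / 4, by positivity, by linarith,
    fun t ht => ?_⟩, B.integral_normed⟩
  refine Function.notMem_support.1 fun h => ht ?_
  rw [B.support_normed_eq] at h
  have := Metric.mem_ball.1 h
  rw [Real.dist_eq, abs_lt] at this
  simp only [B] at this
  constructor <;> linarith

/-- The lemma of du Bois-Reymond: `f` minus the primitive of `g` has vanishing weak derivative, so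
it is almost everywhere constant, and constant by continuity. The argument is carried out on `[0,
t₁]` with `t₁ < T`, since `g` is integrable only up to times before `T`. -/
lemma weak_ftc_Ioo {T : ℝ} {f g : ℝ → ℝ} (hf : ContinuousOn f (Ico 0 T))
    (hg : ∀ t ∈ Ico 0 T, IntervalIntegrable g volume 0 t)
    (h : ∀ θ, IsTimeTest T θ → ∫ t in Ioo 0 T, f t * deriv θ t = -∫ t in Ioo 0 T, g t * θ t)
    {t₁ : ℝ} (ht : t₁ ∈ Ioo 0 T) :
    ∀ t ∈ Icc 0 t₁, f t = f 0 + ∫ s in (0 : ℝ)..t, g s := by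
  have hg1 := hg t₁ ⟨ht.1.le, ht.2⟩
  have hcG : ContinuousOn (fun t => ∫ s in (0 : ℝ)..t, g s) (Icc 0 t₁) := by
    have := intervalIntegral.continuousOn_primitive_interval' hg1 left_mem_uIcc
    rwa [uIcc_of_le ht.1.le] at this
  have hcf : ContinuousOn f (Icc 0 t₁) := hf.mono fun t h => ⟨h.1, h.2.trans_lt ht.2⟩
  set G : ℝ → ℝ := fun t => ∫ s in (0 : ℝ)..t, g s with hG
  set k : ℝ → ℝ := fun t => f t - G t with hk
  have hck : ContinuousOn k (Icc 0 t₁) := hcf.sub hcG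
  have ii : ∀ {p q : ℝ → ℝ}, ContinuousOn p (Icc 0 t₁) → Continuous q →
      IntervalIntegrable (fun t => p t * q t) volume 0 t₁ := fun hp hq =>
    (hp.mul hq.continuousOn).intervalIntegrable_of_Icc ht.1.le
  have key : ∀ θ, IsTimeTest t₁ θ → ∫ t in (0 : ℝ)..t₁, k t * deriv θ t = 0 := by
    rintro θ ⟨hθ, a, b, ha, hb, hab⟩
    have hz : ∀ t, b < t → θ t = 0 := fun t h => hab t fun h' => by linarith [h'.2]
    have hz' : ∀ t, b < t → deriv θ t = 0 := fun t h => by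
      have : θ =ᶠ[𝓝 t] fun _ => 0 := by
        filter_upwards [lt_mem_nhds h] with s hs using hz s hs
      rw [this.deriv_eq, deriv_const]
    have e := h θ ⟨hθ, a, b, ha, hb.trans ht.2, hab⟩
    rw [integral_timeTest hb.le ht.2.le ht.1.le hz', integral_timeTest hb.le ht.2.le ht.1.le hz] at e
    have e2 := integral_primitive_mul_deriv hg1 hθ
    rw [hz _ hb] at e2
    have cd : Continuous (deriv θ) := (contDiff_infty_iff_deriv.1 hθ).2.continuous
    simp only [hk, sub_mul]
    rw [intervalIntegral.integral_sub (ii hcf cd) (ii hcG cd), e, e2]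
    ring
  obtain ⟨ρ, hρ, ⟨a₀, b₀, ha₀, hb₀, hab₀⟩, hρ1⟩ := exists_timeTest_integral_one ht.1
  set c := ∫ t in (0 : ℝ)..t₁, k t * ρ t
  have full : ∀ {q : ℝ → ℝ}, (∃ a b : ℝ, 0 < a ∧ b < t₁ ∧ ∀ t, t ∉ Icc a b → q t = 0) →
      ∫ t in (0 : ℝ)..t₁, q t = ∫ t, q t := by
    rintro q ⟨a, b, ha, hb, hab⟩
    rw [intervalIntegral.integral_of_le ht.1.le]
    exact setIntegral_eq_integral_of_forall_compl_eq_zero fun t h' => hab t fun h'' =>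
      h' ⟨by linarith [h''.1], by linarith [h''.2]⟩
  have hae : ∀ᵐ t, t ∈ Ioo 0 t₁ → k t - c = 0 := by
    refine isOpen_Ioo.ae_eq_zero_of_integral_contDiff_smul_eq_zero
      (((hck.mono Ioo_subset_Icc_self).sub continuousOn_const).locallyIntegrableOn measurableSet_Ioo)
      fun ψ hψ cψ sψ => ?_
    obtain ⟨a₁, b₁, ha₁, hb₁, hab₁⟩ := exists_Icc_of_tsupport cψ sψ
    set m := ∫ t, ψ t
    -- Subtracting a multiple of the fixed bump of integral one gives a function of mean zero. Its
    -- primitive is again compactly supported, hence an admissible test function.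
    set η : ℝ → ℝ := fun t => ψ t - m * ρ t with hη
    have sη : ContDiff ℝ ∞ η := hψ.sub (contDiff_const.mul hρ)
    have zη : ∀ t, t ∉ Icc (min a₀ a₁) (max b₀ b₁) → η t = 0 := by
      intro t h'
      have h1 : t ∉ Icc a₀ b₀ := fun q => h' ⟨(min_le_left _ _).trans q.1, q.2.trans (le_max_left _ _)⟩
      have h2 : t ∉ Icc a₁ b₁ := fun q => h' ⟨(min_le_right _ _).trans q.1, q.2.trans (le_max_right _ _)⟩
      simp [hη, hab₀ t h1, hab₁ t h2]
    have hmin : 0 < min a₀ a₁ := lt_min ha₀ ha₁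
    have hmax : max b₀ b₁ < t₁ := max_lt hb₀ hb₁
    have iψ : ∫ t in (0 : ℝ)..t₁, ψ t = m := full ⟨a₁, b₁, ha₁, hb₁, hab₁⟩
    have iρ : ∫ t in (0 : ℝ)..t₁, ρ t = 1 := by
      rw [← hρ1]; exact full ⟨a₀, b₀, ha₀, hb₀, hab₀⟩
    have iη : ∫ t in (0 : ℝ)..t₁, η t = 0 := by
      simp only [hη]
      have cρ := hρ.continuous
      rw [intervalIntegral.integral_sub (hψ.continuous.intervalIntegrable _ _)
        (Continuous.intervalIntegrable (by fun_prop) _ _),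
        intervalIntegral.integral_const_mul, iψ, iρ]; ring
    have dθ : ∀ t, HasDerivAt (fun t => ∫ s in (0 : ℝ)..t, η s) (η t) t := fun t =>
      intervalIntegral.integral_hasDerivAt_right (sη.continuous.intervalIntegrable _ _)
        sη.continuous.aestronglyMeasurable.stronglyMeasurableAtFilter sη.continuous.continuousAt
    have dθ' : deriv (fun t => ∫ s in (0 : ℝ)..t, η s) = η := funext fun t => (dθ t).deriv
    have test : IsTimeTest t₁ fun t => ∫ s in (0 : ℝ)..t, η s := by
      refine ⟨contDiff_infty_iff_deriv.2 ⟨fun t => (dθ t).differentiableAt, by rwa [dθ']⟩,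
        min a₀ a₁, max b₀ b₁, hmin, hmax, fun t h' => ?_⟩
      by_cases h1 : t < min a₀ a₁
      · refine (intervalIntegral.integral_congr (g := fun _ => (0 : ℝ)) fun s hs => ?_).trans
          (by simp)
        refine zη s fun q => ?_
        have := hs.2
        rcases max_choice 0 t with h2 | h2 <;> rw [h2] at this <;> linarith [q.1]
      · have h2 : max b₀ b₁ < t := by
          by_contra h2; exact h' ⟨not_lt.1 h1, not_lt.1 h2⟩
        have ci := sη.continuous.intervalIntegrable (μ := volume)
        rw [← intervalIntegral.integral_add_adjacent_intervals (ci 0 t₁) (ci t₁ t), iη, zero_add]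
        refine (intervalIntegral.integral_congr (g := fun _ => (0 : ℝ)) fun s hs => ?_).trans
          (by simp)
        refine zη s fun q => ?_
        have := hs.1
        rcases min_choice t₁ t with h3 | h3 <;> rw [h3] at this <;> linarith [q.2]
    have e := key _ test
    rw [dθ'] at e
    have e1 : ∫ t in (0 : ℝ)..t₁, k t * η t =
        (∫ t in (0 : ℝ)..t₁, k t * ψ t) - m * c := by
      rw [← intervalIntegral.integral_const_mul, ← intervalIntegral.integral_sub
        (ii hck hψ.continuous) ((ii hck hρ.continuous).const_mul m)]
      congr 1; ext t; simp only [hη]; ring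
    rw [e] at e1
    have e2 : ∫ t, ψ t • (k t - c) = ∫ t in (0 : ℝ)..t₁, ψ t • (k t - c) :=
      (full ⟨a₁, b₁, ha₁, hb₁, fun t h' => by simp [hab₁ t h']⟩).symm
    have e3 : ∫ t in (0 : ℝ)..t₁, ψ t • (k t - c) =
        (∫ t in (0 : ℝ)..t₁, k t * ψ t) - m * c := by
      have cψ' := hψ.continuous
      rw [← iψ, ← intervalIntegral.integral_mul_const, ← intervalIntegral.integral_sub
        (ii hck hψ.continuous) (Continuous.intervalIntegrable (by fun_prop) _ _)]
      congr 1; ext t; simp only [smul_eq_mul]; ring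
    rw [e2, e3, ← e1]
  have heq : EqOn k (fun _ => c) (Icc 0 t₁) := by
    refine Measure.eqOn_Icc_of_ae_eq volume ht.1.ne ?_ hck continuousOn_const
    rw [Measure.restrict_congr_set Ioo_ae_eq_Icc.symm, EventuallyEq, ae_restrict_iff' measurableSet_Ioo]
    filter_upwards [hae] with t h1 h2
    linarith [h1 h2]
  intro t h'
  have h0 := heq (show (0 : ℝ) ∈ Icc 0 t₁ from ⟨le_rfl, ht.1.le⟩)
  have h1 := heq h'
  simp only [hk, hG, intervalIntegral.integral_same] at h0 h1
  linarith

/-- A continuous function whose weak derivative is locally integrable is its primitive. -/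
theorem weak_ftc {T : ℝ} {f g : ℝ → ℝ} (hf : ContinuousOn f (Ico 0 T))
    (hg : ∀ t ∈ Ico 0 T, IntervalIntegrable g volume 0 t)
    (h : ∀ θ, IsTimeTest T θ → ∫ t in Ioo 0 T, f t * deriv θ t = -∫ t in Ioo 0 T, g t * θ t)
    {t : ℝ} (ht : t ∈ Ico 0 T) : f t = f 0 + ∫ s in (0 : ℝ)..t, g s := by
  refine weak_ftc_Ioo hf hg h (t₁ := (t + T) / 2) ⟨?_, ?_⟩ t ⟨ht.1, ?_⟩ <;>
    linarith [ht.1, ht.2]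

/-- Product rule for primitives of integrable functions. -/
lemma primitive_mul {m n : ℝ} {f g : ℝ → ℝ} {t : ℝ}
    (hf : IntervalIntegrable f volume 0 t) (hg : IntervalIntegrable g volume 0 t) :
    (m + ∫ s in (0 : ℝ)..t, f s) * (n + ∫ s in (0 : ℝ)..t, g s) =
      m * n + ∫ s in (0 : ℝ)..t, (f s * (n + ∫ r in (0 : ℝ)..s, g r) +
        (m + ∫ r in (0 : ℝ)..s, f r) * g s) := by
  have cst : ∀ c : ℝ, AbsolutelyContinuousOnInterval (fun _ => c) 0 t := fun c =>
    ContDiffOn.absolutelyContinuousOnInterval contDiffOn_const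
  have hF := (cst m).add (hf.absolutelyContinuousOnInterval_intervalIntegral (c := 0) (by simp))
  have hG := (cst n).add (hg.absolutelyContinuousOnInterval_intervalIntegral (c := 0) (by simp))
  have e := hF.integral_deriv_mul_eq_sub hG
  simp only [Pi.add_apply, intervalIntegral.integral_same, add_zero] at e
  rw [eq_sub_iff_add_eq, add_comm] at e
  rw [← e]
  congr 1
  refine intervalIntegral.integral_congr_ae ?_
  filter_upwards [hf.ae_hasDerivAt_integral, hg.ae_hasDerivAt_integral] with x hx hy hx'
  have h1 := (hx (uIoc_subset_uIcc hx') 0 (by simp)).const_add m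
  have h2 := (hy (uIoc_subset_uIcc hx') 0 (by simp)).const_add n
  have e1 : ∀ (c : ℝ) (F : ℝ → ℝ), ((fun _ => c) + F) = fun x => c + F x := fun c F => rfl
  rw [e1, e1, h1.deriv, h2.deriv]

/-- The map `x ↦ e^(-x)` is `1`-Lipschitz on `[0, ∞)`, so the same `δ` works. This provides the
integrating factor in Grönwall's inequality for a coefficient that is merely integrable. -/
lemma _root_.AbsolutelyContinuousOnInterval.exp_neg {f : ℝ → ℝ} {a b : ℝ}
    (hf : AbsolutelyContinuousOnInterval f a b) (h0 : ∀ x ∈ uIcc a b, 0 ≤ f x) :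
    AbsolutelyContinuousOnInterval (fun x => Real.exp (-f x)) a b := by
  rw [absolutelyContinuousOnInterval_iff] at hf ⊢
  intro ε hε
  obtain ⟨δ, hδ, h⟩ := hf ε hε
  refine ⟨δ, hδ, fun E hE hs => lt_of_le_of_lt (Finset.sum_le_sum fun i hi => ?_) (h E hE hs)⟩
  have key : ∀ x y : ℝ, 0 ≤ x → 0 ≤ y → Real.exp (-x) - Real.exp (-y) ≤ |x - y| := by
    intro x y hx hy
    have e1 : Real.exp (-x) ≤ 1 := Real.exp_le_one_iff.2 (by linarith)
    have e2 : Real.exp (-y) = Real.exp (-x) * Real.exp (x - y) := by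
      rw [← Real.exp_add]; congr 1; ring
    have e3 := Real.add_one_le_exp (x - y)
    have e4 := Real.exp_pos (-x)
    rcases le_total 0 (x - y) with h | h
    · rw [abs_of_nonneg h]; nlinarith
    · rw [abs_of_nonpos h]; nlinarith
  have hm := hE.1 i (Finset.mem_coe.2 hi)
  have p1 := h0 _ hm.1
  have p2 := h0 _ hm.2
  rw [Real.dist_eq, Real.dist_eq]
  refine abs_le.2 ⟨?_, key _ _ p1 p2⟩
  have := key _ _ p2 p1
  rw [abs_sub_comm] at this
  linarith

/-- Grönwall's inequality with an integrable coefficient. -/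
lemma gronwall {F t : ℝ} {y g : ℝ → ℝ} (ht : 0 ≤ t) (hg : IntervalIntegrable g volume 0 t)
    (hgy : IntervalIntegrable (fun s => g s * y s) volume 0 t) (g0 : ∀ s, 0 ≤ g s)
    (h : ∀ᵐ s, s ∈ Ioo 0 t → y s ≤ F + ∫ r in (0 : ℝ)..s, g r * y r) :
    F + ∫ s in (0 : ℝ)..t, g s * y s ≤ F * Real.exp (∫ s in (0 : ℝ)..t, g s) := by
  have cst : AbsolutelyContinuousOnInterval (fun _ => F) 0 t :=
    ContDiffOn.absolutelyContinuousOnInterval contDiffOn_const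
  have hY := cst.add (hgy.absolutelyContinuousOnInterval_intervalIntegral (c := 0) (by simp))
  have hE := (hg.absolutelyContinuousOnInterval_intervalIntegral (c := 0) (by simp)).exp_neg
    fun x hx => intervalIntegral.integral_nonneg (by rw [uIcc_of_le ht] at hx; exact hx.1)
      fun s _ => g0 s
  have e := hY.integral_deriv_mul_eq_sub hE
  simp only [Pi.add_apply, intervalIntegral.integral_same, add_zero, neg_zero, Real.exp_zero,
    mul_one] at e
  -- With `Y = F + ∫ g y`, the derivative of `Y e^(-∫ g)` is `g (y - Y) e^(-∫ g) ≤ 0` almost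
  -- everywhere. Since `Y` is absolutely continuous, `y` itself needs neither continuity nor a bound
  -- at every time.
  have le : ∫ x in (0 : ℝ)..t, (deriv ((fun _ => F) + fun x => ∫ s in (0 : ℝ)..x, g s * y s) x *
      Real.exp (-∫ s in (0 : ℝ)..x, g s) + (F + ∫ s in (0 : ℝ)..x, g s * y s) *
        deriv (fun x => Real.exp (-∫ s in (0 : ℝ)..x, g s)) x) ≤ 0 := by
    rw [intervalIntegral.integral_of_le ht, ← integral_Ioc_eq_integral_Ioo.symm]
    refine integral_nonpos_of_ae ?_
    rw [EventuallyLE, ae_restrict_iff' measurableSet_Ioo]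
    filter_upwards [h, hg.ae_hasDerivAt_integral, hgy.ae_hasDerivAt_integral] with x hx h1 h2 hx'
    have hm : x ∈ uIcc 0 t := by rw [uIcc_of_le ht]; exact Ioo_subset_Icc_self hx'
    have h3 := (h2 hm 0 (by simp)).const_add F
    have h4 := (h1 hm 0 (by simp)).neg.exp
    have e1 : ∀ (c : ℝ) (F : ℝ → ℝ), ((fun _ => c) + F) = fun x => c + F x := fun c F => rfl
    have e2 : ∀ (F : ℝ → ℝ), (fun x => Real.exp ((-F) x)) = fun x => Real.exp (-F x) :=
      fun F => rfl
    rw [e2] at h4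
    rw [e1, h3.deriv, h4.deriv]
    simp only [Pi.neg_apply, Pi.zero_apply]
    have := mul_nonneg (g0 x) (sub_nonneg.2 (hx hx'))
    have p := Real.exp_pos (-∫ s in (0 : ℝ)..x, g s)
    nlinarith
  rw [e] at le
  have p := Real.exp_pos (∫ s in (0 : ℝ)..t, g s)
  rw [Real.exp_neg] at le
  have := mul_le_mul_of_nonneg_right (sub_nonpos.1 le) p.le
  rwa [mul_assoc, inv_mul_cancel₀ p.ne', mul_one] at this

/-! ### Time-dependent fields -/

section Time

variable {L₁ L₂ T : ℝ}

/-- The measurability class of time-dependent functions. -/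
abbrev CylMeasurable (L₁ L₂ T : ℝ) (f : ℝ → E3 → ℝ) : Prop :=
  AEStronglyMeasurable (fun q : ℝ × E3 => f q.1 q.2) (cylMeas L₁ L₂ T)

lemma CylMeasurable.integral {f : ℝ → E3 → ℝ} (hf : CylMeasurable L₁ L₂ T f) :
    AEStronglyMeasurable (fun t => ∫ x, f t x ∂(boxMeas L₁ L₂)) (volume.restrict (Ioo 0 T)) :=
  AEStronglyMeasurable.integral_prod_right' (f := fun q : ℝ × E3 => f q.1 q.2) hf

lemma CylMeasurable.lintegral {f : ℝ → E3 → ℝ} (hf : CylMeasurable L₁ L₂ T f) :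
    AEMeasurable (fun t => nsq L₁ L₂ (f t)) (volume.restrict (Ioo 0 T)) :=
  AEMeasurable.lintegral_prod_right' (f := fun q : ℝ × E3 => ‖f q.1 q.2‖ₑ ^ 2)
    (hf.enorm.pow_const 2)

lemma CylMeasurable.l2 {f : ℝ → E3 → ℝ} (hf : CylMeasurable L₁ L₂ T f) :
    AEStronglyMeasurable (fun t => l2 (boxMeas L₁ L₂) (f t)) (volume.restrict (Ioo 0 T)) := by
  have := CylMeasurable.integral (f := fun t x => f t x ^ 2) (AEStronglyMeasurable.pow hf 2)
  exact Real.continuous_sqrt.comp_aestronglyMeasurable this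

lemma cylMeasurable_space {g : E3 → ℝ} (hg : AEStronglyMeasurable g (boxMeas L₁ L₂)) :
    CylMeasurable L₁ L₂ T fun _ x => g x := hg.comp_snd

lemma cylMeasurable_time {g : ℝ → ℝ} (hg : AEStronglyMeasurable g (volume.restrict (Ioo 0 T))) :
    CylMeasurable L₁ L₂ T fun t _ => g t := hg.comp_fst

lemma CylMeasurable.coef {f : ℝ → E3 → ℝ} (hf : CylMeasurable L₁ L₂ T f) (k : Fin 3 → ℤ) (b : Bool) :
    AEStronglyMeasurable (fun t => coef L₁ L₂ (f t) k b) (volume.restrict (Ioo 0 T)) :=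
  CylMeasurable.integral (f := fun t x => f t x * mode L₁ L₂ k b x)
    (AEStronglyMeasurable.mul hf (cylMeasurable_space (memLp_mode k b 2).1))

lemma CylMeasurable.trunc {f : ℝ → E3 → ℝ} (hf : CylMeasurable L₁ L₂ T f) (N : ℕ) :
    CylMeasurable L₁ L₂ T fun t => trunc L₁ L₂ N (f t) := by
  unfold CylMeasurable HydroMHD.trunc
  refine AEStronglyMeasurable.const_mul ?_ _
  refine Finset.aestronglyMeasurable_fun_sum _ fun k _ =>
    Finset.aestronglyMeasurable_fun_sum _ fun b _ => ?_
  exact AEStronglyMeasurable.mul (cylMeasurable_time (hf.coef k b))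
    (cylMeasurable_space (memLp_mode k b 2).1)

namespace InL2L2

variable {f g : ℝ → E3 → ℝ}

lemma meas (hf : InL2L2 L₁ L₂ T f) : CylMeasurable L₁ L₂ T f := hf.1

lemma slice (hf : InL2L2 L₁ L₂ T f) :
    ∀ᵐ t ∂(volume.restrict (Ioo 0 T)), MemLp (f t) 2 (boxMeas L₁ L₂) := by
  have h1 := MemLp.integrable_sq hf
  have h2 := Integrable.prod_right_ae h1
  have h3 := AEStronglyMeasurable.prodMk_left hf.1
  filter_upwards [h2, h3] with t a b
  exact (memLp_two_iff_integrable_sq b).2 a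

lemma integrable_inner (hf : InL2L2 L₁ L₂ T f) (hg : InL2L2 L₁ L₂ T g) :
    Integrable (fun t => ∫ x, f t x * g t x ∂(boxMeas L₁ L₂)) (volume.restrict (Ioo 0 T)) :=
  Integrable.integral_prod_left (f := fun q : ℝ × E3 => f q.1 q.2 * g q.1 q.2)
    (MemLp.integrable_mul hf hg)

lemma integrable_l2_sq (hf : InL2L2 L₁ L₂ T f) :
    Integrable (fun t => l2 (boxMeas L₁ L₂) (f t) ^ 2) (volume.restrict (Ioo 0 T)) := by
  simp only [l2_sq]
  simpa only [sq] using hf.integrable_inner hf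

lemma memLp_l2 (hf : InL2L2 L₁ L₂ T f) :
    MemLp (fun t => l2 (boxMeas L₁ L₂) (f t)) 2 (volume.restrict (Ioo 0 T)) :=
  (memLp_two_iff_integrable_sq hf.meas.l2).2 hf.integrable_l2_sq

lemma sub (hf : InL2L2 L₁ L₂ T f) (hg : InL2L2 L₁ L₂ T g) :
    InL2L2 L₁ L₂ T fun t x => f t x - g t x := MemLp.sub hf hg

lemma lintegral_nsq (hf : InL2L2 L₁ L₂ T f) :
    ∫⁻ t in Ioo 0 T, nsq L₁ L₂ (f t) =
      ENNReal.ofReal (∫ t in Ioo 0 T, l2 (boxMeas L₁ L₂) (f t) ^ 2) := by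
  rw [ofReal_integral_eq_lintegral_ofReal hf.integrable_l2_sq
    (Eventually.of_forall fun _ => sq_nonneg _)]
  refine lintegral_congr_ae ?_
  filter_upwards [hf.slice] with t ht
  exact (ofReal_l2_sq ht).symm

lemma mul_smooth (hf : InL2L2 L₁ L₂ T f) {e : E3 → ℝ} (he : Continuous e) :
    InL2L2 L₁ L₂ T fun t x => f t x * e x := by
  obtain ⟨C, hC, h⟩ := exists_bound_on_box (L₁ := L₁) (L₂ := L₂) he
  have hm : AEStronglyMeasurable (fun q : ℝ × E3 => e q.2) (cylMeas L₁ L₂ T) :=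
    (he.comp continuous_snd).aestronglyMeasurable
  refine MemLp.of_le_mul (c := C) hf (AEStronglyMeasurable.mul hf.1 hm) ?_
  have hb : ∀ᵐ q ∂(cylMeas L₁ L₂ T), |e q.2| ≤ C := by
    have : ∀ᵐ x ∂(boxMeas L₁ L₂), |e x| ≤ C := ae_box h
    exact Measure.quasiMeasurePreserving_snd.ae this
  filter_upwards [hb] with q hq
  rw [norm_mul, mul_comm, Real.norm_eq_abs]
  exact mul_le_mul_of_nonneg_right hq (norm_nonneg _)

end InL2L2

lemma inL2L2_space {e : E3 → ℝ} (he : MemLp e 2 (boxMeas L₁ L₂)) :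
    InL2L2 L₁ L₂ T fun _ x => e x := he.comp_snd _

/-! ### Slices -/

/-- Fubini reduces the regularity in space-time to regularity of almost every time slice, so that
the estimates can be made at a fixed time. -/
lemma WeakField.goodW (W : WeakField L₁ L₂) (hT : 0 < T) :
    ∀ᵐ t ∂(volume.restrict (Ioo 0 T)), GoodW L₁ L₂ (W.u t) (W.D t) := by
  have h1 : ∀ᵐ t ∂(volume.restrict (Ioo 0 T)), ∀ i j,
      MemLp (fun x => W.D t x i j) 2 (boxMeas L₁ L₂) :=
    ae_all_iff.2 fun i => ae_all_iff.2 fun j => ((W.l2h1 T hT i).grad j).slice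
  have h2 := ae_all_iff.2 fun i => (W.l2h1 T hT i).weak
  filter_upwards [h1, h2, ae_restrict_mem measurableSet_Ioo] with t a b c
  exact ⟨W.sigma t c.1.le, fun x => (W.symm t c.1.le x).2, a, b⟩

lemma StrongField.goodS (S : StrongField L₁ L₂ T) :
    ∀ᵐ t ∂(volume.restrict (Ioo 0 T)), GoodS L₁ L₂ (S.u t) (S.D t) (S.D2 t) := by
  have h1 : ∀ᵐ t ∂(volume.restrict (Ioo 0 T)), ∀ i j,
      MemLp (fun x => S.D t x i j) 2 (boxMeas L₁ L₂) :=
    ae_all_iff.2 fun i => ae_all_iff.2 fun j => ((S.l2h1 i).grad j).slice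
  have h2 := ae_all_iff.2 fun i => (S.l2h1 i).weak
  have h3 : ∀ᵐ t ∂(volume.restrict (Ioo 0 T)), ∀ i j k,
      MemLp (fun x => S.D2 t x i j k) 2 (boxMeas L₁ L₂) :=
    ae_all_iff.2 fun i => ae_all_iff.2 fun j => ae_all_iff.2 fun k =>
      ((S.l2h1_horizontal i j).grad k).slice
  have h4 := ae_all_iff.2 fun i => ae_all_iff.2 fun j => (S.l2h1_horizontal i j).weak
  filter_upwards [h1, h2, h3, h4, ae_restrict_mem measurableSet_Ioo] with t a b c d e
  have e' : t ∈ Ico 0 T := ⟨e.1.le, e.2⟩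
  exact ⟨⟨S.sigma t e', fun x => (S.symm t e' x).2, a, b⟩, c, d⟩

end Time

/-! ### The weak formulation tested with stationary fields -/

lemma memLp_fun_sub {X : Type*} [MeasurableSpace X] {μ : Measure X} {f g : X → ℝ}
    (hf : MemLp f 2 μ) (hg : MemLp g 2 μ) : MemLp (fun x => f x - g x) 2 μ := hf.sub hg

section WeakModes

variable {L₁ L₂ T ε α : ℝ}

/-- Stationary test fields. -/
structure SpatialTest (L₁ L₂ : ℝ) (e : E3 → E3) : Prop where
  smooth : ∀ i, ContDiff ℝ ∞ fun x => e x i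
  periodic : IsPeriodic L₁ L₂ e
  symm : IsSymmetric e
  div_free : ∀ x, ∑ j : Fin 3, pd j (fun y => e y j) x = 0

/-- Transport and diffusion terms of the weak form of the equation for `u` with transporting
velocity `v`, at a fixed time, tested with a field `e` with gradient `De`. -/
noncomputable def wform (L₁ L₂ ε α : ℝ) (v : E3 → E3) (D : E3 → Fin 3 → Fin 3 → ℝ) (e : E3 → E3)
    (De : E3 → Fin 3 → Fin 3 → ℝ) : ℝ :=
  ∑ i : Fin 3, wt ε i * (∑ j : Fin 3, ∫ x, v x j * D x i j * e x i ∂(boxMeas L₁ L₂) +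
    ∑ j : Fin 3, visc ε α j * ∫ x, D x i j * De x i j ∂(boxMeas L₁ L₂))

/-- The pairing `(u, e)` with weights `1, 1, ε²`. -/
noncomputable def wpair (L₁ L₂ ε : ℝ) (u e : E3 → E3) : ℝ :=
  ∑ i : Fin 3, wt ε i * ∫ x, u x i * e x i ∂(boxMeas L₁ L₂)

/-- The gradient of a field. -/
noncomputable def grad (e : E3 → E3) (x : E3) (i j : Fin 3) : ℝ := pd j (fun y => e y i) x

lemma pd_const_mul (c : ℝ) {f : E3 → ℝ} (hf : ContDiff ℝ ∞ f) (j : Fin 3) (x : E3) :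
    pd j (fun y => c * f y) x = c * pd j f x := by
  unfold pd
  rw [fderiv_const_mul (hf.differentiable (by simp) x)]
  simp

lemma SpatialTest.isTestField {e : E3 → E3} (he : SpatialTest L₁ L₂ e) {θ : ℝ → ℝ}
    (hθ : IsTimeTest T θ) : IsTestField L₁ L₂ fun t x => θ t • e x where
  smooth := by
    refine (hθ.smooth.comp contDiff_fst).smul ?_
    exact (contDiff_pi.2 he.smooth).comp contDiff_snd
  compact := by
    obtain ⟨a, b, -, -, h⟩ := hθ.supp
    refine ⟨b + 1, fun t ht x => ?_⟩
    rw [h t fun h' => by linarith [h'.2], zero_smul]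
  periodic t _ i x := by simp only [he.periodic i x]
  symm t _ x := by
    refine ⟨fun i => ?_, ?_⟩
    · simp only [Pi.smul_apply, (he.symm x).1 i]
    · simp only [Pi.smul_apply, (he.symm x).2, smul_neg]
  div_free t _ x := by
    simp only [Pi.smul_apply, smul_eq_mul, fun j => pd_const_mul (θ t) (he.smooth j) j x]
    rw [← Finset.mul_sum, he.div_free x, mul_zero]

lemma isTestField_zero : IsTestField L₁ L₂ fun _ _ => 0 where
  smooth := contDiff_const
  compact := ⟨0, fun _ _ _ => rfl⟩
  periodic _ _ _ _ := rfl
  symm _ _ _ := by simp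
  div_free _ _ _ := by simp [pd]

lemma weakIntegrand_zero (U V : WeakField L₁ L₂) (t : ℝ) (x : E3) :
    weakIntegrand ε α U V (fun _ _ => 0) t x = 0 := by
  simp [weakIntegrand, pd]

lemma integral_weakIntegrand {U V : WeakField L₁ L₂} {e : E3 → E3} (he : SpatialTest L₁ L₂ e)
    {θ : ℝ → ℝ} {t : ℝ} (hθ : DifferentiableAt ℝ θ t) (hU : GoodW L₁ L₂ (U.u t) (U.D t))
    (hV : GoodW L₁ L₂ (V.u t) (V.D t)) :
    ∫ x, weakIntegrand ε α U V (fun t x => θ t • e x) t x ∂(boxMeas L₁ L₂) =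
      -(wpair L₁ L₂ ε (U.u t) e * deriv θ t) +
        wform L₁ L₂ ε α (V.u t) (U.D t) e (grad e) * θ t := by
  have me := fun i => memLp_smooth (L₁ := L₁) (L₂ := L₂) (he.smooth i)
  have mde := fun i j => memLp_smooth (L₁ := L₁) (L₂ := L₂) (contDiff_pd (he.smooth i) j)
  have i1 := fun i => integrable_mul (hU.sigma.memLp i) (me i)
  have i2 : ∀ i j, Integrable (fun x => V.u t x j * U.D t x i j * e x i) (boxMeas L₁ L₂) :=
    fun i j => by
      simpa only [mul_assoc] using
        integrable_mul (hV.sigma.memLp j) (memLp_mul_smooth (hU.memD i j) (he.smooth i))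
  have i3 := fun i j => integrable_mul (hU.memD i j) (mde i j)
  have e1 : ∀ x, weakIntegrand ε α U V (fun t x => θ t • e x) t x = ∑ i, wt ε i *
      (-(deriv θ t * (U.u t x i * e x i)) + (θ t * (∑ j, V.u t x j * U.D t x i j * e x i) +
        θ t * (∑ j, visc ε α j * (U.D t x i j * pd j (fun y => e y i) x)))) := by
    intro x
    unfold weakIntegrand
    refine Finset.sum_congr rfl fun i _ => ?_
    have d : deriv (fun s => (θ s • e x) i) t = deriv θ t * e x i := by
      simp only [Pi.smul_apply, smul_eq_mul]
      rw [deriv_mul_const hθ]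
    simp only [Pi.smul_apply, smul_eq_mul] at d ⊢
    rw [d]
    simp only [fun j => pd_const_mul (θ t) (he.smooth i) j x, Finset.mul_sum, Finset.sum_mul]
    congr 1
    rw [add_assoc]
    congr 1
    · ring
    · congr 1 <;> refine Finset.sum_congr rfl fun j _ => ?_ <;> ring
  have s2 : ∀ i, Integrable (fun x => ∑ j, V.u t x j * U.D t x i j * e x i) (boxMeas L₁ L₂) :=
    fun i => integrable_finsetSum _ fun j _ => i2 i j
  have s3 : ∀ i, Integrable (fun x => ∑ j, visc ε α j * (U.D t x i j * pd j (fun y => e y i) x))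
      (boxMeas L₁ L₂) := fun i => integrable_finsetSum _ fun j _ => (i3 i j).const_mul _
  simp only [e1]
  rw [integral_finsetSum _ fun i _ => Integrable.const_mul (((i1 i).const_mul _).fun_neg.fun_add
    (((s2 i).const_mul _).fun_add ((s3 i).const_mul _))) _]
  unfold wform wpair
  rw [Finset.sum_mul, Finset.sum_mul, ← Finset.sum_neg_distrib, ← Finset.sum_add_distrib]
  refine Finset.sum_congr rfl fun i _ => ?_
  rw [integral_const_mul, integral_add ((i1 i).const_mul _).fun_neg
    (((s2 i).const_mul _).fun_add ((s3 i).const_mul _)), integral_add ((s2 i).const_mul _)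
    ((s3 i).const_mul _), integral_neg, integral_const_mul, integral_const_mul, integral_const_mul,
    integral_finsetSum _ fun j _ => i2 i j, integral_finsetSum _ fun j _ => (i3 i j).const_mul _]
  simp only [integral_const_mul, grad]
  ring

lemma continuousOn_wpair (W : WeakField L₁ L₂) {e : E3 → E3}
    (he : ∀ i, MemLp (fun x => e x i) 2 (boxMeas L₁ L₂)) :
    ContinuousOn (fun t => wpair L₁ L₂ ε (W.u t) e) (Ici 0) := by
  unfold wpair
  exact continuousOn_finsetSum _ fun i _ => continuousOn_const.mul (W.weak_cont i _ (he i))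

lemma integrable_wform (U V : WeakField L₁ L₂) (hT : 0 < T) {e : E3 → E3}
    (he : ∀ i, ContDiff ℝ ∞ fun x => e x i) :
    Integrable (fun t => wform L₁ L₂ ε α (V.u t) (U.D t) e (grad e))
      (volume.restrict (Ioo 0 T)) := by
  unfold wform
  refine integrable_finsetSum _ fun i _ => Integrable.const_mul (Integrable.add
    (integrable_finsetSum _ fun j _ => ?_) (integrable_finsetSum _ fun j _ =>
      Integrable.const_mul ?_ _)) _
  · have := ((V.l2h1 T hT j).val).integrable_inner
      (((U.l2h1 T hT i).grad j).mul_smooth (he i).continuous)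
    simpa only [mul_assoc] using this
  · exact (((U.l2h1 T hT i).grad j)).integrable_inner
      (inL2L2_space (memLp_smooth (contDiff_pd (he i) j)))

/-- Weak solutions tested with a stationary field: abstract form. -/
lemma weak_mode_aux {U V : WeakField L₁ L₂} (hT : 0 < T) {e : E3 → E3}
    (he : SpatialTest L₁ L₂ e)
    (hw : ∀ θ, IsTimeTest T θ → ∫ t in Ioi (0 : ℝ), ∫ x,
      weakIntegrand ε α U V (fun t x => θ t • e x) t x ∂(boxMeas L₁ L₂) = 0)
    {t : ℝ} (ht : t ∈ Ico 0 T) :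
    wpair L₁ L₂ ε (U.u t) e = wpair L₁ L₂ ε (U.u 0) e +
      ∫ s in (0 : ℝ)..t, -wform L₁ L₂ ε α (V.u s) (U.D s) e (grad e) := by
  have me := fun i => memLp_smooth (L₁ := L₁) (L₂ := L₂) (he.smooth i)
  have iF := integrable_wform (ε := ε) (α := α) U V hT he.smooth
  have cm := continuousOn_wpair (ε := ε) U me
  refine weak_ftc (T := T) (f := fun t => wpair L₁ L₂ ε (U.u t) e) (cm.mono fun s hs => hs.1)
    (fun s hs => ?_) (fun θ hθ => ?_) ht
  · refine (IntegrableOn.intervalIntegrable ?_).neg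
    rw [uIcc_of_le hs.1, integrableOn_Icc_iff_integrableOn_Ioo]
    exact IntegrableOn.mono_set iF (Ioo_subset_Ioo_right hs.2.le)
  · have h := hw θ hθ
    obtain ⟨a, b, ha, hb, hab⟩ := hθ.supp
    have hd : ∀ t, t ∉ Icc a b → deriv θ t = 0 := by
      intro t ht
      have : θ =ᶠ[𝓝 t] fun _ => 0 := by
        filter_upwards [isClosed_Icc.isOpen_compl.mem_nhds ht] with s hs using hab s hs
      rw [this.deriv_eq, deriv_const]
    have hsub : ∫ t in Ioi (0 : ℝ), ∫ x,
        weakIntegrand ε α U V (fun t x => θ t • e x) t x ∂(boxMeas L₁ L₂) =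
        ∫ t in Ioo 0 T, ∫ x,
        weakIntegrand ε α U V (fun t x => θ t • e x) t x ∂(boxMeas L₁ L₂) := by
      refine setIntegral_eq_of_subset_of_forall_sdiff_eq_zero measurableSet_Ioi
        (fun t ht => ht.1) fun t ht => ?_
      have hn : t ∉ Icc a b := fun h' => ht.2 ⟨ht.1, h'.2.trans_lt hb⟩
      have z : ∀ x, weakIntegrand ε α U V (fun t x => θ t • e x) t x = 0 := by
        intro x
        unfold weakIntegrand
        refine Finset.sum_eq_zero fun i _ => ?_
        have d : deriv (fun s => (θ s • e x) i) t = 0 := by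
          simp only [Pi.smul_apply, smul_eq_mul]
          rw [deriv_mul_const (hθ.smooth.differentiable (by simp) t), hd t hn, zero_mul]
        simp only [Pi.smul_apply, smul_eq_mul] at d ⊢
        rw [d]
        simp [hab t hn, pd]
      simp only [z, integral_zero]
    rw [hsub] at h
    have hc : ∫ t in Ioo 0 T, ∫ x,
        weakIntegrand ε α U V (fun t x => θ t • e x) t x ∂(boxMeas L₁ L₂) =
        ∫ t in Ioo 0 T, (-(wpair L₁ L₂ ε (U.u t) e * deriv θ t) +
        wform L₁ L₂ ε α (V.u t) (U.D t) e (grad e) * θ t) := by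
      refine integral_congr_ae ?_
      filter_upwards [U.goodW hT, V.goodW hT] with t h1 h2
      exact integral_weakIntegrand he (hθ.smooth.differentiable (by simp) t) h1 h2
    have cθ := hθ.smooth.continuous
    have cθ' : Continuous (deriv θ) := (contDiff_infty_iff_deriv.1 hθ.smooth).2.continuous
    have j1 : Integrable (fun t => wpair L₁ L₂ ε (U.u t) e * deriv θ t)
        (volume.restrict (Ioo 0 T)) := by
      have : ContinuousOn (fun t => wpair L₁ L₂ ε (U.u t) e * deriv θ t) (Icc 0 T) :=
        (cm.mono fun s hs => hs.1).mul cθ'.continuousOn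
      exact this.integrableOn_Icc.mono_set Ioo_subset_Icc_self
    have j2 : Integrable (fun t => wform L₁ L₂ ε α (V.u t) (U.D t) e (grad e) * θ t)
        (volume.restrict (Ioo 0 T)) := by
      obtain ⟨C, hC⟩ := isCompact_Icc.exists_bound_of_continuousOn (s := Icc 0 T) cθ.continuousOn
      refine Integrable.mul_bdd iF cθ.aestronglyMeasurable (c := C) ?_
      filter_upwards [ae_restrict_mem measurableSet_Ioo] with t ht
      exact hC t (Ioo_subset_Icc_self ht)
    rw [hc, integral_add j1.fun_neg j2, integral_neg] at h
    simp only [neg_mul, integral_neg]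
    linarith

variable {A₀ B₀ : InitialField L₁ L₂} {A B : WeakField L₁ L₂}

/-- The second test field is zero, which isolates the equation for `A`. The time factor vanishes at
`0`, so the initial data drop out of the weak form; the value at `0` enters through weak continuity
instead. -/
lemma IsLerayHopf.weak_mode (h : IsLerayHopf ε α A₀ B₀ A B) (hT : 0 < T) {e : E3 → E3}
    (he : SpatialTest L₁ L₂ e) {t : ℝ} (ht : t ∈ Ico 0 T) :
    wpair L₁ L₂ ε (A.u t) e = wpair L₁ L₂ ε (A.u 0) e +
      ∫ s in (0 : ℝ)..t, -wform L₁ L₂ ε α (B.u s) (A.D s) e (grad e) := by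
  refine weak_mode_aux hT he (fun θ hθ => ?_) ht
  have := h.weak_form _ _ (he.isTestField hθ) isTestField_zero
  obtain ⟨a, b, ha, hb, hab⟩ := hθ.supp
  have z : θ 0 = 0 := hab 0 fun h' => by linarith [h'.1]
  simpa [weakIntegrand_zero, z] using this

/-- Exchanging the roles of `A` and `B`. -/
lemma IsLerayHopf.symm (h : IsLerayHopf ε α A₀ B₀ A B) : IsLerayHopf ε α B₀ A₀ B A where
  init_A := h.init_B
  init_B := h.init_A
  weak_form φ χ hφ hχ := by
    have := h.weak_form χ φ hχ hφ
    simp only [add_comm (weakIntegrand ε α B A φ _ _)]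
    rw [this]
    simp only [add_comm (A₀.u _ _ * _)]

end WeakModes

/-! ### Time derivatives of Fourier coefficients -/

section StrongModes

variable {L₁ L₂ T : ℝ}

lemma StrongField.tendsto_l2 (S : StrongField L₁ L₂ T) (i : Fin 2) {t₀ : ℝ} (ht₀ : t₀ ∈ Ico 0 T) :
    Tendsto (fun t => l2 (boxMeas L₁ L₂) fun x => S.u t x i.castSucc - S.u t₀ x i.castSucc)
      (𝓝[Ico 0 T] t₀) (𝓝 0) := by
  have h := (ENNReal.continuousAt_toReal ENNReal.zero_ne_top).tendsto.comp (S.cont i t₀ ht₀)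
  have h2 := h.sqrt
  simp only [ENNReal.toReal_zero, Real.sqrt_zero] at h2
  refine h2.congr' ?_
  filter_upwards [self_mem_nhdsWithin] with t ht
  rw [Function.comp_apply, nsq, ← ofReal_l2_sq
    (memLp_fun_sub ((S.sigma t ht).memLp i.castSucc) ((S.sigma t₀ ht₀).memLp i.castSucc)),
    ENNReal.toReal_ofReal (sq_nonneg _), Real.sqrt_sq l2_nonneg]

lemma StrongField.continuousOn_coef (S : StrongField L₁ L₂ T) (i : Fin 2) (k : Fin 3 → ℤ)
    (b : Bool) :
    ContinuousOn (fun t => coef L₁ L₂ (fun x => S.u t x i.castSucc) k b) (Ico 0 T) := by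
  intro t₀ ht₀
  have h := (S.tendsto_l2 i ht₀).mul_const (l2 (boxMeas L₁ L₂) (mode L₁ L₂ k b))
  rw [zero_mul] at h
  rw [ContinuousWithinAt, tendsto_iff_norm_sub_tendsto_zero]
  refine tendsto_of_tendsto_of_tendsto_of_le_of_le' tendsto_const_nhds h
    (Eventually.of_forall fun _ => norm_nonneg _) ?_
  filter_upwards [self_mem_nhdsWithin] with t ht
  have m1 := (S.sigma t ht).memLp i.castSucc
  have m2 := (S.sigma t₀ ht₀).memLp i.castSucc
  rw [← coef_sub m1 m2]
  exact abs_integral_mul_le (m1.sub m2) (memLp_mode k b 2)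

/-- The weak time derivative is tested with a function of time multiplied by a mode, and `weak_ftc`
makes the resulting scalar identity hold at every time. -/
lemma StrongField.coef_eq (S : StrongField L₁ L₂ T) (h₁ : 0 < L₁) (h₂ : 0 < L₂) (i : Fin 2)
    (k : Fin 3 → ℤ) (b : Bool) {t : ℝ} (ht : t ∈ Ico 0 T) :
    coef L₁ L₂ (fun x => S.u t x i.castSucc) k b = coef L₁ L₂ (fun x => S.u 0 x i.castSucc) k b +
      ∫ s in (0 : ℝ)..t, coef L₁ L₂ (fun x => S.dt s x i) k b := by
  have iI : Integrable (fun t => coef L₁ L₂ (fun x => S.dt t x i) k b)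
      (volume.restrict (Ioo 0 T)) :=
    (S.l2_dt i).integrable_inner (inL2L2_space (memLp_mode k b 2))
  refine weak_ftc (f := fun t => coef L₁ L₂ (fun x => S.u t x i.castSucc) k b)
    (S.continuousOn_coef i k b) (fun s hs => ?_) (fun θ hθ => ?_) ht
  · refine IntegrableOn.intervalIntegrable ?_
    rw [uIcc_of_le hs.1, integrableOn_Icc_iff_integrableOn_Ioo]
    exact IntegrableOn.mono_set iI (Ioo_subset_Ioo_right hs.2.le)
  · obtain ⟨a, b', ha, hb, hab⟩ := hθ.supp
    have h := S.weak_dt i (fun t x => θ t * mode L₁ L₂ k b x)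
      ((hθ.smooth.comp contDiff_fst).mul ((contDiff_mode k b).comp contDiff_snd))
      (fun t j x => by simp only [isPeriodic_mode h₁ h₂ k b j x])
      ⟨a, b', ha, hb, fun t ht x => by rw [hab t ht, zero_mul]⟩
    have d : ∀ t x, deriv (fun s => θ s * mode L₁ L₂ k b x) t = deriv θ t * mode L₁ L₂ k b x :=
      fun t x => deriv_mul_const (hθ.smooth.differentiable (by simp) t) _
    have e : ∀ (f : E3 → ℝ) (c : ℝ), ∫ x, f x * (c * mode L₁ L₂ k b x) ∂(boxMeas L₁ L₂) =
        coef L₁ L₂ f k b * c := by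
      intro f c
      rw [coef, ← integral_mul_const]
      congr 1; ext x; ring
    simp only [d, e] at h
    exact h

end StrongModes

/-! ### Divergence-free trigonometric fields -/

section Basis

variable {L₁ L₂ T ε α : ℝ}

/-- Signs of the components under the reflection `z ↦ -z`. -/
def parity : Fin 3 → ℝ := ![1, 1, -1]

/-- The `i`-th horizontal direction made orthogonal to the frequency `k`. -/
noncomputable def dirVec (L₁ L₂ : ℝ) (k : Fin 3 → ℤ) (i : Fin 2) : Fin 3 → ℝ :=
  if k 2 = 0 then
    ![(if i = 0 then 1 else 0) - wave L₁ L₂ k i.castSucc * wave L₁ L₂ k 0 /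
        (wave L₁ L₂ k 0 ^ 2 + wave L₁ L₂ k 1 ^ 2),
      (if i = 1 then 1 else 0) - wave L₁ L₂ k i.castSucc * wave L₁ L₂ k 1 /
        (wave L₁ L₂ k 0 ^ 2 + wave L₁ L₂ k 1 ^ 2), 0]
  else ![if i = 0 then 1 else 0, if i = 1 then 1 else 0,
    -wave L₁ L₂ k i.castSucc / wave L₁ L₂ k 2]

/-- For `k₂ ≠ 0` the vertical entry is chosen to cancel the horizontal contribution. For `k₂ = 0` no
vertical entry can help, and the direction is projected orthogonally to the horizontal frequency. -/
lemma sum_dirVec_mul_wave (k : Fin 3 → ℤ) (i : Fin 2) :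
    ∑ j, dirVec L₁ L₂ k i j * wave L₁ L₂ k j = 0 := by
  by_cases hk : k 2 = 0
  · have key : (wave L₁ L₂ k 0 ^ 2 + wave L₁ L₂ k 1 ^ 2)⁻¹ *
        (wave L₁ L₂ k 0 ^ 2 + wave L₁ L₂ k 1 ^ 2) * wave L₁ L₂ k i.castSucc =
          wave L₁ L₂ k i.castSucc := by
      -- At zero horizontal frequency the quotient is a division by zero with value `0`, and both
      -- sides of the identity vanish.
      by_cases hs : wave L₁ L₂ k 0 ^ 2 + wave L₁ L₂ k 1 ^ 2 = 0
      · have h0 : wave L₁ L₂ k 0 = 0 := by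
          nlinarith [sq_nonneg (wave L₁ L₂ k 0), sq_nonneg (wave L₁ L₂ k 1)]
        have h1 : wave L₁ L₂ k 1 = 0 := by
          nlinarith [sq_nonneg (wave L₁ L₂ k 0), sq_nonneg (wave L₁ L₂ k 1)]
        fin_cases i <;> simp [h0, h1]
      · rw [inv_mul_cancel₀ hs, one_mul]
    rw [Fin.sum_univ_three]
    revert key
    revert i
    simp only [dirVec, if_pos hk, Matrix.cons_val_zero, Matrix.cons_val_one, Matrix.cons_val,
      Fin.forall_fin_two, Fin.castSucc_zero, Fin.castSucc_one, if_true, div_eq_mul_inv,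
      zero_ne_one, one_ne_zero, if_false]
    exact ⟨fun key => by linear_combination -key, fun key => by linear_combination -key⟩
  · have hw : wave L₁ L₂ k 2 ≠ 0 := by
      have := one_le_abs_wave (L₁ := L₁) (L₂ := L₂) hk
      intro h; rw [h, abs_zero] at this; linarith
    rw [Fin.sum_univ_three]
    revert i
    simp only [dirVec, if_neg hk, Matrix.cons_val_zero, Matrix.cons_val_one, Matrix.cons_val,
      Fin.forall_fin_two, Fin.castSucc_zero, Fin.castSucc_one, if_true,
      zero_ne_one, one_ne_zero, if_false, div_mul_cancel₀ _ hw]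
    constructor <;> ring

/-- If `a` is orthogonal to the horizontal frequency whenever the vertical frequency vanishes, the
horizontal part of `∑ᵢ aᵢ vᵢ` is `a`. -/
lemma sum_dirVec_horizontal {k : Fin 3 → ℤ} {a : Fin 2 → ℝ}
    (h : k 2 = 0 → wave L₁ L₂ k 0 * a 0 + wave L₁ L₂ k 1 * a 1 = 0) (j : Fin 2) :
    ∑ i, a i * dirVec L₁ L₂ k i j.castSucc = a j ∧
      ∑ i : Fin 2, dirVec L₁ L₂ k j i.castSucc * a i = a j := by
  rw [Fin.sum_univ_two, Fin.sum_univ_two]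
  revert j
  by_cases hk : k 2 = 0
  · have h' := h hk
    simp only [dirVec, if_pos hk, Matrix.cons_val_zero, Matrix.cons_val_one,
      Fin.forall_fin_two, Fin.castSucc_zero, Fin.castSucc_one, if_true, div_eq_mul_inv,
      zero_ne_one, one_ne_zero, if_false]
    set s := (wave L₁ L₂ k 0 ^ 2 + wave L₁ L₂ k 1 ^ 2)⁻¹
    refine ⟨⟨?_, ?_⟩, ?_, ?_⟩
    · linear_combination (-(wave L₁ L₂ k 0 * s)) * h'
    · linear_combination (-(wave L₁ L₂ k 0 * s)) * h'
    · linear_combination (-(wave L₁ L₂ k 1 * s)) * h'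
    · linear_combination (-(wave L₁ L₂ k 1 * s)) * h'
  · simp [dirVec, if_neg hk, Fin.forall_fin_two]

lemma sum_dirVec_vertical (k : Fin 3 → ℤ) (a : Fin 2 → ℝ) :
    ∑ i, a i * dirVec L₁ L₂ k i 2 = vertCoef L₁ L₂ k a := by
  by_cases hk : k 2 = 0
  · simp [dirVec, vertCoef, hk]
  · simp only [dirVec, vertCoef, if_neg hk, Matrix.cons_val, Fin.sum_univ_two, Fin.castSucc_zero,
      Fin.castSucc_one]
    ring

/-- Divergence-free symmetric trigonometric fields. -/
noncomputable def basisField (L₁ L₂ : ℝ) (κ : (Fin 3 → ℤ) × Bool × Fin 2) (x : E3) (j : Fin 3) : ℝ :=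
  dirVec L₁ L₂ κ.1 κ.2.2 j / 2 *
    (mode L₁ L₂ κ.1 κ.2.1 x + parity j * mode L₁ L₂ (flip κ.1) κ.2.1 x)

lemma wave_flip (k : Fin 3 → ℤ) (j : Fin 3) :
    wave L₁ L₂ (flip k) j = parity j * wave L₁ L₂ k j := by
  fin_cases j <;> simp [wave, flip, parity, neg_div]

lemma parity_mul_self (j : Fin 3) : parity j * parity j = 1 := by
  fin_cases j <;> simp [parity]

/-- Adding the reflected mode with the sign of the component gives the required parity. It does not
spoil the divergence: the flipped wave number carries the same sign, the two signs cancel, and both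
modes are multiplied by the same vanishing sum. -/
lemma spatialTest_basisField (h₁ : 0 < L₁) (h₂ : 0 < L₂) (κ : (Fin 3 → ℤ) × Bool × Fin 2) :
    SpatialTest L₁ L₂ (basisField L₁ L₂ κ) where
  smooth j := by
    unfold basisField
    exact contDiff_const.mul ((contDiff_mode _ _).add (contDiff_const.mul (contDiff_mode _ _)))
  periodic i x := by
    ext j
    simp only [basisField, isPeriodic_mode h₁ h₂ _ _ i x]
  symm x := by
    have e : ∀ j, basisField L₁ L₂ κ (reflect x) j = parity j * basisField L₁ L₂ κ x j := by
      intro j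
      have := parity_mul_self j
      simp only [basisField, mode_reflect, flip_flip]
      linear_combination (-(dirVec L₁ L₂ κ.1 κ.2.2 j / 2 * mode L₁ L₂ (flip κ.1) κ.2.1 x)) * this
    refine ⟨fun i => (e i.castSucc).trans ?_, (e 2).trans ?_⟩
    · fin_cases i <;> simp [parity]
    · simp [parity]
  div_free x := by
    have e : ∀ j, pd j (fun y => basisField L₁ L₂ κ y j) x = modeSign κ.2.1 / 2 *
        (mode L₁ L₂ κ.1 (!κ.2.1) x + mode L₁ L₂ (flip κ.1) (!κ.2.1) x) *
        (dirVec L₁ L₂ κ.1 κ.2.2 j * wave L₁ L₂ κ.1 j) := by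
      intro j
      have d1 := (contDiff_mode (L₁ := L₁) (L₂ := L₂) κ.1 κ.2.1)
      have d2 := (contDiff_mode (L₁ := L₁) (L₂ := L₂) (flip κ.1) κ.2.1)
      have d3 : ContDiff ℝ ∞ fun y => parity j * mode L₁ L₂ (flip κ.1) κ.2.1 y :=
        contDiff_const.mul d2
      unfold basisField
      rw [pd_const_mul _ (d1.add d3)]
      have : pd j (fun y => mode L₁ L₂ κ.1 κ.2.1 y + parity j * mode L₁ L₂ (flip κ.1) κ.2.1 y) x =
          pd j (mode L₁ L₂ κ.1 κ.2.1) x + parity j * pd j (mode L₁ L₂ (flip κ.1) κ.2.1) x := by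
        rw [← pd_const_mul _ d2]
        unfold pd
        rw [fderiv_fun_add (d1.differentiable (by simp) x) (d3.differentiable (by simp) x)]
        rfl
      have p := parity_mul_self j
      rw [this, pd_mode, pd_mode, wave_flip]
      linear_combination (dirVec L₁ L₂ κ.1 κ.2.2 j / 2 * modeSign κ.2.1 * wave L₁ L₂ κ.1 j *
        mode L₁ L₂ (flip κ.1) (!κ.2.1) x) * p
    simp only [e, ← Finset.mul_sum, sum_dirVec_mul_wave, mul_zero]

/-- The index set of the truncated basis. -/
noncomputable def basisIndex (N : ℕ) : Finset ((Fin 3 → ℤ) × Bool × Fin 2) :=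
  freqs N ×ˢ Finset.univ

lemma sum_basisIndex (N : ℕ) (F : (Fin 3 → ℤ) × Bool × Fin 2 → ℝ) :
    ∑ κ ∈ basisIndex N, F κ = ∑ k ∈ freqs N, ∑ b : Bool, ∑ i : Fin 2, F (k, b, i) := by
  rw [basisIndex, Finset.sum_product]
  refine Finset.sum_congr rfl fun k _ => ?_
  rw [Fintype.sum_prod_type]

/-- Componentwise truncation of a field. -/
noncomputable def truncField (L₁ L₂ : ℝ) (N : ℕ) (u : E3 → E3) (x : E3) (j : Fin 3) : ℝ :=
  trunc L₁ L₂ N (fun x => u x j) x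

/-- A divergence-free symmetric field. -/
structure SymSigma (L₁ L₂ : ℝ) (u : E3 → E3) : Prop where
  sigma : IsL2Sigma L₁ L₂ u
  symm : IsSymmetric u

lemma SymSigma.reflect {u : E3 → E3} (h : SymSigma L₁ L₂ u) (j : Fin 3) (x : E3) :
    u (reflect x) j = parity j * u x j := by
  have := h.symm x
  fin_cases j
  · simpa [parity, HydroMHD.reflect] using this.1 0
  · simpa [parity, HydroMHD.reflect] using this.1 1
  · simpa [parity, HydroMHD.reflect] using this.2

lemma SymSigma.coef_flip {u : E3 → E3} (h : SymSigma L₁ L₂ u) (j : Fin 3) (k : Fin 3 → ℤ) (b : Bool) :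
    coef L₁ L₂ (fun x => u x j) (flip k) b = parity j * coef L₁ L₂ (fun x => u x j) k b := by
  rw [← coef_reflect]
  simp only [h.reflect j]
  unfold coef
  rw [← integral_const_mul]
  congr 1; ext x; ring

lemma SymSigma.coef_orthogonal (h₁ : 0 < L₁) (h₂ : 0 < L₂) {u : E3 → E3} (h : SymSigma L₁ L₂ u)
    (k : Fin 3 → ℤ) (b : Bool) (hk : k 2 = 0) :
    wave L₁ L₂ k 0 * coef L₁ L₂ (fun x => u x 0) k b +
      wave L₁ L₂ k 1 * coef L₁ L₂ (fun x => u x 1) k b = 0 := by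
  have := coef_sigma h₁ h₂ h.sigma k b
  rw [Fin.sum_univ_three, wave_two, hk] at this
  simpa using this

/-- The truncation of a divergence-free symmetric field in terms of the basis fields. -/
lemma SymSigma.truncField_eq (h₁ : 0 < L₁) (h₂ : 0 < L₂) {u : E3 → E3} (h : SymSigma L₁ L₂ u)
    (N : ℕ) (x : E3) (j : Fin 3) :
    truncField L₁ L₂ N u x j = ∑ κ ∈ basisIndex N, volInv L₁ L₂ *
      coef L₁ L₂ (fun x => u x κ.2.2.castSucc) κ.1 κ.2.1 * basisField L₁ L₂ κ x j := by
  have key : ∀ k b, ∑ i : Fin 2, coef L₁ L₂ (fun x => u x i.castSucc) k b * dirVec L₁ L₂ k i j =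
      coef L₁ L₂ (fun x => u x j) k b := by
    intro k b
    have hz := h.coef_orthogonal h₁ h₂ k b
    fin_cases j
    · exact (sum_dirVec_horizontal
        (a := fun i : Fin 2 => coef L₁ L₂ (fun x => u x i.castSucc) k b) hz 0).1
    · exact (sum_dirVec_horizontal
        (a := fun i : Fin 2 => coef L₁ L₂ (fun x => u x i.castSucc) k b) hz 1).1
    · exact (sum_dirVec_vertical k _).trans
        (coef_vertical h₁ h₂ h.sigma (fun x => (h.symm x).2) k b).symm
  have hr : trunc L₁ L₂ N (fun x => u x j) (HydroMHD.reflect x) =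
      parity j * trunc L₁ L₂ N (fun x => u x j) x := by
    have e := h.reflect j
    fin_cases j
    · simpa [parity] using trunc_even (f := fun x => u x 0) (by simpa [parity] using e) N x
    · simpa [parity] using trunc_even (f := fun x => u x 1) (by simpa [parity] using e) N x
    · simpa [parity] using trunc_odd (f := fun x => u x 2) (by simpa [parity] using e) N x
  have p := parity_mul_self j
  -- A truncation with the right parity equals its own symmetrisation, and symmetrising each mode
  -- produces exactly the basis fields.
  have e1 : truncField L₁ L₂ N u x j = (trunc L₁ L₂ N (fun x => u x j) x +
      parity j * trunc L₁ L₂ N (fun x => u x j) (HydroMHD.reflect x)) / 2 := by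
    rw [hr, ← mul_assoc, p, truncField]; ring
  rw [e1, sum_basisIndex]
  unfold trunc
  simp only [mode_reflect, Finset.mul_sum, ← Finset.sum_add_distrib, Finset.sum_div]
  refine Finset.sum_congr rfl fun k _ => Finset.sum_congr rfl fun b _ => ?_
  rw [← key k b, Fin.sum_univ_two, Fin.sum_univ_two]
  simp only [basisField]
  ring

/-- Pairing with a basis field. -/
lemma SymSigma.wpair_basisField (h₁ : 0 < L₁) (h₂ : 0 < L₂) {u : E3 → E3} (h : SymSigma L₁ L₂ u)
    (κ : (Fin 3 → ℤ) × Bool × Fin 2) :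
    wpair L₁ L₂ ε u (basisField L₁ L₂ κ) = coef L₁ L₂ (fun x => u x κ.2.2.castSucc) κ.1 κ.2.1 +
      ε ^ 2 * (dirVec L₁ L₂ κ.1 κ.2.2 2 * coef L₁ L₂ (fun x => u x 2) κ.1 κ.2.1) := by
  have e : ∀ j, ∫ x, u x j * basisField L₁ L₂ κ x j ∂(boxMeas L₁ L₂) =
      dirVec L₁ L₂ κ.1 κ.2.2 j * coef L₁ L₂ (fun x => u x j) κ.1 κ.2.1 := by
    intro j
    have i1 := fun k => integrable_mul_mode (h.sigma.memLp j) k κ.2.1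
    have e1 : ∀ x, u x j * basisField L₁ L₂ κ x j = dirVec L₁ L₂ κ.1 κ.2.2 j / 2 *
        (u x j * mode L₁ L₂ κ.1 κ.2.1 x + parity j * (u x j * mode L₁ L₂ (flip κ.1) κ.2.1 x)) := by
      intro x; unfold basisField; ring
    simp only [e1]
    rw [integral_const_mul, integral_add (i1 _) ((i1 _).const_mul _), integral_const_mul]
    have c1 : ∀ k, ∫ x, u x j * mode L₁ L₂ k κ.2.1 x ∂(boxMeas L₁ L₂) =
      coef L₁ L₂ (fun x => u x j) k κ.2.1 := fun k => rfl
    rw [c1, c1, h.coef_flip, ← mul_assoc (parity j), parity_mul_self]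
    ring
  have hz := (sum_dirVec_horizontal (a := fun i : Fin 2 => coef L₁ L₂ (fun x => u x i.castSucc) κ.1 κ.2.1)
    (h.coef_orthogonal h₁ h₂ κ.1 κ.2.1) κ.2.2).2
  unfold wpair
  simp only [e]
  rw [Fin.sum_univ_two] at hz
  rw [Fin.sum_univ_three, ← hz]
  simp [wt]

lemma wpair_sum {ι : Type*} (s : Finset ι) (c : ι → ℝ) {u : E3 → E3} {e : ι → E3 → E3}
    (hu : ∀ i, MemLp (fun x => u x i) 2 (boxMeas L₁ L₂))
    (he : ∀ κ i, MemLp (fun x => e κ x i) 2 (boxMeas L₁ L₂)) :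
    wpair L₁ L₂ ε u (fun x i => ∑ κ ∈ s, c κ * e κ x i) =
      ∑ κ ∈ s, c κ * wpair L₁ L₂ ε u (e κ) := by
  unfold wpair
  simp only [Finset.mul_sum]
  rw [Finset.sum_comm]
  refine Finset.sum_congr rfl fun i _ => ?_
  rw [integral_finsetSum _ fun κ _ => by
    simpa only [mul_left_comm] using (integrable_mul (hu i) (he κ i)).const_mul (c κ),
    Finset.mul_sum]
  refine Finset.sum_congr rfl fun κ _ => ?_
  simp only [mul_left_comm _ (c κ), integral_const_mul]

lemma wform_sum {ι : Type*} (s : Finset ι) (c : ι → ℝ) {v : E3 → E3} {D : E3 → Fin 3 → Fin 3 → ℝ}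
    {e : ι → E3 → E3} {De : ι → E3 → Fin 3 → Fin 3 → ℝ}
    (i1 : ∀ κ i j, Integrable (fun x => v x j * D x i j * e κ x i) (boxMeas L₁ L₂))
    (i2 : ∀ κ i j, Integrable (fun x => D x i j * De κ x i j) (boxMeas L₁ L₂)) :
    wform L₁ L₂ ε α v D (fun x i => ∑ κ ∈ s, c κ * e κ x i)
      (fun x i j => ∑ κ ∈ s, c κ * De κ x i j) =
      ∑ κ ∈ s, c κ * wform L₁ L₂ ε α v D (e κ) (De κ) := by
  have e1 : ∀ i j, ∫ x, v x j * D x i j * ∑ κ ∈ s, c κ * e κ x i ∂(boxMeas L₁ L₂) =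
      ∑ κ ∈ s, c κ * ∫ x, v x j * D x i j * e κ x i ∂(boxMeas L₁ L₂) := by
    intro i j
    simp only [Finset.mul_sum, mul_left_comm _ (c _)]
    rw [integral_finsetSum _ fun κ _ => (i1 κ i j).const_mul (c κ)]
    simp only [integral_const_mul]
  have e2 : ∀ i j, ∫ x, D x i j * ∑ κ ∈ s, c κ * De κ x i j ∂(boxMeas L₁ L₂) =
      ∑ κ ∈ s, c κ * ∫ x, D x i j * De κ x i j ∂(boxMeas L₁ L₂) := by
    intro i j
    simp only [Finset.mul_sum, mul_left_comm _ (c _)]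
    rw [integral_finsetSum _ fun κ _ => (i2 κ i j).const_mul (c κ)]
    simp only [integral_const_mul]
  unfold wform
  simp only [e1, e2]
  simp only [Fin.sum_univ_three, Finset.mul_sum, ← Finset.sum_add_distrib]
  exact Finset.sum_congr rfl fun κ _ => by ring

lemma pd_sum {ι : Type*} (s : Finset ι) (c : ι → ℝ) {f : ι → E3 → ℝ}
    (hf : ∀ κ, ContDiff ℝ ∞ (f κ)) (j : Fin 3) (x : E3) :
    pd j (fun y => ∑ κ ∈ s, c κ * f κ y) x = ∑ κ ∈ s, c κ * pd j (f κ) x := by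
  simp only [← fun κ => pd_const_mul (c κ) (hf κ) j x]
  unfold pd
  rw [fderiv_fun_sum fun κ _ => (contDiff_const.mul (hf κ)).differentiable (by simp) x]
  simp

/-- The contribution of the vertical component to the pairing of a time derivative `dt` with the
truncation of `u`. -/
noncomputable def vertPair (L₁ L₂ : ℝ) (N : ℕ) (dt : E3 → Fin 2 → ℝ) (f : E3 → ℝ) : ℝ :=
  ∑ κ ∈ basisIndex N, volInv L₁ L₂ * coef L₁ L₂ (fun x => dt x κ.2.2) κ.1 κ.2.1 *
    (dirVec L₁ L₂ κ.1 κ.2.2 2 * coef L₁ L₂ f κ.1 κ.2.1)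

/-- The vertical entry of a direction is a horizontal wave number divided by a vertical one of
modulus at least `1`, or it is zero. The horizontal wave number is absorbed by the coefficient of
`f` and turns it into a coefficient of a horizontal derivative; Cauchy–Schwarz and Bessel finish.
The bound does not depend on `N` and makes a square integrable `∂ₜ u₃` unnecessary. -/
lemma abs_vertPair_le (h₁ : 0 < L₁) (h₂ : 0 < L₂) {dt : E3 → Fin 2 → ℝ} {f : E3 → ℝ}
    {g : Fin 2 → E3 → ℝ} (hdt : ∀ i, MemLp (fun x => dt x i) 2 (boxMeas L₁ L₂))
    (hg : ∀ i, MemLp (g i) 2 (boxMeas L₁ L₂))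
    (hw : ∀ i : Fin 2, HasWeakPartial L₁ L₂ i.castSucc f (g i)) (N : ℕ) :
    |vertPair L₁ L₂ N dt f| ≤
      ∑ i, l2 (boxMeas L₁ L₂) (fun x => dt x i) * l2 (boxMeas L₁ L₂) (g i) := by
  have v0 := volInv_pos h₁ h₂
  have h1 : |vertPair L₁ L₂ N dt f| ≤ ∑ κ ∈ basisIndex N, volInv L₁ L₂ *
      (|coef L₁ L₂ (fun x => dt x κ.2.2) κ.1 κ.2.1| * |coef L₁ L₂ (g κ.2.2) κ.1 (!κ.2.1)|) := by
    refine (Finset.abs_sum_le_sum_abs _ _).trans (Finset.sum_le_sum fun κ _ => ?_)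
    rw [abs_mul, abs_mul, abs_of_pos v0, mul_assoc]
    refine mul_le_mul_of_nonneg_left (mul_le_mul_of_nonneg_left ?_ (abs_nonneg _)) v0.le
    rw [coef_weakPartial h₁ h₂ (hw κ.2.2), Bool.not_not, abs_neg, abs_mul, abs_mul, abs_mul]
    refine mul_le_mul_of_nonneg_right ?_ (abs_nonneg _)
    have hs : ∀ b, |modeSign b| = 1 := by intro b; cases b <;> simp [modeSign]
    rw [hs, one_mul]
    by_cases hk : κ.1 2 = 0
    · simp [dirVec, hk]
    · have := one_le_abs_wave (L₁ := L₁) (L₂ := L₂) hk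
      simp only [dirVec, if_neg hk, Matrix.cons_val, abs_div, abs_neg]
      exact div_le_self (abs_nonneg _) this
  refine h1.trans ?_
  have h2 : ∑ κ ∈ basisIndex N, volInv L₁ L₂ *
      (|coef L₁ L₂ (fun x => dt x κ.2.2) κ.1 κ.2.1| * |coef L₁ L₂ (g κ.2.2) κ.1 (!κ.2.1)|) =
      ∑ i : Fin 2, volInv L₁ L₂ * ∑ q ∈ freqs N ×ˢ (Finset.univ : Finset Bool),
        |coef L₁ L₂ (fun x => dt x i) q.1 q.2| * |coef L₁ L₂ (g i) q.1 (!q.2)| := by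
    rw [sum_basisIndex]
    simp only [Finset.sum_product, Finset.mul_sum, Fin.sum_univ_two, ← Finset.sum_add_distrib]
  rw [h2]
  refine Finset.sum_le_sum fun i _ => ?_
  have b1 := bessel h₁ h₂ (hdt i) N
  have b2 := bessel h₁ h₂ (hg i) N
  have cs := Real.sum_mul_le_sqrt_mul_sqrt (freqs N ×ˢ (Finset.univ : Finset Bool))
    (fun q => |coef L₁ L₂ (fun x => dt x i) q.1 q.2|) (fun q => |coef L₁ L₂ (g i) q.1 (!q.2)|)
  simp only [sq_abs, Finset.sum_product] at cs
  have sw : ∀ k, ∑ b, coef L₁ L₂ (g i) k (!b) ^ 2 = ∑ b, coef L₁ L₂ (g i) k b ^ 2 := by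
    intro k; simp [add_comm]
  simp only [sw] at cs
  rw [Finset.sum_product]
  refine (mul_le_mul_of_nonneg_left cs v0.le).trans ?_
  rw [← Real.mul_self_sqrt v0.le, mul_mul_mul_comm, ← Real.sqrt_mul v0.le, ← Real.sqrt_mul v0.le]
  exact mul_le_mul (Real.sqrt_le_iff.2 ⟨l2_nonneg, b1⟩) (Real.sqrt_le_iff.2 ⟨l2_nonneg, b2⟩)
    (Real.sqrt_nonneg _) l2_nonneg

lemma integrable_mul_mul_smooth {v : E3 → E3} {D : E3 → Fin 3 → Fin 3 → ℝ}
    (hv : ∀ j, MemLp (fun x => v x j) 2 (boxMeas L₁ L₂))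
    (hD : ∀ i j, MemLp (fun x => D x i j) 2 (boxMeas L₁ L₂)) {f : E3 → ℝ} (hf : ContDiff ℝ ∞ f)
    (i j : Fin 3) : Integrable (fun x => v x j * D x i j * f x) (boxMeas L₁ L₂) := by
  simpa only [mul_assoc] using integrable_mul (hv j) (memLp_mul_smooth (hD i j) hf)

lemma SymSigma.wform_truncField (h₁ : 0 < L₁) (h₂ : 0 < L₂) {u v : E3 → E3}
    {D : E3 → Fin 3 → Fin 3 → ℝ} (h : SymSigma L₁ L₂ u)
    (hv : ∀ j, MemLp (fun x => v x j) 2 (boxMeas L₁ L₂))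
    (hD : ∀ i j, MemLp (fun x => D x i j) 2 (boxMeas L₁ L₂)) (N : ℕ) :
    wform L₁ L₂ ε α v D (truncField L₁ L₂ N u) (grad (truncField L₁ L₂ N u)) =
      ∑ κ ∈ basisIndex N, volInv L₁ L₂ * coef L₁ L₂ (fun x => u x κ.2.2.castSucc) κ.1 κ.2.1 *
        wform L₁ L₂ ε α v D (basisField L₁ L₂ κ) (grad (basisField L₁ L₂ κ)) := by
  have sm := fun κ => (spatialTest_basisField h₁ h₂ κ).smooth
  have e : truncField L₁ L₂ N u = fun x j => ∑ κ ∈ basisIndex N, volInv L₁ L₂ *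
      coef L₁ L₂ (fun x => u x κ.2.2.castSucc) κ.1 κ.2.1 * basisField L₁ L₂ κ x j :=
    funext fun x => funext fun j => h.truncField_eq h₁ h₂ N x j
  rw [e, ← wform_sum (De := fun κ => grad (basisField L₁ L₂ κ)) _ _ (fun κ i j => integrable_mul_mul_smooth hv hD (sm κ i) i j)
    fun κ i j => integrable_mul (hD i j) (memLp_smooth (contDiff_pd (sm κ i) j))]
  congr 1
  funext x i j
  exact pd_sum _ _ (fun κ => sm κ i) j x

lemma SymSigma.wpair_truncField (h₁ : 0 < L₁) (h₂ : 0 < L₂) {u v : E3 → E3}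
    (h : SymSigma L₁ L₂ u) (hv : ∀ j, MemLp (fun x => v x j) 2 (boxMeas L₁ L₂)) (N : ℕ) :
    wpair L₁ L₂ ε v (truncField L₁ L₂ N u) =
      ∑ κ ∈ basisIndex N, volInv L₁ L₂ * coef L₁ L₂ (fun x => u x κ.2.2.castSucc) κ.1 κ.2.1 *
        wpair L₁ L₂ ε v (basisField L₁ L₂ κ) := by
  have e : truncField L₁ L₂ N u = fun x j => ∑ κ ∈ basisIndex N, volInv L₁ L₂ *
      coef L₁ L₂ (fun x => u x κ.2.2.castSucc) κ.1 κ.2.1 * basisField L₁ L₂ κ x j :=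
    funext fun x => funext fun j => h.truncField_eq h₁ h₂ N x j
  rw [e, wpair_sum _ _ hv fun κ i => memLp_smooth ((spatialTest_basisField h₁ h₂ κ).smooth i)]

/-- This separates the contribution of the time derivative into a horizontal part, which converges
as `N → ∞`, and a vertical part, which is only estimated. -/
lemma SymSigma.sum_coef_mul_wpair (h₁ : 0 < L₁) (h₂ : 0 < L₂) {u : E3 → E3}
    (h : SymSigma L₁ L₂ u) (dt : E3 → Fin 2 → ℝ) (N : ℕ) :
    ∑ κ ∈ basisIndex N, volInv L₁ L₂ * coef L₁ L₂ (fun x => dt x κ.2.2) κ.1 κ.2.1 *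
        wpair L₁ L₂ ε u (basisField L₁ L₂ κ) =
      ∑ i, ∫ x, trunc L₁ L₂ N (fun x => dt x i) x * u x i.castSucc ∂(boxMeas L₁ L₂) +
        ε ^ 2 * vertPair L₁ L₂ N dt fun x => u x 2 := by
  simp only [h.wpair_basisField h₁ h₂, mul_add, Finset.sum_add_distrib, vertPair, Finset.mul_sum]
  congr 1
  · rw [sum_basisIndex]
    simp only [integral_trunc_mul (h.sigma.memLp _), Fin.sum_univ_two, Finset.mul_sum,
      ← Finset.sum_add_distrib]
    exact Finset.sum_congr rfl fun k _ => Finset.sum_congr rfl fun b _ => by ring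
  · exact Finset.sum_congr rfl fun κ _ => by ring

variable {A₀ B₀ : InitialField L₁ L₂} {Aε Bε : WeakField L₁ L₂}

lemma WeakField.symSigma (W : WeakField L₁ L₂) {t : ℝ} (ht : 0 ≤ t) : SymSigma L₁ L₂ (W.u t) :=
  ⟨W.sigma t ht, W.symm t ht⟩

lemma StrongField.symSigma (S : StrongField L₁ L₂ T) {t : ℝ} (ht : t ∈ Ico 0 T) :
    SymSigma L₁ L₂ (S.u t) :=
  ⟨S.sigma t ht, S.symm t ht⟩

lemma intervalIntegrable_of_Ioo {f : ℝ → ℝ} (hf : Integrable f (volume.restrict (Ioo 0 T))) {t : ℝ}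
    (ht : t ∈ Ico 0 T) : IntervalIntegrable f volume 0 t := by
  refine IntegrableOn.intervalIntegrable ?_
  rw [uIcc_of_le ht.1, integrableOn_Icc_iff_integrableOn_Ioo]
  exact IntegrableOn.mono_set hf (Ioo_subset_Ioo_right ht.2.le)

/-- The evolution of the pairing of a weak solution with the truncated strong solution. -/
lemma IsLerayHopf.pair_truncField (h₁ : 0 < L₁) (h₂ : 0 < L₂)
    (h : IsLerayHopf ε α A₀ B₀ Aε Bε) (S : StrongField L₁ L₂ T) (N : ℕ) {t : ℝ}
    (ht : t ∈ Ico 0 T) :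
    wpair L₁ L₂ ε (Aε.u t) (truncField L₁ L₂ N (S.u t)) =
      wpair L₁ L₂ ε (Aε.u 0) (truncField L₁ L₂ N (S.u 0)) + ∫ s in (0 : ℝ)..t,
        (∑ i, ∫ x, trunc L₁ L₂ N (fun x => S.dt s x i) x * Aε.u s x i.castSucc ∂(boxMeas L₁ L₂) +
          ε ^ 2 * vertPair L₁ L₂ N (S.dt s) (fun x => Aε.u s x 2) -
          wform L₁ L₂ ε α (Bε.u s) (Aε.D s) (truncField L₁ L₂ N (S.u s))
            (grad (truncField L₁ L₂ N (S.u s)))) := by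
  have hT : 0 < T := ht.1.trans_lt ht.2
  have h0 : (0 : ℝ) ∈ Ico 0 T := ⟨le_rfl, hT⟩
  rw [(S.symSigma ht).wpair_truncField h₁ h₂ (Aε.sigma t ht.1).memLp,
    (S.symSigma h0).wpair_truncField h₁ h₂ (Aε.sigma 0 le_rfl).memLp]
  -- The strong solution enters through its coefficients `a`, with derivative `a'`, and the weak one
  -- through its pairings `m` with the basis fields, with derivative `-F`. All are scalar absolutely
  -- continuous functions, so the product rule applies.
  set a : (Fin 3 → ℤ) × Bool × Fin 2 → ℝ → ℝ := fun κ s =>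
    coef L₁ L₂ (fun x => S.u s x κ.2.2.castSucc) κ.1 κ.2.1 with ha
  set a' : (Fin 3 → ℤ) × Bool × Fin 2 → ℝ → ℝ := fun κ s =>
    coef L₁ L₂ (fun x => S.dt s x κ.2.2) κ.1 κ.2.1 with ha'
  set m : (Fin 3 → ℤ) × Bool × Fin 2 → ℝ → ℝ := fun κ s =>
    wpair L₁ L₂ ε (Aε.u s) (basisField L₁ L₂ κ) with hm
  set F : (Fin 3 → ℤ) × Bool × Fin 2 → ℝ → ℝ := fun κ s =>
    wform L₁ L₂ ε α (Bε.u s) (Aε.D s) (basisField L₁ L₂ κ) (grad (basisField L₁ L₂ κ)) with hF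
  have iF : ∀ κ, IntervalIntegrable (fun s => -F κ s) volume 0 t := fun κ =>
    (intervalIntegrable_of_Ioo (integrable_wform Aε Bε hT
      (spatialTest_basisField h₁ h₂ κ).smooth) ht).neg
  have ia : ∀ κ, IntervalIntegrable (a' κ) volume 0 t := fun κ =>
    intervalIntegrable_of_Ioo ((S.l2_dt κ.2.2).integrable_inner
      (inL2L2_space (memLp_mode κ.1 κ.2.1 2))) ht
  have ea : ∀ κ, ∀ s ∈ Icc 0 t, a κ s = a κ 0 + ∫ r in (0 : ℝ)..s, a' κ r := fun κ s hs =>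
    S.coef_eq h₁ h₂ κ.2.2 κ.1 κ.2.1 ⟨hs.1, hs.2.trans_lt ht.2⟩
  have em : ∀ κ, ∀ s ∈ Icc 0 t, m κ s = m κ 0 + ∫ r in (0 : ℝ)..s, -F κ r := fun κ s hs =>
    h.weak_mode hT (spatialTest_basisField h₁ h₂ κ) ⟨hs.1, hs.2.trans_lt ht.2⟩
  have ca : ∀ κ, ContinuousOn (a κ) (uIcc 0 t) := fun κ =>
    (S.continuousOn_coef κ.2.2 κ.1 κ.2.1).mono fun s hs => by
      rw [uIcc_of_le ht.1] at hs; exact ⟨hs.1, hs.2.trans_lt ht.2⟩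
  have cm : ∀ κ, ContinuousOn (m κ) (uIcc 0 t) := fun κ =>
    (continuousOn_wpair Aε fun i => memLp_smooth ((spatialTest_basisField h₁ h₂ κ).smooth i)).mono
      fun s hs => by rw [uIcc_of_le ht.1] at hs; exact hs.1
  have prod : ∀ κ, a κ t * m κ t = a κ 0 * m κ 0 +
      ∫ s in (0 : ℝ)..t, (a' κ s * m κ s + a κ s * -F κ s) := by
    intro κ
    have ht' : t ∈ Icc 0 t := ⟨ht.1, le_rfl⟩
    rw [ea κ t ht', em κ t ht', primitive_mul (ia κ) (iF κ)]
    congr 1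
    refine intervalIntegral.integral_congr fun s hs => ?_
    rw [uIcc_of_le ht.1] at hs
    simp only [ea κ s hs, em κ s hs]
  have ii : ∀ κ, IntervalIntegrable (fun s => a' κ s * m κ s + a κ s * -F κ s) volume 0 t :=
    fun κ => ((ia κ).mul_continuousOn (cm κ)).add ((iF κ).continuousOn_mul (ca κ))
  have e1 : ∑ κ ∈ basisIndex N, volInv L₁ L₂ * a κ t * m κ t =
      ∑ κ ∈ basisIndex N, volInv L₁ L₂ * a κ 0 * m κ 0 + ∫ s in (0 : ℝ)..t,
        ∑ κ ∈ basisIndex N, volInv L₁ L₂ * (a' κ s * m κ s + a κ s * -F κ s) := by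
    rw [intervalIntegral.integral_finsetSum fun κ _ => (ii κ).const_mul _,
      ← Finset.sum_add_distrib]
    refine Finset.sum_congr rfl fun κ _ => ?_
    rw [intervalIntegral.integral_const_mul, mul_assoc, prod κ]
    ring
  refine e1.trans ?_
  congr 1
  refine intervalIntegral.integral_congr_ae ?_
  rw [uIoc_of_le ht.1]
  have g1 := (ae_restrict_iff' measurableSet_Ioo).1 (Aε.goodW hT)
  filter_upwards [g1] with s g hs
  have hs' : s ∈ Ioo 0 T := ⟨hs.1, hs.2.trans_lt ht.2⟩
  rw [← (Aε.symSigma hs.1.le).sum_coef_mul_wpair h₁ h₂,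
    (S.symSigma ⟨hs'.1.le, hs'.2⟩).wform_truncField h₁ h₂ (Bε.sigma s hs.1.le).memLp (g hs').memD,
    ← Finset.sum_sub_distrib]
  exact Finset.sum_congr rfl fun κ _ => by ring

/-- The evolution of the truncated norm of the horizontal part of the strong solution. -/
lemma StrongField.norm_trunc (h₁ : 0 < L₁) (h₂ : 0 < L₂) (S : StrongField L₁ L₂ T) (i : Fin 2)
    (N : ℕ) {t : ℝ} (ht : t ∈ Ico 0 T) :
    ∫ x, trunc L₁ L₂ N (fun x => S.u t x i.castSucc) x * S.u t x i.castSucc ∂(boxMeas L₁ L₂) =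
      ∫ x, trunc L₁ L₂ N (fun x => S.u 0 x i.castSucc) x * S.u 0 x i.castSucc ∂(boxMeas L₁ L₂) +
      ∫ s in (0 : ℝ)..t, 2 * ∫ x, trunc L₁ L₂ N (fun x => S.dt s x i) x *
        S.u s x i.castSucc ∂(boxMeas L₁ L₂) := by
  have hT : 0 < T := ht.1.trans_lt ht.2
  have h0 : (0 : ℝ) ∈ Ico 0 T := ⟨le_rfl, hT⟩
  set a : (Fin 3 → ℤ) → Bool → ℝ → ℝ := fun k b s => coef L₁ L₂ (fun x => S.u s x i.castSucc) k b
  set a' : (Fin 3 → ℤ) → Bool → ℝ → ℝ := fun k b s => coef L₁ L₂ (fun x => S.dt s x i) k b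
  have ia : ∀ k b, IntervalIntegrable (a' k b) volume 0 t := fun k b =>
    intervalIntegrable_of_Ioo ((S.l2_dt i).integrable_inner (inL2L2_space (memLp_mode k b 2))) ht
  have ea : ∀ k b, ∀ s ∈ Icc 0 t, a k b s = a k b 0 + ∫ r in (0 : ℝ)..s, a' k b r :=
    fun k b s hs => S.coef_eq h₁ h₂ i k b ⟨hs.1, hs.2.trans_lt ht.2⟩
  have ca : ∀ k b, ContinuousOn (a k b) (uIcc 0 t) := fun k b =>
    (S.continuousOn_coef i k b).mono fun s hs => by
      rw [uIcc_of_le ht.1] at hs; exact ⟨hs.1, hs.2.trans_lt ht.2⟩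
  have prod : ∀ k b, a k b t * a k b t = a k b 0 * a k b 0 +
      ∫ s in (0 : ℝ)..t, (a' k b s * a k b s + a k b s * a' k b s) := by
    intro k b
    rw [ea k b t ⟨ht.1, le_rfl⟩, primitive_mul (ia k b) (ia k b)]
    congr 1
    refine intervalIntegral.integral_congr fun s hs => ?_
    rw [uIcc_of_le ht.1] at hs
    simp only [ea k b s hs]
  have ii : ∀ k b, IntervalIntegrable (fun s => a' k b s * a k b s + a k b s * a' k b s) volume 0 t :=
    fun k b => ((ia k b).mul_continuousOn (ca k b)).add ((ia k b).continuousOn_mul (ca k b))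
  rw [integral_trunc_mul ((S.sigma t ht).memLp _), integral_trunc_mul ((S.sigma 0 h0).memLp _)]
  have e : ∀ s ∈ uIcc 0 t, 2 * ∫ x, trunc L₁ L₂ N (fun x => S.dt s x i) x *
        S.u s x i.castSucc ∂(boxMeas L₁ L₂) = volInv L₁ L₂ * ∑ k ∈ freqs N, ∑ b : Bool,
          (a' k b s * a k b s + a k b s * a' k b s) := by
    intro s hs
    rw [uIcc_of_le ht.1] at hs
    rw [integral_trunc_mul ((S.sigma s ⟨hs.1, hs.2.trans_lt ht.2⟩).memLp _)]
    simp only [Finset.mul_sum]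
    exact Finset.sum_congr rfl fun k _ => Finset.sum_congr rfl fun b _ => by ring
  rw [intervalIntegral.integral_congr e, intervalIntegral.integral_const_mul,
    intervalIntegral.integral_finsetSum fun k _ => by
      simpa only [Finset.sum_fn] using IntervalIntegrable.sum _ fun b _ => ii k b]
  simp only [intervalIntegral.integral_finsetSum fun b _ => ii _ b]
  rw [← mul_add, ← Finset.sum_add_distrib]
  congr 1
  refine Finset.sum_congr rfl fun k _ => ?_
  rw [← Finset.sum_add_distrib]
  exact Finset.sum_congr rfl fun b _ => prod k b

end Basis

/-! ### Passage to the limit in the truncated identities -/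

section Bounds

variable {L₁ L₂ T ε α : ℝ}

lemma TendstoL2.const (f : E3 → ℝ) : TendstoL2 L₁ L₂ (fun _ => f) f := by
  simp [TendstoL2, l2]

lemma WHV.of_smooth {s : E3 → ℝ} (hs : ContDiff ℝ ∞ s) :
    WHV L₁ L₂ s (pd 0 s) (pd 1 s) (pd 2 s) (pd 0 (pd 2 s)) (pd 1 (pd 2 s)) where
  memLp := memLp_smooth hs
  memLp_x := memLp_smooth (contDiff_pd hs 0)
  memLp_y := memLp_smooth (contDiff_pd hs 1)
  memLp_z := memLp_smooth (contDiff_pd hs 2)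
  memLp_zx := memLp_smooth (contDiff_pd (contDiff_pd hs 2) 0)
  memLp_zy := memLp_smooth (contDiff_pd (contDiff_pd hs 2) 1)
  approx := ⟨fun _ => s, fun _ => hs, TendstoL2.const _, TendstoL2.const _, TendstoL2.const _,
    TendstoL2.const _, TendstoL2.const _, TendstoL2.const _⟩

lemma lad_mono {f fx fy g gx gy : E3 → ℝ} (h : l2 (boxMeas L₁ L₂) f ≤ l2 (boxMeas L₁ L₂) g)
    (hx : l2 (boxMeas L₁ L₂) fx ≤ l2 (boxMeas L₁ L₂) gx)
    (hy : l2 (boxMeas L₁ L₂) fy ≤ l2 (boxMeas L₁ L₂) gy) :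
    lad L₁ L₂ f fx fy ≤ lad L₁ L₂ g gx gy := by
  have a : 0 ≤ l2 (boxMeas L₁ L₂) f := l2_nonneg
  have b : 0 ≤ l2 (boxMeas L₁ L₂) fx := l2_nonneg
  have c : 0 ≤ l2 (boxMeas L₁ L₂) fy := l2_nonneg
  unfold lad
  gcongr
  exact l2_nonneg

lemma sq_lad_le {M : ℝ} {f fx fy : E3 → ℝ} (h : l2 (boxMeas L₁ L₂) f ≤ M) :
    lad L₁ L₂ f fx fy ^ 2 ≤ 2 * M ^ 4 +
      4 * M ^ 2 * (l2 (boxMeas L₁ L₂) fx ^ 2 + l2 (boxMeas L₁ L₂) fy ^ 2) := by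
  have a : 0 ≤ l2 (boxMeas L₁ L₂) f := l2_nonneg
  have b : 0 ≤ l2 (boxMeas L₁ L₂) fx := l2_nonneg
  have c : 0 ≤ l2 (boxMeas L₁ L₂) fy := l2_nonneg
  unfold lad
  set p := l2 (boxMeas L₁ L₂) f
  set x := l2 (boxMeas L₁ L₂) fx
  set y := l2 (boxMeas L₁ L₂) fy
  have h1 : p ^ 2 + p * (x + y) ≤ M ^ 2 + M * (x + y) := by gcongr
  calc (p ^ 2 + p * (x + y)) ^ 2 ≤ (M ^ 2 + M * (x + y)) ^ 2 := by gcongr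
    _ ≤ _ := by nlinarith [sq_nonneg (M ^ 2 - M * (x + y)), sq_nonneg (M * (x - y))]

/-- The square is quartic in norms, but at most quadratic in those of the derivatives. A uniform
bound on `‖f‖` therefore suffices for integrability in time. -/
lemma integrable_sq_lad {M : ℝ} {f fx fy : ℝ → E3 → ℝ} (hf : InL2L2 L₁ L₂ T f)
    (hx : InL2L2 L₁ L₂ T fx) (hy : InL2L2 L₁ L₂ T fy)
    (hM : ∀ᵐ t ∂(volume.restrict (Ioo 0 T)), l2 (boxMeas L₁ L₂) (f t) ≤ M) :
    Integrable (fun t => lad L₁ L₂ (f t) (fx t) (fy t) ^ 2) (volume.restrict (Ioo 0 T)) := by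
  have ib : Integrable (fun t => 2 * M ^ 4 + 4 * M ^ 2 * (l2 (boxMeas L₁ L₂) (fx t) ^ 2 +
      l2 (boxMeas L₁ L₂) (fy t) ^ 2)) (volume.restrict (Ioo 0 T)) :=
    (integrable_const _).add ((hx.integrable_l2_sq.add hy.integrable_l2_sq).const_mul _)
  refine ib.mono' ?_ ?_
  · unfold lad
    exact ((hf.meas.l2.pow 2).add (hf.meas.l2.mul (hx.meas.l2.add hy.meas.l2))).pow 2
  · filter_upwards [hM] with t ht
    rw [Real.norm_eq_abs, abs_of_nonneg (sq_nonneg _)]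
    exact sq_lad_le ht

/-- Two integrable bounds on the transport term. -/
lemma abs_transport_le (h₁ : 0 < L₁) (h₂ : 0 < L₂) {f fx fy g e ex ey ez ezx ezy : E3 → ℝ}
    (hf : WH L₁ L₂ f fx fy) (hg : MemLp g 2 (boxMeas L₁ L₂)) (he : WHV L₁ L₂ e ex ey ez ezx ezy) :
    |∫ x, f x * g x * e x ∂(boxMeas L₁ L₂)| ≤ 2 * ladConst L₁ L₂ * (lad L₁ L₂ f fx fy ^ 2 +
      (lad L₁ L₂ e ex ey ^ 2 + lad L₁ L₂ ez ezx ezy ^ 2) + l2 (boxMeas L₁ L₂) g ^ 2) := by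
  refine (abs_integral_le_integral_abs.trans (trilinear_L2 h₁ h₂ hf hg he).2).trans ?_
  have c := ladConst_pos h₁ h₂
  rw [mul_assoc]
  refine mul_le_mul_of_nonneg_left ?_ (by positivity)
  have p1 := lad_nonneg (L₁ := L₁) (L₂ := L₂) f fx fy
  have p2 := lad_nonneg (L₁ := L₁) (L₂ := L₂) e ex ey
  have p3 := lad_nonneg (L₁ := L₁) (L₂ := L₂) ez ezx ezy
  set X := lad L₁ L₂ f fx fy
  set Y := lad L₁ L₂ e ex ey
  set Z := lad L₁ L₂ ez ezx ezy
  have s1 := Real.sq_sqrt p1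
  have s2 := Real.sq_sqrt (add_nonneg p2 p3)
  set d := l2 (boxMeas L₁ L₂) g
  nlinarith [sq_nonneg (√X * √(Y + Z) - d), mul_pow (√X) (√(Y + Z)) 2, sq_nonneg (X - (Y + Z)),
    sq_nonneg (Y - Z), sq_nonneg X, sq_nonneg Y, sq_nonneg Z, sq_nonneg d]

/-- An upper bound for the horizontal `H¹` norm of `S` for almost every time. -/
def StrongField.BoundedBy (S : StrongField L₁ L₂ T) (q : ℝ) : Prop :=
  ∀ᵐ t ∂(volume.restrict (Ioo 0 T)), h1sq L₁ L₂ (S.u t) (S.D t) ≤ ENNReal.ofReal (q ^ 2)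

variable {u : E3 → E3} {D : E3 → Fin 3 → Fin 3 → ℝ} {D2 : E3 → Fin 2 → Fin 2 → Fin 3 → ℝ}

lemma GoodW.h1_bounds {q : ℝ} (h : GoodW L₁ L₂ u D) (hq : 0 ≤ q)
    (hb : h1sq L₁ L₂ u D ≤ ENNReal.ofReal (q ^ 2)) (i : Fin 2) :
    l2 (boxMeas L₁ L₂) (fun x => u x i.castSucc) ≤ q ∧
      ∀ j, l2 (boxMeas L₁ L₂) (fun x => D x i.castSucc j) ≤ q := by
  have aux : ∀ {f : E3 → ℝ}, MemLp f 2 (boxMeas L₁ L₂) → nsq L₁ L₂ f ≤ ENNReal.ofReal (q ^ 2) →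
      l2 (boxMeas L₁ L₂) f ≤ q := by
    intro f hf hle
    rw [nsq, ← ofReal_l2_sq hf, ENNReal.ofReal_le_ofReal_iff (sq_nonneg q)] at hle
    exact (pow_le_pow_iff_left₀ l2_nonneg hq two_ne_zero).1 hle
  have h0 : (nsq L₁ L₂ (fun x => u x i.castSucc) + ∑ j : Fin 3, nsq L₁ L₂ (fun x => D x i.castSucc j))
      ≤ ENNReal.ofReal (q ^ 2) :=
    (Finset.single_le_sum (f := fun i : Fin 2 => nsq L₁ L₂ (fun x => u x i.castSucc) +
      ∑ j : Fin 3, nsq L₁ L₂ (fun x => D x i.castSucc j)) (fun _ _ => zero_le)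
      (Finset.mem_univ i)).trans hb
  refine ⟨aux (h.sigma.memLp _) (le_self_add.trans h0), fun j => aux (h.memD _ _) ?_⟩
  exact ((Finset.single_le_sum (f := fun j : Fin 3 => nsq L₁ L₂ (fun x => D x i.castSucc j))
    (fun _ _ => zero_le) (Finset.mem_univ j)).trans le_add_self).trans h0

/-- For the vertical component, `∂_z u₃` is a sum of two horizontal derivatives, each of norm at
most `q`, and Poincaré passes the bound on to `u₃`. -/
lemma GoodW.vertical_bounds (h₁ : 0 < L₁) (h₂ : 0 < L₂) {q : ℝ} (h : GoodW L₁ L₂ u D)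
    (hq : 0 ≤ q) (hb : h1sq L₁ L₂ u D ≤ ENNReal.ofReal (q ^ 2)) (i : Fin 3) :
    l2 (boxMeas L₁ L₂) (fun x => u x i) ≤ 2 * q ∧ l2 (boxMeas L₁ L₂) (fun x => D x i 2) ≤ 2 * q := by
  have b0 := h.h1_bounds hq hb 0
  have b1 := h.h1_bounds hq hb 1
  have z : l2 (boxMeas L₁ L₂) (fun x => D x 2 2) ≤ 2 * q :=
    (h.l2_zz_le h₁ h₂).trans (by have := b0.2 0; have := b1.2 1; simp at *; linarith)
  fin_cases i
  · exact ⟨b0.1.trans (by linarith), (b0.2 2).trans (by linarith)⟩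
  · exact ⟨b1.1.trans (by linarith), (b1.2 2).trans (by linarith)⟩
  · exact ⟨(h.l2_vertical_le h₁ h₂).trans z, z⟩

lemma StrongField.inL2L2_dzh (S : StrongField L₁ L₂ T) (i : Fin 3) (j : Fin 2) :
    InL2L2 L₁ L₂ T fun t => dzh (S.D2 t) i j := by
  have h := fun i j k => (S.l2h1_horizontal i j).grad k
  unfold dzh
  fin_cases i
  · exact h 0 j 2
  · exact h 1 j 2
  · exact MemLp.neg (MemLp.add (h 0 0 j.castSucc) (h 1 1 j.castSucc))

lemma wt_nonneg (ε : ℝ) (i : Fin 3) : 0 ≤ wt ε i := by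
  fin_cases i <;> simp [wt]; positivity

lemma visc_nonneg (hε : 0 ≤ ε) (j : Fin 3) : 0 ≤ visc ε α j := by
  fin_cases j <;> simp [visc]; positivity

lemma abs_wform_le (hε : 0 ≤ ε) {v e : E3 → E3} {D De : E3 → Fin 3 → Fin 3 → ℝ}
    {b c : Fin 3 → Fin 3 → ℝ}
    (hb : ∀ i j, |∫ x, v x j * D x i j * e x i ∂(boxMeas L₁ L₂)| ≤ b i j)
    (hc : ∀ i j, |∫ x, D x i j * De x i j ∂(boxMeas L₁ L₂)| ≤ c i j) :
    |wform L₁ L₂ ε α v D e De| ≤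
      ∑ i, wt ε i * (∑ j, b i j + ∑ j, visc ε α j * c i j) := by
  unfold wform
  refine (Finset.abs_sum_le_sum_abs _ _).trans (Finset.sum_le_sum fun i _ => ?_)
  rw [abs_mul, abs_of_nonneg (wt_nonneg ε i)]
  refine mul_le_mul_of_nonneg_left ((abs_add_le _ _).trans (add_le_add ?_ ?_)) (wt_nonneg ε i)
  · exact (Finset.abs_sum_le_sum_abs _ _).trans (Finset.sum_le_sum fun j _ => hb i j)
  · refine (Finset.abs_sum_le_sum_abs _ _).trans (Finset.sum_le_sum fun j _ => ?_)
    rw [abs_mul, abs_of_nonneg (visc_nonneg hε j)]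
    exact mul_le_mul_of_nonneg_left (hc i j) (visc_nonneg hε j)

/-- A bound on the weak form tested with (truncations of) `u`. -/
noncomputable def wbound (L₁ L₂ ε α : ℝ) (v : E3 → E3) (Dv D : E3 → Fin 3 → Fin 3 → ℝ)
    (u : E3 → E3) (Du : E3 → Fin 3 → Fin 3 → ℝ) (D2 : E3 → Fin 2 → Fin 2 → Fin 3 → ℝ) : ℝ :=
  ∑ i, wt ε i * (∑ j, 2 * ladConst L₁ L₂ *
      (lad L₁ L₂ (fun x => v x j) (fun x => Dv x j 0) (fun x => Dv x j 1) ^ 2 +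
        (lad L₁ L₂ (fun x => u x i) (fun x => Du x i 0) (fun x => Du x i 1) ^ 2 +
          lad L₁ L₂ (fun x => Du x i 2) (dzh D2 i 0) (dzh D2 i 1) ^ 2) +
        l2 (boxMeas L₁ L₂) (fun x => D x i j) ^ 2) +
    ∑ j, visc ε α j * (l2 (boxMeas L₁ L₂) (fun x => D x i j) ^ 2 +
      l2 (boxMeas L₁ L₂) (fun x => Du x i j) ^ 2))

lemma abs_integral_mul_le_sq {f g g' : E3 → ℝ} (hf : MemLp f 2 (boxMeas L₁ L₂))
    (hg : MemLp g 2 (boxMeas L₁ L₂)) (h : l2 (boxMeas L₁ L₂) g ≤ l2 (boxMeas L₁ L₂) g') :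
    |∫ x, f x * g x ∂(boxMeas L₁ L₂)| ≤ l2 (boxMeas L₁ L₂) f ^ 2 + l2 (boxMeas L₁ L₂) g' ^ 2 := by
  have h0 : 0 ≤ l2 (boxMeas L₁ L₂) f := l2_nonneg
  have h1 := (abs_integral_mul_le hf hg).trans (mul_le_mul_of_nonneg_left h h0)
  nlinarith [sq_nonneg (l2 (boxMeas L₁ L₂) f - l2 (boxMeas L₁ L₂) g')]

variable {v : E3 → E3} {Dv : E3 → Fin 3 → Fin 3 → ℝ} {D' : E3 → Fin 3 → Fin 3 → ℝ}

lemma GoodS.abs_wform_le (h₁ : 0 < L₁) (h₂ : 0 < L₂) (hε : 0 ≤ ε) (hv : GoodW L₁ L₂ v Dv)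
    (hD' : ∀ i j, MemLp (fun x => D' x i j) 2 (boxMeas L₁ L₂)) (h : GoodS L₁ L₂ u D D2) :
    |wform L₁ L₂ ε α v D' u D| ≤ wbound L₁ L₂ ε α v Dv D' u D D2 :=
  HydroMHD.abs_wform_le hε
    (fun i j => abs_transport_le h₁ h₂ (hv.wh h₁ h₂ j) (hD' i j) (h.whv h₁ h₂ i))
    fun i j => abs_integral_mul_le_sq (hD' i j) (h.memD i j) le_rfl

lemma GoodS.grad_truncField (h₁ : 0 < L₁) (h₂ : 0 < L₂) (h : GoodS L₁ L₂ u D D2) (N : ℕ)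
    (x : E3) (i j : Fin 3) :
    grad (truncField L₁ L₂ N u) x i j = trunc L₁ L₂ N (fun x => D x i j) x :=
  congrFun (pd_trunc h₁ h₂ (h.weak i j) N) x

/-- Truncation commutes with the weak derivatives and contracts `L²` norms, so the bound for `u`
also holds for its truncations, uniformly in `N`. It is the dominating function in the passage to
the limit. -/
lemma GoodS.abs_wform_truncField_le (h₁ : 0 < L₁) (h₂ : 0 < L₂) (hε : 0 ≤ ε)
    (hv : GoodW L₁ L₂ v Dv) (hD' : ∀ i j, MemLp (fun x => D' x i j) 2 (boxMeas L₁ L₂))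
    (h : GoodS L₁ L₂ u D D2) (N : ℕ) :
    |wform L₁ L₂ ε α v D' (truncField L₁ L₂ N u) (grad (truncField L₁ L₂ N u))| ≤
      wbound L₁ L₂ ε α v Dv D' u D D2 := by
  refine HydroMHD.abs_wform_le hε (fun i j => ?_) fun i j => ?_
  · refine (abs_transport_le h₁ h₂ (hv.wh h₁ h₂ j) (hD' i j) (WHV.of_smooth
      (contDiff_trunc (L₁ := L₁) (L₂ := L₂) N (fun x => u x i)))).trans ?_
    have c := ladConst_pos h₁ h₂
    have z0 : pd 0 (trunc L₁ L₂ N fun x => D x i 2) = _ := pd_trunc h₁ h₂ (h.weak_dzh h₁ h₂ i 0) N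
    have z1 : pd 1 (trunc L₁ L₂ N fun x => D x i 2) = _ := pd_trunc h₁ h₂ (h.weak_dzh h₁ h₂ i 1) N
    rw [pd_trunc h₁ h₂ (h.weak i 0), pd_trunc h₁ h₂ (h.weak i 1), pd_trunc h₁ h₂ (h.weak i 2),
      z0, z1]
    have a1 := lad_mono (l2_trunc_le h₁ h₂ (h.sigma.memLp i) N) (l2_trunc_le h₁ h₂ (h.memD i 0) N)
      (l2_trunc_le h₁ h₂ (h.memD i 1) N)
    have a2 := lad_mono (l2_trunc_le h₁ h₂ (h.memD i 2) N)
      (l2_trunc_le h₁ h₂ (h.memLp_dzh i 0) N) (l2_trunc_le h₁ h₂ (h.memLp_dzh i 1) N)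
    have b1 := pow_le_pow_left₀ (lad_nonneg _ _ _) a1 2
    have b2 := pow_le_pow_left₀ (lad_nonneg _ _ _) a2 2
    refine mul_le_mul_of_nonneg_left ?_ (by positivity)
    linarith
  · simp only [h.grad_truncField h₁ h₂ N]
    exact abs_integral_mul_le_sq (hD' i j) (memLp_trunc N _ 2) (l2_trunc_le h₁ h₂ (h.memD i j) N)

lemma GoodS.tendsto_wform_truncField (h₁ : 0 < L₁) (h₂ : 0 < L₂) (hv : GoodW L₁ L₂ v Dv)
    (hD' : ∀ i j, MemLp (fun x => D' x i j) 2 (boxMeas L₁ L₂)) (h : GoodS L₁ L₂ u D D2) :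
    Tendsto (fun N => wform L₁ L₂ ε α v D' (truncField L₁ L₂ N u) (grad (truncField L₁ L₂ N u)))
      atTop (𝓝 (wform L₁ L₂ ε α v D' u D)) := by
  unfold wform
  refine tendsto_finsetSum _ fun i _ => Tendsto.const_mul _ (Tendsto.add
    (tendsto_finsetSum _ fun j _ => ?_) (tendsto_finsetSum _ fun j _ => Tendsto.const_mul _ ?_))
  · exact tendsto_transport_trunc h₁ h₂ hv (hD' i j) h i j
  · simp only [fun N => h.grad_truncField h₁ h₂ N, mul_comm (D' _ _ _)]
    exact tendsto_integral_mul (h.memD i j) (fun n => memLp_trunc n _ 2) (hD' i j)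
      (tendsto_trunc h₁ h₂ (h.memD i j))

end Bounds

/-! ### Evolution relations for the untruncated strong solution -/

section Limit

variable {L₁ L₂ T ε α : ℝ}

lemma aestronglyMeasurable_wform {v e : ℝ → E3 → E3} {D De : ℝ → E3 → Fin 3 → Fin 3 → ℝ}
    (hv : ∀ j, CylMeasurable L₁ L₂ T fun t x => v t x j)
    (hD : ∀ i j, CylMeasurable L₁ L₂ T fun t x => D t x i j)
    (he : ∀ j, CylMeasurable L₁ L₂ T fun t x => e t x j)
    (hDe : ∀ i j, CylMeasurable L₁ L₂ T fun t x => De t x i j) :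
    AEStronglyMeasurable (fun t => wform L₁ L₂ ε α (v t) (D t) (e t) (De t))
      (volume.restrict (Ioo 0 T)) := by
  unfold wform
  refine Finset.aestronglyMeasurable_fun_sum _ fun i _ => AEStronglyMeasurable.const_mul
    (AEStronglyMeasurable.add (Finset.aestronglyMeasurable_fun_sum _ fun j _ => ?_)
    (Finset.aestronglyMeasurable_fun_sum _ fun j _ => AEStronglyMeasurable.const_mul ?_ _)) _
  · exact CylMeasurable.integral (f := fun t x => v t x j * D t x i j * e t x i)
      (AEStronglyMeasurable.mul (AEStronglyMeasurable.mul (hv j) (hD i j)) (he i))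
  · exact CylMeasurable.integral (f := fun t x => D t x i j * De t x i j)
      (AEStronglyMeasurable.mul (hD i j) (hDe i j))

/-- An upper bound for the `L²` norm of `W` for almost every time. -/
def WeakField.BoundedBy (W : WeakField L₁ L₂) (T M : ℝ) : Prop :=
  ∀ᵐ t ∂(volume.restrict (Ioo 0 T)), ∀ j, l2 (boxMeas L₁ L₂) (fun x => W.u t x j) ≤ M

/-- Each ladder term involves a field bounded in `L²` uniformly in time, whose horizontal
derivatives are square integrable in space-time. For `∂_z S` these derivatives come from the strong
class. -/
lemma integrable_wbound (h₁ : 0 < L₁) (h₂ : 0 < L₂) (hT : 0 < T) {U V : WeakField L₁ L₂}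
    {S : StrongField L₁ L₂ T} {M q : ℝ} (hV : V.BoundedBy T M) (hq : 0 ≤ q) (hS : S.BoundedBy q) :
    Integrable (fun t => wbound L₁ L₂ ε α (V.u t) (V.D t) (U.D t) (S.u t) (S.D t) (S.D2 t))
      (volume.restrict (Ioo 0 T)) := by
  have b : ∀ᵐ t ∂(volume.restrict (Ioo 0 T)), ∀ i, l2 (boxMeas L₁ L₂) (fun x => S.u t x i) ≤ 2 * q ∧
      l2 (boxMeas L₁ L₂) (fun x => S.D t x i 2) ≤ 2 * q := by
    filter_upwards [S.goodS, hS] with t h h'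
    exact h.toGoodW.vertical_bounds h₁ h₂ hq h'
  have gU := fun i j => ((U.l2h1 T hT i).grad j)
  have gV := fun i j => ((V.l2h1 T hT i).grad j)
  have gS := fun i j => ((S.l2h1 i).grad j)
  unfold wbound
  refine integrable_finsetSum _ fun i _ => Integrable.const_mul (Integrable.add
    (integrable_finsetSum _ fun j _ => Integrable.const_mul (Integrable.add (Integrable.add ?_
      (Integrable.add ?_ ?_)) (gU i j).integrable_l2_sq) _)
    (integrable_finsetSum _ fun j _ => Integrable.const_mul
      ((gU i j).integrable_l2_sq.add (gS i j).integrable_l2_sq) _)) _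
  · exact integrable_sq_lad (V.l2h1 T hT j).val (gV j 0) (gV j 1) (hV.mono fun t h => h j)
  · exact integrable_sq_lad (S.l2h1 i).val (gS i 0) (gS i 1) (b.mono fun t h => (h i).1)
  · exact integrable_sq_lad (gS i 2) (S.inL2L2_dzh i 0) (S.inL2L2_dzh i 1)
      (b.mono fun t h => (h i).2)

lemma integrable_wform_strong (h₁ : 0 < L₁) (h₂ : 0 < L₂) (hε : 0 ≤ ε) (hT : 0 < T)
    {U V : WeakField L₁ L₂} {S : StrongField L₁ L₂ T} {M q : ℝ} (hV : V.BoundedBy T M) (hq : 0 ≤ q)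
    (hS : S.BoundedBy q) :
    Integrable (fun t => wform L₁ L₂ ε α (V.u t) (U.D t) (S.u t) (S.D t))
      (volume.restrict (Ioo 0 T)) := by
  refine (integrable_wbound (ε := ε) (α := α) (U := U) h₁ h₂ hT hV hq hS).mono' ?_ ?_
  · exact aestronglyMeasurable_wform (fun j => (V.l2h1 T hT j).val.meas)
      (fun i j => ((U.l2h1 T hT i).grad j).meas) (fun j => (S.l2h1 j).val.meas)
      fun i j => ((S.l2h1 i).grad j).meas
  · filter_upwards [U.goodW hT, V.goodW hT, S.goodS] with t hU hV hS
    exact hS.abs_wform_le h₁ h₂ hε hV hU.memD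

lemma tendsto_intervalIntegral_of_dominated {F : ℕ → ℝ → ℝ} {f b : ℝ → ℝ} {t : ℝ}
    (ht : t ∈ Ico 0 T) (hF : ∀ n, AEStronglyMeasurable (F n) (volume.restrict (Ioo 0 T)))
    (hb : Integrable b (volume.restrict (Ioo 0 T)))
    (hle : ∀ n, ∀ᵐ s ∂(volume.restrict (Ioo 0 T)), |F n s| ≤ b s)
    (hlim : ∀ᵐ s ∂(volume.restrict (Ioo 0 T)), Tendsto (fun n => F n s) atTop (𝓝 (f s))) :
    Tendsto (fun n => ∫ s in (0 : ℝ)..t, F n s) atTop (𝓝 (∫ s in (0 : ℝ)..t, f s)) := by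
  simp only [intervalIntegral.integral_of_le ht.1, integral_Ioc_eq_integral_Ioo]
  have hs : Ioo 0 t ⊆ Ioo 0 T := Ioo_subset_Ioo_right ht.2.le
  exact tendsto_integral_of_dominated_convergence b
    (fun n => (hF n).mono_measure (Measure.restrict_mono hs le_rfl)) (hb.mono_measure
      (Measure.restrict_mono hs le_rfl)) (fun n => ae_restrict_of_ae_restrict_of_subset hs (hle n))
    (ae_restrict_of_ae_restrict_of_subset hs hlim)

variable {A₀ B₀ : InitialField L₁ L₂} {Aε Bε : WeakField L₁ L₂}

lemma tendsto_wpair_truncField (h₁ : 0 < L₁) (h₂ : 0 < L₂) {u v : E3 → E3}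
    (hu : ∀ i, MemLp (fun x => u x i) 2 (boxMeas L₁ L₂))
    (hv : ∀ i, MemLp (fun x => v x i) 2 (boxMeas L₁ L₂)) :
    Tendsto (fun N => wpair L₁ L₂ ε v (truncField L₁ L₂ N u)) atTop (𝓝 (wpair L₁ L₂ ε v u)) := by
  unfold wpair
  refine tendsto_finsetSum _ fun i _ => Tendsto.const_mul _ ?_
  simp only [mul_comm (v _ _)]
  exact tendsto_integral_mul (hu i) (fun n => memLp_trunc n _ 2) (hv i) (tendsto_trunc h₁ h₂ (hu i))

/-- The pairing of `∂ₜ` of the strong solution with the horizontal part of a field. -/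
noncomputable def dtPair (L₁ L₂ : ℝ) (dt : E3 → Fin 2 → ℝ) (u : E3 → E3) : ℝ :=
  ∑ i, ∫ x, dt x i * u x i.castSucc ∂(boxMeas L₁ L₂)

/-- The remainder from the vertical component. -/
noncomputable def vertRem (L₁ L₂ : ℝ) (dt : E3 → Fin 2 → ℝ) (D : E3 → Fin 3 → Fin 3 → ℝ) : ℝ :=
  ∑ i : Fin 2, l2 (boxMeas L₁ L₂) (fun x => dt x i) * l2 (boxMeas L₁ L₂) (fun x => D x 2 i.castSucc)

lemma integrable_vertRem (hT : 0 < T) (U : WeakField L₁ L₂) (S : StrongField L₁ L₂ T) :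
    Integrable (fun s => vertRem L₁ L₂ (S.dt s) (U.D s)) (volume.restrict (Ioo 0 T)) := by
  unfold vertRem
  exact integrable_finsetSum _ fun i _ =>
    integrable_mul (S.l2_dt i).memLp_l2 ((U.l2h1 T hT 2).grad i.castSucc).memLp_l2

lemma integrable_dtPair (S : StrongField L₁ L₂ T) {u : ℝ → E3 → E3}
    (hu : ∀ i, InL2L2 L₁ L₂ T fun t x => u t x i) :
    Integrable (fun s => dtPair L₁ L₂ (S.dt s) (u s)) (volume.restrict (Ioo 0 T)) := by
  unfold dtPair
  exact integrable_finsetSum _ fun i _ => (S.l2_dt i).integrable_inner (hu i.castSucc)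

/-- The weak solution tested with the strong solution. -/
theorem IsLerayHopf.pair_strong (h₁ : 0 < L₁) (h₂ : 0 < L₂) (hε : 0 ≤ ε)
    (h : IsLerayHopf ε α A₀ B₀ Aε Bε) (S : StrongField L₁ L₂ T) {M q : ℝ} (hB : Bε.BoundedBy T M)
    (hq : 0 ≤ q) (hS : S.BoundedBy q) {t : ℝ} (ht : t ∈ Ico 0 T) :
    wpair L₁ L₂ ε (Aε.u 0) (S.u 0) + (∫ s in (0 : ℝ)..t, (dtPair L₁ L₂ (S.dt s) (Aε.u s) -
        wform L₁ L₂ ε α (Bε.u s) (Aε.D s) (S.u s) (S.D s))) -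
      ε ^ 2 * (∫ s in (0 : ℝ)..t, vertRem L₁ L₂ (S.dt s) (Aε.D s)) ≤
    wpair L₁ L₂ ε (Aε.u t) (S.u t) := by
  have hT : 0 < T := ht.1.trans_lt ht.2
  have h0 : (0 : ℝ) ∈ Ico 0 T := ⟨le_rfl, hT⟩
  set p : ℕ → ℝ → ℝ := fun N s =>
    ∑ i, ∫ x, trunc L₁ L₂ N (fun x => S.dt s x i) x * Aε.u s x i.castSucc ∂(boxMeas L₁ L₂)
  set w : ℕ → ℝ → ℝ := fun N s => wform L₁ L₂ ε α (Bε.u s) (Aε.D s) (truncField L₁ L₂ N (S.u s))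
            (grad (truncField L₁ L₂ N (S.u s)))
  set r : ℕ → ℝ → ℝ := fun N s => vertPair L₁ L₂ N (S.dt s) (fun x => Aε.u s x 2)
  have aA := fun i => (Aε.l2h1 T hT i).val
  have aD := fun i j => ((Aε.l2h1 T hT i).grad j)
  have mp : ∀ N, AEStronglyMeasurable (p N) (volume.restrict (Ioo 0 T)) := fun N =>
    Finset.aestronglyMeasurable_fun_sum _ fun i _ => CylMeasurable.integral
      (f := fun s x => trunc L₁ L₂ N (fun x => S.dt s x i) x * Aε.u s x i.castSucc)
      (AEStronglyMeasurable.mul ((S.l2_dt i).meas.trunc N) (aA i.castSucc).meas)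
  have mw : ∀ N, AEStronglyMeasurable (w N) (volume.restrict (Ioo 0 T)) := by
    intro N
    refine (aestronglyMeasurable_wform (ε := ε) (α := α) (v := Bε.u) (D := Aε.D)
      (e := fun t => truncField L₁ L₂ N (S.u t))
      (De := fun t x i j => trunc L₁ L₂ N (fun x => S.D t x i j) x)
      (fun j => (Bε.l2h1 T hT j).val.meas) (fun i j => (aD i j).meas)
      (fun j => (S.l2h1 j).val.meas.trunc N) fun i j => ((S.l2h1 i).grad j).meas.trunc N).congr ?_
    filter_upwards [S.goodS] with s hs
    simp only [w]
    congr 1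
    funext x i j
    exact (hs.grad_truncField h₁ h₂ N x i j).symm
  have mr : ∀ N, AEStronglyMeasurable (r N) (volume.restrict (Ioo 0 T)) := fun N =>
    Finset.aestronglyMeasurable_fun_sum _ fun κ _ =>
      (((S.l2_dt κ.2.2).meas.coef κ.1 κ.2.1).const_mul _).mul
        (((aA 2).meas.coef κ.1 κ.2.1).const_mul _)
  have sdt : ∀ᵐ s ∂(volume.restrict (Ioo 0 T)), ∀ i,
      MemLp (fun x => S.dt s x i) 2 (boxMeas L₁ L₂) := ae_all_iff.2 fun i => (S.l2_dt i).slice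
  set bp : ℝ → ℝ := fun s => ∑ i : Fin 2, (l2 (boxMeas L₁ L₂) (fun x => S.dt s x i) ^ 2 +
    l2 (boxMeas L₁ L₂) (fun x => Aε.u s x i.castSucc) ^ 2)
  have ibp : Integrable bp (volume.restrict (Ioo 0 T)) := integrable_finsetSum _ fun i _ =>
    (S.l2_dt i).integrable_l2_sq.add (aA i.castSucc).integrable_l2_sq
  have lp : ∀ N, ∀ᵐ s ∂(volume.restrict (Ioo 0 T)), |p N s| ≤ bp s := by
    intro N
    filter_upwards [sdt, Aε.goodW hT] with s h1 h2
    refine (Finset.abs_sum_le_sum_abs _ _).trans (Finset.sum_le_sum fun i _ => ?_)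
    simp only [mul_comm (trunc _ _ _ _ _)]
    rw [add_comm]
    exact abs_integral_mul_le_sq (h2.sigma.memLp _) (memLp_trunc N _ 2) (l2_trunc_le h₁ h₂ (h1 i) N)
  set bw : ℝ → ℝ := fun s => wbound L₁ L₂ ε α (Bε.u s) (Bε.D s) (Aε.D s) (S.u s) (S.D s) (S.D2 s)
  have ibw : Integrable bw (volume.restrict (Ioo 0 T)) := integrable_wbound h₁ h₂ hT hB hq hS
  have lw : ∀ N, ∀ᵐ s ∂(volume.restrict (Ioo 0 T)), |w N s| ≤ bw s := by
    intro N
    filter_upwards [Aε.goodW hT, Bε.goodW hT, S.goodS] with s hA hB hS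
    exact hS.abs_wform_truncField_le h₁ h₂ hε hB hA.memD N
  have lr : ∀ N, ∀ᵐ s ∂(volume.restrict (Ioo 0 T)),
      |r N s| ≤ vertRem L₁ L₂ (S.dt s) (Aε.D s) := by
    intro N
    filter_upwards [Aε.goodW hT, sdt] with s hA hd
    exact abs_vertPair_le h₁ h₂ hd (fun i => hA.memD 2 i.castSucc) (fun i => hA.weak 2 i.castSucc) N
  have ir := integrable_vertRem hT Aε S
  have lim : Tendsto (fun N => ∫ s in (0 : ℝ)..t, (p N s - w N s)) atTop
      (𝓝 (∫ s in (0 : ℝ)..t, (dtPair L₁ L₂ (S.dt s) (Aε.u s) -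
        wform L₁ L₂ ε α (Bε.u s) (Aε.D s) (S.u s) (S.D s)))) := by
    refine tendsto_intervalIntegral_of_dominated ht (fun N => (mp N).sub (mw N)) (ibp.add ibw)
      (fun N => ?_) ?_
    · filter_upwards [lp N, lw N] with s h1 h2
      exact (abs_sub _ _).trans (add_le_add h1 h2)
    · filter_upwards [Aε.goodW hT, Bε.goodW hT, S.goodS, sdt] with s hA hB hS hd
      refine Tendsto.sub (tendsto_finsetSum _ fun i _ => ?_)
        (hS.tendsto_wform_truncField h₁ h₂ hB hA.memD)
      exact tendsto_integral_mul (hd i) (fun n => memLp_trunc n _ 2) (hA.sigma.memLp _)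
        (tendsto_trunc h₁ h₂ (hd i))
  -- Only an inequality survives the limit: the vertical part of the time derivative is not shown to
  -- converge and is bounded below by `-vertRem` for each `N`. This is the direction needed, as the
  -- pairing enters the relative energy with a minus sign.
  refine le_of_tendsto_of_tendsto' (((tendsto_wpair_truncField h₁ h₂ (S.sigma 0 h0).memLp
    (Aε.sigma 0 le_rfl).memLp).add lim).sub_const _) (tendsto_wpair_truncField h₁ h₂
    (S.sigma t ht).memLp (Aε.sigma t ht.1).memLp) fun N => ?_
  rw [h.pair_truncField h₁ h₂ S N ht]
  have ip : Integrable (p N) (volume.restrict (Ioo 0 T)) := ibp.mono' (mp N) (lp N)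
  have iw : Integrable (w N) (volume.restrict (Ioo 0 T)) := ibw.mono' (mw N) (lw N)
  have irN : Integrable (r N) (volume.restrict (Ioo 0 T)) := ir.mono' (mr N) (lr N)
  have jp := intervalIntegrable_of_Ioo ip ht
  have jw := intervalIntegrable_of_Ioo iw ht
  have jr := intervalIntegrable_of_Ioo irN ht
  have split : ∫ s in (0 : ℝ)..t, (p N s + ε ^ 2 * r N s - w N s) =
      (∫ s in (0 : ℝ)..t, (p N s - w N s)) + ε ^ 2 * ∫ s in (0 : ℝ)..t, r N s := by
    rw [← intervalIntegral.integral_const_mul, ← intervalIntegral.integral_add (jp.sub jw)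
      (jr.const_mul _)]
    congr 1; ext s; ring
  have hr : -(∫ s in (0 : ℝ)..t, vertRem L₁ L₂ (S.dt s) (Aε.D s)) ≤ ∫ s in (0 : ℝ)..t, r N s := by
    rw [← intervalIntegral.integral_neg]
    refine intervalIntegral.integral_mono_ae_restrict ht.1 (intervalIntegrable_of_Ioo ir ht).neg jr ?_
    rw [Measure.restrict_congr_set Ioo_ae_eq_Icc.symm]
    filter_upwards [ae_restrict_of_ae_restrict_of_subset (Ioo_subset_Ioo_right ht.2.le) (lr N)]
      with s hs
    exact (abs_le.1 hs).1
  rw [split]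
  have := mul_le_mul_of_nonneg_left hr (sq_nonneg ε)
  linarith

/-- The evolution of the norm of the horizontal part of the strong solution. -/
lemma StrongField.norm_eq (h₁ : 0 < L₁) (h₂ : 0 < L₂) (S : StrongField L₁ L₂ T) {t : ℝ}
    (ht : t ∈ Ico 0 T) :
    ∑ i : Fin 2, l2 (boxMeas L₁ L₂) (fun x => S.u t x i.castSucc) ^ 2 =
      ∑ i : Fin 2, l2 (boxMeas L₁ L₂) (fun x => S.u 0 x i.castSucc) ^ 2 +
        ∫ s in (0 : ℝ)..t, 2 * dtPair L₁ L₂ (S.dt s) (S.u s) := by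
  have hT : 0 < T := ht.1.trans_lt ht.2
  have h0 : (0 : ℝ) ∈ Ico 0 T := ⟨le_rfl, hT⟩
  have sdt : ∀ᵐ s ∂(volume.restrict (Ioo 0 T)), ∀ i,
      MemLp (fun x => S.dt s x i) 2 (boxMeas L₁ L₂) := ae_all_iff.2 fun i => (S.l2_dt i).slice
  have key : ∀ i : Fin 2, l2 (boxMeas L₁ L₂) (fun x => S.u t x i.castSucc) ^ 2 =
      l2 (boxMeas L₁ L₂) (fun x => S.u 0 x i.castSucc) ^ 2 +
        ∫ s in (0 : ℝ)..t, 2 * ∫ x, S.dt s x i * S.u s x i.castSucc ∂(boxMeas L₁ L₂) := by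
    intro i
    have lim : ∀ r ∈ Ico 0 T, Tendsto (fun N => ∫ x, trunc L₁ L₂ N (fun x => S.u r x i.castSucc) x *
        S.u r x i.castSucc ∂(boxMeas L₁ L₂)) atTop
        (𝓝 (l2 (boxMeas L₁ L₂) (fun x => S.u r x i.castSucc) ^ 2)) := by
      intro r hr
      have m := (S.sigma r hr).memLp i.castSucc
      rw [l2_sq]
      simp only [sq]
      exact tendsto_integral_mul m (fun n => memLp_trunc n _ 2) m (tendsto_trunc h₁ h₂ m)
    refine tendsto_nhds_unique (lim t ht) ?_
    simp only [fun N => S.norm_trunc h₁ h₂ i N ht]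
    refine (lim 0 h0).add (tendsto_intervalIntegral_of_dominated (b := fun s =>
      2 * (l2 (boxMeas L₁ L₂) (fun x => S.dt s x i) ^ 2 +
        l2 (boxMeas L₁ L₂) (fun x => S.u s x i.castSucc) ^ 2)) ht (fun N => ?_)
      (((S.l2_dt i).integrable_l2_sq.add (S.l2h1 i.castSucc).val.integrable_l2_sq).const_mul 2)
      (fun N => ?_) ?_)
    · exact (CylMeasurable.integral
        (f := fun s x => trunc L₁ L₂ N (fun x => S.dt s x i) x * S.u s x i.castSucc)
        (AEStronglyMeasurable.mul ((S.l2_dt i).meas.trunc N) (S.l2h1 i.castSucc).val.meas)).const_mul _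
    · filter_upwards [sdt, S.goodS] with s h1 h2
      rw [abs_mul, abs_two]
      refine mul_le_mul_of_nonneg_left ?_ zero_le_two
      simp only [mul_comm (trunc _ _ _ _ _)]
      rw [add_comm]
      exact abs_integral_mul_le_sq (h2.sigma.memLp _) (memLp_trunc N _ 2)
        (l2_trunc_le h₁ h₂ (h1 i) N)
    · filter_upwards [sdt, S.goodS] with s h1 h2
      exact (tendsto_integral_mul (h1 i) (fun n => memLp_trunc n _ 2) (h2.sigma.memLp _)
        (tendsto_trunc h₁ h₂ (h1 i))).const_mul 2
  simp only [key, Finset.sum_add_distrib]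
  congr 1
  rw [← intervalIntegral.integral_finsetSum fun i _ => (intervalIntegrable_of_Ioo
    ((S.l2_dt i).integrable_inner (S.l2h1 i.castSucc).val) ht).const_mul 2]
  simp only [dtPair, Finset.mul_sum]

end Limit

/-! ### The relative energy at a fixed time -/

section Slice

variable {L₁ L₂ ε α : ℝ}

/-- The dissipation functional as a real number. -/
noncomputable def dissr (L₁ L₂ ε α : ℝ) (D : E3 → Fin 3 → Fin 3 → ℝ) : ℝ :=
  ∑ i : Fin 3, ∑ j : Fin 3, wt ε i * visc ε α j * l2 (boxMeas L₁ L₂) (fun x => D x i j) ^ 2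

/-- The limit equation for the horizontal velocity with gradient `D` at a fixed time, with
transporting velocity `v`. -/
def SliceEquation (L₁ L₂ : ℝ) (dt : E3 → Fin 2 → ℝ) (v : E3 → E3) (D : E3 → Fin 3 → Fin 3 → ℝ)
    (D2 : E3 → Fin 2 → Fin 2 → Fin 3 → ℝ) : Prop :=
  ∃ (p : E3 → ℝ) (Dp : E3 → Fin 3 → ℝ), (∀ j, MemLp (fun x => Dp x j) 2 (boxMeas L₁ L₂)) ∧
    (∀ j, HasWeakPartial L₁ L₂ j p (fun x => Dp x j)) ∧
    ∀ᵐ x ∂(boxMeas L₁ L₂), Dp x 2 = 0 ∧ ∀ i : Fin 2,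
      dt x i + ∑ j : Fin 3, v x j * D x i.castSucc j - ∑ j : Fin 2, D2 x i j j.castSucc +
        Dp x i.castSucc = 0

variable {A B a b U : E3 → E3} {DA DB Da Db DU : E3 → Fin 3 → Fin 3 → ℝ}
  {D2A D2B : E3 → Fin 2 → Fin 2 → Fin 3 → ℝ} {dt : E3 → Fin 2 → ℝ}

lemma transport_gradient_integrable (h₁ : 0 < L₁) (h₂ : 0 < L₂) (hv : GoodW L₁ L₂ b Db)
    (hA : GoodS L₁ L₂ A DA D2A) (hU : GoodW L₁ L₂ U DU) (i : Fin 2) (j : Fin 3) :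
    Integrable (fun x => b x j * DA x i.castSucc j * U x i.castSucc) (boxMeas L₁ L₂) := by
  obtain ⟨C, hC⟩ := gradient_estimate h₁ h₂ hv hA i j
  exact (hC _ _ _ (hU.wh h₁ h₂ i.castSucc)).1

/-- The limit equation is inserted for `dt`. The pressure drops out because `U` is divergence-free
and `∂_z p = 0`, and the horizontal diffusion is integrated by parts once. -/
lemma dtPair_eq (h₁ : 0 < L₁) (h₂ : 0 < L₂) (hB : GoodS L₁ L₂ B DB D2B)
    (hA : GoodS L₁ L₂ A DA D2A) (hdt : SliceEquation L₁ L₂ dt B DA D2A) (hU : GoodW L₁ L₂ U DU) :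
    dtPair L₁ L₂ dt U =
      -(∑ i : Fin 2, ∑ j, ∫ x, B x j * DA x i.castSucc j * U x i.castSucc ∂(boxMeas L₁ L₂)) -
        ∑ i : Fin 2, ∑ j : Fin 2,
          ∫ x, DA x i.castSucc j.castSucc * DU x i.castSucc j.castSucc ∂(boxMeas L₁ L₂) := by
  obtain ⟨p, Dp, mp, wp, he⟩ := hdt
  have hz : ∑ i : Fin 2, ∫ x, U x i.castSucc * Dp x i.castSucc ∂(boxMeas L₁ L₂) = 0 := by
    have h := sigma_orthogonal h₁ h₂ hU.sigma mp wp
    have h2 : ∫ x, U x 2 * Dp x 2 ∂(boxMeas L₁ L₂) = 0 := by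
      refine (integral_congr_ae (g := fun _ => 0) ?_).trans (by simp)
      filter_upwards [he] with x hx
      rw [hx.1, mul_zero]
    rw [Fin.sum_univ_castSucc] at h
    change _ + ∫ x, U x 2 * Dp x 2 ∂(boxMeas L₁ L₂) = 0 at h
    rwa [h2, add_zero] at h
  have i1 := fun i j => transport_gradient_integrable h₁ h₂ hB.toGoodW hA hU i j
  have i2 := fun (i j : Fin 2) => integrable_mul (hA.memD2 i j j.castSucc) (hU.sigma.memLp i.castSucc)
  have i3 := fun i : Fin 2 => integrable_mul (hU.sigma.memLp i.castSucc) (mp i.castSucc)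
  have key : ∀ i : Fin 2, ∫ x, dt x i * U x i.castSucc ∂(boxMeas L₁ L₂) =
      -(∑ j, ∫ x, B x j * DA x i.castSucc j * U x i.castSucc ∂(boxMeas L₁ L₂)) -
        ∑ j : Fin 2, ∫ x, DA x i.castSucc j.castSucc * DU x i.castSucc j.castSucc ∂(boxMeas L₁ L₂) -
        ∫ x, U x i.castSucc * Dp x i.castSucc ∂(boxMeas L₁ L₂) := by
    intro i
    have e1 : ∫ x, dt x i * U x i.castSucc ∂(boxMeas L₁ L₂) =
        ∫ x, ((∑ j : Fin 2, D2A x i j j.castSucc * U x i.castSucc -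
          ∑ j, B x j * DA x i.castSucc j * U x i.castSucc) - U x i.castSucc * Dp x i.castSucc)
          ∂(boxMeas L₁ L₂) := by
      refine integral_congr_ae ?_
      filter_upwards [he] with x hx
      have := hx.2 i
      simp only [← Finset.sum_mul]
      linear_combination (U x i.castSucc) * this
    have s1 : Integrable (fun x => ∑ j : Fin 2, D2A x i j j.castSucc * U x i.castSucc)
        (boxMeas L₁ L₂) := integrable_finsetSum _ fun j _ => i2 i j
    have s2 : Integrable (fun x => ∑ j, B x j * DA x i.castSucc j * U x i.castSucc)
        (boxMeas L₁ L₂) := integrable_finsetSum _ fun j _ => i1 i j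
    have s3 : Integrable (fun x => ∑ j : Fin 2, D2A x i j j.castSucc * U x i.castSucc -
        ∑ j, B x j * DA x i.castSucc j * U x i.castSucc) (boxMeas L₁ L₂) := s1.sub s2
    rw [e1, integral_sub s3 (i3 i), integral_sub s1 s2,
      integral_finsetSum _ fun j _ => i2 i j, integral_finsetSum _ fun j _ => i1 i j]
    have e2 : ∀ j : Fin 2, ∫ x, D2A x i j j.castSucc * U x i.castSucc ∂(boxMeas L₁ L₂) =
        -∫ x, DA x i.castSucc j.castSucc * DU x i.castSucc j.castSucc ∂(boxMeas L₁ L₂) := by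
      intro j
      have := weak_ibp h₁ h₂ (hA.weak2 i j j.castSucc) (hU.weak i.castSucc j.castSucc)
        (hA.memD _ _) (hU.sigma.memLp _) (hA.memD2 i j _) (hU.memD _ _)
      linarith
    simp only [e2, Finset.sum_neg_distrib]
    ring
  unfold dtPair
  simp only [key, Finset.sum_sub_distrib, Finset.sum_neg_distrib, hz, sub_zero]

/-- The transport terms of the horizontal equation. -/
lemma transport_difference (h₁ : 0 < L₁) (h₂ : 0 < L₂) (ha : GoodW L₁ L₂ a Da)
    (hb : GoodW L₁ L₂ b Db) (hA : GoodS L₁ L₂ A DA D2A) (hB : GoodS L₁ L₂ B DB D2B) (i : Fin 2) :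
    ∑ j, ∫ x, B x j * DA x i.castSucc j * (a - A) x i.castSucc ∂(boxMeas L₁ L₂) +
      ∑ j, ∫ x, b x j * Da x i.castSucc j * A x i.castSucc ∂(boxMeas L₁ L₂) =
    -∑ j, ∫ x, (b - B) x j * DA x i.castSucc j * (a - A) x i.castSucc ∂(boxMeas L₁ L₂) := by
  -- Antisymmetry moves the derivative from `a` to `A`. With `A` in both slots it says that the
  -- self-interaction vanishes, so `a` may be replaced by `a - A`.
  have t1 := transport_antisymm h₁ h₂ hb hA (ha.sigma.memLp i.castSucc)
    (Df := fun j x => Da x i.castSucc j) (fun j => ha.memD _ j) (fun j => ha.weak _ j) i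
  have t2 := transport_antisymm h₁ h₂ hb hA (hA.sigma.memLp i.castSucc)
    (Df := fun j x => DA x i.castSucc j) (fun j => hA.memD _ j) (fun j => hA.weak _ j) i
  have hU := ha.sub hA.toGoodW
  have j1 := fun j => transport_gradient_integrable h₁ h₂ hB.toGoodW hA hU i j
  have j2 := fun j => transport_gradient_integrable h₁ h₂ hb hA hU i j
  have j3 := fun j => transport_gradient_integrable h₁ h₂ hb hA ha i j
  have j4 := fun j => transport_gradient_integrable h₁ h₂ hb hA hA.toGoodW i j
  have e1 : ∀ j, ∫ x, (b - B) x j * DA x i.castSucc j * (a - A) x i.castSucc ∂(boxMeas L₁ L₂) =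
      ∫ x, b x j * DA x i.castSucc j * (a - A) x i.castSucc ∂(boxMeas L₁ L₂) -
      ∫ x, B x j * DA x i.castSucc j * (a - A) x i.castSucc ∂(boxMeas L₁ L₂) := by
    intro j
    rw [← integral_sub (j2 j) (j1 j)]
    congr 1; ext x; simp only [Pi.sub_apply]; ring
  have e2 : ∀ j, ∫ x, b x j * DA x i.castSucc j * (a - A) x i.castSucc ∂(boxMeas L₁ L₂) =
      ∫ x, b x j * DA x i.castSucc j * a x i.castSucc ∂(boxMeas L₁ L₂) -
      ∫ x, b x j * DA x i.castSucc j * A x i.castSucc ∂(boxMeas L₁ L₂) := by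
    intro j
    rw [← integral_sub (j3 j) (j4 j)]
    congr 1; ext x; simp only [Pi.sub_apply]; ring
  simp only [e1, e2, Finset.sum_sub_distrib]
  linarith

/-- The viscous terms. -/
lemma two_mul_integral_mul {f g : E3 → ℝ} (hf : MemLp f 2 (boxMeas L₁ L₂))
    (hg : MemLp g 2 (boxMeas L₁ L₂)) :
    2 * ∫ x, f x * g x ∂(boxMeas L₁ L₂) = l2 (boxMeas L₁ L₂) f ^ 2 + l2 (boxMeas L₁ L₂) g ^ 2 -
      l2 (boxMeas L₁ L₂) (fun x => f x - g x) ^ 2 := by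
  simp only [l2_sq]
  have i1 := hf.integrable_sq
  have i2 := hg.integrable_sq
  have i3 := (memLp_fun_sub hf hg).integrable_sq
  rw [← integral_add i1 i2, ← integral_sub (i1.fun_add i2) i3, ← integral_const_mul]
  congr 1; ext x; ring

lemma integral_mul_sub {f g : E3 → ℝ} (hf : MemLp f 2 (boxMeas L₁ L₂))
    (hg : MemLp g 2 (boxMeas L₁ L₂)) :
    ∫ x, g x * (f x - g x) ∂(boxMeas L₁ L₂) =
      ∫ x, f x * g x ∂(boxMeas L₁ L₂) - l2 (boxMeas L₁ L₂) g ^ 2 := by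
  rw [l2_sq, ← integral_sub (integrable_mul hf hg) hg.integrable_sq]
  congr 1; ext x; ring

/-- The density of the relative energy identity. -/
noncomputable def relDensity (L₁ L₂ ε α : ℝ) (dt : E3 → Fin 2 → ℝ) (a A b : E3 → E3)
    (Da DA : E3 → Fin 3 → Fin 3 → ℝ) : ℝ :=
  -2 * dissr L₁ L₂ ε α Da - 2 * dtPair L₁ L₂ dt (a - A) + 2 * wform L₁ L₂ ε α b Da A DA +
    2 * ε ^ 2 * vertRem L₁ L₂ dt Da

/-- Polarisation turns the viscous cross terms into the dissipation of the error. For horizontal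
derivatives of horizontal components the limit equation has the matching viscosity and nothing
remains. For all other derivatives the scaled system has a viscosity that the limit lacks, and a
squared norm of `DA` with a small weight is left over. The horizontal transport terms combine by
`transport_difference`, while vertical transport and the vertical remainder are kept for later. -/
lemma relDensity_le (h₁ : 0 < L₁) (h₂ : 0 < L₂) (hε : 0 ≤ ε) (ha : GoodW L₁ L₂ a Da)
    (hb : GoodW L₁ L₂ b Db) (hA : GoodS L₁ L₂ A DA D2A) (hB : GoodS L₁ L₂ B DB D2B)
    (hdt : SliceEquation L₁ L₂ dt B DA D2A) :
    relDensity L₁ L₂ ε α dt a A b Da DA ≤ -dissr L₁ L₂ ε α (Da - DA) +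
      (visc ε α 2 * ∑ i : Fin 2, l2 (boxMeas L₁ L₂) (fun x => DA x i.castSucc 2) ^ 2 +
        ε ^ 2 * ∑ j : Fin 2, l2 (boxMeas L₁ L₂) (fun x => DA x 2 j.castSucc) ^ 2 +
        ε ^ 2 * visc ε α 2 * l2 (boxMeas L₁ L₂) (fun x => DA x 2 2) ^ 2) -
      2 * ∑ i : Fin 2, ∑ j, ∫ x, (b - B) x j * DA x i.castSucc j * (a - A) x i.castSucc
        ∂(boxMeas L₁ L₂) +
      2 * ε ^ 2 * ∑ j, ∫ x, b x j * Da x 2 j * A x 2 ∂(boxMeas L₁ L₂) +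
      2 * ε ^ 2 * vertRem L₁ L₂ dt Da := by
  have hU := ha.sub hA.toGoodW
  have hd := dtPair_eq h₁ h₂ hB hA hdt hU
  have tr0 := transport_difference h₁ h₂ ha hb hA hB 0
  have tr1 := transport_difference h₁ h₂ ha hb hA hB 1
  have v1 := fun i j => two_mul_integral_mul (ha.memD i j) (hA.memD i j)
  have v2 := fun i j => integral_mul_sub (ha.memD i j) (hA.memD i j)
  have p := visc_nonneg (α := α) hε 2
  have n : ∀ i j, 0 ≤ l2 (boxMeas L₁ L₂) (fun x => Da x i j - DA x i j) ^ 2 := fun i j => sq_nonneg _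
  have n' : ∀ i j, 0 ≤ l2 (boxMeas L₁ L₂) (fun x => Da x i j) ^ 2 := fun i j => sq_nonneg _
  have w0 : wt ε 0 = 1 := by simp [wt]
  have w1 : wt ε 1 = 1 := by simp [wt]
  have w2 : wt ε 2 = ε ^ 2 := by simp [wt]
  have s0 : visc ε α 0 = 1 := by simp [visc]
  have s1 : visc ε α 1 = 1 := by simp [visc]
  unfold relDensity
  rw [hd]
  unfold dissr wform
  simp only [Fin.sum_univ_three, Fin.sum_univ_two, Fin.castSucc_zero, Fin.castSucc_one, w0, w1, w2,
    s0, s1, Pi.sub_apply] at tr0 tr1 ⊢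
  have m0 := mul_nonneg p (n' 0 2)
  have m1 := mul_nonneg p (n' 1 2)
  have m2 := mul_nonneg (sq_nonneg ε) (n' 2 0)
  have m3 := mul_nonneg (sq_nonneg ε) (n' 2 1)
  have m4 := mul_nonneg (mul_nonneg (sq_nonneg ε) p) (n' 2 2)
  -- The identities reproduce the density exactly. The terms `n` discard one of two copies of the
  -- horizontal dissipation of the error, and the terms `m0` to `m4` discard the remaining weighted
  -- dissipation of `a`.
  linear_combination 2 * v2 0 0 + 2 * v2 0 1 + 2 * v2 1 0 + 2 * v2 1 1 + 2 * v1 0 0 + 2 * v1 0 1 +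
    2 * v1 1 0 + 2 * v1 1 1 + visc ε α 2 * v1 0 2 + visc ε α 2 * v1 1 2 + ε ^ 2 * v1 2 0 +
    ε ^ 2 * v1 2 1 + ε ^ 2 * visc ε α 2 * v1 2 2 + 2 * tr0 + 2 * tr1 + n 0 0 + n 0 1 + n 1 0 +
    n 1 1 + m0 + m1 + m2 + m3 + m4

end Slice

/-! ### The relative energy density is controlled by the relative energy -/

section Estimate

variable {L₁ L₂ ε α : ℝ}

lemma lad_le {f fx fy : E3 → ℝ} {p s : ℝ} (h : l2 (boxMeas L₁ L₂) f ≤ p)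
    (hx : l2 (boxMeas L₁ L₂) fx ≤ s) (hy : l2 (boxMeas L₁ L₂) fy ≤ s) :
    lad L₁ L₂ f fx fy ≤ p ^ 2 + 2 * (p * s) := by
  have a : 0 ≤ l2 (boxMeas L₁ L₂) f := l2_nonneg
  have b : 0 ≤ l2 (boxMeas L₁ L₂) fx := l2_nonneg
  have c : 0 ≤ l2 (boxMeas L₁ L₂) fy := l2_nonneg
  unfold lad
  have : l2 (boxMeas L₁ L₂) f * (l2 (boxMeas L₁ L₂) fx + l2 (boxMeas L₁ L₂) fy) ≤ p * (s + s) := by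
    gcongr
    exact a.trans h
  have : l2 (boxMeas L₁ L₂) f ^ 2 ≤ p ^ 2 := by gcongr
  linarith

lemma abs_integral_trilinear_sup (h₁ : 0 < L₁) (h₂ : 0 < L₂) {f fx fy g gx gy h hz : E3 → ℝ}
    (hf : WH L₁ L₂ f fx fy) (hg : WH L₁ L₂ g gx gy) (hh : WV L₁ L₂ h hz) {F G s : ℝ}
    (lf : lad L₁ L₂ f fx fy ≤ F) (lg : lad L₁ L₂ g gx gy ≤ G)
    (ls : l2 (boxMeas L₁ L₂) h + l2 (boxMeas L₁ L₂) hz ≤ s) :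
    |∫ x, f x * g x * h x ∂(boxMeas L₁ L₂)| ≤ 2 * ladConst L₁ L₂ * (√F * √G) * s := by
  refine (abs_integral_le_integral_abs.trans (trilinear_sup h₁ h₂ hf hg hh).2).trans ?_
  have c := (ladConst_pos h₁ h₂).le
  have n1 : 0 ≤ l2 (boxMeas L₁ L₂) h := l2_nonneg
  have n2 : 0 ≤ l2 (boxMeas L₁ L₂) hz := l2_nonneg
  gcongr

/-- The factor `c` is distributed as `c √lad = √(c² lad)`, which allows a power of `ε` to be spent
on a factor `f` that is controlled only with that weight. -/
lemma abs_integral_trilinear_L2 (h₁ : 0 < L₁) (h₂ : 0 < L₂)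
    {f fx fy g h hx hy hz hzx hzy : E3 → ℝ} (hf : WH L₁ L₂ f fx fy)
    (hg : MemLp g 2 (boxMeas L₁ L₂)) (hh : WHV L₁ L₂ h hx hy hz hzx hzy) {c F H s : ℝ}
    (hc : 0 ≤ c) (lf : c ^ 2 * lad L₁ L₂ f fx fy ≤ F) (lh : lad L₁ L₂ h hx hy ≤ H)
    (lz : lad L₁ L₂ hz hzx hzy ≤ H) (ls : l2 (boxMeas L₁ L₂) g ≤ s) :
    c * |∫ x, f x * g x * h x ∂(boxMeas L₁ L₂)| ≤
      2 * ladConst L₁ L₂ * (√F * √(2 * H)) * s := by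
  have e := abs_integral_le_integral_abs.trans (trilinear_L2 h₁ h₂ hf hg hh).2
  have n1 : 0 ≤ l2 (boxMeas L₁ L₂) g := l2_nonneg
  have k := (ladConst_pos h₁ h₂).le
  have e1 : c * √(lad L₁ L₂ f fx fy) ≤ √F := by
    refine le_trans (le_of_eq ?_) (Real.sqrt_le_sqrt lf)
    rw [Real.sqrt_mul (sq_nonneg c), Real.sqrt_sq hc]
  have e2 : √(lad L₁ L₂ h hx hy + lad L₁ L₂ hz hzx hzy) ≤ √(2 * H) :=
    Real.sqrt_le_sqrt (by linarith)
  calc _ ≤ _ := mul_le_mul_of_nonneg_left e hc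
    _ = 2 * ladConst L₁ L₂ * ((c * √(lad L₁ L₂ f fx fy)) *
        √(lad L₁ L₂ h hx hy + lad L₁ L₂ hz hzx hzy)) * l2 (boxMeas L₁ L₂) g := by ring
    _ ≤ _ := by gcongr

variable {A B a b : E3 → E3} {DA DB Da Db : E3 → Fin 3 → Fin 3 → ℝ}
  {D2A D2B : E3 → Fin 2 → Fin 2 → Fin 3 → ℝ} {dt : E3 → Fin 2 → ℝ}

lemma l2_dzh_le {P : ℝ}
    (hP : ∀ i j k, l2 (boxMeas L₁ L₂) (fun x => D2A x i j k) ≤ P) (i : Fin 2) (j : Fin 2) :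
    l2 (boxMeas L₁ L₂) (dzh D2A i.castSucc j) ≤ P := by
  fin_cases i
  · exact hP 0 j 2
  · exact hP 1 j 2

lemma GoodS.l2_dzh_vertical_le {P : ℝ} (hA : GoodS L₁ L₂ A DA D2A)
    (hP : ∀ i j k, l2 (boxMeas L₁ L₂) (fun x => D2A x i j k) ≤ P) (j : Fin 2) :
    l2 (boxMeas L₁ L₂) (dzh D2A 2 j) ≤ 2 * P := by
  have e : dzh D2A 2 j = fun x => -(D2A x 0 0 j.castSucc + D2A x 1 1 j.castSucc) := rfl
  rw [e, l2_neg]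
  have := l2_add_le (hA.memD2 0 0 j.castSucc) (hA.memD2 1 1 j.castSucc)
  linarith [hP 0 0 j.castSucc, hP 1 1 j.castSucc]

/-- The vertical derivative of `∂ⱼ A₃` is `-∂ⱼ ∇_H · Ã`, which belongs to the strong class, so
Poincaré applies. The gradient is given only up to null sets; the absence of `z`-independent modes
is therefore read off from the coefficients of the odd function `A₃`. -/
lemma GoodS.l2_vertical_grad_le (h₁ : 0 < L₁) (h₂ : 0 < L₂) {P : ℝ} (hA : GoodS L₁ L₂ A DA D2A)
    (hP : ∀ i j k, l2 (boxMeas L₁ L₂) (fun x => D2A x i j k) ≤ P) (j : Fin 2) :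
    l2 (boxMeas L₁ L₂) (fun x => DA x 2 j.castSucc) ≤ 2 * P := by
  refine le_trans ?_ (hA.l2_dzh_vertical_le hP j)
  refine poincare_of_coef h₁ h₂ (hA.memD _ _) (hA.memLp_dzh 2 j)
    ((hA.weak 2 2).comm (hA.weak 2 j.castSucc) (hA.weak_dzh h₁ h₂ 2 j)) fun k c hk => ?_
  rw [coef_weakPartial h₁ h₂ (hA.weak 2 j.castSucc), coef_odd hA.odd hk, mul_zero, neg_zero]

/-- The interaction of the errors with the gradient of the limit. -/
lemma abs_error_transport_le (h₁ : 0 < L₁) (h₂ : 0 < L₂) {U V : E3 → E3}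
    {DU DV : E3 → Fin 3 → Fin 3 → ℝ} (hU : GoodW L₁ L₂ U DU) (hV : GoodW L₁ L₂ V DV)
    (hA : GoodS L₁ L₂ A DA D2A) {q P x y : ℝ} (hq : 0 ≤ q) (hP : 0 ≤ P) (hx0 : 0 ≤ x)
    (hb : h1sq L₁ L₂ A DA ≤ ENNReal.ofReal (q ^ 2))
    (hD2 : ∀ i j k, l2 (boxMeas L₁ L₂) (fun x => D2A x i j k) ≤ P)
    (hx : ∀ i j : Fin 2, l2 (boxMeas L₁ L₂) (fun x => DU x i.castSucc j.castSucc) ≤ x)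
    (hx' : ∀ i j : Fin 2, l2 (boxMeas L₁ L₂) (fun x => DV x i.castSucc j.castSucc) ≤ x)
    (hy : ∀ i : Fin 2, l2 (boxMeas L₁ L₂) (fun x => U x i.castSucc) ≤ y)
    (hy' : ∀ i : Fin 2, l2 (boxMeas L₁ L₂) (fun x => V x i.castSucc) ≤ y) (i : Fin 2) :
    |∑ j, ∫ x, V x j * DA x i.castSucc j * U x i.castSucc ∂(boxMeas L₁ L₂)| ≤
      2 * ladConst L₁ L₂ * (2 * (y ^ 2 + 2 * (y * x)) * (q + P) +
        √(y ^ 2 + 2 * (y * x)) * √(4 * q ^ 2 + 8 * (q * P)) * (4 * x)) := by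
  have y0 : 0 ≤ y := l2_nonneg.trans (hy 0)
  have bd := hA.toGoodW.h1_bounds hq hb i
  have lU := lad_le (hy i) (hx i 0) (hx i 1)
  -- In horizontal directions `∂ⱼ Ãᵢ` has a vertical derivative and is taken in the supremum along
  -- columns; both errors enter through horizontal derivatives only.
  have t1 : ∀ j : Fin 2,
      |∫ x, V x j.castSucc * DA x i.castSucc j.castSucc * U x i.castSucc ∂(boxMeas L₁ L₂)| ≤
        2 * ladConst L₁ L₂ * (y ^ 2 + 2 * (y * x)) * (q + P) := by
    intro j
    have := abs_integral_trilinear_sup h₁ h₂ (hV.wh h₁ h₂ j.castSucc) (hU.wh h₁ h₂ i.castSucc)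
      (hA.wv_h h₁ h₂ i j) (lad_le (hy' j) (hx' j 0) (hx' j 1)) lU
      (add_le_add (bd.2 j.castSucc) (hD2 i j 2))
    rw [Real.mul_self_sqrt (by positivity)] at this
    convert this using 4 with z
    ring
  -- In the vertical direction `V₃` is the factor bounded along columns. Divergence and Poincaré
  -- give `2 x` for each of `‖∂_z V₃‖` and `‖V₃‖`, hence the `4 x`.
  have t2 : |∫ x, V x 2 * DA x i.castSucc 2 * U x i.castSucc ∂(boxMeas L₁ L₂)| ≤
      2 * ladConst L₁ L₂ * (√(y ^ 2 + 2 * (y * x)) * √(4 * q ^ 2 + 8 * (q * P))) * (4 * x) := by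
    have l1 : lad L₁ L₂ (fun x => DA x i.castSucc 2) (dzh D2A i.castSucc 0) (dzh D2A i.castSucc 1) ≤
        4 * q ^ 2 + 8 * (q * P) := by
      refine (lad_le (bd.2 2) (l2_dzh_le hD2 i 0) (l2_dzh_le hD2 i 1)).trans ?_
      nlinarith [mul_nonneg hq hP, sq_nonneg q]
    have l3 := hV.l2_zz_le h₁ h₂
    have l4 := hV.l2_vertical_le h₁ h₂
    have := hx' 0 0
    have := hx' 1 1
    simp only [Fin.castSucc_zero, Fin.castSucc_one] at *
    have := abs_integral_trilinear_sup h₁ h₂ (hU.wh h₁ h₂ i.castSucc) (hA.wh_z h₁ h₂ i.castSucc)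
      (hV.wv h₁ h₂ 2) lU l1 (s := 4 * x) (by linarith)
    convert this using 4 with z
    ring
  rw [Fin.sum_univ_three]
  have := t1 0
  have := t1 1
  simp only [Fin.castSucc_zero, Fin.castSucc_one] at *
  refine (abs_add_three _ _ _).trans ?_
  linarith

/-- The transport of the vertical component. -/
lemma abs_vertical_transport_le (h₁ : 0 < L₁) (h₂ : 0 < L₂) (hε : 0 ≤ ε)
    (ha : GoodW L₁ L₂ a Da) (hb : GoodW L₁ L₂ b Db)
    (hA : GoodS L₁ L₂ A DA D2A) {q P r w x z : ℝ} (hq : 0 ≤ q) (hP : 0 ≤ P)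
    (hr0 : 0 ≤ r)
    (hbA : h1sq L₁ L₂ A DA ≤ ENNReal.ofReal (q ^ 2))
    (hD2 : ∀ i j k, l2 (boxMeas L₁ L₂) (fun x => D2A x i j k) ≤ P)
    (hx : ∀ i j : Fin 2, l2 (boxMeas L₁ L₂) (fun x => (Da - DA) x i.castSucc j.castSucc) ≤ x)
    (hz : ∀ j : Fin 2, ε * l2 (boxMeas L₁ L₂) (fun x => (Da - DA) x 2 j.castSucc) ≤ z)
    (hr : ∀ i : Fin 2, l2 (boxMeas L₁ L₂) (fun x => b x i.castSucc) ≤ r)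
    (hr' : ε * l2 (boxMeas L₁ L₂) (fun x => b x 2) ≤ r)
    (hw : ∀ i j : Fin 2, l2 (boxMeas L₁ L₂) (fun x => Db x i.castSucc j.castSucc) ≤ w)
    (hw' : ∀ j : Fin 2, ε * l2 (boxMeas L₁ L₂) (fun x => Db x 2 j.castSucc) ≤ w) :
    ε ^ 2 * |∑ j, ∫ x, b x j * Da x 2 j * A x 2 ∂(boxMeas L₁ L₂)| ≤
      2 * ladConst L₁ L₂ * (ε * (√(r ^ 2 + 2 * (r * w)) * √(2 * (4 * q ^ 2 + 8 * (q * P)))) *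
        (2 * (z + 2 * ε * P) + 2 * x) + ε ^ 2 * (4 * q ^ 2 + 8 * (q * P)) * (4 * w)) := by
  have k := (ladConst_pos h₁ h₂).le
  have hU := ha.sub hA.toGoodW
  have vb := hA.toGoodW.vertical_bounds h₁ h₂ hq hbA 2
  have g2 := hA.l2_vertical_grad_le h₁ h₂ hD2
  have zz := hA.l2_dzh_vertical_le hD2
  have l1 : lad L₁ L₂ (fun x => A x 2) (fun x => DA x 2 0) (fun x => DA x 2 1) ≤
      4 * q ^ 2 + 8 * (q * P) := (lad_le vb.1 (g2 0) (g2 1)).trans (by ring_nf; rfl)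
  have l3 : lad L₁ L₂ (fun x => DA x 2 2) (dzh D2A 2 0) (dzh D2A 2 1) ≤ 4 * q ^ 2 + 8 * (q * P) :=
    (lad_le vb.2 (zz 0) (zz 1)).trans (by ring_nf; rfl)
  -- One factor `ε` is spent on `∂ⱼ a₃`, which is controlled only with this weight; the other
  -- remains as a gain. Splitting `∂ⱼ a₃` into error and limit gives `z + 2 ε P`.
  have t3 : ∀ j : Fin 2, ε ^ 2 * |∫ x, b x j.castSucc * Da x 2 j.castSucc * A x 2 ∂(boxMeas L₁ L₂)| ≤
      2 * ladConst L₁ L₂ * (ε * (√(r ^ 2 + 2 * (r * w)) * √(2 * (4 * q ^ 2 + 8 * (q * P)))) *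
        (z + 2 * ε * P)) := by
    intro j
    have e := abs_integral_trilinear_L2 h₁ h₂ (hb.wh h₁ h₂ j.castSucc) (ha.memD 2 j.castSucc)
      (hA.whv h₁ h₂ 2) (c := 1) (F := r ^ 2 + 2 * (r * w)) zero_le_one
      (by rw [one_pow, one_mul]; exact lad_le (hr j) (hw j 0) (hw j 1)) l1 l3 le_rfl
    have e2 : ε * l2 (boxMeas L₁ L₂) (fun x => Da x 2 j.castSucc) ≤ z + 2 * ε * P := by
      have := l2_add_le (hU.memD 2 j.castSucc) (hA.memD 2 j.castSucc)
      simp only [Pi.sub_apply, sub_add_cancel] at this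
      have h1 := hz j
      have h2 := mul_le_mul_of_nonneg_left (g2 j) hε
      have h3 := mul_le_mul_of_nonneg_left this hε
      simp only [Pi.sub_apply] at h1
      linarith
    rw [one_mul] at e
    calc _ ≤ _ := mul_le_mul_of_nonneg_left e (sq_nonneg ε)
      _ = 2 * ladConst L₁ L₂ * (ε * (√(r ^ 2 + 2 * (r * w)) *
          √(2 * (4 * q ^ 2 + 8 * (q * P)))) *
            (ε * l2 (boxMeas L₁ L₂) (fun x => Da x 2 j.castSucc))) := by ring
      _ ≤ _ := by gcongr
  -- Here `b₃` needs the weight `ε`, whereas `∂_z (a₃ - A₃)` is a horizontal divergence of the error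
  -- and needs none.
  have t4 : ε ^ 2 * |∫ x, b x 2 * (Da - DA) x 2 2 * A x 2 ∂(boxMeas L₁ L₂)| ≤
      2 * ladConst L₁ L₂ * (ε * (√(r ^ 2 + 2 * (r * w)) * √(2 * (4 * q ^ 2 + 8 * (q * P)))) *
        (2 * x)) := by
    have lb : ε ^ 2 * lad L₁ L₂ (fun x => b x 2) (fun x => Db x 2 0) (fun x => Db x 2 1) ≤
        r ^ 2 + 2 * (r * w) := by
      have n : 0 ≤ l2 (boxMeas L₁ L₂) (fun x => b x 2) := l2_nonneg
      have n0 : 0 ≤ l2 (boxMeas L₁ L₂) (fun x => Db x 2 0) := l2_nonneg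
      have n1 : 0 ≤ l2 (boxMeas L₁ L₂) (fun x => Db x 2 1) := l2_nonneg
      have w0 := hw' 0
      have w1 := hw' 1
      simp only [Fin.castSucc_zero, Fin.castSucc_one] at w0 w1
      unfold lad
      have h1 : (ε * l2 (boxMeas L₁ L₂) (fun x => b x 2)) ^ 2 ≤ r ^ 2 := by gcongr
      have h2 : ε * l2 (boxMeas L₁ L₂) (fun x => b x 2) *
        (ε * l2 (boxMeas L₁ L₂) (fun x => Db x 2 0) + ε * l2 (boxMeas L₁ L₂) (fun x => Db x 2 1)) ≤
          r * (w + w) := by gcongr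
      linarith
    have e := abs_integral_trilinear_L2 h₁ h₂ (hb.wh h₁ h₂ 2) (hU.memD 2 2)
      (hA.whv h₁ h₂ 2) hε lb l1 l3 (s := 2 * x) (by
        have := hU.l2_zz_le h₁ h₂
        have := hx 0 0
        have := hx 1 1
        simp only [Fin.castSucc_zero, Fin.castSucc_one] at *
        linarith)
    calc _ = ε * (ε * |∫ x, b x 2 * (Da - DA) x 2 2 * A x 2 ∂(boxMeas L₁ L₂)|) := by ring
      _ ≤ _ := mul_le_mul_of_nonneg_left e hε
      _ = _ := by ring
  -- With both other factors belonging to the limit, `b₃` can be the factor bounded along columns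
  -- and costs only `4 w` without weight, so the whole `ε²` is gained.
  have t5 : |∫ x, b x 2 * DA x 2 2 * A x 2 ∂(boxMeas L₁ L₂)| ≤
      2 * ladConst L₁ L₂ * ((4 * q ^ 2 + 8 * (q * P)) * (4 * w)) := by
    have e := abs_integral_trilinear_sup h₁ h₂ (hA.wh_z h₁ h₂ 2) (hA.wh h₁ h₂ 2) (hb.wv h₁ h₂ 2)
      l3 l1 (s := 4 * w) (by
        have := hb.l2_zz_le h₁ h₂
        have := hb.l2_vertical_le h₁ h₂
        have := hw 0 0
        have := hw 1 1
        simp only [Fin.castSucc_zero, Fin.castSucc_one] at *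
        linarith)
    rw [Real.mul_self_sqrt (by positivity), mul_assoc] at e
    convert e using 4 with y
    ring
  have sp : ∫ x, b x 2 * Da x 2 2 * A x 2 ∂(boxMeas L₁ L₂) =
      ∫ x, b x 2 * (Da - DA) x 2 2 * A x 2 ∂(boxMeas L₁ L₂) +
        ∫ x, b x 2 * DA x 2 2 * A x 2 ∂(boxMeas L₁ L₂) := by
    rw [← integral_add (transport_integrable h₁ h₂ hb (hU.memD 2 2) hA 2 2)
      (transport_integrable h₁ h₂ hb (hA.memD 2 2) hA 2 2)]
    congr 1; ext x; simp only [Pi.sub_apply]; ring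
  have t5' := mul_le_mul_of_nonneg_left t5 (sq_nonneg ε)
  have u0 := t3 0
  have u1 := t3 1
  simp only [Fin.castSucc_zero, Fin.castSucc_one] at u0 u1
  rw [Fin.sum_univ_three, sp]
  have tri : ∀ p s t v : ℝ, |p + s + (t + v)| ≤ |p| + |s| + |t| + |v| := fun p s t v => by
    have := abs_add_le (p + s) (t + v)
    have := abs_add_le p s
    have := abs_add_le t v
    linarith
  have h4 := mul_le_mul_of_nonneg_left (tri (∫ x, b x 0 * Da x 2 0 * A x 2 ∂(boxMeas L₁ L₂))
    (∫ x, b x 1 * Da x 2 1 * A x 2 ∂(boxMeas L₁ L₂))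
    (∫ x, b x 2 * (Da - DA) x 2 2 * A x 2 ∂(boxMeas L₁ L₂))
    (∫ x, b x 2 * DA x 2 2 * A x 2 ∂(boxMeas L₁ L₂))) (sq_nonneg ε)
  linarith

/-- One of the two powers of `ε` in front of the remainder serves as the weight of `∂ⱼ a₃`, again
split into error and limit; the other is left for Young's inequality. -/
lemma vertRem_le (h₁ : 0 < L₁) (h₂ : 0 < L₂) (hε : 0 ≤ ε) (ha : GoodW L₁ L₂ a Da)
    (hA : GoodS L₁ L₂ A DA D2A) {P z : ℝ} (hP : 0 ≤ P)
    (hD2 : ∀ i j k, l2 (boxMeas L₁ L₂) (fun x => D2A x i j k) ≤ P)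
    (hdt : ∀ i, l2 (boxMeas L₁ L₂) (fun x => dt x i) ≤ P)
    (hz : ∀ j : Fin 2, ε * l2 (boxMeas L₁ L₂) (fun x => (Da - DA) x 2 j.castSucc) ≤ z) :
    ε * vertRem L₁ L₂ dt Da ≤ 2 * P * (z + 2 * ε * P) := by
  have hU := ha.sub hA.toGoodW
  have key : ∀ j : Fin 2, l2 (boxMeas L₁ L₂) (fun x => dt x j) *
      (ε * l2 (boxMeas L₁ L₂) (fun x => Da x 2 j.castSucc)) ≤ P * (z + 2 * ε * P) := by
    intro j
    have := l2_add_le (hU.memD 2 j.castSucc) (hA.memD 2 j.castSucc)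
    simp only [Pi.sub_apply, sub_add_cancel] at this
    have h1 := hz j
    have h2 := mul_le_mul_of_nonneg_left (hA.l2_vertical_grad_le h₁ h₂ hD2 j) hε
    have h3 := mul_le_mul_of_nonneg_left this hε
    simp only [Pi.sub_apply] at h1
    have n : 0 ≤ l2 (boxMeas L₁ L₂) (fun x => Da x 2 j.castSucc) := l2_nonneg
    exact mul_le_mul (hdt j) (by linarith) (by positivity) hP
  have := key 0
  have := key 1
  unfold vertRem
  rw [Fin.sum_univ_two]
  linarith

end Estimate

/-! ### Young's inequality and the resulting bound on the density -/

section Young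

/-- Each product is completed to a square. The error gradients are charged four times `x² / 32` and
twice `z² / 8`, which leaves `x² / 8` unused within `x² / 4`. The product `S R x` needs two
completions: after the first, `S² = y² + 2 y x` leaves a term `L y x`, and the second produces the
`k⁴ L² y²`. Here `S`, `R` and `Q` stand for the square roots coming from the ladder bounds of the
error, of the limit, and (doubled) of the weak solution. -/
lemma young_terms {k q P w x y z ε Λ L W S R Q : ℝ}
    (hS : S ^ 2 = Λ) (hR : R ^ 2 = L) (hQ : Q ^ 2 * 2 = W * 4)
    (hΛ : Λ = y ^ 2 + 2 * (y * x)) :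
    4 * (k * (2 * Λ * (q + P) + S * R * (4 * x))) +
      2 * (k * (ε * (Q * R) * (2 * (z + 2 * ε * P) + 2 * x) + ε ^ 2 * L * (4 * w))) +
      2 * (ε * (2 * P * (z + 2 * ε * P))) ≤
    x ^ 2 / 4 + z ^ 2 / 4 +
      (8 * k * (q + P) + 2048 * k ^ 2 * (q + P) ^ 2 + 2048 * k ^ 2 * L +
        8 * 4096 ^ 2 * k ^ 4 * L ^ 2) * y ^ 2 +
      ε ^ 2 * (176 * k ^ 2 * (W ^ 2 + L ^ 2) + 16 * k ^ 2 * L ^ 2 + w ^ 2 + 41 * P ^ 2) := by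
  have hQR : (Q * R) ^ 2 = 2 * (W * L) := by rw [mul_pow, hR]; linear_combination L / 2 * hQ
  have hSR : (S * R) ^ 2 = Λ * L := by rw [mul_pow, hR, hS]
  have a := sq_nonneg (x - 256 * k * (q + P) * y)
  have b := sq_nonneg (x - 256 * k * (S * R))
  have b' := sq_nonneg (x - 16 * 4096 * k ^ 2 * L * y)
  have c := sq_nonneg (z - 16 * ε * k * (Q * R))
  have c' := mul_nonneg (sq_nonneg ε) (sq_nonneg (P - 4 * k * (Q * R)))
  have d := sq_nonneg (x - 64 * ε * k * (Q * R))
  have e := mul_nonneg (sq_nonneg ε) (sq_nonneg (w - 4 * k * L))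
  have f := sq_nonneg (z - 16 * ε * P)
  have g := mul_nonneg (mul_nonneg (sq_nonneg ε) (sq_nonneg k)) (sq_nonneg (W - L))
  have x2 := sq_nonneg x
  subst hΛ
  linear_combination a / 32 + b / 32 + b' / 32 + c / 8 + c' + d / 32 + e + f / 8 + 176 * g +
    1 / 8 * x2 + (2048 * k ^ 2) * hSR + (32 + 16 + 128) * ε ^ 2 * k ^ 2 * hQR

/-- The ladder bound of the limit is affine in `P`, so even its square grows only like `1 + P²`, and
`P²` will be integrable in time. The quantities of the weak solution stay in the form `r⁴ + r² w²`.
The `49 P²` makes room for `8 P²` from the horizontal viscosity acting on `A₃`, in addition to the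
`41 P²` of `young_terms`. -/
lemma exists_young_bound {k q : ℝ} (hk : 0 ≤ k) (hq : 0 ≤ q) : ∃ G, 0 ≤ G ∧ ∀ P r w : ℝ, 0 ≤ P →
    8 * k * (q + P) + 2048 * k ^ 2 * (q + P) ^ 2 + 2048 * k ^ 2 * (4 * q ^ 2 + 8 * (q * P)) +
        8 * 4096 ^ 2 * k ^ 4 * (4 * q ^ 2 + 8 * (q * P)) ^ 2 ≤ G * (1 + P ^ 2) ∧
    176 * k ^ 2 * ((r ^ 2 + 2 * (r * w)) ^ 2 + (4 * q ^ 2 + 8 * (q * P)) ^ 2) +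
      16 * k ^ 2 * (4 * q ^ 2 + 8 * (q * P)) ^ 2 + w ^ 2 + 49 * P ^ 2 ≤
        G * (1 + P ^ 2 + w ^ 2 + r ^ 4 + r ^ 2 * w ^ 2) := by
  set M := 32 * q ^ 4 + 128 * q ^ 2 with hM
  have M0 : 0 ≤ M := by positivity
  have L2 : ∀ P, (4 * q ^ 2 + 8 * (q * P)) ^ 2 ≤ M * (1 + P ^ 2) := fun P => by
    have : 0 ≤ 32 * q ^ 4 * P ^ 2 + 128 * q ^ 2 := by positivity
    nlinarith [sq_nonneg (4 * q ^ 2 - 8 * (q * P))]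
  have W2 : ∀ r w : ℝ, (r ^ 2 + 2 * (r * w)) ^ 2 ≤ 8 * (r ^ 4 + r ^ 2 * w ^ 2) := fun r w => by
    nlinarith [sq_nonneg (r ^ 2 - 2 * (r * w)), sq_nonneg (r ^ 2)]
  refine ⟨(8 * k * (q + 1) + 2048 * k ^ 2 * (2 * q ^ 2 + 2) + 2048 * k ^ 2 * (4 * q ^ 2 + 8 * q) +
    8 * 4096 ^ 2 * k ^ 4 * M) + (176 * k ^ 2 * (8 + M) + 16 * k ^ 2 * M + 50), by positivity,
    fun P r w hP => ?_⟩
  have P1 : P ≤ 1 + P ^ 2 := by nlinarith [sq_nonneg (P - 1)]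
  have P2 : 1 ≤ 1 + P ^ 2 := by nlinarith [sq_nonneg P]
  have L2P := L2 P
  have W2P := W2 r w
  have hX : 1 + P ^ 2 ≤ 1 + P ^ 2 + w ^ 2 + r ^ 4 + r ^ 2 * w ^ 2 := by
    have : 0 ≤ w ^ 2 + r ^ 4 + r ^ 2 * w ^ 2 := by positivity
    linarith
  constructor
  · have e1 : q + P ≤ (q + 1) * (1 + P ^ 2) := by nlinarith
    have e2 : (q + P) ^ 2 ≤ (2 * q ^ 2 + 2) * (1 + P ^ 2) := by
      nlinarith [sq_nonneg (q - P), mul_nonneg (sq_nonneg q) (sq_nonneg P)]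
    have e3 : 4 * q ^ 2 + 8 * (q * P) ≤ (4 * q ^ 2 + 8 * q) * (1 + P ^ 2) := by
      nlinarith [mul_le_mul_of_nonneg_left P1 hq, mul_nonneg (sq_nonneg q) (sq_nonneg P)]
    calc _ ≤ 8 * k * ((q + 1) * (1 + P ^ 2)) + 2048 * k ^ 2 * ((2 * q ^ 2 + 2) * (1 + P ^ 2)) +
          2048 * k ^ 2 * ((4 * q ^ 2 + 8 * q) * (1 + P ^ 2)) +
          8 * 4096 ^ 2 * k ^ 4 * (M * (1 + P ^ 2)) := by gcongr
      _ = (8 * k * (q + 1) + 2048 * k ^ 2 * (2 * q ^ 2 + 2) + 2048 * k ^ 2 * (4 * q ^ 2 + 8 * q) +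
          8 * 4096 ^ 2 * k ^ 4 * M) * (1 + P ^ 2) := by ring
      _ ≤ _ := by
        refine mul_le_mul_of_nonneg_right ?_ (by positivity)
        have : 0 ≤ 176 * k ^ 2 * (8 + M) + 16 * k ^ 2 * M + 50 := by positivity
        linarith
  · set X := 1 + P ^ 2 + w ^ 2 + r ^ 4 + r ^ 2 * w ^ 2 with hX'
    have e4 : r ^ 4 + r ^ 2 * w ^ 2 ≤ X := by
      have : 0 ≤ w ^ 2 := by positivity
      linarith
    have e5 : w ^ 2 + 49 * P ^ 2 ≤ 50 * X := by
      have : 0 ≤ w ^ 2 + r ^ 4 + r ^ 2 * w ^ 2 := by positivity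
      have : 0 ≤ r ^ 4 + r ^ 2 * w ^ 2 := by positivity
      nlinarith [sq_nonneg w, sq_nonneg P]
    have X0 : 0 ≤ X := by positivity
    calc _ = 176 * k ^ 2 * ((r ^ 2 + 2 * (r * w)) ^ 2 + (4 * q ^ 2 + 8 * (q * P)) ^ 2) +
          16 * k ^ 2 * (4 * q ^ 2 + 8 * (q * P)) ^ 2 + (w ^ 2 + 49 * P ^ 2) := by ring
      _ ≤ 176 * k ^ 2 * (8 * X + M * X) + 16 * k ^ 2 * (M * X) + 50 * X := by
        gcongr
        · exact W2P.trans (by linarith)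
        · exact L2P.trans (by gcongr)
        · exact L2P.trans (by gcongr)
      _ = (176 * k ^ 2 * (8 + M) + 16 * k ^ 2 * M + 50) * X := by ring
      _ ≤ _ := by
        refine mul_le_mul_of_nonneg_right ?_ X0
        have : 0 ≤ 8 * k * (q + 1) + 2048 * k ^ 2 * (2 * q ^ 2 + 2) +
          2048 * k ^ 2 * (4 * q ^ 2 + 8 * q) + 8 * 4096 ^ 2 * k ^ 4 * M := by positivity
        linarith

variable {L₁ L₂ : ℝ}

/-- The relative energy density in terms of bounds on the norms involved: `x, y, z` for the errors,
`q, P` for the limit and `r, w` for the solution of the scaled system. -/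
theorem exists_relDensity_le (h₁ : 0 < L₁) (h₂ : 0 < L₂) {q : ℝ} (hq : 0 ≤ q) :
    ∃ G, 0 ≤ G ∧ ∀ (ε α : ℝ) (A B a b : E3 → E3) (DA DB Da Db : E3 → Fin 3 → Fin 3 → ℝ)
      (D2A D2B : E3 → Fin 2 → Fin 2 → Fin 3 → ℝ) (dt : E3 → Fin 2 → ℝ) (P r w x y z : ℝ),
      0 ≤ ε → GoodW L₁ L₂ a Da → GoodW L₁ L₂ b Db → GoodS L₁ L₂ A DA D2A →
      GoodS L₁ L₂ B DB D2B → SliceEquation L₁ L₂ dt B DA D2A → 0 ≤ P → 0 ≤ r → 0 ≤ x →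
      h1sq L₁ L₂ A DA ≤ ENNReal.ofReal (q ^ 2) →
      (∀ i j k, l2 (boxMeas L₁ L₂) (fun x => D2A x i j k) ≤ P) →
      (∀ i, l2 (boxMeas L₁ L₂) (fun x => dt x i) ≤ P) →
      (∀ i j : Fin 2, l2 (boxMeas L₁ L₂) (fun x => (Da - DA) x i.castSucc j.castSucc) ≤ x) →
      (∀ i j : Fin 2, l2 (boxMeas L₁ L₂) (fun x => (Db - DB) x i.castSucc j.castSucc) ≤ x) →
      (∀ i : Fin 2, l2 (boxMeas L₁ L₂) (fun x => (a - A) x i.castSucc) ≤ y) →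
      (∀ i : Fin 2, l2 (boxMeas L₁ L₂) (fun x => (b - B) x i.castSucc) ≤ y) →
      (∀ j : Fin 2, ε * l2 (boxMeas L₁ L₂) (fun x => (Da - DA) x 2 j.castSucc) ≤ z) →
      (∀ i : Fin 2, l2 (boxMeas L₁ L₂) (fun x => b x i.castSucc) ≤ r) →
      ε * l2 (boxMeas L₁ L₂) (fun x => b x 2) ≤ r →
      (∀ i j : Fin 2, l2 (boxMeas L₁ L₂) (fun x => Db x i.castSucc j.castSucc) ≤ w) →
      (∀ j : Fin 2, ε * l2 (boxMeas L₁ L₂) (fun x => Db x 2 j.castSucc) ≤ w) →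
      relDensity L₁ L₂ ε α dt a A b Da DA ≤ -dissr L₁ L₂ ε α (Da - DA) + x ^ 2 / 4 + z ^ 2 / 4 +
        G * (1 + P ^ 2) * y ^ 2 + ε ^ 2 * (G * (1 + P ^ 2 + w ^ 2 + r ^ 4 + r ^ 2 * w ^ 2)) +
        (2 + 4 * ε ^ 2) * (visc ε α 2 * q ^ 2) := by
  have k0 : 0 ≤ 2 * ladConst L₁ L₂ := by have := ladConst_pos h₁ h₂; positivity
  obtain ⟨G, G0, hG⟩ := exists_young_bound k0 hq
  refine ⟨G, G0, fun ε α A B a b DA DB Da Db D2A D2B dt P r w x y z hε ha hb hA hB hdt hP hr0 hx0 hbA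
    hD2 hdtP hx hx' hy hy' hz hr hr' hw hw' => ?_⟩
  have y0 : 0 ≤ y := l2_nonneg.trans (hy 0)
  have w0 : 0 ≤ w := l2_nonneg.trans (hw 0 0)
  have hU := ha.sub hA.toGoodW
  have hV := hb.sub hB.toGoodW
  refine (relDensity_le (α := α) h₁ h₂ hε ha hb hA hB hdt).trans ?_
  have tr := fun i => abs_error_transport_le h₁ h₂ hU hV hA hq hP hx0 hbA hD2 hx hx' hy hy' i
  have ve := abs_vertical_transport_le h₁ h₂ hε ha hb hA hq hP hr0 hbA hD2 hx hz hr hr' hw hw'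
  have vr := mul_le_mul_of_nonneg_left (vertRem_le h₁ h₂ hε ha hA hP hD2 hdtP hz) hε
  have tr0 := (abs_le.1 (tr 0)).1
  have tr1 := (abs_le.1 (tr 1)).1
  have ve' := mul_le_mul_of_nonneg_left (le_abs_self
    (∑ j, ∫ x, b x j * Da x 2 j * A x 2 ∂(boxMeas L₁ L₂))) (sq_nonneg ε)
  have Y := young_terms (k := 2 * ladConst L₁ L₂) (q := q) (P := P) (w := w) (x := x)
    (y := y) (z := z) (ε := ε) (W := r ^ 2 + 2 * (r * w)) (Q := √(r ^ 2 + 2 * (r * w)) * √2)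
    (Real.sq_sqrt (show 0 ≤ y ^ 2 + 2 * (y * x) by positivity))
    (Real.sq_sqrt (show 0 ≤ 4 * q ^ 2 + 8 * (q * P) by positivity))
    (by rw [mul_pow, Real.sq_sqrt (by positivity), Real.sq_sqrt (by positivity)]; ring) rfl
  rw [Real.sqrt_mul (by norm_num), ← mul_assoc (√(r ^ 2 + 2 * (r * w)))] at ve
  have bd := fun i => hA.toGoodW.h1_bounds hq hbA i
  have p := visc_nonneg (α := α) hε 2
  have s0 : visc ε α 2 * ∑ i : Fin 2, l2 (boxMeas L₁ L₂) (fun x => DA x i.castSucc 2) ^ 2 ≤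
      visc ε α 2 * (2 * q ^ 2) := by
    refine mul_le_mul_of_nonneg_left ?_ p
    rw [Fin.sum_univ_two]
    have := pow_le_pow_left₀ l2_nonneg ((bd 0).2 2) 2
    have := pow_le_pow_left₀ l2_nonneg ((bd 1).2 2) 2
    linarith
  have s1 : ε ^ 2 * ∑ j : Fin 2, l2 (boxMeas L₁ L₂) (fun x => DA x 2 j.castSucc) ^ 2 ≤
      ε ^ 2 * (8 * P ^ 2) := by
    refine mul_le_mul_of_nonneg_left ?_ (sq_nonneg ε)
    rw [Fin.sum_univ_two]
    have := pow_le_pow_left₀ l2_nonneg (hA.l2_vertical_grad_le h₁ h₂ hD2 0) 2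
    have := pow_le_pow_left₀ l2_nonneg (hA.l2_vertical_grad_le h₁ h₂ hD2 1) 2
    linarith
  have s2 : ε ^ 2 * visc ε α 2 * l2 (boxMeas L₁ L₂) (fun x => DA x 2 2) ^ 2 ≤
      ε ^ 2 * visc ε α 2 * (2 * q) ^ 2 := by
    gcongr
    · exact l2_nonneg
    · exact (hA.toGoodW.vertical_bounds h₁ h₂ hq hbA 2).2
  obtain ⟨g1, g2⟩ := hG P r w hP
  have g1' := mul_le_mul_of_nonneg_right g1 (sq_nonneg y)
  have g2' := mul_le_mul_of_nonneg_left g2 (sq_nonneg ε)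
  rw [Fin.sum_univ_two (f := fun i : Fin 2 => ∑ j, ∫ x, (b - B) x j * DA x i.castSucc j *
    (a - A) x i.castSucc ∂(boxMeas L₁ L₂))]
  linarith

end Young

/-! ### The relative energy inequality -/

section Relative

variable {L₁ L₂ T ε α : ℝ}

/-- The energy functional as a real number. -/
noncomputable def kinr (L₁ L₂ ε : ℝ) (u : E3 → E3) : ℝ :=
  ∑ i : Fin 3, wt ε i * l2 (boxMeas L₁ L₂) (fun x => u x i) ^ 2

lemma nsq_eq {f : E3 → ℝ} (hf : MemLp f 2 (boxMeas L₁ L₂)) :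
    nsq L₁ L₂ f = ENNReal.ofReal (l2 (boxMeas L₁ L₂) f ^ 2) := (ofReal_l2_sq hf).symm

lemma kin_eq {u : E3 → E3} (hu : ∀ i, MemLp (fun x => u x i) 2 (boxMeas L₁ L₂)) :
    kin L₁ L₂ ε u = ENNReal.ofReal (kinr L₁ L₂ ε u) := by
  unfold kin kinr
  rw [ENNReal.ofReal_sum_of_nonneg fun i _ => mul_nonneg (wt_nonneg ε i) (sq_nonneg _)]
  refine Finset.sum_congr rfl fun i _ => ?_
  rw [nsq_eq (hu i), ENNReal.ofReal_mul (wt_nonneg ε i)]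

lemma diss_eq (hε : 0 ≤ ε) {D : E3 → Fin 3 → Fin 3 → ℝ}
    (hD : ∀ i j, MemLp (fun x => D x i j) 2 (boxMeas L₁ L₂)) :
    diss L₁ L₂ ε α D = ENNReal.ofReal (dissr L₁ L₂ ε α D) := by
  unfold diss dissr
  have n : ∀ i j, 0 ≤ wt ε i * visc ε α j := fun i j =>
    mul_nonneg (wt_nonneg ε i) (visc_nonneg hε j)
  rw [ENNReal.ofReal_sum_of_nonneg fun i _ =>
    Finset.sum_nonneg fun j _ => mul_nonneg (n i j) (sq_nonneg _)]
  refine Finset.sum_congr rfl fun i _ => ?_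
  rw [ENNReal.ofReal_sum_of_nonneg fun j _ => mul_nonneg (n i j) (sq_nonneg _)]
  refine Finset.sum_congr rfl fun j _ => ?_
  rw [nsq_eq (hD i j), ENNReal.ofReal_mul (n i j)]

lemma kinr_nonneg (u : E3 → E3) : 0 ≤ kinr L₁ L₂ ε u :=
  Finset.sum_nonneg fun i _ => mul_nonneg (wt_nonneg ε i) (sq_nonneg _)

lemma dissr_nonneg (hε : 0 ≤ ε) (D : E3 → Fin 3 → Fin 3 → ℝ) : 0 ≤ dissr L₁ L₂ ε α D :=
  Finset.sum_nonneg fun i _ => Finset.sum_nonneg fun j _ =>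
    mul_nonneg (mul_nonneg (wt_nonneg ε i) (visc_nonneg hε j)) (sq_nonneg _)

lemma kinr_congr {u v : E3 → E3} (h : ∀ i, (fun x => u x i) =ᵐ[boxMeas L₁ L₂] fun x => v x i) :
    kinr L₁ L₂ ε u = kinr L₁ L₂ ε v := by
  unfold kinr
  simp only [fun i => l2_congr (h i)]

lemma kinr_sub {u v : E3 → E3} (hu : ∀ i, MemLp (fun x => u x i) 2 (boxMeas L₁ L₂))
    (hv : ∀ i, MemLp (fun x => v x i) 2 (boxMeas L₁ L₂)) :
    kinr L₁ L₂ ε (u - v) = kinr L₁ L₂ ε u - 2 * wpair L₁ L₂ ε u v + kinr L₁ L₂ ε v := by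
  unfold kinr wpair
  rw [Finset.mul_sum, ← Finset.sum_sub_distrib, ← Finset.sum_add_distrib]
  refine Finset.sum_congr rfl fun i _ => ?_
  have := two_mul_integral_mul (hu i) (hv i)
  simp only [Pi.sub_apply]
  linear_combination wt ε i * this

lemma kinr_eq (u : E3 → E3) : kinr L₁ L₂ ε u =
    ∑ i : Fin 2, l2 (boxMeas L₁ L₂) (fun x => u x i.castSucc) ^ 2 +
      ε ^ 2 * l2 (boxMeas L₁ L₂) (fun x => u x 2) ^ 2 := by
  unfold kinr
  simp [Fin.sum_univ_three, wt]

lemma integrable_dissr {D : ℝ → E3 → Fin 3 → Fin 3 → ℝ}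
    (hD : ∀ i j, InL2L2 L₁ L₂ T fun t x => D t x i j) :
    Integrable (fun t => dissr L₁ L₂ ε α (D t)) (volume.restrict (Ioo 0 T)) :=
  integrable_finsetSum _ fun i _ => integrable_finsetSum _ fun j _ =>
    (hD i j).integrable_l2_sq.const_mul _

lemma WeakField.integrable_dissr (W : WeakField L₁ L₂) (hT : 0 < T) :
    Integrable (fun t => dissr L₁ L₂ ε α (W.D t)) (volume.restrict (Ioo 0 T)) :=
  HydroMHD.integrable_dissr fun i j => (W.l2h1 T hT i).grad j

lemma lintegral_diss_eq (hε : 0 ≤ ε) {D : ℝ → E3 → Fin 3 → Fin 3 → ℝ}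
    (hD : ∀ i j, InL2L2 L₁ L₂ T fun t x => D t x i j) :
    ∫⁻ t in Ioo 0 T, diss L₁ L₂ ε α (D t) =
      ENNReal.ofReal (∫ t in Ioo 0 T, dissr L₁ L₂ ε α (D t)) := by
  rw [ofReal_integral_eq_lintegral_ofReal (integrable_dissr hD)
    (Eventually.of_forall fun _ => dissr_nonneg hε _)]
  refine lintegral_congr_ae ?_
  have : ∀ᵐ t ∂(volume.restrict (Ioo 0 T)), ∀ i j, MemLp (fun x => D t x i j) 2 (boxMeas L₁ L₂) :=
    ae_all_iff.2 fun i => ae_all_iff.2 fun j => (hD i j).slice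
  filter_upwards [this] with t ht
  exact diss_eq hε ht

variable {A₀ B₀ : InitialField L₁ L₂} {Aε Bε : WeakField L₁ L₂}

lemma lintegral_diss_add (hε : 0 ≤ ε) {D D' : ℝ → E3 → Fin 3 → Fin 3 → ℝ}
    (hD : ∀ i j, InL2L2 L₁ L₂ T fun t x => D t x i j)
    (hD' : ∀ i j, InL2L2 L₁ L₂ T fun t x => D' t x i j) :
    ∫⁻ t in Ioo 0 T, (diss L₁ L₂ ε α (D t) + diss L₁ L₂ ε α (D' t)) =
      ENNReal.ofReal (∫ t in Ioo 0 T, (dissr L₁ L₂ ε α (D t) + dissr L₁ L₂ ε α (D' t))) := by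
  rw [integral_add (integrable_dissr hD) (integrable_dissr hD'),
    ENNReal.ofReal_add (integral_nonneg fun _ => dissr_nonneg hε _)
      (integral_nonneg fun _ => dissr_nonneg hε _), ← lintegral_diss_eq hε hD,
    ← lintegral_diss_eq hε hD', lintegral_add_left']
  refine Finset.aemeasurable_fun_sum _ fun i _ => Finset.aemeasurable_fun_sum _ fun j _ => ?_
  exact (hD i j).meas.lintegral.const_mul _

/-- The energy inequality in terms of real numbers. -/
lemma EnergyInequality.real (hε : 0 ≤ ε) (h : IsLerayHopf ε α A₀ B₀ Aε Bε)
    (hE : EnergyInequality ε α A₀ B₀ Aε Bε) : ∀ᵐ t ∂(volume.restrict (Ioi (0 : ℝ))),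
    kinr L₁ L₂ ε (Aε.u t) + kinr L₁ L₂ ε (Bε.u t) +
      2 * (∫ s in Ioo 0 t, (dissr L₁ L₂ ε α (Aε.D s) + dissr L₁ L₂ ε α (Bε.D s))) ≤
      kinr L₁ L₂ ε (Aε.u 0) + kinr L₁ L₂ ε (Bε.u 0) := by
  filter_upwards [hE, ae_restrict_mem measurableSet_Ioi] with t ht t0
  have i1 : ∀ {u : E3 → E3} {v : E3 → E3}, u =ᵐ[boxMeas L₁ L₂] v → kin L₁ L₂ ε u = kin L₁ L₂ ε v := by
    intro u v huv
    unfold kin nsq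
    refine Finset.sum_congr rfl fun i _ => ?_
    congr 1
    exact lintegral_congr_ae (huv.mono fun x hx => by simp only [hx])
  rw [← i1 h.init_A, ← i1 h.init_B, kin_eq (Aε.sigma t t0.le).memLp, kin_eq (Bε.sigma t t0.le).memLp,
    kin_eq (Aε.sigma 0 le_rfl).memLp, kin_eq (Bε.sigma 0 le_rfl).memLp,
    lintegral_diss_add hε (fun i j => (Aε.l2h1 t t0 i).grad j) fun i j => (Bε.l2h1 t t0 i).grad j,
    ← ENNReal.ofReal_add (kinr_nonneg _) (kinr_nonneg _),
    ← ENNReal.ofReal_add (kinr_nonneg _) (kinr_nonneg _),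
    show (2 : ℝ≥0∞) = ENNReal.ofReal 2 by simp, ← ENNReal.ofReal_mul zero_le_two,
    ← ENNReal.ofReal_add (add_nonneg (kinr_nonneg _) (kinr_nonneg _))
      (mul_nonneg zero_le_two (integral_nonneg fun _ => add_nonneg (dissr_nonneg hε _)
        (dissr_nonneg hε _))),
    ENNReal.ofReal_le_ofReal_iff (add_nonneg (kinr_nonneg _) (kinr_nonneg _))] at ht
  exact ht

lemma sq_le_kinr (u : E3 → E3) (i : Fin 2) :
    l2 (boxMeas L₁ L₂) (fun x => u x i.castSucc) ^ 2 ≤ kinr L₁ L₂ ε u := by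
  rw [kinr_eq]
  have := Finset.single_le_sum (f := fun i : Fin 2 =>
    l2 (boxMeas L₁ L₂) (fun x => u x i.castSucc) ^ 2) (fun i _ => sq_nonneg _) (Finset.mem_univ i)
  have := mul_nonneg (sq_nonneg ε) (sq_nonneg (l2 (boxMeas L₁ L₂) (fun x => u x 2)))
  linarith

lemma vertical_sq_le_kinr (u : E3 → E3) :
    (ε * l2 (boxMeas L₁ L₂) (fun x => u x 2)) ^ 2 ≤ kinr L₁ L₂ ε u := by
  rw [kinr_eq, mul_pow]
  have : 0 ≤ ∑ i : Fin 2, l2 (boxMeas L₁ L₂) (fun x => u x i.castSucc) ^ 2 :=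
    Finset.sum_nonneg fun i _ => sq_nonneg _
  linarith

/-- The energy bound for almost every time. -/
lemma EnergyInequality.kinr_le (hε : 0 ≤ ε) (h : IsLerayHopf ε α A₀ B₀ Aε Bε)
    (hE : EnergyInequality ε α A₀ B₀ Aε Bε) : ∀ᵐ t ∂(volume.restrict (Ioo 0 T)),
    kinr L₁ L₂ ε (Aε.u t) + kinr L₁ L₂ ε (Bε.u t) ≤
      kinr L₁ L₂ ε (Aε.u 0) + kinr L₁ L₂ ε (Bε.u 0) := by
  filter_upwards [ae_restrict_of_ae_restrict_of_subset Ioo_subset_Ioi_self (hE.real hε h)] with t ht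
  have : 0 ≤ ∫ s in Ioo 0 t, (dissr L₁ L₂ ε α (Aε.D s) + dissr L₁ L₂ ε α (Bε.D s)) :=
    integral_nonneg fun _ => add_nonneg (dissr_nonneg hε _) (dissr_nonneg hε _)
  linarith

/-- The time `T` may be exceptional for the energy inequality. It is used at some later admissible
time, and the dissipation integral is monotone. -/
lemma EnergyInequality.integral_le (hε : 0 ≤ ε) (hT : 0 < T) (h : IsLerayHopf ε α A₀ B₀ Aε Bε)
    (hE : EnergyInequality ε α A₀ B₀ Aε Bε) :
    2 * (∫ s in Ioo 0 T, (dissr L₁ L₂ ε α (Aε.D s) + dissr L₁ L₂ ε α (Bε.D s))) ≤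
      kinr L₁ L₂ ε (Aε.u 0) + kinr L₁ L₂ ε (Bε.u 0) := by
  have h1 := ae_restrict_of_ae_restrict_of_subset (s := Ioi T) (Ioi_subset_Ioi hT.le) (hE.real hε h)
  have : (volume.restrict (Ioi T)) ≠ 0 := by simp [Measure.restrict_eq_zero]
  have : NeBot (ae (volume.restrict (Ioi T))) := ae_neBot.2 this
  obtain ⟨t, ht, tT⟩ := (h1.and (ae_restrict_mem measurableSet_Ioi)).exists
  have t0 : 0 < t := hT.trans tT
  have mono := setIntegral_mono_set (μ := volume) (s := Ioo 0 T) (t := Ioo 0 t)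
    (f := fun s => dissr L₁ L₂ ε α (Aε.D s) + dissr L₁ L₂ ε α (Bε.D s))
    ((Aε.integrable_dissr t0).add (Bε.integrable_dissr t0))
    (Eventually.of_forall fun _ => add_nonneg (dissr_nonneg hε _) (dissr_nonneg hε _))
    (LE.le.eventuallyLE (Ioo_subset_Ioo_right (le_of_lt tT)))
  have := kinr_nonneg (L₁ := L₁) (L₂ := L₂) (ε := ε) (Aε.u t)
  have := kinr_nonneg (L₁ := L₁) (L₂ := L₂) (ε := ε) (Bε.u t)
  linarith

/-- The bound degenerates as `ε → 0`. It serves only to guarantee integrability and never enters the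
constants of the estimate. -/
lemma EnergyInequality.boundedBy (hε : 0 < ε) (h : IsLerayHopf ε α A₀ B₀ Aε Bε)
    (hE : EnergyInequality ε α A₀ B₀ Aε Bε) : ∃ M, 0 ≤ M ∧ Aε.BoundedBy T M ∧ Bε.BoundedBy T M := by
  set E := kinr L₁ L₂ ε (Aε.u 0) + kinr L₁ L₂ ε (Bε.u 0) with hE'
  have key : ∀ u : E3 → E3, kinr L₁ L₂ ε u ≤ E →
      ∀ j, l2 (boxMeas L₁ L₂) (fun x => u x j) ≤ √E + √E / ε := by
    intro u hu j
    have n := Real.sqrt_nonneg E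
    have n' : 0 ≤ √E / ε := by positivity
    induction j using Fin.lastCases with
    | last =>
      have h1 := Real.le_sqrt_of_sq_le ((vertical_sq_le_kinr u).trans hu)
      have h2 : l2 (boxMeas L₁ L₂) (fun x => u x 2) ≤ √E / ε := by
        rw [le_div_iff₀ hε, mul_comm]; exact h1
      exact h2.trans (by linarith)
    | cast i =>
      exact (Real.le_sqrt_of_sq_le ((sq_le_kinr u i).trans hu)).trans (by linarith)
  refine ⟨√E + √E / ε, by positivity, ?_, ?_⟩
  · filter_upwards [hE.kinr_le (T := T) hε.le h] with t ht
    exact key _ (by have := kinr_nonneg (L₁ := L₁) (L₂ := L₂) (ε := ε) (Bε.u t); linarith)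
  · filter_upwards [hE.kinr_le (T := T) hε.le h] with t ht
    exact key _ (by have := kinr_nonneg (L₁ := L₁) (L₂ := L₂) (ε := ε) (Aε.u t); linarith)

lemma IsStrongPEHM.symm {A B : StrongField L₁ L₂ T} (h : IsStrongPEHM A₀ B₀ A B) :
    IsStrongPEHM B₀ A₀ B A where
  init_A := h.init_B
  init_B := h.init_A
  equations := by
    obtain ⟨p, Dp, hp, he⟩ := h.equations
    exact ⟨p, Dp, hp, he.mono fun q hq => ⟨hq.1, fun i => (hq.2 i).symm⟩⟩

lemma IsStrongPEHM.slice {A B : StrongField L₁ L₂ T} (h : IsStrongPEHM A₀ B₀ A B) :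
    ∀ᵐ t ∂(volume.restrict (Ioo 0 T)),
      SliceEquation L₁ L₂ (A.dt t) (B.u t) (A.D t) (A.D2 t) := by
  obtain ⟨p, Dp, hp, he⟩ := h.equations
  have h1 := Measure.ae_ae_of_ae_prod he
  have h2 : ∀ᵐ t ∂(volume.restrict (Ioo 0 T)), ∀ j, MemLp (fun x => Dp t x j) 2 (boxMeas L₁ L₂) :=
    ae_all_iff.2 fun j => (hp.grad j).slice
  filter_upwards [h1, h2, hp.weak] with t a b c
  exact ⟨p t, Dp t, b, c, a.mono fun x hx => ⟨hx.1, fun i => (hx.2 i).1⟩⟩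

/-- The initial values agree. -/
lemma init_eq (h₁ : 0 < L₁) (h₂ : 0 < L₂) (hT : 0 < T) {A B : StrongField L₁ L₂ T}
    (hs : IsStrongPEHM A₀ B₀ A B) (h : IsLerayHopf ε α A₀ B₀ Aε Bε) (i : Fin 3) :
    (fun x => Aε.u 0 x i) =ᵐ[boxMeas L₁ L₂] fun x => A.u 0 x i := by
  have h0 : (0 : ℝ) ∈ Ico 0 T := ⟨le_rfl, hT⟩
  have hh : ∀ i : Fin 2, (fun x => Aε.u 0 x i.castSucc) =ᵐ[boxMeas L₁ L₂]
      fun x => A.u 0 x i.castSucc := fun i => by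
    filter_upwards [h.init_A, hs.init_A i] with x a b
    rw [a, b]
  induction i using Fin.lastCases with
  | last =>
    exact vertical_unique h₁ h₂ (Aε.sigma 0 le_rfl) (A.sigma 0 h0) (fun x => (Aε.symm 0 le_rfl x).2)
      (fun x => (A.symm 0 h0 x).2) hh
  | cast i => exact hh i

lemma wpair_self {u v : E3 → E3} (h : ∀ i, (fun x => u x i) =ᵐ[boxMeas L₁ L₂] fun x => v x i) :
    wpair L₁ L₂ ε u v = kinr L₁ L₂ ε u := by
  unfold wpair kinr
  refine Finset.sum_congr rfl fun i _ => ?_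
  rw [l2_sq]
  congr 1
  refine integral_congr_ae ((h i).mono fun x hx => ?_)
  simp only [← (show u x i = v x i from hx)]; ring

/-- The contribution of one of the two velocities to the relative energy. -/
lemma relative_energy_half (h₁ : 0 < L₁) (h₂ : 0 < L₂) (hε : 0 ≤ ε) {A B : StrongField L₁ L₂ T}
    (hs : IsStrongPEHM A₀ B₀ A B) (h : IsLerayHopf ε α A₀ B₀ Aε Bε) {M q : ℝ}
    (hB : Bε.BoundedBy T M) (hq : 0 ≤ q) (hA : A.BoundedBy q) {t : ℝ} (ht : t ∈ Ico 0 T) :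
    kinr L₁ L₂ ε (Aε.u t - A.u t) ≤ kinr L₁ L₂ ε (Aε.u t) +
      2 * (∫ s in (0 : ℝ)..t, dissr L₁ L₂ ε α (Aε.D s)) - kinr L₁ L₂ ε (Aε.u 0) +
      ε ^ 2 * l2 (boxMeas L₁ L₂) (fun x => A.u t x 2) ^ 2 +
      ∫ s in (0 : ℝ)..t,
        relDensity L₁ L₂ ε α (A.dt s) (Aε.u s) (A.u s) (Bε.u s) (Aε.D s) (A.D s) := by
  have hT : 0 < T := ht.1.trans_lt ht.2
  have p := h.pair_strong h₁ h₂ hε A hB hq hA ht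
  have n := A.norm_eq h₁ h₂ ht
  have i0 := fun i => init_eq h₁ h₂ hT hs h i
  rw [wpair_self i0] at p
  have k0 := kinr_eq (L₁ := L₁) (L₂ := L₂) (ε := ε) (A.u 0)
  rw [← kinr_congr i0] at k0
  -- The initial energies agree including the vertical part, while the norm identity for the limit
  -- concerns only the horizontal part. The difference at time `0` has a favourable sign and is
  -- dropped.
  have v0 := mul_nonneg (sq_nonneg ε) (sq_nonneg (l2 (boxMeas L₁ L₂) (fun x => A.u 0 x 2)))
  have iv := intervalIntegrable_of_Ioo (integrable_vertRem hT Aε A) ht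
  have iw := intervalIntegrable_of_Ioo
    (integrable_wform_strong (α := α) (U := Aε) h₁ h₂ hε hT hB hq hA) ht
  have ia := intervalIntegrable_of_Ioo (integrable_dtPair A fun i => (Aε.l2h1 T hT i).val) ht
  have iA := intervalIntegrable_of_Ioo (integrable_dtPair A fun i => (A.l2h1 i).val) ht
  have id := intervalIntegrable_of_Ioo (Aε.integrable_dissr (ε := ε) (α := α) hT) ht
  have e : ∫ s in (0 : ℝ)..t,
      relDensity L₁ L₂ ε α (A.dt s) (Aε.u s) (A.u s) (Bε.u s) (Aε.D s) (A.D s) =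
      -2 * (∫ s in (0 : ℝ)..t, dissr L₁ L₂ ε α (Aε.D s)) -
      2 * (∫ s in (0 : ℝ)..t, (dtPair L₁ L₂ (A.dt s) (Aε.u s) -
        wform L₁ L₂ ε α (Bε.u s) (Aε.D s) (A.u s) (A.D s))) +
      (∫ s in (0 : ℝ)..t, 2 * dtPair L₁ L₂ (A.dt s) (A.u s)) +
      2 * (ε ^ 2 * (∫ s in (0 : ℝ)..t, vertRem L₁ L₂ (A.dt s) (Aε.D s))) := by
    rw [← intervalIntegral.integral_const_mul, ← intervalIntegral.integral_const_mul,
      ← intervalIntegral.integral_const_mul, ← intervalIntegral.integral_const_mul,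
      ← intervalIntegral.integral_sub (id.const_mul _) ((ia.sub iw).const_mul _),
      ← intervalIntegral.integral_add ((id.const_mul _).sub ((ia.sub iw).const_mul _))
        (iA.const_mul 2),
      ← intervalIntegral.integral_add (((id.const_mul _).sub ((ia.sub iw).const_mul _)).add
        (iA.const_mul 2)) ((iv.const_mul _).const_mul _)]
    refine intervalIntegral.integral_congr_ae ?_
    have sl : ∀ᵐ s ∂(volume.restrict (Ioo 0 T)), (∀ i, MemLp (fun x => A.dt s x i) 2 (boxMeas L₁ L₂)) ∧
        GoodW L₁ L₂ (Aε.u s) (Aε.D s) ∧ GoodS L₁ L₂ (A.u s) (A.D s) (A.D2 s) :=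
      (ae_all_iff.2 fun i => (A.l2_dt i).slice).and ((Aε.goodW hT).and A.goodS)
    rw [ae_restrict_iff' measurableSet_Ioo] at sl
    filter_upwards [sl] with s hs' hst
    rw [uIoc_of_le ht.1] at hst
    obtain ⟨m1, m2, m3⟩ := hs' ⟨hst.1, hst.2.trans_lt ht.2⟩
    have : dtPair L₁ L₂ (A.dt s) (Aε.u s - A.u s) =
        dtPair L₁ L₂ (A.dt s) (Aε.u s) - dtPair L₁ L₂ (A.dt s) (A.u s) := by
      unfold dtPair
      rw [← Finset.sum_sub_distrib]
      refine Finset.sum_congr rfl fun i _ => ?_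
      rw [← integral_sub (integrable_mul (m1 i) (m2.sigma.memLp _))
        (integrable_mul (m1 i) (m3.sigma.memLp _))]
      simp only [Pi.sub_apply, mul_sub]
    unfold relDensity
    rw [this]
    ring
  rw [kinr_sub (Aε.sigma t ht.1).memLp (A.sigma t ht).memLp, e, kinr_eq (A.u t), n]
  linarith

/-- The relative energy inequality, for almost every time. -/
theorem relative_energy (h₁ : 0 < L₁) (h₂ : 0 < L₂) (hε : 0 < ε) {A B : StrongField L₁ L₂ T}
    (hs : IsStrongPEHM A₀ B₀ A B) (h : IsLerayHopf ε α A₀ B₀ Aε Bε)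
    (hE : EnergyInequality ε α A₀ B₀ Aε Bε) {q : ℝ} (hq : 0 ≤ q) (hA : A.BoundedBy q)
    (hB : B.BoundedBy q) : ∀ᵐ t ∂(volume.restrict (Ioo 0 T)),
    kinr L₁ L₂ ε (Aε.u t - A.u t) + kinr L₁ L₂ ε (Bε.u t - B.u t) ≤ ε ^ 2 * (8 * q ^ 2) +
      ((∫ s in (0 : ℝ)..t,
        relDensity L₁ L₂ ε α (A.dt s) (Aε.u s) (A.u s) (Bε.u s) (Aε.D s) (A.D s)) +
      ∫ s in (0 : ℝ)..t,
        relDensity L₁ L₂ ε α (B.dt s) (Bε.u s) (B.u s) (Aε.u s) (Bε.D s) (B.D s)) := by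
  obtain ⟨M, M0, bA, bB⟩ := hE.boundedBy (T := T) hε h
  filter_upwards [ae_restrict_of_ae_restrict_of_subset Ioo_subset_Ioi_self (hE.real hε.le h),
    ae_restrict_mem measurableSet_Ioo, hA, hB, A.goodS, B.goodS] with t e ht qA qB gA gB
  have ht' : t ∈ Ico 0 T := ⟨ht.1.le, ht.2⟩
  have hT : 0 < T := ht.1.trans ht.2
  -- In the sum of both halves, the energies and the dissipation of the weak solution are removed by
  -- the energy inequality, which is available only for the pair. The two vertical terms of the
  -- limit, each at most `ε² (2 q)²`, give `8 q²`.
  have e1 := relative_energy_half h₁ h₂ hε.le hs h bB hq hA ht'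
  have e2 := relative_energy_half h₁ h₂ hε.le hs.symm h.symm bA hq hB ht'
  have vA := pow_le_pow_left₀ l2_nonneg (gA.toGoodW.vertical_bounds h₁ h₂ hq qA 2).1 2
  have vB := pow_le_pow_left₀ l2_nonneg (gB.toGoodW.vertical_bounds h₁ h₂ hq qB 2).1 2
  have vA' := mul_le_mul_of_nonneg_left vA (sq_nonneg ε)
  have vB' := mul_le_mul_of_nonneg_left vB (sq_nonneg ε)
  have idA := intervalIntegrable_of_Ioo (Aε.integrable_dissr (ε := ε) (α := α) hT) ht'
  have idB := intervalIntegrable_of_Ioo (Bε.integrable_dissr (ε := ε) (α := α) hT) ht'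
  rw [← integral_Ioc_eq_integral_Ioo, ← intervalIntegral.integral_of_le ht.1.le,
    intervalIntegral.integral_add idA idB] at e
  linarith

end Relative

/-! ### Gronwall's argument -/

section Closing

variable {L₁ L₂ T ε α : ℝ}

/-- The squared norm of the second derivatives and of the time derivative. -/
noncomputable def strongSq (L₁ L₂ : ℝ) (D2 : E3 → Fin 2 → Fin 2 → Fin 3 → ℝ)
    (dt : E3 → Fin 2 → ℝ) : ℝ :=
  (∑ i, ∑ j, ∑ k, l2 (boxMeas L₁ L₂) (fun x => D2 x i j k) ^ 2) +
    ∑ i, l2 (boxMeas L₁ L₂) (fun x => dt x i) ^ 2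

lemma strongSq_nonneg (D2 : E3 → Fin 2 → Fin 2 → Fin 3 → ℝ) (dt : E3 → Fin 2 → ℝ) :
    0 ≤ strongSq L₁ L₂ D2 dt := by
  unfold strongSq; positivity

lemma l2_D2_le (D2 : E3 → Fin 2 → Fin 2 → Fin 3 → ℝ) (dt : E3 → Fin 2 → ℝ) (i j : Fin 2)
    (k : Fin 3) : l2 (boxMeas L₁ L₂) (fun x => D2 x i j k) ^ 2 ≤ strongSq L₁ L₂ D2 dt := by
  have h1 := Finset.single_le_sum (f := fun k => l2 (boxMeas L₁ L₂) (fun x => D2 x i j k) ^ 2)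
    (fun _ _ => sq_nonneg _) (Finset.mem_univ k)
  have h2 := Finset.single_le_sum (f := fun j => ∑ k, l2 (boxMeas L₁ L₂) (fun x => D2 x i j k) ^ 2)
    (fun _ _ => by positivity) (Finset.mem_univ j)
  have h3 := Finset.single_le_sum
    (f := fun i => ∑ j, ∑ k, l2 (boxMeas L₁ L₂) (fun x => D2 x i j k) ^ 2)
    (fun _ _ => by positivity) (Finset.mem_univ i)
  have h4 : 0 ≤ ∑ i, l2 (boxMeas L₁ L₂) (fun x => dt x i) ^ 2 := by positivity
  unfold strongSq
  linarith

lemma l2_dt_le (D2 : E3 → Fin 2 → Fin 2 → Fin 3 → ℝ) (dt : E3 → Fin 2 → ℝ) (i : Fin 2) :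
    l2 (boxMeas L₁ L₂) (fun x => dt x i) ^ 2 ≤ strongSq L₁ L₂ D2 dt := by
  have h1 := Finset.single_le_sum (f := fun i => l2 (boxMeas L₁ L₂) (fun x => dt x i) ^ 2)
    (fun _ _ => sq_nonneg _) (Finset.mem_univ i)
  have h4 : 0 ≤ ∑ i, ∑ j, ∑ k, l2 (boxMeas L₁ L₂) (fun x => D2 x i j k) ^ 2 := by positivity
  unfold strongSq
  linarith

/-- The horizontal part of the dissipation of the horizontal components. -/
noncomputable def horSq (L₁ L₂ : ℝ) (D : E3 → Fin 3 → Fin 3 → ℝ) : ℝ :=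
  ∑ i : Fin 2, ∑ j : Fin 2, l2 (boxMeas L₁ L₂) (fun x => D x i.castSucc j.castSucc) ^ 2

/-- The horizontal part of the dissipation of the vertical component. -/
noncomputable def verSq (L₁ L₂ ε : ℝ) (D : E3 → Fin 3 → Fin 3 → ℝ) : ℝ :=
  ∑ j : Fin 2, (ε * l2 (boxMeas L₁ L₂) (fun x => D x 2 j.castSucc)) ^ 2

lemma horSq_nonneg (D : E3 → Fin 3 → Fin 3 → ℝ) : 0 ≤ horSq L₁ L₂ D := by
  unfold horSq; positivity

lemma verSq_nonneg (D : E3 → Fin 3 → Fin 3 → ℝ) : 0 ≤ verSq L₁ L₂ ε D := by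
  unfold verSq; positivity

lemma dissr_eq (D : E3 → Fin 3 → Fin 3 → ℝ) : dissr L₁ L₂ ε α D = horSq L₁ L₂ D + verSq L₁ L₂ ε D +
    visc ε α 2 * (∑ i : Fin 2, l2 (boxMeas L₁ L₂) (fun x => D x i.castSucc 2) ^ 2 +
      ε ^ 2 * l2 (boxMeas L₁ L₂) (fun x => D x 2 2) ^ 2) := by
  have w0 : wt ε 0 = 1 := by simp [wt]
  have w1 : wt ε 1 = 1 := by simp [wt]
  have w2 : wt ε 2 = ε ^ 2 := by simp [wt]
  have s0 : visc ε α 0 = 1 := by simp [visc]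
  have s1 : visc ε α 1 = 1 := by simp [visc]
  unfold dissr horSq verSq
  simp only [Fin.sum_univ_three, Fin.sum_univ_two, Fin.castSucc_zero, Fin.castSucc_one, w0, w1, w2,
    s0, s1]
  ring

lemma horSq_add_verSq_le (hε : 0 ≤ ε) (D : E3 → Fin 3 → Fin 3 → ℝ) :
    horSq L₁ L₂ D + verSq L₁ L₂ ε D ≤ dissr L₁ L₂ ε α D := by
  rw [dissr_eq]
  have := visc_nonneg (α := α) hε 2
  have : 0 ≤ visc ε α 2 * (∑ i : Fin 2, l2 (boxMeas L₁ L₂) (fun x => D x i.castSucc 2) ^ 2 +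
      ε ^ 2 * l2 (boxMeas L₁ L₂) (fun x => D x 2 2) ^ 2) := by positivity
  linarith

lemma l2_le_horSq (D : E3 → Fin 3 → Fin 3 → ℝ) (i j : Fin 2) :
    l2 (boxMeas L₁ L₂) (fun x => D x i.castSucc j.castSucc) ^ 2 ≤ horSq L₁ L₂ D := by
  have h1 := Finset.single_le_sum
    (f := fun j : Fin 2 => l2 (boxMeas L₁ L₂) (fun x => D x i.castSucc j.castSucc) ^ 2)
    (fun _ _ => sq_nonneg _) (Finset.mem_univ j)
  have h2 := Finset.single_le_sum (f := fun i : Fin 2 => ∑ j : Fin 2,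
      l2 (boxMeas L₁ L₂) (fun x => D x i.castSucc j.castSucc) ^ 2)
    (fun _ _ => by positivity) (Finset.mem_univ i)
  exact h1.trans h2

lemma l2_le_verSq (D : E3 → Fin 3 → Fin 3 → ℝ) (j : Fin 2) :
    (ε * l2 (boxMeas L₁ L₂) (fun x => D x 2 j.castSucc)) ^ 2 ≤ verSq L₁ L₂ ε D :=
  Finset.single_le_sum (f := fun j : Fin 2 =>
    (ε * l2 (boxMeas L₁ L₂) (fun x => D x 2 j.castSucc)) ^ 2)
    (fun _ _ => sq_nonneg _) (Finset.mem_univ j)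

/-- The source terms in the differential inequality for the relative energy. -/
noncomputable def source (ε α G q E p d : ℝ) : ℝ :=
  ε ^ 2 * (G * (1 + p + (1 + E) * d + E ^ 2)) + (4 + 8 * ε ^ 2) * (visc ε α 2 * q ^ 2)

/-- The fractions `1/4` of the squared error gradients occur once for each equation, so together
they consume at most half of the dissipation. The remaining terms are linear in the quantities that
are integrable in time: `p` from the strong solution and `d` from the energy inequality. -/
theorem exists_relDensity_add_le (h₁ : 0 < L₁) (h₂ : 0 < L₂) {q : ℝ} (hq : 0 ≤ q) :
    ∃ G, 0 ≤ G ∧ ∀ (ε α E : ℝ) (A B a b : E3 → E3) (DA DB Da Db : E3 → Fin 3 → Fin 3 → ℝ)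
      (D2A D2B : E3 → Fin 2 → Fin 2 → Fin 3 → ℝ) (dtA dtB : E3 → Fin 2 → ℝ),
      0 ≤ ε → GoodW L₁ L₂ a Da → GoodW L₁ L₂ b Db → GoodS L₁ L₂ A DA D2A →
      GoodS L₁ L₂ B DB D2B → SliceEquation L₁ L₂ dtA B DA D2A →
      SliceEquation L₁ L₂ dtB A DB D2B → h1sq L₁ L₂ A DA ≤ ENNReal.ofReal (q ^ 2) →
      h1sq L₁ L₂ B DB ≤ ENNReal.ofReal (q ^ 2) → kinr L₁ L₂ ε a + kinr L₁ L₂ ε b ≤ E →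
      relDensity L₁ L₂ ε α dtA a A b Da DA + relDensity L₁ L₂ ε α dtB b B a Db DB ≤
        -((dissr L₁ L₂ ε α (Da - DA) + dissr L₁ L₂ ε α (Db - DB)) / 2) +
        G * (1 + (strongSq L₁ L₂ D2A dtA + strongSq L₁ L₂ D2B dtB)) *
          (kinr L₁ L₂ ε (a - A) + kinr L₁ L₂ ε (b - B)) +
        source ε α G q E (strongSq L₁ L₂ D2A dtA + strongSq L₁ L₂ D2B dtB)
          (dissr L₁ L₂ ε α Da + dissr L₁ L₂ ε α Db) := by
  obtain ⟨G, G0, hG⟩ := exists_relDensity_le h₁ h₂ hq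
  refine ⟨2 * G, by positivity, fun ε α E A B a b DA DB Da Db D2A D2B dtA dtB hε ha hb hA hB hdA hdB
    qA qB hE => ?_⟩
  set p := strongSq L₁ L₂ D2A dtA + strongSq L₁ L₂ D2B dtB with hp
  set d := dissr L₁ L₂ ε α Da + dissr L₁ L₂ ε α Db with hd
  set Y := kinr L₁ L₂ ε (a - A) + kinr L₁ L₂ ε (b - B) with hY
  set X := horSq L₁ L₂ (Da - DA) + horSq L₁ L₂ (Db - DB) with hX
  set Z := verSq L₁ L₂ ε (Da - DA) + verSq L₁ L₂ ε (Db - DB) with hZ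
  have nA := strongSq_nonneg (L₁ := L₁) (L₂ := L₂) D2A dtA
  have nB := strongSq_nonneg (L₁ := L₁) (L₂ := L₂) D2B dtB
  have dA := dissr_nonneg (L₁ := L₁) (L₂ := L₂) (α := α) hε Da
  have dB := dissr_nonneg (L₁ := L₁) (L₂ := L₂) (α := α) hε Db
  have kA := kinr_nonneg (L₁ := L₁) (L₂ := L₂) (ε := ε) (a - A)
  have kB := kinr_nonneg (L₁ := L₁) (L₂ := L₂) (ε := ε) (b - B)
  have ka := kinr_nonneg (L₁ := L₁) (L₂ := L₂) (ε := ε) a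
  have kb := kinr_nonneg (L₁ := L₁) (L₂ := L₂) (ε := ε) b
  have xA := horSq_nonneg (L₁ := L₁) (L₂ := L₂) (Da - DA)
  have xB := horSq_nonneg (L₁ := L₁) (L₂ := L₂) (Db - DB)
  have zA := verSq_nonneg (L₁ := L₁) (L₂ := L₂) (ε := ε) (Da - DA)
  have zB := verSq_nonneg (L₁ := L₁) (L₂ := L₂) (ε := ε) (Db - DB)
  have fa := horSq_add_verSq_le (L₁ := L₁) (L₂ := L₂) (α := α) hε Da
  have fb := horSq_add_verSq_le (L₁ := L₁) (L₂ := L₂) (α := α) hε Db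
  have ga := horSq_nonneg (L₁ := L₁) (L₂ := L₂) Da
  have gb := horSq_nonneg (L₁ := L₁) (L₂ := L₂) Db
  have la := verSq_nonneg (L₁ := L₁) (L₂ := L₂) (ε := ε) Da
  have lb := verSq_nonneg (L₁ := L₁) (L₂ := L₂) (ε := ε) Db
  have E0 : 0 ≤ E := by linarith
  have s : ∀ {u v : ℝ}, u ^ 2 ≤ v → u ≤ √v := fun h => Real.le_sqrt_of_sq_le h
  -- All bounds are square roots of quantities summed over both velocities, so the same values serve
  -- in both equations.
  have e1 := hG ε α A B a b DA DB Da Db D2A D2B dtA (√p) (√E) (√d) (√X) (√Y) (√Z) hε ha hb hA hB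
    hdA (Real.sqrt_nonneg _) (Real.sqrt_nonneg _) (Real.sqrt_nonneg _) qA
    (fun i j k => s ((l2_D2_le D2A dtA i j k).trans (by linarith)))
    (fun i => s ((l2_dt_le D2A dtA i).trans (by linarith)))
    (fun i j => s ((l2_le_horSq _ i j).trans (by linarith)))
    (fun i j => s ((l2_le_horSq _ i j).trans (by linarith)))
    (fun i => s ((sq_le_kinr _ i).trans (by linarith)))
    (fun i => s ((sq_le_kinr _ i).trans (by linarith)))
    (fun j => s ((l2_le_verSq _ j).trans (by linarith)))
    (fun i => s ((sq_le_kinr (ε := ε) _ i).trans (by linarith)))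
    (s ((vertical_sq_le_kinr _).trans (by linarith)))
    (fun i j => s ((l2_le_horSq _ i j).trans (by linarith)))
    (fun j => s ((l2_le_verSq _ j).trans (by linarith)))
  have e2 := hG ε α B A b a DB DA Db Da D2B D2A dtB (√p) (√E) (√d) (√X) (√Y) (√Z) hε hb ha hB hA
    hdB (Real.sqrt_nonneg _) (Real.sqrt_nonneg _) (Real.sqrt_nonneg _) qB
    (fun i j k => s ((l2_D2_le D2B dtB i j k).trans (by linarith)))
    (fun i => s ((l2_dt_le D2B dtB i).trans (by linarith)))
    (fun i j => s ((l2_le_horSq _ i j).trans (by linarith)))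
    (fun i j => s ((l2_le_horSq _ i j).trans (by linarith)))
    (fun i => s ((sq_le_kinr _ i).trans (by linarith)))
    (fun i => s ((sq_le_kinr _ i).trans (by linarith)))
    (fun j => s ((l2_le_verSq _ j).trans (by linarith)))
    (fun i => s ((sq_le_kinr (ε := ε) _ i).trans (by linarith)))
    (s ((vertical_sq_le_kinr _).trans (by linarith)))
    (fun i j => s ((l2_le_horSq _ i j).trans (by linarith)))
    (fun j => s ((l2_le_verSq _ j).trans (by linarith)))
  have q4 : √E ^ 4 = E ^ 2 := by
    rw [show √E ^ 4 = (√E ^ 2) ^ 2 by ring, Real.sq_sqrt E0]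
  rw [Real.sq_sqrt (by positivity), Real.sq_sqrt (by positivity), Real.sq_sqrt (by positivity),
    Real.sq_sqrt (by positivity), Real.sq_sqrt (by positivity), Real.sq_sqrt (by positivity), q4]
    at e1 e2
  have f1 := horSq_add_verSq_le (L₁ := L₁) (L₂ := L₂) (α := α) hε (Da - DA)
  have f2 := horSq_add_verSq_le (L₁ := L₁) (L₂ := L₂) (α := α) hε (Db - DB)
  unfold source
  linarith

variable {A₀ B₀ : InitialField L₁ L₂} {Aε Bε : WeakField L₁ L₂} {A B : StrongField L₁ L₂ T}

lemma integrable_relDensity (h₁ : 0 < L₁) (h₂ : 0 < L₂) (hε : 0 ≤ ε) (hT : 0 < T) {M q : ℝ}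
    (hB : Bε.BoundedBy T M) (hq : 0 ≤ q) (hA : A.BoundedBy q) :
    Integrable (fun s => relDensity L₁ L₂ ε α (A.dt s) (Aε.u s) (A.u s) (Bε.u s) (Aε.D s) (A.D s))
      (volume.restrict (Ioo 0 T)) :=
  ((((Aε.integrable_dissr hT).const_mul _).sub ((integrable_dtPair A (u := fun s => Aε.u s - A.u s)
    fun i => (Aε.l2h1 T hT i).val.sub (A.l2h1 i).val).const_mul _)).add
    ((integrable_wform_strong h₁ h₂ hε hT hB hq hA).const_mul _)).add
    ((integrable_vertRem hT Aε A).const_mul _)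

lemma StrongField.integrable_strongSq (A : StrongField L₁ L₂ T) :
    Integrable (fun s => strongSq L₁ L₂ (A.D2 s) (A.dt s)) (volume.restrict (Ioo 0 T)) :=
  (integrable_finsetSum _ fun i _ => integrable_finsetSum _ fun j _ => integrable_finsetSum _
    fun k _ => ((A.l2h1_horizontal i j).grad k).integrable_l2_sq).add
    (integrable_finsetSum _ fun i _ => (A.l2_dt i).integrable_l2_sq)

/-- This is used only qualitatively: it makes the product of the Grönwall coefficient with the
relative energy integrable. -/
lemma ae_kinr_sub_le {M q : ℝ} (hM : Aε.BoundedBy T M) (h₁ : 0 < L₁) (h₂ : 0 < L₂)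
    (hq : 0 ≤ q) (hA : A.BoundedBy q) : ∀ᵐ s ∂(volume.restrict (Ioo 0 T)),
      kinr L₁ L₂ ε (Aε.u s - A.u s) ≤ ∑ i, wt ε i * (M + 2 * q) ^ 2 := by
  filter_upwards [hM, hA, A.goodS, ae_restrict_mem measurableSet_Ioo] with s m b g hs
  refine Finset.sum_le_sum fun i _ => mul_le_mul_of_nonneg_left ?_ (wt_nonneg ε i)
  refine pow_le_pow_left₀ l2_nonneg ?_ 2
  refine (l2_sub_le ((Aε.sigma s hs.1.le).memLp i) (g.sigma.memLp i)).trans ?_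
  exact add_le_add (m i) (g.toGoodW.vertical_bounds h₁ h₂ hq b i).1

lemma aestronglyMeasurable_kinr_sub (hT : 0 < T) :
    AEStronglyMeasurable (fun s => kinr L₁ L₂ ε (Aε.u s - A.u s)) (volume.restrict (Ioo 0 T)) := by
  unfold kinr
  exact Finset.aestronglyMeasurable_fun_sum _ fun i _ =>
    ((((Aε.l2h1 T hT i).val.sub (A.l2h1 i).val).meas.l2).pow 2).const_mul _

/-- The estimate of the error for almost every time. -/
theorem exists_error_ae_le (h₁ : 0 < L₁) (h₂ : 0 < L₂) {q : ℝ} (hq : 0 ≤ q) :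
    ∃ G, 0 ≤ G ∧ ∀ (ε α T K : ℝ) (A₀ B₀ : InitialField L₁ L₂) (A B : StrongField L₁ L₂ T)
      (Aε Bε : WeakField L₁ L₂), 0 < ε → 0 < T → IsStrongPEHM A₀ B₀ A B →
      IsLerayHopf ε α A₀ B₀ Aε Bε → EnergyInequality ε α A₀ B₀ Aε Bε →
      A.BoundedBy q → B.BoundedBy q →
      ∫ s in Ioo 0 T, (strongSq L₁ L₂ (A.D2 s) (A.dt s) + strongSq L₁ L₂ (B.D2 s) (B.dt s)) ≤ K →
      ∀ᵐ t ∂(volume.restrict (Ioo 0 T)),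
        kinr L₁ L₂ ε (Aε.u t - A.u t) + kinr L₁ L₂ ε (Bε.u t - B.u t) +
          (∫ s in (0 : ℝ)..t, (dissr L₁ L₂ ε α (Aε.D s - A.D s) +
            dissr L₁ L₂ ε α (Bε.D s - B.D s))) / 2 ≤
        (ε ^ 2 * (8 * q ^ 2) + T * source ε α G q
          (kinr L₁ L₂ ε (Aε.u 0) + kinr L₁ L₂ ε (Bε.u 0)) (K / T)
          ((kinr L₁ L₂ ε (Aε.u 0) + kinr L₁ L₂ ε (Bε.u 0)) / T)) *
          Real.exp (G * (T + K)) := by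
  obtain ⟨G, G0, hG⟩ := exists_relDensity_add_le h₁ h₂ hq
  refine ⟨G, G0, fun ε α T K A₀ B₀ A B Aε Bε hε hT hs h hE hA hB hK => ?_⟩
  obtain ⟨M, M0, bA, bB⟩ := hE.boundedBy (T := T) hε h
  set E := kinr L₁ L₂ ε (Aε.u 0) + kinr L₁ L₂ ε (Bε.u 0) with hEdef
  have E0 : 0 ≤ E := add_nonneg (kinr_nonneg _) (kinr_nonneg _)
  set p : ℝ → ℝ := fun s => strongSq L₁ L₂ (A.D2 s) (A.dt s) + strongSq L₁ L₂ (B.D2 s) (B.dt s)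
  set w : ℝ → ℝ := fun s => dissr L₁ L₂ ε α (Aε.D s) + dissr L₁ L₂ ε α (Bε.D s)
  set d : ℝ → ℝ := fun s => dissr L₁ L₂ ε α (Aε.D s - A.D s) + dissr L₁ L₂ ε α (Bε.D s - B.D s)
  set Y : ℝ → ℝ := fun s => kinr L₁ L₂ ε (Aε.u s - A.u s) + kinr L₁ L₂ ε (Bε.u s - B.u s)
  set g : ℝ → ℝ := fun s => G * (1 + p s)
  set f : ℝ → ℝ := fun s => source ε α G q E (p s) (w s)
  set R : ℝ → ℝ := fun s =>
    relDensity L₁ L₂ ε α (A.dt s) (Aε.u s) (A.u s) (Bε.u s) (Aε.D s) (A.D s)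
  set R' : ℝ → ℝ := fun s =>
    relDensity L₁ L₂ ε α (B.dt s) (Bε.u s) (B.u s) (Aε.u s) (Bε.D s) (B.D s)
  have p0 : ∀ s, 0 ≤ p s := fun s => add_nonneg (strongSq_nonneg _ _) (strongSq_nonneg _ _)
  have w0 : ∀ s, 0 ≤ w s := fun s => add_nonneg (dissr_nonneg hε.le _) (dissr_nonneg hε.le _)
  have d0 : ∀ s, 0 ≤ d s := fun s => add_nonneg (dissr_nonneg hε.le _) (dissr_nonneg hε.le _)
  have Y0 : ∀ s, 0 ≤ Y s := fun s => add_nonneg (kinr_nonneg _) (kinr_nonneg _)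
  have g0 : ∀ s, 0 ≤ g s := fun s => mul_nonneg G0 (by have := p0 s; positivity)
  have v0 := visc_nonneg (α := α) hε.le 2
  have f0 : ∀ s, 0 ≤ f s := fun s => by
    have := p0 s; have := w0 s
    simp only [f, source]; positivity
  have ip : Integrable p (volume.restrict (Ioo 0 T)) := A.integrable_strongSq.add B.integrable_strongSq
  have iw : Integrable w (volume.restrict (Ioo 0 T)) :=
    (Aε.integrable_dissr hT).add (Bε.integrable_dissr hT)
  have idd : Integrable d (volume.restrict (Ioo 0 T)) :=
    (integrable_dissr fun i j => ((Aε.l2h1 T hT i).grad j).sub ((A.l2h1 i).grad j)).add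
      (integrable_dissr fun i j => ((Bε.l2h1 T hT i).grad j).sub ((B.l2h1 i).grad j))
  have ig : Integrable g (volume.restrict (Ioo 0 T)) :=
    ((integrable_const _).add ip).const_mul _
  have ifs : Integrable f (volume.restrict (Ioo 0 T)) :=
    (((((integrable_const _).add ip).add (iw.const_mul _)).add (integrable_const _)).const_mul
      _).const_mul _ |>.add (integrable_const _)
  have igY : Integrable (fun s => g s * Y s) (volume.restrict (Ioo 0 T)) := by
    refine ig.mul_bdd (c := ∑ i, wt ε i * (M + 2 * q) ^ 2 + ∑ i, wt ε i * (M + 2 * q) ^ 2)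
      ((aestronglyMeasurable_kinr_sub hT).add (aestronglyMeasurable_kinr_sub hT)) ?_
    filter_upwards [ae_kinr_sub_le (ε := ε) bA h₁ h₂ hq hA,
      ae_kinr_sub_le (ε := ε) bB h₁ h₂ hq hB] with s a b
    rw [Real.norm_eq_abs, abs_of_nonneg (Y0 s)]
    exact add_le_add a b
  have iR : Integrable R (volume.restrict (Ioo 0 T)) := integrable_relDensity h₁ h₂ hε.le hT bB hq hA
  have iR' : Integrable R' (volume.restrict (Ioo 0 T)) :=
    integrable_relDensity h₁ h₂ hε.le hT bA hq hB
  have dens : ∀ᵐ s ∂(volume.restrict (Ioo 0 T)), R s + R' s ≤ -(d s / 2) + g s * Y s + f s := by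
    filter_upwards [Aε.goodW hT, Bε.goodW hT, A.goodS, B.goodS, hs.slice, hs.symm.slice, hA, hB,
      hE.kinr_le (T := T) hε.le h] with s a b c e a' b' c' e' k
    exact hG ε α E _ _ _ _ _ _ _ _ _ _ _ _ hε.le a b c e a' b' c' e' k
  -- The source is affine and nondecreasing in its last two arguments, so its time integral is at
  -- most `T` times its value at the averages `K / T` and `E / T`.
  set F := ε ^ 2 * (8 * q ^ 2) + T * source ε α G q E (K / T) (E / T) with hF
  have iF : ε ^ 2 * (8 * q ^ 2) + ∫ s in Ioo 0 T, f s ≤ F := by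
    have iw' := hE.integral_le (α := α) hε.le hT h
    have wE : ∫ s in Ioo 0 T, w s ≤ E := by
      have : 0 ≤ ∫ s in Ioo 0 T, w s := integral_nonneg w0
      have : 2 * ∫ s in Ioo 0 T, w s ≤ E := iw'
      linarith
    have fe : ∫ s in Ioo 0 T, f s = ε ^ 2 * (G * (T + (∫ s in Ioo 0 T, p s) +
        (1 + E) * (∫ s in Ioo 0 T, w s) + E ^ 2 * T)) +
        (4 + 8 * ε ^ 2) * (visc ε α 2 * q ^ 2) * T := by
      simp only [f, source]
      rw [integral_add (by fun_prop) (by fun_prop), integral_const_mul, integral_const_mul,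
        integral_add (by fun_prop) (by fun_prop), integral_add (by fun_prop) (by fun_prop),
        integral_add (by fun_prop) (by fun_prop), integral_const_mul]
      simp [hT.le]
      ring
    have fe' : T * source ε α G q E (K / T) (E / T) = ε ^ 2 * (G * (T + K +
        (1 + E) * E + E ^ 2 * T)) + (4 + 8 * ε ^ 2) * (visc ε α 2 * q ^ 2) * T := by
      unfold source; field_simp
    rw [fe, hF, fe']
    gcongr
  have main : ∀ᵐ t ∂(volume.restrict (Ioo 0 T)),
      Y t + (∫ s in (0 : ℝ)..t, d s) / 2 ≤ F + ∫ s in (0 : ℝ)..t, g s * Y s := by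
    filter_upwards [relative_energy h₁ h₂ hε hs h hE hq hA hB, ae_restrict_mem measurableSet_Ioo]
      with t ht t0
    have ht' : t ∈ Ico 0 T := ⟨t0.1.le, t0.2⟩
    have jR := intervalIntegrable_of_Ioo iR ht'
    have jR' := intervalIntegrable_of_Ioo iR' ht'
    have jd := intervalIntegrable_of_Ioo idd ht'
    have jf := intervalIntegrable_of_Ioo ifs ht'
    have jgY := intervalIntegrable_of_Ioo igY ht'
    have jn : IntervalIntegrable (fun s => -(d s / 2)) volume 0 t := (jd.div_const 2).neg
    have e1 : (∫ s in (0 : ℝ)..t, R s) + ∫ s in (0 : ℝ)..t, R' s ≤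
        -((∫ s in (0 : ℝ)..t, d s) / 2) + (∫ s in (0 : ℝ)..t, g s * Y s) +
          ∫ s in (0 : ℝ)..t, f s := by
      rw [← intervalIntegral.integral_add jR jR', ← intervalIntegral.integral_div,
        ← intervalIntegral.integral_neg, ← intervalIntegral.integral_add jn jgY,
        ← intervalIntegral.integral_add (jn.add jgY) jf]
      refine intervalIntegral.integral_mono_ae_restrict t0.1.le (jR.add jR')
        ((jn.add jgY).add jf) ?_
      rw [← restrict_Ioo_eq_restrict_Icc]
      exact ae_restrict_of_ae_restrict_of_subset (Ioo_subset_Ioo_right t0.2.le) dens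
    have e2 : ∫ s in (0 : ℝ)..t, f s ≤ ∫ s in Ioo 0 T, f s := by
      rw [intervalIntegral.integral_of_le t0.1.le, integral_Ioc_eq_integral_Ioo]
      exact setIntegral_mono_set ifs (Eventually.of_forall f0)
        (LE.le.eventuallyLE (Ioo_subset_Ioo_right t0.2.le))
    have e3 : Y t ≤ _ := ht
    linarith
  have F0 : 0 ≤ F := by
    have : 0 ≤ ∫ s in Ioo 0 T, f s := integral_nonneg f0
    exact le_trans (by positivity) iF
  filter_upwards [main, ae_restrict_mem measurableSet_Ioo] with t ht t0
  have ht' : t ∈ Ico 0 T := ⟨t0.1.le, t0.2⟩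
  -- Grönwall is applied to the relative energy alone, after discarding the nonnegative dissipation
  -- integral. It bounds the right side of `ht`, on whose left side the dissipation is still
  -- present.
  have gr := gronwall t0.1.le (intervalIntegrable_of_Ioo ig ht') (intervalIntegrable_of_Ioo igY ht') g0
    (F := F) (y := Y) (by
      rw [ae_restrict_iff' measurableSet_Ioo] at main
      filter_upwards [main] with s hs' hst
      have := hs' ⟨hst.1, hst.2.trans t0.2⟩
      have : 0 ≤ ∫ r in (0 : ℝ)..s, d r :=
        intervalIntegral.integral_nonneg hst.1.le fun r _ => d0 r
      linarith)
  refine ht.trans (gr.trans (mul_le_mul_of_nonneg_left (Real.exp_le_exp.2 ?_) F0))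
  have e2 : ∫ s in (0 : ℝ)..t, g s ≤ ∫ s in Ioo 0 T, g s := by
    rw [intervalIntegral.integral_of_le t0.1.le, integral_Ioc_eq_integral_Ioo]
    exact setIntegral_mono_set ig (Eventually.of_forall g0)
      (LE.le.eventuallyLE (Ioo_subset_Ioo_right t0.2.le))
  refine e2.trans ?_
  simp only [g]
  rw [integral_const_mul, integral_add (by fun_prop) ip]
  refine mul_le_mul_of_nonneg_left ?_ G0
  simp [hT.le]
  exact hK

end Closing

/-! ### From almost every time to every time -/

section AllTimes

variable {L₁ L₂ T ε α : ℝ}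

/-- The continuous functions `max f c` and `c` agree almost everywhere, hence everywhere on the
interval. -/
lemma le_of_ae_le_Ico {f : ℝ → ℝ} {c : ℝ} (hf : ContinuousOn f (Ico 0 T))
    (h : ∀ᵐ t ∂(volume.restrict (Ioo 0 T)), f t ≤ c) {t : ℝ} (ht : t ∈ Ico 0 T) : f t ≤ c := by
  have := Measure.eqOn_Ico_of_ae_eq (μ := volume) (a := 0) (b := T) (f := fun t => max (f t) c)
    (g := fun _ => c) (by
      rw [← restrict_Ioo_eq_restrict_Ico]
      exact h.mono fun t ht => max_eq_right ht) (continuous_max.comp_continuousOn (hf.prodMk continuousOn_const)) continuousOn_const ht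
  exact max_eq_right_iff.1 this

lemma le_of_ae_le_Icc (hT : 0 < T) {f : ℝ → ℝ} {c : ℝ} (hf : ContinuousOn f (Icc 0 T))
    (h : ∀ᵐ t ∂(volume.restrict (Ioo 0 T)), f t ≤ c) {t : ℝ} (ht : t ∈ Icc 0 T) : f t ≤ c := by
  have := Measure.eqOn_Icc_of_ae_eq (μ := volume) hT.ne (f := fun t => max (f t) c)
    (g := fun _ => c) (by
      rw [← restrict_Ioo_eq_restrict_Icc]
      exact h.mono fun t ht => max_eq_right ht) (continuous_max.comp_continuousOn (hf.prodMk continuousOn_const)) continuousOn_const ht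
  exact max_eq_right_iff.1 this

lemma tendsto_bessel (h₁ : 0 < L₁) (h₂ : 0 < L₂) {f : E3 → ℝ} (hf : MemLp f 2 (boxMeas L₁ L₂)) :
    Tendsto (fun N => volInv L₁ L₂ * ∑ k ∈ freqs N, ∑ b : Bool, coef L₁ L₂ f k b ^ 2) atTop
      (𝓝 (l2 (boxMeas L₁ L₂) f ^ 2)) := by
  have t := tendsto_integral_mul hf (fun n => memLp_trunc n f 2) hf (tendsto_trunc h₁ h₂ hf)
  simp only [integral_trunc_mul hf, ← pow_two] at t
  rwa [l2_sq]

/-- A weighted sum of squared norms that is bounded at almost every time is bounded at every time if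
the Fourier coefficients are continuous in time. -/
lemma sum_sq_le_of_ae (h₁ : 0 < L₁) (h₂ : 0 < L₂) {ι : Type*} [Fintype ι] {c : ι → ℝ}
    (hc : ∀ i, 0 ≤ c i) {f : ι → ℝ → E3 → ℝ}
    (hf : ∀ i, ∀ t ∈ Ico 0 T, MemLp (f i t) 2 (boxMeas L₁ L₂))
    (hcont : ∀ i k b, ContinuousOn (fun t => coef L₁ L₂ (f i t) k b) (Ico 0 T)) {R : ℝ}
    (h : ∀ᵐ t ∂(volume.restrict (Ioo 0 T)), ∑ i, c i * l2 (boxMeas L₁ L₂) (f i t) ^ 2 ≤ R) {t : ℝ}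
    (ht : t ∈ Ico 0 T) : ∑ i, c i * l2 (boxMeas L₁ L₂) (f i t) ^ 2 ≤ R := by
  have lim := tendsto_finsetSum (Finset.univ : Finset ι) fun i _ =>
    (tendsto_bessel h₁ h₂ (hf i t ht)).const_mul (c i)
  -- For each `N` the truncated sum is continuous in time and is bounded almost everywhere by
  -- Bessel, hence at every time. Parseval then lets `N → ∞` at the given time.
  refine le_of_tendsto lim (Eventually.of_forall fun N => ?_)
  refine le_of_ae_le_Ico (f := fun t => ∑ i, c i * (volInv L₁ L₂ * ∑ k ∈ freqs N, ∑ b : Bool,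
    coef L₁ L₂ (f i t) k b ^ 2)) ?_ ?_ ht
  · exact continuousOn_finsetSum _ fun i _ => continuousOn_const.mul (continuousOn_const.mul
      (continuousOn_finsetSum _ fun k _ => continuousOn_finsetSum _ fun b _ => (hcont i k b).pow 2))
  · filter_upwards [h, ae_restrict_mem measurableSet_Ioo] with s hs hs'
    exact (Finset.sum_le_sum fun i _ => mul_le_mul_of_nonneg_left
      (bessel h₁ h₂ (hf i s ⟨hs'.1.le, hs'.2⟩) N) (hc i)).trans hs

/-- Continuity in time is assumed only for the horizontal part. The vertical coefficients inherit
it, being fixed linear combinations of the horizontal ones. -/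
lemma StrongField.continuousOn_coef_all (h₁ : 0 < L₁) (h₂ : 0 < L₂) (S : StrongField L₁ L₂ T)
    (i : Fin 3) (k : Fin 3 → ℤ) (b : Bool) :
    ContinuousOn (fun t => coef L₁ L₂ (fun x => S.u t x i) k b) (Ico 0 T) := by
  induction i using Fin.lastCases with
  | last =>
    have e : ∀ t ∈ Ico 0 T, coef L₁ L₂ (fun x => S.u t x 2) k b =
        vertCoef L₁ L₂ k fun i => coef L₁ L₂ (fun x => S.u t x i.castSucc) k b := fun t ht =>
      coef_vertical h₁ h₂ (S.sigma t ht) (fun x => (S.symm t ht x).2) k b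
    refine ContinuousOn.congr ?_ e
    unfold vertCoef
    split_ifs
    · exact continuousOn_const
    · exact (((continuousOn_const.mul (S.continuousOn_coef 0 k b)).add
        (continuousOn_const.mul (S.continuousOn_coef 1 k b))).neg).div_const _
  | cast i => exact S.continuousOn_coef i k b

lemma continuousOn_coef_sub (h₁ : 0 < L₁) (h₂ : 0 < L₂) (W : WeakField L₁ L₂)
    (S : StrongField L₁ L₂ T) (i : Fin 3) (k : Fin 3 → ℤ) (b : Bool) :
    ContinuousOn (fun t => coef L₁ L₂ (fun x => W.u t x i - S.u t x i) k b) (Ico 0 T) := by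
  refine ContinuousOn.congr (((W.weak_cont i _ (memLp_mode k b 2)).mono fun t ht => ht.1).sub
    (S.continuousOn_coef_all h₁ h₂ i k b)) fun t ht => ?_
  exact coef_sub ((W.sigma t ht.1).memLp i) ((S.sigma t ht).memLp i) k b

variable {Aε Bε : WeakField L₁ L₂} {A B : StrongField L₁ L₂ T}

lemma kinr_sub_le_of_ae (h₁ : 0 < L₁) (h₂ : 0 < L₂) {R : ℝ}
    (h : ∀ᵐ t ∂(volume.restrict (Ioo 0 T)),
      kinr L₁ L₂ ε (Aε.u t - A.u t) + kinr L₁ L₂ ε (Bε.u t - B.u t) ≤ R) {t : ℝ}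
    (ht : t ∈ Ico 0 T) :
    kinr L₁ L₂ ε (Aε.u t - A.u t) + kinr L₁ L₂ ε (Bε.u t - B.u t) ≤ R := by
  have key := sum_sq_le_of_ae (T := T) h₁ h₂ (ι := Fin 3 ⊕ Fin 3)
    (c := Sum.elim (wt ε) (wt ε)) (f := Sum.elim (fun i t x => Aε.u t x i - A.u t x i)
      fun i t x => Bε.u t x i - B.u t x i) (R := R)
    (by rintro (i | i) <;> exact wt_nonneg ε i)
    (by
      rintro (i | i) s hs
      · exact ((Aε.sigma s hs.1).memLp i).sub ((A.sigma s hs).memLp i)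
      · exact ((Bε.sigma s hs.1).memLp i).sub ((B.sigma s hs).memLp i))
    (by
      rintro (i | i) k b
      · exact continuousOn_coef_sub h₁ h₂ Aε A i k b
      · exact continuousOn_coef_sub h₁ h₂ Bε B i k b)
    (by simpa only [Fintype.sum_sum_type, Sum.elim_inl, Sum.elim_inr, kinr, Pi.sub_apply] using h) ht
  simpa only [Fintype.sum_sum_type, Sum.elim_inl, Sum.elim_inr, kinr, Pi.sub_apply] using key

lemma StrongField.l2_vertical_le (h₁ : 0 < L₁) (h₂ : 0 < L₂) {q : ℝ} (hq : 0 ≤ q)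
    (hA : A.BoundedBy q) {t : ℝ} (ht : t ∈ Ico 0 T) :
    l2 (boxMeas L₁ L₂) (fun x => A.u t x 2) ^ 2 ≤ (2 * q) ^ 2 := by
  have key := sum_sq_le_of_ae (T := T) h₁ h₂ (ι := Unit) (c := fun _ => 1)
    (f := fun _ t x => A.u t x 2) (R := (2 * q) ^ 2) (fun _ => zero_le_one)
    (fun _ s hs => (A.sigma s hs).memLp 2) (fun _ k b => A.continuousOn_coef_all h₁ h₂ 2 k b)
    (by
      filter_upwards [hA, A.goodS] with s b g
      simpa using pow_le_pow_left₀ l2_nonneg (g.toGoodW.vertical_bounds h₁ h₂ hq b 2).1 2) ht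
  simpa using key

/-- The supremum of the energy costs `R` and the full dissipation integral `2 R`, because only half
of it is present on the left; hence `3 R`. The energy part passes to every time through the Fourier
coefficients, the dissipation part through continuity of the primitive up to `T`. -/
lemma errorEnergy_le_of_ae (h₁ : 0 < L₁) (h₂ : 0 < L₂) (hε : 0 ≤ ε) (hT : 0 < T) {R : ℝ}
    (h : ∀ᵐ t ∂(volume.restrict (Ioo 0 T)),
      kinr L₁ L₂ ε (Aε.u t - A.u t) + kinr L₁ L₂ ε (Bε.u t - B.u t) +
        (∫ s in (0 : ℝ)..t, (dissr L₁ L₂ ε α (Aε.D s - A.D s) +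
          dissr L₁ L₂ ε α (Bε.D s - B.D s))) / 2 ≤ R) :
    errorEnergy ε α Aε Bε A B ≤ ENNReal.ofReal (3 * R) := by
  set d : ℝ → ℝ := fun s => dissr L₁ L₂ ε α (Aε.D s - A.D s) + dissr L₁ L₂ ε α (Bε.D s - B.D s)
  have d0 : ∀ s, 0 ≤ d s := fun s => add_nonneg (dissr_nonneg hε _) (dissr_nonneg hε _)
  have gA := fun i j => ((Aε.l2h1 T hT i).grad j).sub ((A.l2h1 i).grad j)
  have gB := fun i j => ((Bε.l2h1 T hT i).grad j).sub ((B.l2h1 i).grad j)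
  have idd : Integrable d (volume.restrict (Ioo 0 T)) :=
    (integrable_dissr gA).add (integrable_dissr gB)
  have hd0 : ∀ t, 0 ≤ t → 0 ≤ ∫ s in (0 : ℝ)..t, d s := fun t ht =>
    intervalIntegral.integral_nonneg ht fun s _ => d0 s
  have k0 := fun t => add_nonneg (kinr_nonneg (L₁ := L₁) (L₂ := L₂) (ε := ε) (Aε.u t - A.u t))
    (kinr_nonneg (L₁ := L₁) (L₂ := L₂) (ε := ε) (Bε.u t - B.u t))
  have hK : ∀ t ∈ Ico 0 T,
      kinr L₁ L₂ ε (Aε.u t - A.u t) + kinr L₁ L₂ ε (Bε.u t - B.u t) ≤ R := fun t ht =>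
    kinr_sub_le_of_ae h₁ h₂ (by
      filter_upwards [h, ae_restrict_mem measurableSet_Ioo] with s hs hs'
      have := hd0 s hs'.1.le
      simp only [d] at this
      linarith) ht
  have R0 : 0 ≤ R := (k0 0).trans (hK 0 ⟨le_rfl, hT⟩)
  have hI : ∫ s in Ioo 0 T, d s ≤ 2 * R := by
    have := le_of_ae_le_Icc hT (f := fun t => ∫ s in (0 : ℝ)..t, d s) (c := 2 * R) (by
      have := intervalIntegral.continuousOn_primitive_interval (a := 0) (b := T) (f := d)
        (μ := volume) (by
          rw [uIcc_of_le hT.le, integrableOn_Icc_iff_integrableOn_Ioo]; exact idd)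
      rwa [uIcc_of_le hT.le] at this) (by
        filter_upwards [h, ae_restrict_mem measurableSet_Ioo] with s hs hs'
        have := k0 s
        simp only [d]
        linarith) (right_mem_Icc.2 hT.le)
    simpa only [intervalIntegral.integral_of_le hT.le, integral_Ioc_eq_integral_Ioo] using this
  have e1 : ⨆ t ∈ Ico 0 T, (kin L₁ L₂ ε (Aε.u t - A.u t) + kin L₁ L₂ ε (Bε.u t - B.u t)) ≤
      ENNReal.ofReal R := by
    refine iSup₂_le fun t ht => ?_
    rw [kin_eq (u := Aε.u t - A.u t) fun i => ((Aε.sigma t ht.1).memLp i).sub ((A.sigma t ht).memLp i),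
      kin_eq (u := Bε.u t - B.u t) fun i => ((Bε.sigma t ht.1).memLp i).sub ((B.sigma t ht).memLp i),
      ← ENNReal.ofReal_add (kinr_nonneg _) (kinr_nonneg _)]
    exact ENNReal.ofReal_le_ofReal (hK t ht)
  have e2 : ∫⁻ t in Ioo 0 T, (diss L₁ L₂ ε α (Aε.D t - A.D t) + diss L₁ L₂ ε α (Bε.D t - B.D t)) ≤
      ENNReal.ofReal (2 * R) := by
    rw [lintegral_diss_add (D := fun t => Aε.D t - A.D t) (D' := fun t => Bε.D t - B.D t) hε gA gB]
    exact ENNReal.ofReal_le_ofReal hI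
  refine (add_le_add e1 e2).trans ?_
  rw [← ENNReal.ofReal_add R0 (by positivity)]
  exact ENNReal.ofReal_le_ofReal (by linarith)

/-! ### The norm of strong solutions -/

lemma boundedBy_of_strongNormSq {K : ℝ≥0} (hK : strongNormSq A B ≤ K) :
    A.BoundedBy (√K) ∧ B.BoundedBy (√K) := by
  have h1 : essSup (fun t => h1sq L₁ L₂ (A.u t) (A.D t) + h1sq L₁ L₂ (B.u t) (B.D t))
      (volume.restrict (Ioo 0 T)) ≤ K := le_self_add.trans hK
  have h2 := ENNReal.ae_le_essSup (μ := volume.restrict (Ioo 0 T))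
    (fun t => h1sq L₁ L₂ (A.u t) (A.D t) + h1sq L₁ L₂ (B.u t) (B.D t))
  have e : ENNReal.ofReal (√(K : ℝ) ^ 2) = K := by
    rw [Real.sq_sqrt K.coe_nonneg, ENNReal.ofReal_coe_nnreal]
  constructor
  · filter_upwards [h2] with t ht
    rw [e]; exact (le_self_add.trans ht).trans h1
  · filter_upwards [h2] with t ht
    rw [e]; exact (le_add_self.trans ht).trans h1

lemma integral_strongSq_le {K : ℝ≥0} (hK : strongNormSq A B ≤ K) :
    ∫ s in Ioo 0 T, (strongSq L₁ L₂ (A.D2 s) (A.dt s) + strongSq L₁ L₂ (B.D2 s) (B.dt s)) ≤ K := by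
  have n : ∀ s, 0 ≤ strongSq L₁ L₂ (A.D2 s) (A.dt s) + strongSq L₁ L₂ (B.D2 s) (B.dt s) :=
    fun s => add_nonneg (strongSq_nonneg _ _) (strongSq_nonneg _ _)
  have h1 := le_trans (le_add_of_nonneg_left (zero_le (a := essSup (fun t =>
    h1sq L₁ L₂ (A.u t) (A.D t) + h1sq L₁ L₂ (B.u t) (B.D t)) (volume.restrict (Ioo 0 T))))) hK
  rw [← ENNReal.ofReal_le_ofReal_iff K.coe_nonneg, ofReal_integral_eq_lintegral_ofReal
    (by exact A.integrable_strongSq.add B.integrable_strongSq) (Eventually.of_forall n)]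
  refine le_trans ?_ (h1.trans (ENNReal.ofReal_coe_nnreal (p := K)).ge)
  refine lintegral_mono_ae ?_
  have sl : ∀ S : StrongField L₁ L₂ T, ∀ᵐ t ∂(volume.restrict (Ioo 0 T)),
      ∀ i, MemLp (fun x => S.dt t x i) 2 (boxMeas L₁ L₂) := fun S =>
    ae_all_iff.2 fun i => (S.l2_dt i).slice
  have conv : ∀ (D2 : E3 → Fin 2 → Fin 2 → Fin 3 → ℝ) (dt : E3 → Fin 2 → ℝ),
      (∀ i j k, MemLp (fun x => D2 x i j k) 2 (boxMeas L₁ L₂)) →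
      (∀ i, MemLp (fun x => dt x i) 2 (boxMeas L₁ L₂)) →
      ENNReal.ofReal (strongSq L₁ L₂ D2 dt) =
        (∑ i, ∑ j, ∑ k, nsq L₁ L₂ (fun x => D2 x i j k)) + ∑ i, nsq L₁ L₂ (fun x => dt x i) := by
    intro D2 dt h h'
    simp only [nsq_eq (h _ _ _), nsq_eq (h' _)]
    unfold strongSq
    rw [ENNReal.ofReal_add (by positivity) (by positivity),
      ENNReal.ofReal_sum_of_nonneg fun _ _ => by positivity,
      ENNReal.ofReal_sum_of_nonneg fun _ _ => by positivity]
    congr 1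
    refine Finset.sum_congr rfl fun i _ => ?_
    rw [ENNReal.ofReal_sum_of_nonneg fun _ _ => by positivity]
    refine Finset.sum_congr rfl fun j _ => ?_
    rw [ENNReal.ofReal_sum_of_nonneg fun _ _ => by positivity]
  filter_upwards [sl A, sl B, A.goodS, B.goodS] with t a b gA gB
  rw [ENNReal.ofReal_add (strongSq_nonneg _ _) (strongSq_nonneg _ _), conv _ _ gA.memD2 a,
    conv _ _ gB.memD2 b]
  rw [add_add_add_comm, ← Finset.sum_add_distrib, ← Finset.sum_add_distrib, ← Finset.sum_add_distrib]
  refine Finset.sum_le_sum fun i _ => ?_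
  rw [← add_assoc, ← Finset.sum_add_distrib]
  gcongr ?_ + _ + _
  refine Finset.sum_le_sum fun j _ => ?_
  rw [← Finset.sum_add_distrib]
  exact le_add_self

end AllTimes

/-! ### The error estimate -/

section ErrorEstimate

variable {L₁ L₂ α : ℝ}

lemma rpow_le_mul_rpow_min {ε ε₀ p q : ℝ} (hε : 0 < ε) (h : ε ≤ ε₀) (hq : q ≤ p) :
    ε ^ p ≤ ε₀ ^ (p - q) * ε ^ q := by
  rw [show ε ^ p = ε ^ (p - q) * ε ^ q by rw [← Real.rpow_add hε]; ring_nf]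
  gcongr

/-- The initial energies. -/
noncomputable def dataSq (L₁ L₂ : ℝ) (a b : E3 → E3) : ℝ :=
  ∑ i : Fin 3, (l2 (boxMeas L₁ L₂) (fun x => a x i) ^ 2 + l2 (boxMeas L₁ L₂) (fun x => b x i) ^ 2)

lemma dataSq_nonneg (a b : E3 → E3) : 0 ≤ dataSq L₁ L₂ a b := by unfold dataSq; positivity

lemma kinr_le_dataSq {ε ε₀ : ℝ} (hε : 0 ≤ ε) (h : ε ≤ ε₀) (a b : E3 → E3) :
    kinr L₁ L₂ ε a + kinr L₁ L₂ ε b ≤ (1 + ε₀ ^ 2) * dataSq L₁ L₂ a b := by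
  unfold kinr dataSq
  rw [← Finset.sum_add_distrib, Finset.mul_sum]
  refine Finset.sum_le_sum fun i _ => ?_
  have hw : wt ε i ≤ 1 + ε₀ ^ 2 := by
    have : ε ^ 2 ≤ ε₀ ^ 2 := by gcongr
    have := sq_nonneg ε₀
    fin_cases i <;> simp [wt] <;> linarith
  have p1 := sq_nonneg (l2 (boxMeas L₁ L₂) (fun x => a x i))
  have p2 := sq_nonneg (l2 (boxMeas L₁ L₂) (fun x => b x i))
  rw [← mul_add]
  gcongr

lemma sum_nsq_eq {A₀ B₀ : InitialField L₁ L₂} {Aε Bε : WeakField L₁ L₂} {ε : ℝ}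
    (h : IsLerayHopf ε α A₀ B₀ Aε Bε) :
    ∑ i : Fin 3, (nsq L₁ L₂ (fun x => A₀.u x i) + nsq L₁ L₂ (fun x => B₀.u x i)) =
      ENNReal.ofReal (dataSq L₁ L₂ (Aε.u 0) (Bε.u 0)) := by
  have i1 : ∀ {u v : E3 → E3}, u =ᵐ[boxMeas L₁ L₂] v → ∀ i,
      nsq L₁ L₂ (fun x => u x i) = nsq L₁ L₂ (fun x => v x i) := fun huv i =>
    lintegral_congr_ae (huv.mono fun x hx => by simp only [hx])
  unfold dataSq
  rw [ENNReal.ofReal_sum_of_nonneg fun _ _ => by positivity]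
  refine Finset.sum_congr rfl fun i _ => ?_
  rw [← i1 h.init_A i, ← i1 h.init_B i, nsq_eq ((Aε.sigma 0 le_rfl).memLp i),
    nsq_eq ((Bε.sigma 0 le_rfl).memLp i), ENNReal.ofReal_add (sq_nonneg _) (sq_nonneg _)]

/-- Both small parameters are at most `m ε^γ`. Since `E` is at most linear in the data `s`, every
other term is bounded by a constant times `(T + 1) (1 + s²)`. -/
lemma source_bound {ε ε₀ α T K G E s γ m : ℝ} (hT : 0 < T) (hK : 0 ≤ K)
    (hG : 0 ≤ G) (hE : 0 ≤ E) (hEs : E ≤ (1 + ε₀ ^ 2) * s) (hεε₀ : ε ^ 2 ≤ ε₀ ^ 2)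
    (h2 : ε ^ 2 ≤ m * ε ^ γ) (hv0 : 0 ≤ visc ε α 2)
    (hv : visc ε α 2 ≤ m * ε ^ γ) (hγ : 0 ≤ m * ε ^ γ) :
    ε ^ 2 * (8 * √K ^ 2) + T * source ε α G (√K) E (K / T) (E / T) ≤
      m * ε ^ γ * ((8 * K + G * (2 + K + 3 * (1 + ε₀ ^ 2) ^ 2) + (4 + 8 * ε₀ ^ 2) * K) *
        ((T + 1) * (1 + s ^ 2))) := by
  have e : T * source ε α G (√K) E (K / T) (E / T) = ε ^ 2 * (G * (T + K + (1 + E) * E + E ^ 2 * T)) +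
      (4 + 8 * ε ^ 2) * (visc ε α 2 * √K ^ 2) * T := by
    unfold source; field_simp
  rw [e, Real.sq_sqrt hK]
  have hE2 : E ^ 2 ≤ (1 + ε₀ ^ 2) ^ 2 * s ^ 2 := by rw [← mul_pow]; gcongr
  set c := (1 + ε₀ ^ 2) ^ 2
  have c0 : 0 ≤ c := by positivity
  set Q := (T + 1) * (1 + s ^ 2) with hQ
  have q1 : 1 ≤ Q := by nlinarith [sq_nonneg s, mul_nonneg hT.le (sq_nonneg s)]
  have qT : T ≤ Q := by nlinarith [sq_nonneg s, mul_nonneg hT.le (sq_nonneg s)]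
  have qs : s ^ 2 ≤ Q := by nlinarith [sq_nonneg s, mul_nonneg hT.le (sq_nonneg s)]
  have qsT : s ^ 2 * T ≤ Q := by nlinarith [sq_nonneg s, mul_nonneg hT.le (sq_nonneg s)]
  have b1 : T + K + (1 + E) * E + E ^ 2 * T ≤ (2 + K + 3 * c) * Q := by
    have t1 : (1 + E) * E ≤ 1 + 2 * (c * s ^ 2) := by nlinarith [sq_nonneg (E - 1)]
    have t2 : E ^ 2 * T ≤ c * (s ^ 2 * T) := by rw [← mul_assoc]; gcongr
    have t3 : c * (s ^ 2 * T) ≤ c * Q := by gcongr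
    have t4 : c * s ^ 2 ≤ c * Q := by gcongr
    have t5 : K ≤ K * Q := le_mul_of_one_le_right hK q1
    linarith
  have b2 : (4 + 8 * ε ^ 2) * (visc ε α 2 * K) * T ≤
      (4 + 8 * ε₀ ^ 2) * (m * ε ^ γ * K) * Q := by
    have n : 0 ≤ m * ε ^ γ * K := mul_nonneg hγ hK
    have n' : 0 ≤ visc ε α 2 * K := mul_nonneg hv0 hK
    gcongr
  have b3 : ε ^ 2 * (8 * K) ≤ m * ε ^ γ * (8 * K * Q) := by
    refine mul_le_mul h2 ?_ (by positivity) hγ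
    exact le_mul_of_one_le_right (by positivity) q1
  have b4 : ε ^ 2 * (G * (T + K + (1 + E) * E + E ^ 2 * T)) ≤
      m * ε ^ γ * (G * ((2 + K + 3 * c) * Q)) := by
    gcongr
  linarith

/-- The error estimate, with a constant that depends only on the parameters and on the norm of the
strong solution. -/
theorem exists_errorEnergy_le (h₁ : 0 < L₁) (h₂ : 0 < L₂) (ε₀ : ℝ) (K : ℝ≥0)
    (hε₀ : 0 < ε₀) : ∃ C : ℝ, 0 < C ∧
      ∀ (T : ℝ) (A₀ B₀ : InitialField L₁ L₂) (A B : StrongField L₁ L₂ T),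
        0 < T → IsStrongPEHM A₀ B₀ A B → strongNormSq A B ≤ K →
        ∀ (ε : ℝ) (Aε Bε : WeakField L₁ L₂), 0 < ε → ε ≤ ε₀ →
          IsLerayHopf ε α A₀ B₀ Aε Bε → EnergyInequality ε α A₀ B₀ Aε Bε →
          errorEnergy ε α Aε Bε A B ≤
            ENNReal.ofReal (C * ε ^ (min 2 (α - 2)) * (T + 1) * Real.exp (C * (T + 1))) *
              (1 + (∑ i : Fin 3, (nsq L₁ L₂ (fun x => A₀.u x i)
                + nsq L₁ L₂ (fun x => B₀.u x i))) ^ 2) := by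
  obtain ⟨G, hG, main⟩ := exists_error_ae_le h₁ h₂ (Real.sqrt_nonneg K)
  have K0 : (0 : ℝ) ≤ K := K.coe_nonneg
  set γ := min 2 (α - 2) with hγ
  -- Both exponents are nonnegative, so on `(0, ε₀]` the first summand compares `ε²` with `ε^γ` and
  -- the second compares `ε^(α-2)` with `ε^γ`.
  set m := ε₀ ^ (2 - γ) + ε₀ ^ (α - 2 - γ) with hm
  have m0 : 0 ≤ m := by positivity
  set C₁ : ℝ := 8 * K + G * (2 + K + 3 * (1 + ε₀ ^ 2) ^ 2) + (4 + 8 * ε₀ ^ 2) * K with hC₁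
  have C₁0 : 0 ≤ C₁ := by positivity
  -- One constant serves twice: `3 m C₁` is the prefactor, `G (1 + K)` covers the exponent because
  -- `G (T + K) ≤ G (1 + K) (T + 1)`, and `1` ensures positivity.
  refine ⟨3 * (m * C₁) + G * (1 + K) + 1, by positivity,
    fun T A₀ B₀ A B hT hs hK ε Aε Bε hε hεε₀ h hE => ?_⟩
  obtain ⟨bA, bB⟩ := boundedBy_of_strongNormSq hK
  have e := errorEnergy_le_of_ae h₁ h₂ hε.le hT
    (main ε α T K A₀ B₀ A B Aε Bε hε hT hs h hE bA bB (integral_strongSq_le hK))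
  refine e.trans ?_
  set E := kinr L₁ L₂ ε (Aε.u 0) + kinr L₁ L₂ ε (Bε.u 0)
  set s := dataSq L₁ L₂ (Aε.u 0) (Bε.u 0) with hs'
  have εγ : 0 ≤ ε ^ γ := by positivity
  have h2 : ε ^ 2 ≤ m * ε ^ γ := by
    have h3 := rpow_le_mul_rpow_min (p := 2) (q := γ) hε hεε₀ (min_le_left _ _)
    rw [Real.rpow_two] at h3
    refine h3.trans (mul_le_mul_of_nonneg_right ?_ εγ)
    rw [hm]
    exact le_add_of_nonneg_right (by positivity)
  have hv : visc ε α 2 ≤ m * ε ^ γ := by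
    have h3 := rpow_le_mul_rpow_min (p := α - 2) (q := γ) hε hεε₀ (min_le_right _ _)
    have : visc ε α 2 = ε ^ (α - 2) := by simp [visc]
    rw [this]
    refine h3.trans (mul_le_mul_of_nonneg_right ?_ εγ)
    rw [hm]
    exact le_add_of_nonneg_left (by positivity)
  have sb := source_bound (G := G) (E := E) (s := s) (α := α) hT K0 hG
    (add_nonneg (kinr_nonneg _) (kinr_nonneg _))
    (kinr_le_dataSq hε.le hεε₀ _ _) (by gcongr) h2 (visc_nonneg hε.le 2) hv (by positivity)
  have ex : Real.exp (G * (T + K)) ≤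
      Real.exp ((3 * (m * C₁) + G * (1 + K) + 1) * (T + 1)) := by
    refine Real.exp_le_exp.2 ?_
    have e1 : G * (T + K) ≤ G * (1 + K) * (T + 1) := by
      have := mul_nonneg hG K0
      have := mul_nonneg this hT.le
      linarith
    have e2 : 0 ≤ (3 * (m * C₁) + 1) * (T + 1) := by positivity
    linarith
  rw [sum_nsq_eq h, ← hs', ← ENNReal.ofReal_pow (dataSq_nonneg _ _), ← ENNReal.ofReal_one,
    ← ENNReal.ofReal_add zero_le_one (by positivity), ← ENNReal.ofReal_mul (by positivity)]
  refine ENNReal.ofReal_le_ofReal ?_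
  calc _ ≤ 3 * (m * ε ^ γ * (C₁ * ((T + 1) * (1 + s ^ 2))) *
        Real.exp ((3 * (m * C₁) + G * (1 + K) + 1) * (T + 1))) := by
        refine mul_le_mul_of_nonneg_left ?_ (by norm_num)
        exact mul_le_mul sb ex (Real.exp_pos _).le (by positivity)
    _ = 3 * (m * C₁) * (ε ^ γ * (T + 1) *
        Real.exp ((3 * (m * C₁) + G * (1 + K) + 1) * (T + 1)) * (1 + s ^ 2)) := by ring
    _ ≤ (3 * (m * C₁) + G * (1 + K) + 1) * (ε ^ γ * (T + 1) *
        Real.exp ((3 * (m * C₁) + G * (1 + K) + 1) * (T + 1)) * (1 + s ^ 2)) := by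
        refine mul_le_mul_of_nonneg_right ?_ (by positivity)
        have : 0 ≤ G * (1 + K) := by positivity
        linarith
    _ = _ := by ring

end ErrorEstimate

/-! ### Strong convergence -/

section Convergence

variable {L₁ L₂ T α : ℝ}

/-- The energy functional is quadratic in the norms, so its order `ε^γ` becomes `ε^(γ/2)` for each
norm. -/
lemma vanishesAtRate_sqrt {γ : ℝ} (hγ : 0 < γ) {X N : ℝ → ℝ≥0∞} {C : ℝ} (hC : 0 ≤ C)
    (hX : ∀ᶠ ε in 𝓝[>] (0 : ℝ), X ε ≤ ENNReal.ofReal (C * ε ^ γ))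
    (hN : ∀ ε, N ε ≤ X ε ^ (1 / 2 : ℝ)) : VanishesAtRate (γ / 2) N := by
  have key : ∀ᶠ ε in 𝓝[>] (0 : ℝ), N ε ≤ ENNReal.ofReal (√C * ε ^ (γ / 2)) := by
    filter_upwards [hX, self_mem_nhdsWithin] with ε h ε0
    have ε0' : (0 : ℝ) < ε := ε0
    refine (hN ε).trans ((ENNReal.rpow_le_rpow h (by norm_num)).trans (le_of_eq ?_))
    rw [ENNReal.ofReal_rpow_of_nonneg (by positivity) (by norm_num), ← Real.sqrt_eq_rpow,
      Real.sqrt_mul hC, Real.sqrt_eq_rpow (ε ^ γ), ← Real.rpow_mul ε0'.le]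
    congr 3
    ring
  refine ⟨?_, √C, key⟩
  refine tendsto_of_tendsto_of_tendsto_of_le_of_le' tendsto_const_nhds ?_
    (Eventually.of_forall fun _ => zero_le) key
  have h1 : Tendsto (fun ε : ℝ => √C * ε ^ (γ / 2)) (𝓝[>] 0) (𝓝 (√C * 0 ^ (γ / 2))) :=
    ((Real.continuousAt_rpow_const 0 (γ / 2) (Or.inr (by positivity))).tendsto.mono_left
      nhdsWithin_le_nhds).const_mul _
  rw [Real.zero_rpow (by positivity), mul_zero] at h1
  have := ENNReal.tendsto_ofReal h1
  rwa [ENNReal.ofReal_zero] at this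

lemma nsq_const_mul (c : ℝ) (f : E3 → ℝ) :
    nsq L₁ L₂ (fun x => c * f x) = ENNReal.ofReal (c ^ 2) * nsq L₁ L₂ f := by
  unfold nsq
  rw [← lintegral_const_mul' _ _ ENNReal.ofReal_ne_top]
  refine lintegral_congr fun x => ?_
  rw [enorm_mul, mul_pow, Real.enorm_eq_ofReal_abs, ← ENNReal.ofReal_pow (abs_nonneg c), sq_abs]

lemma nsq_le_two_mul {f g : E3 → ℝ} (hf : MemLp f 2 (boxMeas L₁ L₂))
    (hg : MemLp g 2 (boxMeas L₁ L₂)) :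
    nsq L₁ L₂ f ≤ 2 * nsq L₁ L₂ (fun x => f x - g x) + 2 * nsq L₁ L₂ g := by
  rw [nsq_eq hf, nsq_eq (memLp_fun_sub hf hg), nsq_eq hg, show (2 : ℝ≥0∞) = ENNReal.ofReal 2 by simp,
    ← ENNReal.ofReal_mul zero_le_two, ← ENNReal.ofReal_mul zero_le_two,
    ← ENNReal.ofReal_add (by positivity) (by positivity)]
  refine ENNReal.ofReal_le_ofReal ?_
  have h := l2_add_le (memLp_fun_sub hf hg) hg
  simp only [sub_add_cancel] at h
  have := pow_le_pow_left₀ l2_nonneg h 2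
  nlinarith [sq_nonneg (l2 (boxMeas L₁ L₂) (fun x => f x - g x) - l2 (boxMeas L₁ L₂) g)]

lemma lintegral_nsq_const_mul_le {f g : ℝ → E3 → ℝ} (hf : InL2L2 L₁ L₂ T f)
    (hg : InL2L2 L₁ L₂ T g) (c : ℝ) :
    ∫⁻ t in Ioo 0 T, nsq L₁ L₂ (fun x => c * f t x) ≤
      2 * (ENNReal.ofReal (c ^ 2) * ∫⁻ t in Ioo 0 T, nsq L₁ L₂ (fun x => f t x - g t x)) +
        2 * (ENNReal.ofReal (c ^ 2) * ∫⁻ t in Ioo 0 T, nsq L₁ L₂ (g t)) := by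
  simp only [nsq_const_mul]
  rw [lintegral_const_mul' _ _ ENNReal.ofReal_ne_top, ← mul_add, ← mul_add, mul_left_comm]
  gcongr
  rw [← lintegral_add_left' (hf.sub hg).meas.lintegral, ← lintegral_const_mul' _ _ (by simp)]
  refine lintegral_mono_ae ?_
  filter_upwards [hf.slice, hg.slice] with t h h'
  rw [mul_add]
  exact nsq_le_two_mul h h'

variable {Aε Bε : WeakField L₁ L₂} {A B : StrongField L₁ L₂ T} {ε : ℝ}

lemma kin_le_errorEnergy {t : ℝ} (ht : t ∈ Ico 0 T) (i : Fin 3) :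
    ENNReal.ofReal (wt ε i) * nsq L₁ L₂ (fun x => Aε.u t x i - A.u t x i) ≤
      errorEnergy ε α Aε Bε A B := by
  have h1 := Finset.single_le_sum (f := fun i => ENNReal.ofReal (wt ε i) *
    nsq L₁ L₂ (fun x => (Aε.u t - A.u t) x i)) (fun _ _ => zero_le) (Finset.mem_univ i)
  have h2 := le_iSup₂_of_le (f := fun t (_ : t ∈ Ico 0 T) =>
    kin L₁ L₂ ε (Aε.u t - A.u t) + kin L₁ L₂ ε (Bε.u t - B.u t)) t ht
    (le_self_add (a := kin L₁ L₂ ε (Aε.u t - A.u t)))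
  exact (h1.trans h2).trans le_self_add

lemma diss_le_errorEnergy (i j : Fin 3) :
    ENNReal.ofReal (wt ε i * visc ε α j) *
      (∫⁻ t in Ioo 0 T, nsq L₁ L₂ (fun x => Aε.D t x i j - A.D t x i j)) ≤
      errorEnergy ε α Aε Bε A B := by
  rw [← lintegral_const_mul' _ _ ENNReal.ofReal_ne_top]
  refine le_trans (lintegral_mono fun t => ?_) (le_add_of_nonneg_left zero_le)
  have h1 := Finset.single_le_sum (f := fun j => ENNReal.ofReal (wt ε i * visc ε α j) *
    nsq L₁ L₂ (fun x => (Aε.D t - A.D t) x i j)) (fun _ _ => zero_le) (Finset.mem_univ j)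
  have h2 := Finset.single_le_sum (f := fun i => ∑ j, ENNReal.ofReal (wt ε i * visc ε α j) *
    nsq L₁ L₂ (fun x => (Aε.D t - A.D t) x i j)) (fun _ _ => zero_le) (Finset.mem_univ i)
  exact (h1.trans h2).trans le_self_add

/-- The errors in the single norms in terms of the error in the energy norm. -/
theorem convergesAtRate_of_errorEnergy (h₁ : 0 < L₁) (h₂ : 0 < L₂) (hα : 2 < α) (hT : 0 < T)
    {Aε Bε : ℝ → WeakField L₁ L₂} {A B : StrongField L₁ L₂ T} {q : ℝ} (hq : 0 ≤ q)
    (hA : A.BoundedBy q) {C : ℝ} (hC : 0 ≤ C)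
    (h : ∀ᶠ ε in 𝓝[>] (0 : ℝ), errorEnergy ε α (Aε ε) (Bε ε) A B ≤
      ENNReal.ofReal (C * ε ^ (min 2 (α - 2)))) :
    ConvergesAtRate α (min 2 (α - 2) / 2) Aε A := by
  set γ := min 2 (α - 2) with hγ
  have γ0 : 0 < γ := lt_min two_pos (by linarith)
  have small : ∀ᶠ ε in 𝓝[>] (0 : ℝ), 0 < ε ∧ ε ≤ 1 := by
    filter_upwards [Ioc_mem_nhdsGT (zero_lt_one' ℝ)] with ε hε using hε
  have pw : ∀ {ε p : ℝ}, 0 < ε → ε ≤ 1 → γ ≤ p → ε ^ p ≤ ε ^ γ := fun h0 h1 hp =>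
    Real.rpow_le_rpow_of_exponent_ge h0 h1 hp
  have pw2 : ∀ {ε : ℝ}, 0 < ε → ε ≤ 1 → ε ^ 2 ≤ ε ^ γ := fun h0 h1 => by
    rw [← Real.rpow_two]; exact pw h0 h1 (min_le_left _ _)
  -- For weighted quantities converging to zero, the limit field is subtracted and added back. The
  -- error is controlled by the energy norm, and the limit carries the weight `c`, with `c² ≤ ε^γ`.
  have comb : ∀ {f : ℝ → ℝ → E3 → ℝ} {g : ℝ → E3 → ℝ}, (∀ ε, InL2L2 L₁ L₂ T (f ε)) →
      InL2L2 L₁ L₂ T g → ∀ c : ℝ → ℝ,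
      (∀ᶠ ε in 𝓝[>] (0 : ℝ), c ε ^ 2 ≤ ε ^ γ ∧ ENNReal.ofReal (c ε ^ 2) *
        (∫⁻ t in Ioo 0 T, nsq L₁ L₂ (fun x => f ε t x - g t x)) ≤
          errorEnergy ε α (Aε ε) (Bε ε) A B) →
      VanishesAtRate (γ / 2) fun ε => normL2 L₁ L₂ T fun t x => c ε * f ε t x := by
    intro f g hf hg c hc
    set I := ∫ t in Ioo 0 T, l2 (boxMeas L₁ L₂) (g t) ^ 2
    have I0 : 0 ≤ I := integral_nonneg fun _ => sq_nonneg _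
    refine vanishesAtRate_sqrt γ0 (C := 2 * C + 2 * I) (by positivity) ?_ fun ε => le_rfl
    filter_upwards [hc, h, small] with ε hc h hs
    refine (lintegral_nsq_const_mul_le (hf ε) hg (c ε)).trans ?_
    have εγ : 0 ≤ ε ^ γ := Real.rpow_nonneg hs.1.le _
    calc _ ≤ 2 * ENNReal.ofReal (C * ε ^ γ) + 2 * (ENNReal.ofReal (ε ^ γ) * ENNReal.ofReal I) := by
          rw [hg.lintegral_nsq]
          gcongr
          · exact hc.2.trans h
          · exact hc.1
      _ = _ := by
          rw [show (2 : ℝ≥0∞) = ENNReal.ofReal 2 by simp, ← ENNReal.ofReal_mul εγ,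
            ← ENNReal.ofReal_mul zero_le_two, ← ENNReal.ofReal_mul zero_le_two,
            ← ENNReal.ofReal_add (by positivity) (by positivity)]
          congr 1
          ring
  have gradε : ∀ ε i j, InL2L2 L₁ L₂ T fun t x => (Aε ε).D t x i j := fun ε i j =>
    ((Aε ε).l2h1 T hT i).grad j
  have gradA : ∀ i j, InL2L2 L₁ L₂ T fun t x => A.D t x i j := fun i j => (A.l2h1 i).grad j
  refine ⟨fun i => ?_, ?_, fun i j => ?_, fun i => ?_, fun j => ?_, ?_, ?_⟩
  · refine vanishesAtRate_sqrt γ0 hC h fun ε => iSup₂_le fun t ht => ?_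
    refine ENNReal.rpow_le_rpow ?_ (by norm_num)
    have := kin_le_errorEnergy (α := α) (ε := ε) (Aε := Aε ε) (Bε := Bε ε) (A := A) (B := B) ht
      i.castSucc
    have w : wt ε i.castSucc = 1 := by fin_cases i <;> simp [wt]
    rwa [w, ENNReal.ofReal_one, one_mul] at this
  -- The same splitting in the supremum norm. It uses the bound `‖A₃‖ ≤ 2 q` at every time, not just
  -- almost every time.
  · refine vanishesAtRate_sqrt γ0 (C := 2 * C + 2 * (2 * q) ^ 2) (by positivity)
      (X := fun ε => 2 * errorEnergy ε α (Aε ε) (Bε ε) A B +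
        2 * ENNReal.ofReal (ε ^ 2 * (2 * q) ^ 2)) ?_ fun ε => iSup₂_le fun t ht => ?_
    · filter_upwards [h, small] with ε h hs
      have εγ : 0 ≤ ε ^ γ := Real.rpow_nonneg hs.1.le _
      calc _ ≤ 2 * ENNReal.ofReal (C * ε ^ γ) + 2 * ENNReal.ofReal (ε ^ γ * (2 * q) ^ 2) := by
            gcongr
            exact pw2 hs.1 hs.2
        _ = _ := by
            rw [show (2 : ℝ≥0∞) = ENNReal.ofReal 2 by simp, ← ENNReal.ofReal_mul zero_le_two,
              ← ENNReal.ofReal_mul zero_le_two,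
              ← ENNReal.ofReal_add (by positivity) (by positivity)]
            congr 1
            ring
    · refine ENNReal.rpow_le_rpow ?_ (by norm_num)
      have e := kin_le_errorEnergy (α := α) (ε := ε) (Aε := Aε ε) (Bε := Bε ε) (A := A) (B := B) ht 2
      have w : wt ε 2 = ε ^ 2 := by simp [wt]
      rw [w] at e
      have mA := (A.sigma t ht).memLp 2
      have e2 := nsq_le_two_mul (((Aε ε).sigma t ht.1).memLp 2) mA
      have e3 : nsq L₁ L₂ (fun x => A.u t x 2) ≤ ENNReal.ofReal ((2 * q) ^ 2) := by
        rw [nsq_eq mA]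
        exact ENNReal.ofReal_le_ofReal (A.l2_vertical_le h₁ h₂ hq hA ht)
      rw [nsq_const_mul]
      calc _ ≤ ENNReal.ofReal (ε ^ 2) * (2 * nsq L₁ L₂ (fun x => (Aε ε).u t x 2 - A.u t x 2) +
            2 * ENNReal.ofReal ((2 * q) ^ 2)) := by gcongr; exact e2.trans (by gcongr)
        _ = 2 * (ENNReal.ofReal (ε ^ 2) * nsq L₁ L₂ (fun x => (Aε ε).u t x 2 - A.u t x 2)) +
            2 * ENNReal.ofReal (ε ^ 2 * (2 * q) ^ 2) := by
            rw [ENNReal.ofReal_mul (sq_nonneg ε)]; ring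
        _ ≤ _ := by gcongr
  · refine vanishesAtRate_sqrt γ0 hC h fun ε => ENNReal.rpow_le_rpow ?_ (by norm_num)
    have := diss_le_errorEnergy (α := α) (ε := ε) (Aε := Aε ε) (Bε := Bε ε) (A := A) (B := B)
      i.castSucc j.castSucc
    have w : wt ε i.castSucc = 1 := by fin_cases i <;> simp [wt]
    have v : visc ε α j.castSucc = 1 := by fin_cases j <;> simp [visc]
    rwa [w, v, one_mul, ENNReal.ofReal_one, one_mul] at this
  · refine comb (fun ε => gradε ε i.castSucc 2) (gradA i.castSucc 2) (fun ε => ε ^ ((α - 2) / 2)) ?_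
    filter_upwards [small] with ε hs
    have e : (ε ^ ((α - 2) / 2)) ^ 2 = ε ^ (α - 2) := by
      rw [← Real.rpow_natCast, ← Real.rpow_mul hs.1.le]; congr 1; push_cast; ring
    have w : wt ε i.castSucc = 1 := by fin_cases i <;> simp [wt]
    have v : visc ε α 2 = ε ^ (α - 2) := by simp [visc]
    rw [e]
    refine ⟨pw hs.1 hs.2 (min_le_right _ _), ?_⟩
    have := diss_le_errorEnergy (α := α) (ε := ε) (Aε := Aε ε) (Bε := Bε ε) (A := A) (B := B)
      i.castSucc 2
    rwa [w, v, one_mul] at this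
  · refine comb (fun ε => gradε ε 2 j.castSucc) (gradA 2 j.castSucc) (fun ε => ε) ?_
    filter_upwards [small] with ε hs
    have w : wt ε 2 = ε ^ 2 := by simp [wt]
    have v : visc ε α j.castSucc = 1 := by fin_cases j <;> simp [visc]
    refine ⟨pw2 hs.1 hs.2, ?_⟩
    have := diss_le_errorEnergy (α := α) (ε := ε) (Aε := Aε ε) (Bε := Bε ε) (A := A) (B := B)
      2 j.castSucc
    rwa [w, v, mul_one] at this
  · refine comb (fun ε => gradε ε 2 2) (gradA 2 2) (fun ε => ε ^ (α / 2)) ?_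
    filter_upwards [small] with ε hs
    have e : (ε ^ (α / 2)) ^ 2 = ε ^ α := by
      rw [← Real.rpow_natCast, ← Real.rpow_mul hs.1.le]; congr 1; push_cast; ring
    have w : wt ε 2 = ε ^ 2 := by simp [wt]
    have v : visc ε α 2 = ε ^ (α - 2) := by simp [visc]
    have wv : wt ε 2 * visc ε α 2 = ε ^ α := by
      rw [w, v, ← Real.rpow_two, ← Real.rpow_add hs.1]; congr 1; ring
    rw [e]
    refine ⟨pw hs.1 hs.2 ((min_le_right _ _).trans (by linarith)), ?_⟩
    have := diss_le_errorEnergy (α := α) (ε := ε) (Aε := Aε ε) (Bε := Bε ε) (A := A) (B := B) 2 2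
    rwa [wv] at this
  -- The energy controls the vertical error only with the weight `ε`. The unweighted bound comes
  -- from Poincaré and incompressibility: the error in `u₃` is at most the sum of the errors in `∂ₓ
  -- u₁` and `∂_y u₂`, whose dissipation weights are `1`.
  · refine vanishesAtRate_sqrt γ0 (C := 2 * C + 2 * C) (by positivity)
      (X := fun ε => 2 * errorEnergy ε α (Aε ε) (Bε ε) A B +
        2 * errorEnergy ε α (Aε ε) (Bε ε) A B) ?_ fun ε => ENNReal.rpow_le_rpow ?_ (by norm_num)
    · filter_upwards [h, small] with ε h hs
      have εγ : 0 ≤ ε ^ γ := Real.rpow_nonneg hs.1.le _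
      calc _ ≤ 2 * ENNReal.ofReal (C * ε ^ γ) + 2 * ENNReal.ofReal (C * ε ^ γ) := by gcongr
        _ = _ := by
            rw [show (2 : ℝ≥0∞) = ENNReal.ofReal 2 by simp, ← ENNReal.ofReal_mul zero_le_two,
              ← ENNReal.ofReal_add (by positivity) (by positivity)]
            congr 1
            ring
    · have s0 := diss_le_errorEnergy (α := α) (ε := ε) (Aε := Aε ε) (Bε := Bε ε) (A := A) (B := B)
        0 0
      have s1 := diss_le_errorEnergy (α := α) (ε := ε) (Aε := Aε ε) (Bε := Bε ε) (A := A) (B := B)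
        1 1
      have w0 : wt ε 0 = 1 := by simp [wt]
      have w1 : wt ε 1 = 1 := by simp [wt]
      have v0 : visc ε α 0 = 1 := by simp [visc]
      have v1 : visc ε α 1 = 1 := by simp [visc]
      rw [w0, v0, one_mul, ENNReal.ofReal_one, one_mul] at s0
      rw [w1, v1, one_mul, ENNReal.ofReal_one, one_mul] at s1
      calc _ ≤ ∫⁻ t in Ioo 0 T, (2 * nsq L₁ L₂ (fun x => (Aε ε).D t x 0 0 - A.D t x 0 0) +
            2 * nsq L₁ L₂ (fun x => (Aε ε).D t x 1 1 - A.D t x 1 1)) := by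
            refine lintegral_mono_ae ?_
            filter_upwards [(Aε ε).goodW hT, A.goodS] with t g g'
            have hU := g.sub g'.toGoodW
            have e := (hU.l2_vertical_le h₁ h₂).trans (hU.l2_zz_le h₁ h₂)
            simp only [Pi.sub_apply] at e
            rw [nsq_eq (memLp_fun_sub (g.sigma.memLp 2) (g'.sigma.memLp 2)),
              nsq_eq (memLp_fun_sub (g.memD 0 0) (g'.memD 0 0)),
              nsq_eq (memLp_fun_sub (g.memD 1 1) (g'.memD 1 1)),
              show (2 : ℝ≥0∞) = ENNReal.ofReal 2 by simp, ← ENNReal.ofReal_mul zero_le_two,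
              ← ENNReal.ofReal_mul zero_le_two, ← ENNReal.ofReal_add (by positivity) (by positivity)]
            refine ENNReal.ofReal_le_ofReal ?_
            have := pow_le_pow_left₀ l2_nonneg e 2
            nlinarith [sq_nonneg (l2 (boxMeas L₁ L₂) (fun x => (Aε ε).D t x 0 0 - A.D t x 0 0) -
              l2 (boxMeas L₁ L₂) (fun x => (Aε ε).D t x 1 1 - A.D t x 1 1))]
        _ ≤ _ := by
            rw [lintegral_add_left' (((gradε ε 0 0).sub (gradA 0 0)).meas.lintegral.const_mul _),
              lintegral_const_mul' _ _ (by simp), lintegral_const_mul' _ _ (by simp)]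
            gcongr

lemma errorEnergy_comm (ε α : ℝ) (Aε Bε : WeakField L₁ L₂) (A B : StrongField L₁ L₂ T) :
    errorEnergy ε α Bε Aε B A = errorEnergy ε α Aε Bε A B := by
  unfold errorEnergy
  simp only [add_comm]

lemma lintegral_sum_lt_top {ι : Type*} [Fintype ι] {f : ι → ℝ → ℝ≥0∞}
    (hf : ∀ i, AEMeasurable (f i) (volume.restrict (Ioo 0 T)) ∧ ∫⁻ t in Ioo 0 T, f i t < ⊤) :
    AEMeasurable (fun t => ∑ i, f i t) (volume.restrict (Ioo 0 T)) ∧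
      ∫⁻ t in Ioo 0 T, ∑ i, f i t < ⊤ := by
  refine ⟨Finset.aemeasurable_fun_sum _ fun i _ => (hf i).1, ?_⟩
  rw [lintegral_finsetSum' _ fun i _ => (hf i).1]
  exact ENNReal.sum_lt_top.2 fun i _ => (hf i).2

lemma lintegral_add_lt_top {f g : ℝ → ℝ≥0∞}
    (hf : AEMeasurable f (volume.restrict (Ioo 0 T)) ∧ ∫⁻ t in Ioo 0 T, f t < ⊤)
    (hg : AEMeasurable g (volume.restrict (Ioo 0 T)) ∧ ∫⁻ t in Ioo 0 T, g t < ⊤) :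
    AEMeasurable (fun t => f t + g t) (volume.restrict (Ioo 0 T)) ∧
      ∫⁻ t in Ioo 0 T, (f t + g t) < ⊤ :=
  ⟨hf.1.add hg.1, by rw [lintegral_add_left' hf.1]; exact ENNReal.add_lt_top.2 ⟨hf.2, hg.2⟩⟩

lemma InL2L2.lintegral_nsq_lt_top {f : ℝ → E3 → ℝ} (hf : InL2L2 L₁ L₂ T f) :
    AEMeasurable (fun t => nsq L₁ L₂ (f t)) (volume.restrict (Ioo 0 T)) ∧
      ∫⁻ t in Ioo 0 T, nsq L₁ L₂ (f t) < ⊤ :=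
  ⟨hf.meas.lintegral, by rw [hf.lintegral_nsq]; exact ENNReal.ofReal_lt_top⟩

/-- Finiteness provides the bound `K` in the convergence statement, where none is prescribed. -/
lemma strongNormSq_lt_top (A B : StrongField L₁ L₂ T) : strongNormSq A B < ⊤ := by
  refine ENNReal.add_lt_top.2 ⟨?_, ?_⟩
  · exact (ENNReal.essSup_add_le _ _).trans_lt (ENNReal.add_lt_top.2 ⟨A.linf_h1, B.linf_h1⟩)
  · refine (lintegral_sum_lt_top fun i => lintegral_add_lt_top (lintegral_add_lt_top
      (lintegral_sum_lt_top fun j => lintegral_add_lt_top (lintegral_add_lt_top ?_ ?_)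
        (lintegral_sum_lt_top fun k => lintegral_add_lt_top ?_ ?_)) ?_) ?_).2
    · exact (A.l2h1_horizontal i j).val.lintegral_nsq_lt_top
    · exact (B.l2h1_horizontal i j).val.lintegral_nsq_lt_top
    · exact ((A.l2h1_horizontal i j).grad k).lintegral_nsq_lt_top
    · exact ((B.l2h1_horizontal i j).grad k).lintegral_nsq_lt_top
    · exact (A.l2_dt i).lintegral_nsq_lt_top
    · exact (B.l2_dt i).lintegral_nsq_lt_top

end Convergence

end HydroMHD

/-! ### The error estimate and the convergences combined -/

theorem theorem2p3 (L₁ L₂ α : ℝ) (hL₁ : 0 < L₁) (hL₂ : 0 < L₂) (hα : 2 < α) :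
    -- the error estimate; `C` is independent of `ε`, of the weak solution and of `T`
    (∀ (ε₀ : ℝ) (K : ℝ≥0), 0 < ε₀ → ∃ C : ℝ, 0 < C ∧
      ∀ (T : ℝ) (A₀ B₀ : HydroMHD.InitialField L₁ L₂) (A B : HydroMHD.StrongField L₁ L₂ T),
        0 < T → HydroMHD.IsStrongPEHM A₀ B₀ A B → HydroMHD.strongNormSq A B ≤ K →
        ∀ (ε : ℝ) (Aε Bε : HydroMHD.WeakField L₁ L₂), 0 < ε → ε ≤ ε₀ →
          HydroMHD.IsLerayHopf ε α A₀ B₀ Aε Bε → HydroMHD.EnergyInequality ε α A₀ B₀ Aε Bε →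
          HydroMHD.errorEnergy ε α Aε Bε A B ≤
            ENNReal.ofReal (C * ε ^ (min 2 (α - 2)) * (T + 1) * Real.exp (C * (T + 1))) *
              (1 + (∑ i : Fin 3, (HydroMHD.nsq L₁ L₂ (fun x => A₀.u x i)
                + HydroMHD.nsq L₁ L₂ (fun x => B₀.u x i))) ^ 2)) ∧
    -- the strong convergences as `ε → 0⁺`, with their rate
    (∀ (T : ℝ) (A₀ B₀ : HydroMHD.InitialField L₁ L₂) (A B : HydroMHD.StrongField L₁ L₂ T),
      0 < T → HydroMHD.IsStrongPEHM A₀ B₀ A B →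
      ∀ Aε Bε : ℝ → HydroMHD.WeakField L₁ L₂,
        (∀ᶠ ε in 𝓝[>] (0 : ℝ), HydroMHD.IsLerayHopf ε α A₀ B₀ (Aε ε) (Bε ε) ∧
          HydroMHD.EnergyInequality ε α A₀ B₀ (Aε ε) (Bε ε)) →
        HydroMHD.ConvergesAtRate α (min 2 (α - 2) / 2) Aε A ∧
          HydroMHD.ConvergesAtRate α (min 2 (α - 2) / 2) Bε B) := by
  refine ⟨fun ε₀ K hε₀ => HydroMHD.exists_errorEnergy_le hL₁ hL₂ ε₀ K hε₀,
    fun T A₀ B₀ A B hT hs Aε Bε h => ?_⟩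
  have hfin := HydroMHD.strongNormSq_lt_top A B
  -- For a fixed strong solution the estimate is applied with `K` its own norm and with `ε₀ = 1`,
  -- since only small `ε` matter.
  obtain ⟨K, hK⟩ : ∃ K : ℝ≥0, (K : ℝ≥0∞) = HydroMHD.strongNormSq A B :=
    ⟨_, ENNReal.coe_toNNReal hfin.ne⟩
  obtain ⟨C, hC, main⟩ :=
    HydroMHD.exists_errorEnergy_le (α := α) hL₁ hL₂ 1 K one_pos
  obtain ⟨bA, bB⟩ := HydroMHD.boundedBy_of_strongNormSq hK.ge
  -- Square integrability of the vertical initial component is not part of the data. It is read off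
  -- from any one of the weak solutions, which attains the data and lies in `L²` at time `0`.
  obtain ⟨ε₁, hε₁⟩ := h.exists
  set S := ∑ i : Fin 3, (HydroMHD.nsq L₁ L₂ (fun x => A₀.u x i) +
    HydroMHD.nsq L₁ L₂ (fun x => B₀.u x i)) with hS
  obtain ⟨s, s0, hs'⟩ : ∃ s : ℝ, 0 ≤ s ∧ S = ENNReal.ofReal s :=
    ⟨_, HydroMHD.dataSq_nonneg _ _, HydroMHD.sum_nsq_eq hε₁.1⟩
  set C' := C * (T + 1) * Real.exp (C * (T + 1)) * (1 + s ^ 2) with hC'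
  have key : ∀ᶠ ε in 𝓝[>] (0 : ℝ), HydroMHD.errorEnergy ε α (Aε ε) (Bε ε) A B ≤
      ENNReal.ofReal (C' * ε ^ (min 2 (α - 2))) := by
    filter_upwards [h, Ioc_mem_nhdsGT (zero_lt_one' ℝ)] with ε hε hε1
    have e := main T A₀ B₀ A B hT hs hK.ge ε (Aε ε) (Bε ε) hε1.1 hε1.2 hε.1 hε.2
    rw [← hS, hs', ← ENNReal.ofReal_pow s0, ← ENNReal.ofReal_one,
      ← ENNReal.ofReal_add zero_le_one (by positivity), ← ENNReal.ofReal_mul (by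
        have := Real.rpow_nonneg hε1.1.le (min 2 (α - 2))
        positivity)] at e
    refine e.trans (le_of_eq ?_)
    rw [hC']
    congr 1
    ring
  -- The error functional is symmetric under exchanging the two velocities, so the statement for `B`
  -- follows with the roles reversed.
  refine ⟨HydroMHD.convergesAtRate_of_errorEnergy hL₁ hL₂ hα hT (Real.sqrt_nonneg _) bA
    (by positivity) key, HydroMHD.convergesAtRate_of_errorEnergy hL₁ hL₂ hα hT
    (Real.sqrt_nonneg _) bB (C := C') (by positivity) (Bε := Aε) (B := A) ?_⟩
  simpa only [HydroMHD.errorEnergy_comm] using key
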